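/- **Setting.** All spaces are real. Operators are partially defined: $T^i(f)$ is considered only when the previous iterates lie in the domain of $T$. *Hyperbolic operators.* Let $\mathcal A$ be a Banach space, $\mathcal O_{\mathcal A}\subseteq\mathcal A$ open and $T:\mathcal O_{\mathcal A}\to\mathcal A$ of class $C^k$ with $2\le k<\infty$ (or real analytic). A compact set $\mathbb K\subset\mathcal O_{\mathcal A}$ is a *hyperbolic basic set* of $T$ with contraction exponent $\theta\in(0,1)$ if: $T|_{\mathbb K}$ is a topologically transitive homeomorphism of $\mathbb K$ with dense periodic points; if all iterates of $y$ are defined then $\mathrm{dist}(T^n y,\mathbb K)\to0$; there are a continuous $DT$-invariant splitting $\mathcal A=E^s_x\oplus E^u_x$ ($x\in\mathbb K$) and $c>0$ with $\|DT^n(x)v\|\le c\,\theta^n\|v\|$ on $E^s_x$ and $\|DT^n(x)v\|\ge c^{-1}\theta^{-n}\|v\|$ on $E^u_x$; and $\dim E^u_x$ is finite and constant. Assume moreover that $E^u_x=\mathbb R\mathbf u_x$ is one-dimensional, with unit vectors $\mathbf u_x$ depending continuously on $x\in\mathbb K$ and $DT(x)\mathbf u_x=\delta_x\mathbf u_{T(x)}$,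 $\delta_x>0$. Fix $C_0>0$ and $\lambda>1$ with $\delta_{T^{m-1}(x)}\cdots\delta_x>C_0\lambda^m$ for all $x\in\mathbb K$, $m\ge1$. Write $E^s_x=\ker\sigma_x$, where $\sigma_x\in\mathcal A^*$, $\sigma_x(\mathbf u_x)=1$. *Compatibility.* For Banach spaces $\mathcal A\subseteq\mathcal X\subseteq\mathcal Y$ and $\theta<\rho<\lambda$, the pair $(\mathcal X,\mathcal Y)$ is *$\rho$-compatible* with $(T,\mathbb K)$ if: (A1) the inclusions $\mathcal A\to\mathcal X\to\mathcal Y$ are compact; (A2) for some $M>0$ each $DT(x)$, $x\in\mathbb K$, extends to a linear operator $\hat L_x$ of $\mathcal Y$ with $\|\hat L_x\|_{\mathcal Y}<M$, $\hat L_x(\mathcal X)\subseteq\mathcal X$ and $\|\hat L_xv\|_{\mathcal X}\le M\|v\|_{\mathcal X}$; (A3) $x\mapsto\hat L_x|_{\mathcal X}\in\mathcal L(\mathcal X,\mathcal Y)$ is continuous on $\mathbb K$; (A4) for some $\Delta>1$, $\{a\in\mathcal A:\|a\|_{\mathcal X}<\Delta\}$ is $\mathcal Y$-dense in the open unit ball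 of $\mathcal X$; (A5) there are $\kappa_0>1$ and $m\ge1$ with $\|\hat L_{T^{m-1}(x)}\cdots\hat L_xv\|_{\mathcal X}\le\max\{\frac{\rho^m}{2(1+\Delta)}\|v\|_{\mathcal X},\kappa_0\|v\|_{\mathcal Y}\}$ for all $x\in\mathbb K$, $v\in\mathcal X$. *Robustness.* Let $\mathcal A\subseteq\mathcal B\subseteq\mathcal C\subseteq\mathcal D$ be Banach spaces with compact inclusions, $\mathcal O_{\mathcal B}\subseteq\mathcal B$ open, $\mathcal O_{\mathcal A}\subseteq\mathcal O_{\mathcal B}$. $T$ is *robust* with respect to $(\mathcal B,\mathcal C,\mathcal D)$ if it extends to an operator $T:\mathcal O_{\mathcal B}\to\mathcal B$ (not assumed continuous) such that, with $\mathcal O^{(m)}_{\mathcal B}$ the interior of $\{f\in\mathcal O_{\mathcal B}:T^i(f)\in\mathcal O_{\mathcal B}\ \forall i<m\}$ and $DT^m(f)$ the derivative at $f\in\mathcal O^{(m)}_{\mathcal B}$ of $T^m:\mathcal O^{(m)}_{\mathcal B}\to\mathcal C$: - **B1.** $(\mathcal B,\mathcal D)$ is $1$-compatible, and $(\mathcal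 C,\mathcal D)$ is $\rho_{\mathcal C}$-compatible for some $\rho_{\mathcal C}<\lambda$, with $(T,\mathbb K)$. - **B2.** For each $m\ge1$: $\mathbb K\subset\mathcal O^{(m)}_{\mathcal B}$; $T^m:\mathcal O^{(m)}_{\mathcal B}\to\mathcal C$ is $C^1$, with derivative uniformly continuous in some neighbourhood of $\mathbb K$; and for $f\in\mathcal A\cap\mathcal O^{(m)}_{\mathcal B}$, $DT^m(f):\mathcal B\to\mathcal C$ extends to a bounded operator of $\mathcal D$ that maps $\mathcal B$ into $\mathcal B$ and $\mathcal C$ into $\mathcal C$. - **B3.** For each $m\ge1$ there is $C_{m,1}>1$ such that each $g\in\mathbb K$ has an open neighbourhood $\mathcal V_g\subseteq\mathcal O^{(m)}_{\mathcal B}$ with $\|DT^m(f)\mathbf u_g-DT^m(g)\mathbf u_g\|_{\mathcal C}\le C_{m,1}\|f-g\|_{\mathcal B}$ for $f\in\mathcal V_g$. - **B4.** There are $C_1>1$, $\rho>1$ such that each $g\in\mathbb K$ has an open neighbourhood $\mathcal V_g\subseteq\mathcal O_{\mathcal B}$ with $\|T(f_1)-T(f_2)-DT(f_2)(f_1-f_2)\|_{\mathcal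 C}\le C_1\|f_1-f_2\|_{\mathcal C}^{\rho}$ for $f_1,f_2\in\mathcal V_g$. - **B5, B6.** There are $\nu_m,C_{m,2},C_{m,3}>0$ ($m\ge1$), with $C_{m,2}<C_0/8$ and $C_{m,3}<1/4$ for all large $m$, such that for all $g\in\mathbb K$: (B5) $\|(DT^m(f)-DT^m(g))v\|_{\mathcal C}\le C_{m,2}\lambda^m\|v\|_{\mathcal C}$ for $f\in\mathcal O^{(m)}_{\mathcal B}$ with $\|f-g\|_{\mathcal B}<\nu_m$ and $v\in\mathcal B$; (B6) $\|T^m(f+v)-T^m(f)-DT^m(g)v\|_{\mathcal B}\le C_{m,3}\|v\|_{\mathcal B}$ for $f\in\mathcal A$, $\|f-g\|_{\mathcal A}<\nu_m$, $v\in\mathcal B$, $\|v\|_{\mathcal B}<\nu_m$, whenever $f,f+v\in\mathcal O^{(m)}_{\mathcal B}$. *Local sets.* Let $\mathcal B(x,\varepsilon)$ be the open ball. For $x\in\mathbb K$, $W^s_\varepsilon(x)$ is the set of $y\in\mathcal B$ with $T^n(y)\in\mathcal B(T^n(x),\varepsilon)$ for all $n\ge0$ and $\|T^n(y)-T^n(x)\|_{\mathcal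 B}\to0$; $W^s(x)$ is the set of $y\in\mathcal O_{\mathcal B}$ all of whose iterates are defined, with $\|T^n(y)-T^n(x)\|_{\mathcal B}\to0$; $W^u_\varepsilon(x)$ is the set of $y=y_0$ that have a backward orbit $y_{n-1}=T(y_n)$ with $y_n\in\mathcal B(T^{-n}(x),\varepsilon)$ for all $n\ge 0$ and $\|y_n-T^{-n}(x)\|_{\mathcal B}\to0$, where $T^{-n}(x)\in\mathbb K$ is taken in $\mathbb K$. **Theorem 6.1.** Let $T:\mathcal O_{\mathcal A}\to\mathcal A$ be a $C^k$, $2\le k<\infty$ (or real analytic), operator, hyperbolic over $\mathbb K$ with one-dimensional unstable direction as above, and robust with respect to $(\mathcal B,\mathcal C,\mathcal D)$. Then the hyperbolic picture holds for $T$ acting on $\mathcal B$: The splitting extends to a continuous splitting $\mathcal B=\hat E^s_x\oplus E^u_x$, $x\in\mathbb K$, where $\hat E^s_x=\ker\hat\sigma_x$ and $\hat\sigma_x\in\mathcal B^*$ extends $\sigma_x$; $DT(x)$ extends to a bounded operator of $\mathcal B$ (which, into $\mathcal C$, is the derivative of $T$ at $x$), and the splitting is invariant and uniformly hyperbolic for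 these operators. There are $\varepsilon_0,C>0$, $0<\vartheta<1$ and $\kappa\ge1$ such that the following hold for all $0<\varepsilon\le\varepsilon_0$ and all $x\in\mathbb K$. (i) *Local manifolds.* There are a $C^1$ function on a ball of $\hat E^s_x$, of radius independent of $x$ and $\varepsilon$, with values in $E^u_x$, and a $C^k$ (respectively real analytic) function on an interval of $E^u_x\cong\mathbb R$, of length independent of $x$ and $\varepsilon$, with values in $\hat E^s_x$, both vanishing with their derivatives at $0$, whose graphs $M^s(x)$ and $M^u(x)$ (in coordinates centred at $x$) satisfy: $W^s_\varepsilon(x)\subseteq M^s(x)$ and $W^s_\varepsilon(x)$ contains $M^s(x)\cap\mathcal B(x,r)$, with $r=r(\varepsilon)>0$ independent of $x$; $W^u_\varepsilon(x)$ is the part of $M^u(x)$ over an open interval, and contains $M^u(x)\cap\mathcal B(x,r)$. So near $x$ the local stable set is a $C^1$ Banach submanifold tangent to $\hat E^s_x$, and the local unstable set is a $C^k$ (respectively real analytic) curve tangent to $E^u_x$. (ii) *Contraction.* $\|T^n(x)-T^n(y)\|_{\mathcal B}\le C\vartheta^n\|x-y\|_{\mathcal B}$ for all $y\in W^s_\varepsilon(x)$,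 $n\ge0$; the same holds for every $y\in W^s(x)$ with a constant depending on $x,y$ in place of $C$. Moreover $T(W^u_\varepsilon(x))\supseteq W^u_\varepsilon(T(x))$, $T$ is one-to-one on $W^u_\varepsilon(x)$, and every backward orbit $(y_n)$ of $y\in W^u_\varepsilon(x)$ as in the definition of $W^u_\varepsilon(x)$ satisfies $\|T^{-n}(x)-y_n\|_{\mathcal B}\le C\vartheta^n\|x-y\|_{\mathcal B}$. (iii) *Orbits that stay close.* If $T^i(y)\in\mathcal B(T^i(x),\varepsilon)$ for all $0\le i\le n$, then $\mathrm{dist}(T^n(y),W^u_\varepsilon(T^n(x)))\le C\vartheta^n$ and $\mathrm{dist}(y,W^s_{\kappa\varepsilon}(x))\le C\vartheta^n$. (iv) *Lamination.* The local stable manifolds form a $C^0$ lamination, and the local unstable manifolds vary continuously, with their tangent spaces: there are $r_0,R>0$ such that for every $x_0\in\mathbb K$ and all $x\in\mathbb K\cap\mathcal B(x_0,r_0)$ the statements of (i), apart from the normalization at $0$, hold for $x$ in the coordinates of $\hat E^s_{x_0}\oplus E^u_{x_0}$ centred at $x_0$, with graphs over the ball, respectively interval, of radius $R$; these functions and their derivatives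 depend continuously on $x$, uniformly over the ball, respectively interval; and two of these stable leaves in the same coordinates are equal or disjoint. -/

import Mathlib

open Set Filter Topology
open scoped ContDiff

noncomputable section

namespace Robust

/-! ### Partial iterates and linear cocycles

A partially defined operator `T : O → E` is represented by a total function `T : E → E` together
with its domain `O`; only values of `T` on `O` are ever meaningful. -/

/-- The cocycle `L_x^{(n)} = L_{T^{n-1} x} ∘ ⋯ ∘ L_{T x} ∘ L_x`. -/
def cocycle {X Y : Type*} [NormedAddCommGroup Y] [NormedSpace ℝ Y]
    (T : X → X) (L : X → Y →L[ℝ] Y) : ℕ → X → Y →L[ℝ] Y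
  | 0, _ => ContinuousLinearMap.id ℝ Y
  | n + 1, x => (cocycle T L n (T x)).comp (L x)

/-- `O^{(m)}`: the interior of the set of points of `O` whose iterates `T^i f`, `i < m`,
all lie in `O`. -/
def iterDomain {E : Type*} [TopologicalSpace E] (T : E → E) (O : Set E) (m : ℕ) : Set E :=
  interior {f | f ∈ O ∧ ∀ i < m, T^[i] f ∈ O}

/-! ### Hyperbolic basic sets -/

/-- `K` is a hyperbolic basic set of `T : O → A`. The splitting `A = E^s_x ⊕ E^u_x` is given by
the projections `P x` onto `E^u_x = range (P x)` along `E^s_x = ker (P x)`; the splitting is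
continuous, i.e. `P` is norm continuous on `K`. The number `θ` is the contraction exponent. -/
structure IsHyperbolicBasicSet {A : Type*} [NormedAddCommGroup A] [NormedSpace ℝ A]
    (T : A → A) (O K : Set A) (P : A → A →L[ℝ] A) (θ : ℝ) : Prop where
  isOpen : IsOpen O
  isCompact : IsCompact K
  subset : K ⊆ O
  /-- `T` maps `K` bijectively onto `K`; as `T` is continuous on the compact set `K`, the
  restriction is a homeomorphism. -/
  bijOn : BijOn T K K
  continuousOn : ContinuousOn T K
  transitive : ∀ U V : Set A, IsOpen U → IsOpen V → (U ∩ K).Nonempty → (V ∩ K).Nonempty →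
    ∃ n : ℕ, ∃ x ∈ U ∩ K, T^[n] x ∈ V
  periodic_dense : K ⊆ closure (K ∩ Function.periodicPts T)
  attracts : ∀ y, (∀ n : ℕ, T^[n] y ∈ O) →
    Tendsto (fun n : ℕ => Metric.infDist (T^[n] y) K) atTop (𝓝 0)
  proj : ∀ x ∈ K, (P x).comp (P x) = P x
  proj_continuous : ContinuousOn P K
  proj_invariant : ∀ x ∈ K, (P (T x)).comp (fderiv ℝ T x) = (fderiv ℝ T x).comp (P x)
  exponent : 0 < θ ∧ θ < 1
  rates : ∃ C : ℝ, 0 < C ∧ ∀ x ∈ K, ∀ n : ℕ,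
    (∀ v, P x v = 0 → ‖fderiv ℝ (T^[n]) x v‖ ≤ C * θ ^ n * ‖v‖) ∧
    (∀ v, P x v = v → C⁻¹ * (θ ^ n)⁻¹ * ‖v‖ ≤ ‖fderiv ℝ (T^[n]) x v‖)
  dim_const : ∃ d : ℕ, ∀ x ∈ K, Module.Finite ℝ (P x).range ∧ Module.finrank ℝ (P x).range = d

/-- The unstable spaces are one-dimensional, and spanned by unit vectors `u x` which vary
continuously with `x ∈ K` and satisfy `DT(x) u_x = δ_x u_{T x}` with `δ_x > 0`. -/
structure IsUnstableFrame {A : Type*} [NormedAddCommGroup A] [NormedSpace ℝ A]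
    (T : A → A) (K : Set A) (P : A → A →L[ℝ] A) (u : A → A) (δ : A → ℝ) : Prop where
  continuousOn : ContinuousOn u K
  unit : ∀ x ∈ K, ‖u x‖ = 1
  span : ∀ x ∈ K, (P x).range = Submodule.span ℝ {u x}
  pos : ∀ x ∈ K, 0 < δ x
  map : ∀ x ∈ K, fderiv ℝ T x (u x) = δ x • u (T x)

/-- `δ_{T^{m-1} x} ⋯ δ_x > C₀ λ^m` for all `x ∈ K` and `m ≥ 1`, where `C₀ > 0` and `λ > 1`. -/
structure IsExpansionRate {A : Type*} (T : A → A) (K : Set A) (δ : A → ℝ)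
    (C₀ lam : ℝ) : Prop where
  const_pos : 0 < C₀
  one_lt : 1 < lam
  lower : ∀ x ∈ K, ∀ m : ℕ, 1 ≤ m → C₀ * lam ^ m < ∏ i ∈ Finset.range m, δ (T^[i] x)

/-! ### Compatible pairs -/

/-- The pair `(X, Y)` is `ρ`-compatible with `(T, K)`. The inclusions `A ⊆ X ⊆ Y` are the
maps `j` and `k`; `Lhat x` is the extension to `Y` of `L_x = DT(x)`. -/
def IsCompatible {A X Y : Type*}
    [NormedAddCommGroup A] [NormedSpace ℝ A] [NormedAddCommGroup X] [NormedSpace ℝ X]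
    [NormedAddCommGroup Y] [NormedSpace ℝ Y]
    (T : A → A) (K : Set A) (j : A →L[ℝ] X) (k : X →L[ℝ] Y) (θ lam ρ : ℝ) : Prop :=
  θ < ρ ∧ ρ < lam ∧
  -- (A1)
  IsCompactOperator j ∧ IsCompactOperator k ∧
  ∃ Lhat : A → Y →L[ℝ] Y,
    -- (A2)
    (∃ M : ℝ, 0 < M ∧ ∀ x ∈ K,
      (∀ v : A, Lhat x (k (j v)) = k (j (fderiv ℝ T x v))) ∧
      ‖Lhat x‖ < M ∧
      ∀ v : X, ∃ w : X, k w = Lhat x (k v) ∧ ‖w‖ ≤ M * ‖v‖) ∧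
    -- (A3)
    ContinuousOn (fun x => (Lhat x).comp k) K ∧
    ∃ Δ : ℝ, 1 < Δ ∧
      -- (A4)
      (∀ b : X, ‖b‖ < 1 → k b ∈ closure (k '' {b' : X | ‖b'‖ < Δ ∧ b' ∈ range j})) ∧
      -- (A5)
      ∃ κ : ℝ, 1 < κ ∧ ∃ m : ℕ, 0 < m ∧ ∀ x ∈ K, ∀ v w : X,
        k w = cocycle T Lhat m x (k v) →
          ‖w‖ ≤ max (ρ ^ m / (2 * (1 + Δ)) * ‖v‖) (κ * ‖k v‖)

/-! ### Robust operators -/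

/-- `TA : OA → A`, having the hyperbolic basic set `K` with unstable vectors `u`, is robust with
respect to `(B, C, D)`, by means of its extension `TB : OB → B`. The inclusions
`A ⊆ B ⊆ C ⊆ D` are the injective compact operators `iAB`, `iBC`, `iCD`. For `f` in
`O_B^{(m)}` the derivative `DT^m(f) : B → C` is `fderiv ℝ (iBC ∘ TB^[m]) f`. -/
structure IsRobust {A B C D : Type*}
    [NormedAddCommGroup A] [NormedSpace ℝ A] [NormedAddCommGroup B] [NormedSpace ℝ B]
    [NormedAddCommGroup C] [NormedSpace ℝ C] [NormedAddCommGroup D] [NormedSpace ℝ D]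
    (iAB : A →L[ℝ] B) (iBC : B →L[ℝ] C) (iCD : C →L[ℝ] D)
    (TA : A → A) (OA K : Set A) (u : A → A) (θ C₀ lam : ℝ)
    (TB : B → B) (OB : Set B) : Prop where
  injective : Function.Injective iAB ∧ Function.Injective iBC ∧ Function.Injective iCD
  compact : IsCompactOperator iAB ∧ IsCompactOperator iBC ∧ IsCompactOperator iCD
  isOpen : IsOpen OB
  /-- `OA ⊆ OB`, and `TB` extends `TA`. -/
  extends_op : ∀ f ∈ OA, iAB f ∈ OB ∧ TB (iAB f) = iAB (TA f)
  B1 : IsCompatible TA K iAB (iCD.comp iBC) θ lam 1 ∧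
    ∃ ρ : ℝ, IsCompatible TA K (iBC.comp iAB) iCD θ lam ρ
  B2 : ∀ m : ℕ, 0 < m →
    iAB '' K ⊆ iterDomain TB OB m ∧
    ContDiffOn ℝ 1 (iBC ∘ TB^[m]) (iterDomain TB OB m) ∧
    (∃ V : Set B, IsOpen V ∧ iAB '' K ⊆ V ∧ V ⊆ iterDomain TB OB m ∧
      UniformContinuousOn (fderiv ℝ (iBC ∘ TB^[m])) V) ∧
    ∀ f : A, iAB f ∈ iterDomain TB OB m → ∃ Lm : D →L[ℝ] D,
      (∀ v : B, Lm (iCD (iBC v)) = iCD (fderiv ℝ (iBC ∘ TB^[m]) (iAB f) v)) ∧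
      (∀ v : B, ∃ w : B, Lm (iCD (iBC v)) = iCD (iBC w)) ∧
      (∀ v : C, ∃ w : C, Lm (iCD v) = iCD w)
  B3 : ∀ m : ℕ, 0 < m → ∃ C₁ : ℝ, 1 < C₁ ∧ ∀ g ∈ K, ∃ V : Set B,
    IsOpen V ∧ iAB g ∈ V ∧ V ⊆ iterDomain TB OB m ∧ ∀ f ∈ V,
      ‖fderiv ℝ (iBC ∘ TB^[m]) f (iAB (u g)) - fderiv ℝ (iBC ∘ TB^[m]) (iAB g) (iAB (u g))‖
        ≤ C₁ * ‖f - iAB g‖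
  B4 : ∃ C₁ : ℝ, 1 < C₁ ∧ ∃ ρ : ℝ, 1 < ρ ∧ ∀ g ∈ K, ∃ V : Set B,
    IsOpen V ∧ iAB g ∈ V ∧ V ⊆ OB ∧ ∀ f₁ ∈ V, ∀ f₂ ∈ V,
      ‖iBC (TB f₁) - iBC (TB f₂) - fderiv ℝ (iBC ∘ TB) f₂ (f₁ - f₂)‖
        ≤ C₁ * ‖iBC (f₁ - f₂)‖ ^ ρ
  /-- (B5) and (B6), which share the radii `ν m`. In (B5) the norm of `DT^m(f) - DT^m(g)` is the
  operator norm for the norm of `C` on both sides. In (B6), `w` is the vector `DT^m(g) v`, which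
  lies in `B`. -/
  B56 : ∃ ν C₂ C₃ : ℕ → ℝ, (∀ m, 0 < m → 0 < ν m ∧ 0 < C₂ m ∧ 0 < C₃ m) ∧
    (∀ m, 0 < m → ∀ g ∈ K, ∀ f ∈ iterDomain TB OB m, ‖f - iAB g‖ < ν m → ∀ v : B,
      ‖fderiv ℝ (iBC ∘ TB^[m]) f v - fderiv ℝ (iBC ∘ TB^[m]) (iAB g) v‖
        ≤ C₂ m * lam ^ m * ‖iBC v‖) ∧
    (∃ m₀ : ℕ, 0 < m₀ ∧ ∀ m > m₀, C₂ m < C₀ / 8) ∧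
    (∀ m, 0 < m → ∀ g ∈ K, ∀ f : A, ‖f - g‖ < ν m → ∀ v : B, ‖v‖ < ν m →
      iAB f ∈ iterDomain TB OB m → iAB f + v ∈ iterDomain TB OB m →
      ∃ w : B, iBC w = fderiv ℝ (iBC ∘ TB^[m]) (iAB g) v ∧
        ‖TB^[m] (iAB f + v) - TB^[m] (iAB f) - w‖ ≤ C₃ m * ‖v‖) ∧
    (∃ m₀ : ℕ, 0 < m₀ ∧ ∀ m > m₀, C₃ m < 1 / 4)

/-! ### Local stable and unstable sets -/

section Sets

variable {E : Type*} [NormedAddCommGroup E] [NormedSpace ℝ E]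

/-- The local stable set `W^s_ε(x)`. -/
def localStable (T : E → E) (O : Set E) (ε : ℝ) (x : E) : Set E :=
  {y | (∀ n : ℕ, T^[n] y ∈ O ∧ T^[n] y ∈ Metric.ball (T^[n] x) ε) ∧
    Tendsto (fun n : ℕ => ‖T^[n] y - T^[n] x‖) atTop (𝓝 0)}

/-- The global stable set `W^s(x)`. -/
def globalStable (T : E → E) (O : Set E) (x : E) : Set E :=
  {y | (∀ n : ℕ, T^[n] y ∈ O) ∧ Tendsto (fun n : ℕ => ‖T^[n] y - T^[n] x‖) atTop (𝓝 0)}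

/-- `T^{-n}(x)` for `x ∈ K`, where `T` restricts to a bijection of `K`. -/
def backIter (T : E → E) (K : Set E) (n : ℕ) (x : E) : E :=
  (Function.invFunOn T K)^[n] x

/-- `z` is a backward orbit of `z 0` which stays `ε`-close, and is asymptotic, to the
backward orbit of `x ∈ K` in `K`. -/
def IsBackwardOrbit (T : E → E) (O K : Set E) (ε : ℝ) (x : E) (z : ℕ → E) : Prop :=
  (∀ n : ℕ, z n ∈ Metric.ball (backIter T K n x) ε) ∧
  (∀ n : ℕ, z (n + 1) ∈ O ∧ T (z (n + 1)) = z n) ∧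
  Tendsto (fun n : ℕ => ‖z n - backIter T K n x‖) atTop (𝓝 0)

/-- The local unstable set `W^u_ε(x)`. -/
def localUnstable (T : E → E) (O K : Set E) (ε : ℝ) (x : E) : Set E :=
  {y | ∃ z : ℕ → E, z 0 = y ∧ IsBackwardOrbit T O K ε x z}

/-! ### The hyperbolic picture

The splitting of `E` over `x ∈ K` is `E = ker (σ x) ⊕ ℝ U x`, where `σ x` is a bounded linear
functional with `σ x (U x) = 1`. -/

/-- `E = ker (σ x) ⊕ ℝ U x`, `x ∈ K`, is a continuous splitting which is invariant under and
uniformly hyperbolic for the linear cocycle `L` over `T`. -/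
structure IsHyperbolicSplitting (T : E → E) (K : Set E) (U : E → E) (σ : E → E →L[ℝ] ℝ)
    (L : E → E →L[ℝ] E) : Prop where
  continuous_unstable : ContinuousOn U K
  continuous_stable : ContinuousOn σ K
  normalized : ∀ x ∈ K, σ x (U x) = 1
  invariant_unstable : ∀ x ∈ K, ∃ c : ℝ, L x (U x) = c • U (T x)
  invariant_stable : ∀ x ∈ K, ∀ v, σ x v = 0 → σ (T x) (L x v) = 0
  rates : ∃ C θ : ℝ, 0 < C ∧ 0 < θ ∧ θ < 1 ∧ ∀ x ∈ K, ∀ n : ℕ,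
    (∀ v, σ x v = 0 → ‖cocycle T L n x v‖ ≤ C * θ ^ n * ‖v‖) ∧
    C⁻¹ * (θ ^ n)⁻¹ * ‖U x‖ ≤ ‖cocycle T L n x (U x)‖

/-- The graph over the ball of radius `R` of `ker (σ x₀)` of a function `h`, in the
coordinates `(v, t) ↦ x₀ + v + t U_{x₀}`. -/
def stableGraph (U : E → E) (σ : E → E →L[ℝ] ℝ) (x₀ : E) (R : ℝ) (h : (σ x₀).ker → ℝ) : Set E :=
  {y | ∃ v ∈ Metric.ball (0 : (σ x₀).ker) R, y = x₀ + (v : E) + h v • U x₀}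

/-- The graph over a set `I ⊆ ℝ` of a function `η` with values in `ker (σ x₀)`, in the
same coordinates. -/
def unstableGraph (U : E → E) (σ : E → E →L[ℝ] ℝ) (x₀ : E) (I : Set ℝ) (η : ℝ → (σ x₀).ker) :
    Set E :=
  {y | ∃ t ∈ I, y = x₀ + t • U x₀ + (η t : E)}

/-- The local stable sets of the points of `K` are `C¹` manifolds tangent to `ker (σ x)` at `x`
which form a `C⁰` lamination.

`h x₀ x` describes, in the coordinates centred at `x₀ ∈ K`, the leaf of a nearby point `x ∈ K`.
All graphs have the same size `R`, and every `W^s_ε(x)` with `ε ≤ ε₀` is contained in the leaf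
of `x` and coincides with it near `x`. -/
def StableLamination (T : E → E) (O K : Set E) (U : E → E) (σ : E → E →L[ℝ] ℝ) (ε₀ : ℝ) : Prop :=
  ∃ r₀ : ℝ, 0 < r₀ ∧ ∃ R : ℝ, 0 < R ∧ ∃ h : (x₀ : E) → E → (σ x₀).ker → ℝ,
    -- the leaf through `x` is a `C¹` graph
    (∀ x₀ ∈ K, ∀ x ∈ K, ‖x - x₀‖ < r₀ → ContDiffOn ℝ 1 (h x₀ x) (Metric.ball 0 R)) ∧
    -- which passes through `x`, tangent to `ker (σ x)`
    (∀ x ∈ K, h x x 0 = 0 ∧ HasFDerivAt (h x x) (0 : (σ x).ker →L[ℝ] ℝ) 0) ∧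
    -- the local stable sets lie in the leaves, and contain neighbourhoods of `x` in the leaves
    (∀ ε, 0 < ε → ε ≤ ε₀ → ∀ x₀ ∈ K, ∀ x ∈ K, ‖x - x₀‖ < r₀ →
      localStable T O ε x ⊆ stableGraph U σ x₀ R (h x₀ x)) ∧
    (∀ ε, 0 < ε → ε ≤ ε₀ → ∃ r, 0 < r ∧ ∀ x₀ ∈ K, ∀ x ∈ K, ‖x - x₀‖ < r₀ →
      stableGraph U σ x₀ R (h x₀ x) ∩ Metric.ball x r ⊆ localStable T O ε x) ∧
    -- leaves in a common chart are equal or disjoint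
    (∀ x₀ ∈ K, ∀ x ∈ K, ∀ x' ∈ K, ‖x - x₀‖ < r₀ → ‖x' - x₀‖ < r₀ →
      (∃ v ∈ Metric.ball (0 : (σ x₀).ker) R, h x₀ x v = h x₀ x' v) →
      ∀ v ∈ Metric.ball (0 : (σ x₀).ker) R, h x₀ x v = h x₀ x' v) ∧
    -- the leaves and their tangent spaces vary continuously
    (∀ x₀ ∈ K, ∀ x ∈ K, ‖x - x₀‖ < r₀ →
      TendstoUniformlyOn (h x₀) (h x₀ x) (𝓝[K] x) (Metric.ball 0 R) ∧
      TendstoUniformlyOn (fun x' => fderiv ℝ (h x₀ x')) (fderiv ℝ (h x₀ x)) (𝓝[K] x)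
        (Metric.ball 0 R))

/-- The local unstable sets of the points of `K` are curves of class `C^n` (real analytic if
`n = ω`) tangent to `ℝ U x` at `x`; the curves, of a uniform size, and their tangent lines vary
continuously with `x ∈ K`. -/
def UnstableCurves (T : E → E) (O K : Set E) (U : E → E) (σ : E → E →L[ℝ] ℝ) (n : WithTop ℕ∞)
    (ε₀ : ℝ) : Prop :=
  ∃ r₀ : ℝ, 0 < r₀ ∧ ∃ R : ℝ, 0 < R ∧ ∃ η : (x₀ : E) → E → ℝ → (σ x₀).ker,
    (∀ x₀ ∈ K, ∀ x ∈ K, ‖x - x₀‖ < r₀ → ContDiffOn ℝ n (η x₀ x) (Ioo (-R) R)) ∧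
    (∀ x ∈ K, η x x 0 = 0 ∧ HasDerivAt (η x x) 0 0) ∧
    -- each local unstable set is the part of the curve over an open interval
    (∀ ε, 0 < ε → ε ≤ ε₀ → ∀ x₀ ∈ K, ∀ x ∈ K, ‖x - x₀‖ < r₀ →
      ∃ I : Set ℝ, I ⊆ Ioo (-R) R ∧ IsOpen I ∧ I.OrdConnected ∧
        localUnstable T O K ε x = unstableGraph U σ x₀ I (η x₀ x)) ∧
    (∀ ε, 0 < ε → ε ≤ ε₀ → ∃ r, 0 < r ∧ ∀ x₀ ∈ K, ∀ x ∈ K, ‖x - x₀‖ < r₀ →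
      unstableGraph U σ x₀ (Ioo (-R) R) (η x₀ x) ∩ Metric.ball x r ⊆ localUnstable T O K ε x) ∧
    (∀ x₀ ∈ K, ∀ x ∈ K, ‖x - x₀‖ < r₀ →
      TendstoUniformlyOn (η x₀) (η x₀ x) (𝓝[K] x) (Ioo (-R) R) ∧
      TendstoUniformlyOn (fun x' => deriv (η x₀ x')) (deriv (η x₀ x)) (𝓝[K] x) (Ioo (-R) R))

/-- The hyperbolic picture for `T : O → E` over `K`, with splitting `E = ker (σ x) ⊕ ℝ U x`. -/
def HyperbolicPicture (T : E → E) (O K : Set E) (U : E → E) (σ : E → E →L[ℝ] ℝ)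
    (n : WithTop ℕ∞) : Prop :=
  ∃ ε₀ C θ κ : ℝ, 0 < ε₀ ∧ 0 < C ∧ 0 < θ ∧ θ < 1 ∧ 1 ≤ κ ∧
    -- (i) and (iv)
    StableLamination T O K U σ ε₀ ∧
    UnstableCurves T O K U σ n ε₀ ∧
    -- (ii), stable sets
    (∀ ε, 0 < ε → ε ≤ ε₀ → ∀ x ∈ K, ∀ y ∈ localStable T O ε x, ∀ m : ℕ,
      ‖T^[m] x - T^[m] y‖ ≤ C * θ ^ m * ‖x - y‖) ∧
    (∀ x ∈ K, ∀ y ∈ globalStable T O x, ∃ C' : ℝ, ∀ m : ℕ,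
      ‖T^[m] x - T^[m] y‖ ≤ C' * θ ^ m * ‖x - y‖) ∧
    -- (ii), unstable sets
    (∀ ε, 0 < ε → ε ≤ ε₀ → ∀ x ∈ K,
      localUnstable T O K ε (T x) ⊆ T '' localUnstable T O K ε x ∧
      InjOn T (localUnstable T O K ε x) ∧
      ∀ z : ℕ → E, IsBackwardOrbit T O K ε x z → ∀ m : ℕ,
        ‖backIter T K m x - z m‖ ≤ C * θ ^ m * ‖x - z 0‖) ∧
    -- (iii)
    (∀ ε, 0 < ε → ε ≤ ε₀ → ∀ x ∈ K, ∀ (y : E) (m : ℕ),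
      (∀ i ≤ m, T^[i] y ∈ Metric.ball (T^[i] x) ε) →
      Metric.infDist (T^[m] y) (localUnstable T O K ε (T^[m] x)) ≤ C * θ ^ m ∧
      Metric.infDist y (localStable T O (κ * ε) x) ≤ C * θ ^ m)

end Sets

end Robust

end

/-!
# The hyperbolic picture for a robust operator

The operator on `B` need not even be continuous there; it is differentiable only as a map into the
larger space `C`, and close to its linearization in `B` only near points of `A`. The proof rests on
the fact that this information is enough for cone estimates, of two kinds, and that a cone field with
a one-dimensional unstable direction determines the invariant manifolds.

**The splitting.** By density and compactness, a vector of `B` or `C` can be approximated by vectors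
of `A`, with an error which the cocycle of derivatives makes grow more slowly than the unstable
vectors. Splitting the approximations by `σ`, one finds the unstable component of the vector
(`exists_extension`); it is unique, because the remainder grows more slowly than the unstable vectors
(`component_unique`). The extended cocycle is the derivative of the iterates into `C`, since both
extend to `D` and agree on the dense subspace `A` (`IsRobust.fderiv_iterate`). Compactness of the
basic set turns the hypotheses into uniform estimates near it; they are collected in the structure
`LocalModel`, which is all that the theory of the stable sets uses.

**Contraction.** A difference between an arbitrary orbit and an orbit near the basic set in the norm of
`A` obeys cone estimates in the norm of `B` (`cone_step`): in a cone around the unstable direction the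
unstable coordinate expands, outside it the difference contracts. An orbit which stays close to one of
the basic set therefore never enters the cone, and converges exponentially (`shadow_contract`);
backward orbits close to each other stay in the cone and converge as well (`backward_contract`).

**Stable leaves.** Two arbitrary points of `B` can only be compared in the norm of `C`
(`block_step`), where the complement of the cone may expand, but more slowly than the unstable direction.
Hence two shadowing points whose difference lies in the cone coincide (`shadow_slow`), and a leaf is
the graph of a Lipschitz function. It is defined everywhere: on a segment in the unstable direction, the
points whose orbits leave a tube upwards, and those whose orbits leave it downwards, form disjoint
nonempty open sets, the unstable coordinates being continuous, so that some point of the connected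
segment does not leave (`exists_shadow`). Comparing the slow growth along a leaf with the growth of
the unstable vectors under a high iterate, for which the Hölder estimate bounds the nonlinearity,
shows that linear functionals approximate a leaf to first order, uniformly (`leaf_approx`). This makes
the leaves of class `C¹`, with derivatives which depend continuously on the base point
(`uniform_fderiv`, `stableLamination`).

**Unstable curves.** They lie in `A`, where the operator is as smooth as assumed. A family of backward
orbits, one for each point of a compact set of base points, is a perturbation in the Banach space of
continuous functions vanishing at infinity from `Z₀ × ℕ` to `A`, and it solves an equation whose
linearization is bijective, by hyperbolicity (`bijective_linearization`). Superposition operators on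
this space are of class `C^k`, or real analytic at the origin, so that the inverse function theorem
yields the curves together with their smooth dependence on the parameter (`exists_unstable_family`).
The curves and their first backward iterates are nearly straight (`exists_straight`), so that the
points whose backward orbits stay `ε`-close form an interval (`unstableCurves`).

**Orbits that stay close.** Moving the initial point along the unstable direction to the stable leaf, or
the final point to the unstable curve, changes it by an exponentially small amount
(`infDist_localStable`, by `cone_decay`; `infDist_localUnstable`, by the cone estimates in `B`).
-/

namespace Robust

/-! ### Cocycles and their expansion factors -/

section Cocycle

variable {X Y Z : Type*} [NormedAddCommGroup Y] [NormedSpace ℝ Y]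
  [NormedAddCommGroup Z] [NormedSpace ℝ Z]

/-- The expansion factor `δ_{S^{n-1} x} ⋯ δ_x` of the unstable direction after `n` steps. -/
def growth (S : X → X) (δ : X → ℝ) (n : ℕ) (x : X) : ℝ := ∏ i ∈ Finset.range n, δ (S^[i] x)

@[simp] lemma growth_zero (S : X → X) (δ : X → ℝ) (x : X) : growth S δ 0 x = 1 := by
  simp [growth]

lemma growth_add (S : X → X) (δ : X → ℝ) (m n : ℕ) (x : X) :
    growth S δ (m + n) x = growth S δ m x * growth S δ n (S^[m] x) := by
  simp only [growth, Finset.prod_range_add]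
  congr 1
  refine Finset.prod_congr rfl fun i _ => ?_
  rw [← Function.iterate_add_apply, add_comm]

lemma growth_one (S : X → X) (δ : X → ℝ) (x : X) : growth S δ 1 x = δ x := by
  simp [growth]

lemma growth_pos {S : X → X} {δ : X → ℝ} (h : ∀ x, 0 < δ x) (n : ℕ) (x : X) :
    0 < growth S δ n x := Finset.prod_pos fun _ _ => h _

lemma continuous_growth [TopologicalSpace X] {S : X → X} {δ : X → ℝ} (hS : Continuous S)
    (hδ : Continuous δ) (n : ℕ) : Continuous (growth S δ n) :=
  continuous_finsetProd _ fun i _ => hδ.comp (hS.iterate i)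

@[simp] lemma cocycle_zero (S : X → X) (L : X → Y →L[ℝ] Y) (x : X) :
    cocycle S L 0 x = ContinuousLinearMap.id ℝ Y := rfl

lemma cocycle_succ (S : X → X) (L : X → Y →L[ℝ] Y) (n : ℕ) (x : X) :
    cocycle S L (n + 1) x = (cocycle S L n (S x)).comp (L x) := rfl

lemma cocycle_add (S : X → X) (L : X → Y →L[ℝ] Y) (m n : ℕ) (x : X) (v : Y) :
    cocycle S L (m + n) x v = cocycle S L n (S^[m] x) (cocycle S L m x v) := by
  induction m generalizing x v with
  | zero => simp
  | succ m ih =>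
    rw [Nat.succ_add, cocycle_succ, cocycle_succ]
    simp [ih]

lemma cocycle_one (S : X → X) (L : X → Y →L[ℝ] Y) (x : X) : cocycle S L 1 x = L x := by
  ext; simp [cocycle_succ]

lemma cocycle_norm_le {S : X → X} {L : X → Y →L[ℝ] Y} {M : ℝ} (hM : 0 ≤ M)
    (h : ∀ x v, ‖L x v‖ ≤ M * ‖v‖) (n : ℕ) (x : X) (v : Y) :
    ‖cocycle S L n x v‖ ≤ M ^ n * ‖v‖ := by
  induction n generalizing x v with
  | zero => simp
  | succ n ih =>
    rw [cocycle_succ]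
    calc _ ≤ M ^ n * ‖L x v‖ := ih _ _
      _ ≤ M ^ n * (M * ‖v‖) := by gcongr; exact h x v
      _ = _ := by ring

lemma cocycle_intertwine {S : X → X} {L : X → Y →L[ℝ] Y} {L' : X → Z →L[ℝ] Z} {k : Y →L[ℝ] Z}
    (h : ∀ x v, k (L x v) = L' x (k v)) (n : ℕ) (x : X) (v : Y) :
    k (cocycle S L n x v) = cocycle S L' n x (k v) := by
  induction n generalizing x v with
  | zero => simp
  | succ n ih => rw [cocycle_succ, cocycle_succ]; simp [ih, h]

lemma iterate_semiconj {E : Type*} {S : X → X} {T : E → E} {p : X → E}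
    (h : ∀ x, T (p x) = p (S x)) (n : ℕ) (x : X) : T^[n] (p x) = p (S^[n] x) := by
  induction n generalizing x with
  | zero => rfl
  | succ n ih => rw [Function.iterate_succ_apply, Function.iterate_succ_apply, h, ih]

lemma cocycle_semiconj {E : Type*} {S : X → X} {T : E → E} {p : X → E}
    (h : ∀ x, T (p x) = p (S x)) (L : E → Y →L[ℝ] Y) (n : ℕ) (x : X) :
    cocycle T L n (p x) = cocycle S (fun x => L (p x)) n x := by
  induction n generalizing x with
  | zero => rfl
  | succ n ih => rw [cocycle_succ, cocycle_succ, h, ih]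

lemma cocycle_unstable {S : X → X} {L : X → Y →L[ℝ] Y} {u : X → Y} {δ : X → ℝ}
    (h : ∀ x, L x (u x) = δ x • u (S x)) (n : ℕ) (x : X) :
    cocycle S L n x (u x) = growth S δ n x • u (S^[n] x) := by
  induction n with
  | zero => simp
  | succ n ih =>
    rw [cocycle_add, ih, map_smul, cocycle_one, h, smul_smul, growth_add, growth_one,
      Function.iterate_succ_apply']

end Cocycle

/-! ### Extension of the splitting to a compatible pair -/

/-- A cocycle `L` over `S` with a splitting into the lines `ℝ u x`, which are expanded, and the
kernels of the functionals `s x`, which are contracted, uniformly in `x`. -/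
structure IsSplitCocycle {X A : Type*} [NormedAddCommGroup A] [NormedSpace ℝ A]
    (S : X → X) (L : X → A →L[ℝ] A) (u : X → A) (δ : X → ℝ) (s : X → A →L[ℝ] ℝ)
    (θ C₀ lam : ℝ) : Prop where
  map : ∀ x, L x (u x) = δ x • u (S x)
  pos : ∀ x, 0 < δ x
  unit : ∀ x, ‖u x‖ ≤ 1
  rate_pos : 0 < θ
  const_pos : 0 < C₀
  one_lt : 1 < lam
  one : ∀ x, s x (u x) = 1
  bound : ∃ Q : ℝ, 0 < Q ∧ ∀ x v, |s x v| ≤ Q * ‖v‖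
  contract : ∃ c : ℝ, 0 < c ∧ ∀ n x v, ‖cocycle S L n x (v - s x v • u x)‖ ≤ c * θ ^ n * ‖v‖
  lower : ∀ n x, C₀ * lam ^ n ≤ growth S δ n x

section Extension

variable {X A V Y : Type*} [NormedAddCommGroup A] [NormedSpace ℝ A]
  [NormedAddCommGroup V] [NormedSpace ℝ V] [NormedAddCommGroup Y] [NormedSpace ℝ Y]

/-- The image in `Y` of the unit ball of `V` is totally bounded, so that finitely many elements
of `A` approximate, in `Y`, every vector of that ball. -/
lemma exists_net {j : A →L[ℝ] V} {k : V →L[ℝ] Y} (hk : IsCompactOperator k) {Δ : ℝ}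
    (h4 : ∀ b : V, ‖b‖ < 1 → k b ∈ closure (k '' {b' : V | ‖b'‖ < Δ ∧ b' ∈ range j}))
    {ε : ℝ} (hε : 0 < ε) :
    ∃ Q : ℝ, 0 < Q ∧ ∀ b : V, ‖b‖ < 1 → ∃ a : A, ‖a‖ ≤ Q ∧ ‖b - j a‖ ≤ 1 + Δ ∧
      ‖k (b - j a)‖ ≤ ε := by
  have htb : TotallyBounded (k '' Metric.ball 0 1) :=
    (IsCompactOperator.isCompact_closure_image_ball (f := (k : V →ₗ[ℝ] Y)) hk 1).totallyBounded.subset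
      subset_closure
  obtain ⟨t, htf, ht⟩ := Metric.totallyBounded_iff.1 htb (ε / 3) (by positivity)
  have key : ∀ y : Y, ∃ a : A, (∃ b : V, ‖b‖ < 1 ∧ dist (k b) y < ε / 3) →
      ‖j a‖ < Δ ∧ dist (k (j a)) y < 2 * (ε / 3) := by
    intro y
    by_cases hy : ∃ b : V, ‖b‖ < 1 ∧ dist (k b) y < ε / 3
    · obtain ⟨b, hb, hby⟩ := hy
      obtain ⟨z, ⟨b', ⟨hb', a, rfl⟩, rfl⟩, hz⟩ := Metric.mem_closure_iff.1 (h4 b hb) (ε / 3)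
        (by positivity)
      refine ⟨a, fun _ => ⟨hb', ?_⟩⟩
      have := dist_triangle (k (j a)) (k b) y
      rw [dist_comm] at hz
      linarith
    · exact ⟨0, fun h => absurd h hy⟩
  choose a ha using key
  obtain ⟨Q, hQ⟩ := (htf.image fun y => ‖a y‖).bddAbove
  refine ⟨max Q 1, by positivity, fun b hb => ?_⟩
  have hb' : k b ∈ ⋃ y ∈ t, Metric.ball y (ε / 3) := ht ⟨b, by simpa using hb, rfl⟩
  simp only [mem_iUnion, Metric.mem_ball] at hb'
  obtain ⟨y, hyt, hy⟩ := hb'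
  obtain ⟨h1, h2⟩ := ha y ⟨b, hb, hy⟩
  refine ⟨a y, (hQ ⟨y, hyt, rfl⟩).trans (le_max_left _ _), ?_, ?_⟩
  · calc _ ≤ ‖b‖ + ‖j (a y)‖ := norm_sub_le _ _
      _ ≤ _ := by linarith
  · rw [map_sub, ← dist_eq_norm]
    have := dist_triangle_right (k b) (k (j (a y))) y
    linarith

/-- A vector of `V` is, up to a vector which the cocycle shrinks, an element of `A` of
comparable size. The factor `3 / 4` is `(1 + Δ) / (2 (1 + Δ))` times the `3 / 2` lost in passing
to the open unit ball. -/
lemma exists_approx {S : X → X} {j : A →L[ℝ] V} {k : V →L[ℝ] Y}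
    {LV : X → V →L[ℝ] V} (hk : IsCompactOperator k) {Δ κ ρ : ℝ} {m : ℕ} (hρ : 0 < ρ)
    (hΔ : 1 < Δ) (hκ : 1 < κ)
    (h4 : ∀ b : V, ‖b‖ < 1 → k b ∈ closure (k '' {b' : V | ‖b'‖ < Δ ∧ b' ∈ range j}))
    (h5 : ∀ x v, ‖cocycle S LV m x v‖ ≤ max (ρ ^ m / (2 * (1 + Δ)) * ‖v‖) (κ * ‖k v‖)) :
    ∃ Q : ℝ, 0 < Q ∧ ∀ x (v : V), ∃ a : A, ‖a‖ ≤ Q * ‖v‖ ∧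
      ‖cocycle S LV m x (v - j a)‖ ≤ 3 / 4 * ρ ^ m * ‖v‖ := by
  have hρm : 0 < ρ ^ m := by positivity
  obtain ⟨Q, hQ, h⟩ := exists_net (j := j) hk h4 (ε := ρ ^ m / (2 * κ)) (by positivity)
  refine ⟨3 / 2 * Q, by positivity, fun x v => ?_⟩
  rcases eq_or_ne v 0 with rfl | hv
  · exact ⟨0, by simp, by simp⟩
  have hv' : 0 < ‖v‖ := norm_pos_iff.2 hv
  obtain ⟨a, ha, hb1, hb2⟩ := h ((3 / 2 * ‖v‖)⁻¹ • v) (by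
    rw [norm_smul, norm_inv, Real.norm_of_nonneg (by positivity)]
    field_simp; norm_num)
  have hc : (0 : ℝ) < 3 / 2 * ‖v‖ := by positivity
  have e : v - j ((3 / 2 * ‖v‖) • a) = (3 / 2 * ‖v‖) • ((3 / 2 * ‖v‖)⁻¹ • v - j a) := by
    rw [smul_sub, smul_smul, mul_inv_cancel₀ hc.ne', one_smul, map_smul]
  refine ⟨(3 / 2 * ‖v‖) • a, ?_, ?_⟩
  · rw [norm_smul, Real.norm_of_nonneg hc.le]
    nlinarith
  · rw [e, map_smul, norm_smul, Real.norm_of_nonneg hc.le]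
    have h1 : ‖cocycle S LV m x ((3 / 2 * ‖v‖)⁻¹ • v - j a)‖ ≤ ρ ^ m / 2 := by
      refine (h5 _ _).trans (max_le ?_ ?_)
      · calc _ ≤ ρ ^ m / (2 * (1 + Δ)) * (1 + Δ) := by gcongr
          _ = ρ ^ m / 2 := by field_simp
      · calc _ ≤ κ * (ρ ^ m / (2 * κ)) := by gcongr
          _ = ρ ^ m / 2 := by field_simp
    calc _ ≤ (3 / 2 * ‖v‖) * (ρ ^ m / 2) := by gcongr
      _ = _ := by ring

/-- The component of a vector of `V` along the unstable direction. The vector is decomposed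
successively, at the times `0, m, 2m, …`, by `exists_approx`; the unstable components of the
pieces, transported back to time `0`, form a convergent series. -/
lemma exists_component {S : X → X} {j : A →L[ℝ] V} {LA : X → A →L[ℝ] A} {LV : X → V →L[ℝ] V}
    {u : X → A} {δ : X → ℝ} {s : X → A →L[ℝ] ℝ} {θ C₀ lam ρ μ : ℝ} {m : ℕ}
    (hA : IsSplitCocycle S LA u δ s θ C₀ lam) (hm : 0 < m)
    (hj : ∀ x v, j (LA x v) = LV x (j v))
    (hθμ : θ < μ) (hμρ : 3 / 4 * ρ ^ m ≤ μ ^ m) (hμ : μ < lam) (hρ : 0 < ρ) (hρl : ρ < lam)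
    {Q : ℝ} (hQ : 0 < Q) (happ : ∀ x (v : V), ∃ a : A, ‖a‖ ≤ Q * ‖v‖ ∧
      ‖cocycle S LV m x (v - j a)‖ ≤ 3 / 4 * ρ ^ m * ‖v‖) :
    ∃ C : ℝ, 0 < C ∧ ∀ x v, ∃ t : ℝ, ∀ k : ℕ,
      ‖cocycle S LV (m * k) x v - (growth S δ (m * k) x * t) • j (u (S^[m * k] x))‖
        ≤ C * μ ^ (m * k) * ‖v‖ := by
  obtain ⟨c, hc, hcon⟩ := hA.contract
  obtain ⟨q, hq, hs⟩ := hA.bound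
  have hθ := hA.rate_pos
  have hC₀ := hA.const_pos
  have hμ0 : 0 < μ := hθ.trans hθμ
  have hlam : 0 < lam := by linarith [hA.one_lt]
  have hpos := growth_pos (S := S) hA.pos
  set r := 3 / 4 * ρ ^ m with hr
  have hr0 : 0 < r := by positivity
  have hrl : r < lam ^ m := by
    have : ρ ^ m < lam ^ m := pow_lt_pow_left₀ hρl hρ.le hm.ne'
    have : 0 < ρ ^ m := by positivity
    linarith
  have hθm : θ ^ m < μ ^ m := pow_lt_pow_left₀ hθμ hθ.le hm.ne'
  choose f hf1 hf2 using happ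
  set D := c * Q * θ ^ m / (μ ^ m - θ ^ m) with hD
  have hD0 : 0 < D := div_pos (by positivity) (by linarith)
  have hDeq : D * θ ^ m + c * Q * θ ^ m = D * μ ^ m := by
    have : μ ^ m - θ ^ m ≠ 0 := by linarith
    rw [hD]; field_simp; ring
  set ϑ := r / lam ^ m with hϑ
  have hϑ1 : ϑ < 1 := (div_lt_one (by positivity)).2 hrl
  have hϑ0 : 0 < ϑ := by positivity
  set G := q * Q / C₀ / (1 - ϑ) with hG
  have hG0 : 0 < G := div_pos (by positivity) (by linarith)
  obtain ⟨N, hN0, hN⟩ : ∃ N : ℝ, 0 ≤ N ∧ ∀ a : A, ‖j a‖ ≤ N * ‖a‖ :=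
    ⟨‖j‖, norm_nonneg _, j.le_opNorm⟩
  refine ⟨1 + N * D + G * N, by positivity, fun x v => ?_⟩
  -- the remainders, at time `m * i`
  let w : ℕ → V := fun i => Nat.rec v
    (fun i w => cocycle S LV m (S^[m * i] x) (w - j (f (S^[m * i] x) w))) i
  have w_succ : ∀ i, w (i + 1) = cocycle S LV m (S^[m * i] x) (w i - j (f (S^[m * i] x) (w i))) :=
    fun i => rfl
  let a : ℕ → A := fun i => f (S^[m * i] x) (w i)
  -- the transported stable components of the pieces
  let b : ℕ → A := fun i => Nat.rec 0 (fun i b => cocycle S LA m (S^[m * i] x)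
    (b + (a i - s (S^[m * i] x) (a i) • u (S^[m * i] x)))) i
  have b_succ : ∀ i, b (i + 1) = cocycle S LA m (S^[m * i] x)
    (b i + (a i - s (S^[m * i] x) (a i) • u (S^[m * i] x))) := fun i => rfl
  let σ : ℕ → ℝ := fun i => Nat.rec 0
    (fun i t => t + s (S^[m * i] x) (a i) / growth S δ (m * i) x) i
  have σ_succ : ∀ i, σ (i + 1) = σ i + s (S^[m * i] x) (a i) / growth S δ (m * i) x :=
    fun i => rfl
  have hSm : ∀ i, S^[m] (S^[m * i] x) = S^[m * (i + 1)] x := fun i => by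
    rw [← Function.iterate_add_apply, show m + m * i = m * (i + 1) by ring]
  have hw : ∀ i, ‖w i‖ ≤ r ^ i * ‖v‖ := by
    intro i
    induction i with
    | zero => simp [w]
    | succ i ih =>
      rw [w_succ]
      calc _ ≤ r * ‖w i‖ := hf2 _ _
        _ ≤ r * (r ^ i * ‖v‖) := by gcongr
        _ = _ := by ring
  have ha : ∀ i, ‖a i‖ ≤ Q * (r ^ i * ‖v‖) := fun i =>
    (hf1 _ _).trans (by gcongr; exact hw i)
  have hb : ∀ i n, ‖cocycle S LA n (S^[m * i] x) (b i)‖ ≤ D * θ ^ n * μ ^ (m * i) * ‖v‖ := by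
    intro i
    induction i with
    | zero =>
      intro n
      rw [show b 0 = 0 from rfl, map_zero, norm_zero]
      positivity
    | succ i ih =>
      intro n
      rw [b_succ, ← hSm, ← cocycle_add, map_add]
      have hri : r ^ i ≤ μ ^ (m * i) := by
        rw [pow_mul]; exact pow_le_pow_left₀ hr0.le hμρ i
      calc _ ≤ D * θ ^ (m + n) * μ ^ (m * i) * ‖v‖ + c * θ ^ (m + n) * ‖a i‖ :=
            (norm_add_le _ _).trans (add_le_add (ih _) (hcon _ _ _))
        _ ≤ D * θ ^ (m + n) * μ ^ (m * i) * ‖v‖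
            + c * θ ^ (m + n) * (Q * (μ ^ (m * i) * ‖v‖)) := by
            gcongr; exact (ha i).trans (by gcongr)
        _ = (D * θ ^ m + c * Q * θ ^ m) * (θ ^ n * μ ^ (m * i) * ‖v‖) := by ring
        _ = _ := by rw [hDeq]; ring
  have hid : ∀ i, cocycle S LV (m * i) x v = w i + j (b i)
      + (growth S δ (m * i) x * σ i) • j (u (S^[m * i] x)) := by
    intro i
    induction i with
    | zero => simp [w, b, σ]
    | succ i ih =>
      have e1 : m * (i + 1) = m * i + m := by ring
      have e2 : S^[m * i + m] x = S^[m] (S^[m * i] x) := by rw [hSm, e1]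
      have e3 : cocycle S LV m (S^[m * i] x) (j (u (S^[m * i] x)))
          = growth S δ m (S^[m * i] x) • j (u (S^[m * (i + 1)] x)) := by
        rw [← cocycle_intertwine hj, cocycle_unstable hA.map, map_smul, hSm]
      have hne : growth S δ (m * i) x ≠ 0 := (hpos _ _).ne'
      have e4 : growth S δ (m * (i + 1)) x * σ (i + 1)
          = (growth S δ (m * i) x * σ i + s (S^[m * i] x) (a i)) * growth S δ m (S^[m * i] x) := by
        rw [σ_succ, e1, growth_add]; field_simp
      rw [e4, w_succ, b_succ, cocycle_intertwine hj, ← smul_smul, ← e3, ← map_smul, ← map_add,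
        ← map_add]
      rw [e1, cocycle_add, ih]
      congr 1
      simp only [map_add, map_sub, map_smul, a, add_smul]
      abel
  -- the scalars converge
  have hσ : ∀ k i, dist (σ (k + i)) (σ (k + (i + 1)))
      ≤ (q * Q / C₀ * r ^ k / growth S δ (m * k) x * ‖v‖) * ϑ ^ i := by
    intro k i
    rw [← add_assoc, σ_succ, dist_eq_norm, sub_add_cancel_left, norm_neg, norm_div,
      Real.norm_of_nonneg (hpos _ _).le, Real.norm_eq_abs]
    have h1 : C₀ * lam ^ (m * i) * growth S δ (m * k) x ≤ growth S δ (m * (k + i)) x := by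
      rw [mul_add, growth_add, mul_comm]
      exact mul_le_mul_of_nonneg_left (hA.lower _ _) (hpos _ _).le
    have h2 := hpos (m * k) x
    calc _ ≤ q * (Q * (r ^ (k + i) * ‖v‖)) / (C₀ * lam ^ (m * i) * growth S δ (m * k) x) := by
          gcongr
          exact (hs _ _).trans (by gcongr; exact ha _)
      _ = _ := by rw [hϑ, div_pow, ← pow_mul, pow_add]; field_simp
  have hcau : CauchySeq σ := by
    refine cauchySeq_of_le_geometric ϑ (q * Q / C₀ * r ^ 0 / growth S δ (m * 0) x * ‖v‖) hϑ1
      fun i => ?_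
    simpa using hσ 0 i
  obtain ⟨t, ht⟩ := cauchySeq_tendsto_of_complete hcau
  refine ⟨t, fun k => ?_⟩
  have hdist : dist (σ k) t ≤ (q * Q / C₀ * r ^ k / growth S δ (m * k) x * ‖v‖) / (1 - ϑ) := by
    have := dist_le_of_le_geometric_of_tendsto₀ ϑ _ hϑ1 (hσ k)
      ((tendsto_add_atTop_iff_nat k).2 ht |>.congr fun i => by rw [add_comm])
    simpa using this
  have hri : r ^ k ≤ μ ^ (m * k) := by
    rw [pow_mul]; exact pow_le_pow_left₀ hr0.le hμρ k
  have hb' : ‖b k‖ ≤ D * μ ^ (m * k) * ‖v‖ := by simpa using hb k 0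
  have e : cocycle S LV (m * k) x v - (growth S δ (m * k) x * t) • j (u (S^[m * k] x))
      = w k + j (b k) + (growth S δ (m * k) x * (σ k - t)) • j (u (S^[m * k] x)) := by
    rw [hid k, mul_sub, sub_smul]; abel
  have h3 : growth S δ (m * k) x * |σ k - t| ≤ G * r ^ k * ‖v‖ := by
    have h2 := hpos (m * k) x
    rw [← Real.norm_eq_abs, ← dist_eq_norm]
    calc _ ≤ growth S δ (m * k) x *
          ((q * Q / C₀ * r ^ k / growth S δ (m * k) x * ‖v‖) / (1 - ϑ)) := by gcongr
      _ = _ := by rw [hG]; field_simp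
  rw [e]
  calc _ ≤ ‖w k‖ + ‖j (b k)‖ + growth S δ (m * k) x * |σ k - t| * ‖j (u (S^[m * k] x))‖ := by
        refine (norm_add₃_le).trans ?_
        rw [norm_smul, norm_mul, Real.norm_of_nonneg (hpos _ _).le, Real.norm_eq_abs]
    _ ≤ μ ^ (m * k) * ‖v‖ + N * (D * μ ^ (m * k) * ‖v‖) + G * μ ^ (m * k) * ‖v‖ * (N * 1) := by
        refine add_le_add (add_le_add ((hw k).trans (by gcongr)) ((hN _).trans (by gcongr)))
          (mul_le_mul (h3.trans (by gcongr)) ((hN _).trans (by gcongr; exact hA.unit _))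
            (norm_nonneg _) (by positivity))
    _ = _ := by ring

/-- The coefficients in an asymptotic expansion `z k = (g k * t) • e k + O(ν ^ k)` are unique if
`g k` grows faster than `ν ^ k`. -/
lemma component_unique {W : Type*} [NormedAddCommGroup W] [NormedSpace ℝ W] {z e : ℕ → W}
    {g : ℕ → ℝ} {C₀ Λ ν C c t t' : ℝ} (hC₀ : 0 < C₀) (hν : 0 ≤ ν) (hνΛ : ν < Λ) (hc : 0 < c)
    (hg : ∀ k, C₀ * Λ ^ k ≤ g k) (he : ∀ k, c ≤ ‖e k‖)
    (h : ∀ k, ‖z k - (g k * t) • e k‖ ≤ C * ν ^ k)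
    (h' : ∀ k, ‖z k - (g k * t') • e k‖ ≤ C * ν ^ k) : t = t' := by
  have hΛ : 0 < Λ := hν.trans_lt hνΛ
  have key : ∀ k, |t - t'| ≤ 2 * C / (C₀ * c) * (ν / Λ) ^ k := by
    intro k
    have h1 : g k * |t - t'| * ‖e k‖ ≤ 2 * C * ν ^ k := by
      have e1 : (g k * (t - t')) • e k
          = (z k - (g k * t') • e k) - (z k - (g k * t) • e k) := by
        rw [mul_sub, sub_smul]; abel
      have hgk : 0 ≤ g k := le_trans (by positivity) (hg k)
      calc g k * |t - t'| * ‖e k‖ = ‖(g k * (t - t')) • e k‖ := by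
            rw [norm_smul, norm_mul, Real.norm_of_nonneg hgk, Real.norm_eq_abs]
        _ ≤ C * ν ^ k + C * ν ^ k := by rw [e1]; exact (norm_sub_le _ _).trans (add_le_add (h' k) (h k))
        _ = _ := by ring
    have h2 : C₀ * Λ ^ k * |t - t'| * c ≤ g k * |t - t'| * ‖e k‖ := by
      have := hg k
      have := he k
      have : 0 ≤ g k := le_trans (by positivity) (hg k)
      gcongr
    rw [div_pow, div_mul_div_comm, le_div_iff₀ (by positivity)]
    calc _ = C₀ * Λ ^ k * |t - t'| * c := by ring
      _ ≤ _ := h2.trans h1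
  have hlim : Tendsto (fun k : ℕ => 2 * C / (C₀ * c) * (ν / Λ) ^ k) atTop (𝓝 0) := by
    have := (tendsto_pow_atTop_nhds_zero_of_lt_one (by positivity)
      ((div_lt_one hΛ).2 hνΛ)).const_mul (2 * C / (C₀ * c))
    simpa using this
  have : |t - t'| ≤ 0 := ge_of_tendsto' hlim key
  exact sub_eq_zero.1 (abs_eq_zero.1 (le_antisymm this (abs_nonneg _)))

/-- Iterates of a cocycle which is continuous as a family of operators `V → Y` are continuous in
the same sense. -/
lemma continuous_cocycle_comp [TopologicalSpace X] {S : X → X} (hS : Continuous S)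
    {k : V →L[ℝ] Y} {LV : X → V →L[ℝ] V} {Lh : X → Y →L[ℝ] Y} {M : ℝ}
    (hk : ∀ x v, k (LV x v) = Lh x (k v)) (hMV : ∀ x v, ‖LV x v‖ ≤ M * ‖v‖)
    (hMY : ∀ x, ‖Lh x‖ ≤ M) (h3 : Continuous fun x => (Lh x).comp k) (n : ℕ) :
    Continuous fun x => (cocycle S Lh n x).comp k := by
  rcases isEmpty_or_nonempty X with hX | ⟨⟨x₁⟩⟩
  · exact continuous_of_discreteTopology
  have hM : 0 ≤ M := (norm_nonneg _).trans (hMY x₁)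
  have hMn : ∀ n x, ‖cocycle S Lh n x‖ ≤ M ^ n := fun n x =>
    ContinuousLinearMap.opNorm_le_bound _ (by positivity) fun v =>
      cocycle_norm_le hM (fun x v => (Lh x).le_of_opNorm_le (hMY x) v) n x v
  induction n with
  | zero => simpa [cocycle_zero] using continuous_const
  | succ n ih =>
    rw [continuous_iff_continuousAt]
    intro x
    have h1 : Tendsto (fun x' => ‖(Lh x').comp k - (Lh x).comp k‖) (𝓝 x) (𝓝 0) := by
      have := (h3.tendsto x).sub_const ((Lh x).comp k)
      simpa using this.norm
    have h2 : Tendsto (fun x' => ‖(cocycle S Lh n (S x')).comp k - (cocycle S Lh n (S x)).comp k‖)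
        (𝓝 x) (𝓝 0) := by
      have := ((ih.comp hS).tendsto x).sub_const ((cocycle S Lh n (S x)).comp k)
      simpa using this.norm
    refine tendsto_iff_norm_sub_tendsto_zero.2 (squeeze_zero (fun _ => norm_nonneg _)
      (g := fun x' => M ^ n * ‖(Lh x').comp k - (Lh x).comp k‖
        + ‖(cocycle S Lh n (S x')).comp k - (cocycle S Lh n (S x)).comp k‖ * M) ?_ ?_)
    · intro x'
      refine ContinuousLinearMap.opNorm_le_bound _ (by positivity) fun v => ?_
      have e : ((cocycle S Lh (n + 1) x').comp k - (cocycle S Lh (n + 1) x).comp k) v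
          = cocycle S Lh n (S x') (((Lh x').comp k - (Lh x).comp k) v)
            + ((cocycle S Lh n (S x')).comp k - (cocycle S Lh n (S x)).comp k) (LV x v) := by
        simp [cocycle_succ, hk]
      rw [e, add_mul]
      refine (norm_add_le _ _).trans (add_le_add ?_ ?_)
      · rw [mul_assoc]
        exact ((cocycle S Lh n (S x')).le_of_opNorm_le (hMn _ _) _).trans
          (mul_le_mul_of_nonneg_left (ContinuousLinearMap.le_opNorm _ _) (by positivity))
      · rw [mul_assoc]
        exact (ContinuousLinearMap.le_opNorm _ _).trans
          (mul_le_mul_of_nonneg_left (hMV _ _) (norm_nonneg _))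
    · simpa using (h1.const_mul (M ^ n)).add (h2.mul_const M)

/-- The functionals `s x`, which define the stable spaces of the cocycle on `A`, extend to `V`,
with rates `μ < ρ` on their kernels, and depend continuously on `x` in the norm of `V*`. -/
theorem exists_extension [TopologicalSpace X] {S : X → X} (hS : Continuous S)
    {j : A →L[ℝ] V} {k : V →L[ℝ] Y} {LA : X → A →L[ℝ] A} {LV : X → V →L[ℝ] V}
    {Lh : X → Y →L[ℝ] Y} {u : X → A} {δ : X → ℝ} {s : X → A →L[ℝ] ℝ}
    {θ C₀ lam ρ M c Δ κ : ℝ} {m : ℕ}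
    (hA : IsSplitCocycle S LA u δ s θ C₀ lam) (hm : 0 < m)
    (hθρ : θ < ρ) (hρl : ρ < lam) (hcpt : IsCompactOperator k)
    (hj : ∀ x v, j (LA x v) = LV x (j v)) (hk : ∀ x v, k (LV x v) = Lh x (k v))
    (hMV : ∀ x v, ‖LV x v‖ ≤ M * ‖v‖) (hMY : ∀ x, ‖Lh x‖ ≤ M)
    (h3 : Continuous fun x => (Lh x).comp k) (hδ : Continuous δ)
    (hu : Continuous fun x => k (j (u x))) (hc : 0 < c) (hcu : ∀ x, c ≤ ‖k (j (u x))‖)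
    (hΔ : 1 < Δ) (hκ : 1 < κ)
    (h4 : ∀ b : V, ‖b‖ < 1 → k b ∈ closure (k '' {b' : V | ‖b'‖ < Δ ∧ b' ∈ range j}))
    (h5 : ∀ x v, ‖cocycle S LV m x v‖ ≤ max (ρ ^ m / (2 * (1 + Δ)) * ‖v‖) (κ * ‖k v‖)) :
    ∃ σ : X → V →L[ℝ] ℝ, Continuous σ ∧ (∀ x v, σ x (j v) = s x v) ∧
      ∃ C μ : ℝ, 0 < C ∧ 0 < μ ∧ μ < ρ ∧ ∀ n x v,
        ‖cocycle S LV n x v - (growth S δ n x * σ x v) • j (u (S^[n] x))‖ ≤ C * μ ^ n * ‖v‖ := by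
  rcases isEmpty_or_nonempty X with hX | ⟨⟨x₁⟩⟩
  · exact ⟨fun _ => 0, continuous_of_discreteTopology, fun x => isEmptyElim x, 1, ρ / 2, one_pos,
      by linarith [hA.rate_pos], by linarith [hA.rate_pos], fun _ x => isEmptyElim x⟩
  have hM : 0 ≤ M := (norm_nonneg _).trans (hMY x₁)
  have hθ := hA.rate_pos
  have hC₀ := hA.const_pos
  have hlam : 0 < lam := by linarith [hA.one_lt]
  have hρ : 0 < ρ := hθ.trans hθρ
  have hpos := growth_pos (S := S) hA.pos
  have hMn : ∀ n x v, ‖cocycle S LV n x v‖ ≤ M ^ n * ‖v‖ := cocycle_norm_le hM hMV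
  obtain ⟨μ, hθμ, hμρ, hμm⟩ : ∃ μ, θ < μ ∧ μ < ρ ∧ 3 / 4 * ρ ^ m ≤ μ ^ m := by
    have h1 : ∀ᶠ μ in 𝓝[<] ρ, 3 / 4 * ρ ^ m < μ ^ m := by
      refine nhdsWithin_le_nhds (((continuous_pow m).tendsto ρ).eventually (lt_mem_nhds ?_))
      have : 0 < ρ ^ m := by positivity
      linarith
    have h2 : ∀ᶠ μ in 𝓝[<] ρ, θ < μ := nhdsWithin_le_nhds (lt_mem_nhds hθρ)
    obtain ⟨μ, ⟨h1, h2⟩, h3⟩ := ((h1.and h2).and self_mem_nhdsWithin).exists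
    exact ⟨μ, h2, h3, h1.le⟩
  have hμ0 : 0 < μ := hθ.trans hθμ
  obtain ⟨Q, hQ, happ⟩ := exists_approx (S := S) (LV := LV) hcpt hρ hΔ hκ h4 h5
  obtain ⟨C, hC, hcomp⟩ := exists_component hA hm hj hθμ hμm (hμρ.trans hρl) hρ hρl hQ happ
  choose t ht using hcomp
  have hk0 : 0 < ‖k‖ := by
    rw [norm_pos_iff]; rintro rfl
    have := hcu x₁
    simp at this; linarith
  set c' := c / ‖k‖ with hc'
  have hc'0 : 0 < c' := by positivity
  have hcV : ∀ x, c' ≤ ‖j (u x)‖ := fun x => by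
    rw [hc', div_le_iff₀ hk0, mul_comm]
    exact (hcu x).trans (k.le_opNorm _)
  have hμl : μ ^ m < lam ^ m := pow_lt_pow_left₀ (hμρ.trans hρl) hμ0.le hm.ne'
  have huniq : ∀ (x : X) (v : V) (a B : ℝ), (∀ i : ℕ, ‖cocycle S LV (m * i) x v
      - (growth S δ (m * i) x * a) • j (u (S^[m * i] x))‖ ≤ B * μ ^ (m * i)) → a = t x v := by
    intro x v a B h
    refine component_unique (z := fun i => cocycle S LV (m * i) x v)
      (e := fun i => j (u (S^[m * i] x))) (g := fun i => growth S δ (m * i) x)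
      (ν := μ ^ m) (Λ := lam ^ m) (C := max B (C * ‖v‖)) hC₀ (by positivity) hμl hc'0
      (fun i => by simpa [pow_mul] using hA.lower (m * i) x) (fun i => hcV _)
      (fun i => ?_) (fun i => ?_)
    · refine (h i).trans ?_
      rw [← pow_mul]; gcongr; exact le_max_left _ _
    · refine (ht x v i).trans ?_
      rw [← pow_mul, mul_right_comm]; gcongr; exact le_max_right _ _
  let σ₀ : X → V →ₗ[ℝ] ℝ := fun x =>
    { toFun := t x
      map_add' := fun v w => by
        refine (huniq x (v + w) (t x v + t x w) (C * ‖v‖ + C * ‖w‖) fun i => ?_).symm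
        have e : cocycle S LV (m * i) x (v + w)
            - (growth S δ (m * i) x * (t x v + t x w)) • j (u (S^[m * i] x))
            = (cocycle S LV (m * i) x v - (growth S δ (m * i) x * t x v) • j (u (S^[m * i] x)))
            + (cocycle S LV (m * i) x w - (growth S δ (m * i) x * t x w) • j (u (S^[m * i] x))) := by
          rw [map_add, mul_add, add_smul]; abel
        rw [e]
        calc _ ≤ C * μ ^ (m * i) * ‖v‖ + C * μ ^ (m * i) * ‖w‖ :=
              (norm_add_le _ _).trans (add_le_add (ht x v i) (ht x w i))
          _ = _ := by ring
      map_smul' := fun a v => by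
        refine (huniq x (a • v) (a * t x v) (|a| * (C * ‖v‖)) fun i => ?_).symm
        have e : cocycle S LV (m * i) x (a • v)
            - (growth S δ (m * i) x * (a * t x v)) • j (u (S^[m * i] x))
            = a • (cocycle S LV (m * i) x v
              - (growth S δ (m * i) x * t x v) • j (u (S^[m * i] x))) := by
          rw [map_smul, smul_sub, smul_smul]; congr 2; ring
        rw [e, norm_smul, Real.norm_eq_abs]
        calc _ ≤ |a| * (C * μ ^ (m * i) * ‖v‖) := by gcongr; exact ht x v i
          _ = _ := by ring }
  set H := (C + 1) / c' with hH
  have hH0 : 0 < H := by positivity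
  have hσ₀ : ∀ x v, ‖σ₀ x v‖ ≤ H * ‖v‖ := by
    intro x v
    have h1 := ht x v 0
    simp only [mul_zero, cocycle_zero, growth_zero, one_mul, Function.iterate_zero, id_eq, pow_zero,
      mul_one, ContinuousLinearMap.id_apply] at h1
    have h2 : |t x v| * ‖j (u x)‖ ≤ (C + 1) * ‖v‖ := by
      rw [← Real.norm_eq_abs, ← norm_smul]
      calc ‖t x v • j (u x)‖ = ‖v - (v - t x v • j (u x))‖ := by rw [sub_sub_cancel]
        _ ≤ ‖v‖ + C * ‖v‖ := (norm_sub_le _ _).trans (by gcongr)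
        _ = _ := by ring
    have h3 : |t x v| * c' ≤ |t x v| * ‖j (u x)‖ := by gcongr; exact hcV x
    change ‖t x v‖ ≤ _
    rw [Real.norm_eq_abs, hH, div_mul_eq_mul_div, le_div_iff₀ hc'0]
    exact h3.trans h2
  let σ : X → V →L[ℝ] ℝ := fun x => (σ₀ x).mkContinuous H (hσ₀ x)
  have hσt : ∀ x v, σ x v = t x v := fun x v => rfl
  obtain ⟨B, hB1, hB⟩ : ∃ B : ℝ, 0 < B ∧ ∀ i < m, (M / μ) ^ i ≤ B := by
    refine ⟨∑ i ∈ Finset.range m, (M / μ) ^ i + 1, by positivity, fun i hi => ?_⟩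
    have := Finset.single_le_sum (f := fun i => (M / μ) ^ i) (fun i _ => by positivity)
      (Finset.mem_range.2 hi)
    linarith
  -- the estimate at all times
  have hall : ∀ n x v, ‖cocycle S LV n x v - (growth S δ n x * σ x v) • j (u (S^[n] x))‖
      ≤ B * C * μ ^ n * ‖v‖ := by
    intro n x v
    obtain ⟨i, r, hr, rfl⟩ : ∃ i r, r < m ∧ n = m * i + r :=
      ⟨n / m, n % m, Nat.mod_lt _ hm, (Nat.div_add_mod n m).symm⟩
    have e : cocycle S LV (m * i + r) x v
        - (growth S δ (m * i + r) x * σ x v) • j (u (S^[m * i + r] x))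
        = cocycle S LV r (S^[m * i] x) (cocycle S LV (m * i) x v
          - (growth S δ (m * i) x * σ x v) • j (u (S^[m * i] x))) := by
      rw [map_sub, ← cocycle_add, map_smul, ← cocycle_intertwine hj, cocycle_unstable hA.map,
        map_smul, smul_smul, growth_add, ← Function.iterate_add_apply, add_comm r]
      congr 2; ring
    rw [e]
    calc _ ≤ M ^ r * (C * μ ^ (m * i) * ‖v‖) := (hMn _ _ _).trans (by gcongr; exact ht x v i)
      _ = (M / μ) ^ r * (C * μ ^ (m * i + r) * ‖v‖) := by rw [div_pow, pow_add]; field_simp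
      _ ≤ B * (C * μ ^ (m * i + r) * ‖v‖) := by gcongr; exact hB r hr
      _ = _ := by ring
  refine ⟨σ, ?_, ?_, B * C, μ, by positivity, hμ0, hμρ, hall⟩
  · rw [continuous_iff_continuousAt]
    intro x
    rw [ContinuousAt, tendsto_iff_norm_sub_tendsto_zero, Metric.tendsto_nhds]
    intro ε hε
    -- at a large time the unstable components dominate the errors
    obtain ⟨n, hn⟩ : ∃ n : ℕ, 2 * (B * C) * ‖k‖ / (C₀ * c) * (μ / lam) ^ n < ε / 2 := by
      have hlim : Tendsto (fun n : ℕ => 2 * (B * C) * ‖k‖ / (C₀ * c) * (μ / lam) ^ n)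
          atTop (𝓝 0) := by
        have := (tendsto_pow_atTop_nhds_zero_of_lt_one (by positivity)
          ((div_lt_one hlam).2 (hμρ.trans hρl))).const_mul (2 * (B * C) * ‖k‖ / (C₀ * c))
        simpa using this
      exact (hlim.eventually (gt_mem_nhds (by positivity))).exists
    set d : ℝ := C₀ * lam ^ n * c with hd
    have hd0 : 0 < d := by positivity
    let E : X → Y := fun x => growth S δ n x • k (j (u (S^[n] x)))
    have hE : Continuous E := (continuous_growth hS hδ n).smul (hu.comp (hS.iterate n))
    have hEd : ∀ x, d ≤ ‖E x‖ := fun x => by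
      rw [norm_smul, Real.norm_of_nonneg (hpos _ _).le]
      exact mul_le_mul (hA.lower n x) (hcu _) hc.le (hpos _ _).le
    have hL := continuous_cocycle_comp hS hk hMV hMY h3 n
    have hT : Tendsto (fun x' => (‖(cocycle S Lh n x').comp k - (cocycle S Lh n x).comp k‖
        + H * ‖E x' - E x‖) / d) (𝓝 x) (𝓝 0) := by
      have h1 := ((hL.tendsto x).sub_const ((cocycle S Lh n x).comp k)).norm
      have h2 := (((hE.tendsto x).sub_const (E x)).norm.const_mul H)
      simpa using (h1.add h2).div_const d
    filter_upwards [hT.eventually (gt_mem_nhds (half_pos hε))] with x' hx'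
    rw [dist_zero_right, norm_norm]
    refine lt_of_le_of_lt (ContinuousLinearMap.opNorm_le_bound _
      (M := (‖(cocycle S Lh n x').comp k - (cocycle S Lh n x).comp k‖ + H * ‖E x' - E x‖) / d
        + 2 * (B * C) * ‖k‖ / (C₀ * c) * (μ / lam) ^ n)
      (by positivity) fun v => ?_) (by linarith)
    have hdiff : ∀ y, ‖cocycle S Lh n y (k v) - σ y v • E y‖ ≤ ‖k‖ * (B * C * μ ^ n * ‖v‖) := by
      intro y
      have e : cocycle S Lh n y (k v) - σ y v • E y
          = k (cocycle S LV n y v - (growth S δ n y * σ y v) • j (u (S^[n] y))) := by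
        rw [map_sub, cocycle_intertwine hk, map_smul, smul_smul, mul_comm]
      rw [e]
      exact (k.le_opNorm _).trans (by gcongr; exact hall n y v)
    have e : (σ x' - σ x) v • E x
        = ((cocycle S Lh n x').comp k - (cocycle S Lh n x).comp k) v - σ x' v • (E x' - E x)
          + ((cocycle S Lh n x (k v) - σ x v • E x)
            - (cocycle S Lh n x' (k v) - σ x' v • E x')) := by
      simp only [sub_apply, ContinuousLinearMap.comp_apply, sub_smul, smul_sub]
      abel
    have h6 : ‖(σ x' - σ x) v‖ * d ≤
        (‖(cocycle S Lh n x').comp k - (cocycle S Lh n x).comp k‖ + H * ‖E x' - E x‖) * ‖v‖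
        + 2 * (‖k‖ * (B * C * μ ^ n * ‖v‖)) := by
      calc _ ≤ ‖(σ x' - σ x) v‖ * ‖E x‖ := by gcongr; exact hEd x
        _ = ‖(σ x' - σ x) v • E x‖ := (norm_smul _ _).symm
        _ ≤ (‖((cocycle S Lh n x').comp k - (cocycle S Lh n x).comp k) v‖
            + ‖σ x' v • (E x' - E x)‖) + (‖cocycle S Lh n x (k v) - σ x v • E x‖
            + ‖cocycle S Lh n x' (k v) - σ x' v • E x'‖) := by
            rw [e]
            exact (norm_add_le _ _).trans (add_le_add (norm_sub_le _ _) (norm_sub_le _ _))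
        _ ≤ (‖(cocycle S Lh n x').comp k - (cocycle S Lh n x).comp k‖ * ‖v‖
            + (H * ‖v‖) * ‖E x' - E x‖) + (‖k‖ * (B * C * μ ^ n * ‖v‖)
            + ‖k‖ * (B * C * μ ^ n * ‖v‖)) := by
            refine add_le_add (add_le_add (ContinuousLinearMap.le_opNorm _ _) ?_)
              (add_le_add (hdiff x) (hdiff x'))
            rw [norm_smul]
            exact mul_le_mul_of_nonneg_right (hσ₀ x' v) (norm_nonneg _)
        _ = _ := by ring
    rw [add_mul, div_mul_eq_mul_div, ← sub_le_iff_le_add, le_div_iff₀ hd0, sub_mul]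
    have e7 : 2 * (B * C) * ‖k‖ / (C₀ * c) * (μ / lam) ^ n * ‖v‖ * d
        = 2 * (‖k‖ * (B * C * μ ^ n * ‖v‖)) := by
      rw [hd, div_pow]; field_simp
    rw [e7]; linarith
  · intro x v
    obtain ⟨c₁, hc₁, hcon⟩ := hA.contract
    refine (huniq x (j v) (s x v) (‖j‖ * (c₁ * ‖v‖)) fun i => ?_).symm
    have e : cocycle S LV (m * i) x (j v) - (growth S δ (m * i) x * s x v) • j (u (S^[m * i] x))
        = j (cocycle S LA (m * i) x (v - s x v • u x)) := by
      rw [map_sub, map_sub, cocycle_intertwine hj, map_smul, cocycle_unstable hA.map, map_smul,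
        map_smul, smul_smul, mul_comm (s x v)]
    rw [e]
    calc _ ≤ ‖j‖ * (c₁ * θ ^ (m * i) * ‖v‖) :=
          (j.le_opNorm _).trans (by gcongr; exact hcon _ _ _)
      _ ≤ ‖j‖ * (c₁ * μ ^ (m * i) * ‖v‖) := by gcongr
      _ = _ := by ring

end Extension

/-! ### Uniform local estimates near the basic set -/

/-- The uniform estimates, near the compact set `p '' X`, on which the hyperbolic theory of the
operator `T : O → B` rests. The base dynamics is `S`, and `T ∘ p = p ∘ S`; `ι` is the inclusion
of `B` into the weaker space `C`; the splitting is given by the vectors `U x` and by the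
functionals `σ x` on `C`; `LB` and `LC` are the linearized cocycles on `B` and on `C`. The sets
`G r x` consist of the points which are close to `p x` in the stronger norm of `A`. -/
structure LocalModel {X B C : Type*} [TopologicalSpace X]
    [NormedAddCommGroup B] [NormedSpace ℝ B] [NormedAddCommGroup C] [NormedSpace ℝ C]
    (S : X → X) (p : X → B) (ι : B →L[ℝ] C) (T : B → B) (O : Set B) (U : X → B) (δ : X → ℝ)
    (σ : X → C →L[ℝ] ℝ) (LB : X → B →L[ℝ] B) (LC : X → C →L[ℝ] C) (G : ℝ → X → Set B)
    (C₀ lam : ℝ) : Prop where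
  contS : Continuous S
  contp : Continuous p
  contU : Continuous U
  contδ : Continuous δ
  contσ : Continuous σ
  inj : Function.Injective ι
  injp : Function.Injective p
  semi : ∀ x, T (p x) = p (S x)
  map : ∀ x, LB x (U x) = δ x • U (S x)
  pos : ∀ x, 0 < δ x
  const_pos : 0 < C₀
  one_lt : 1 < lam
  lower : ∀ n x, 0 < n → C₀ * lam ^ n ≤ growth S δ n x
  one : ∀ x, σ x (ι (U x)) = 1
  inter : ∀ x v, ι (LB x v) = LC x (ι v)
  invariant : ∀ x v, σ (S x) (LC x v) = δ x * σ x v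
  rateB : ∃ c θ : ℝ, 0 < c ∧ 0 < θ ∧ θ < 1 ∧ ∀ n x v, σ x (ι v) = 0 →
    ‖cocycle S LB n x v‖ ≤ c * θ ^ n * ‖v‖
  rateC : ∃ c μ : ℝ, 0 < c ∧ 0 < μ ∧ μ < lam ∧ ∀ n x v, σ x v = 0 →
    ‖cocycle S LC n x v‖ ≤ c * μ ^ n * ‖v‖
  domain : ∀ m, 0 < m → ∃ r, 0 < r ∧ ∀ x, Metric.ball (p x) r ⊆ iterDomain T O m
  contDiff : ∀ m, 0 < m → ContDiffOn ℝ 1 (ι ∘ T^[m]) (iterDomain T O m)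
  approx : ∀ m, 0 < m → ∀ τ : ℝ, 0 < τ → ∃ r, 0 < r ∧ ∀ x, ∀ y ∈ Metric.ball (p x) r,
    ∀ z ∈ Metric.ball (p x) r,
      ‖ι (T^[m] y - T^[m] z - cocycle S LB m x (y - z))‖ ≤ τ * ‖y - z‖
  approxC : ∃ m₀, ∀ m, m₀ ≤ m → ∀ τ : ℝ, 0 < τ → ∃ r, 0 < r ∧ ∀ x, ∀ y ∈ Metric.ball (p x) r,
    ∀ z ∈ Metric.ball (p x) r,
      ‖ι (T^[m] y - T^[m] z - cocycle S LB m x (y - z))‖ ≤ τ * |σ x (ι (y - z))|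
        + C₀ / 8 * lam ^ m * ‖ι (y - z) - σ x (ι (y - z)) • ι (U x)‖
  holder : ∃ r c ρ : ℝ, 0 < r ∧ 0 < c ∧ 1 < ρ ∧ ∀ x, ∀ y ∈ Metric.ball (p x) r,
    ∃ D : B →L[ℝ] C, (∀ v, ‖D v‖ ≤ c * ‖ι v‖) ∧ ∀ z ∈ Metric.ball (p x) r,
      ‖ι (T z - T y) - D (z - y)‖ ≤ c * ‖ι (z - y)‖ ^ ρ
  mem_G : ∀ r, 0 < r → ∀ x, p x ∈ G r x
  mono_G : ∀ r r', r ≤ r' → ∀ x, G r x ⊆ G r' x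
  small_G : ∀ r, 0 < r → ∃ r', 0 < r' ∧ ∀ x, G r' x ⊆ Metric.ball (p x) r
  approxG : ∃ m₀, ∀ m, m₀ ≤ m → ∃ r, 0 < r ∧ ∀ x, ∀ f ∈ G r x, ∀ y ∈ Metric.ball (p x) r,
    ‖T^[m] y - T^[m] f - cocycle S LB m x (y - f)‖ ≤ 1 / 4 * ‖y - f‖
  map_G : ∀ r, 0 < r → ∃ r', 0 < r' ∧ ∀ x, ∀ f ∈ G r' x, T f ∈ G r (S x)
  lipG : ∀ m, ∃ r c : ℝ, 0 < r ∧ 0 < c ∧ ∀ x, ∀ f ∈ G r x, ∀ y ∈ Metric.ball (p x) r,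
    ‖T^[m] y - T^[m] f‖ ≤ c * ‖y - f‖

/-- Bounds at multiples of `N` for a sequence which grows at most by a bounded factor in between
give exponential bounds. -/
lemma exists_geometric_of_blocks (N : ℕ) :
    ∃ ϑ : ℝ, 0 < ϑ ∧ ϑ < 1 ∧ ∀ k i, i < N → (1 / 2 : ℝ) ^ k ≤ 4 * ϑ ^ (N * k + i) := by
  obtain ⟨ϑ, ⟨h1, h2⟩, h3⟩ : ∃ ϑ : ℝ, (1 / 2 < ϑ ^ N ∧ 0 < ϑ) ∧ ϑ < 1 := by
    have h1 : ∀ᶠ μ in 𝓝[<] (1 : ℝ), 1 / 2 < μ ^ N := by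
      refine nhdsWithin_le_nhds (((continuous_pow N).tendsto 1).eventually (lt_mem_nhds ?_))
      norm_num
    have h2 : ∀ᶠ μ in 𝓝[<] (1 : ℝ), 0 < μ := nhdsWithin_le_nhds (lt_mem_nhds one_pos)
    exact ((h1.and h2).and self_mem_nhdsWithin).exists
  refine ⟨ϑ, h2, h3, fun k i hi => ?_⟩
  have h4 : ϑ ^ N ≤ ϑ ^ i := pow_le_pow_of_le_one h2.le h3.le hi.le
  have h5 : (1 / 2 : ℝ) ^ k ≤ (ϑ ^ N) ^ k := pow_le_pow_left₀ (by norm_num) h1.le k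
  rw [pow_add, pow_mul]
  have h6 : 0 < (ϑ ^ N) ^ k := by positivity
  nlinarith

namespace LocalModel

variable {X B C : Type*} [TopologicalSpace X] [CompactSpace X]
    [NormedAddCommGroup B] [NormedSpace ℝ B] [NormedAddCommGroup C] [NormedSpace ℝ C]
    {S : X → X} {p : X → B} {ι : B →L[ℝ] C} {T : B → B} {O : Set B} {U : X → B} {δ : X → ℝ}
    {σ : X → C →L[ℝ] ℝ} {LB : X → B →L[ℝ] B} {LC : X → C →L[ℝ] C} {G : ℝ → X → Set B}
    {C₀ lam : ℝ}

lemma exists_upper {f : X → ℝ} (hf : Continuous f) : ∃ M : ℝ, 1 ≤ M ∧ ∀ x, f x ≤ M := by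
  obtain ⟨M, hM⟩ := (isCompact_range hf).bddAbove
  exact ⟨max M 1, le_max_right _ _, fun x => (hM ⟨x, rfl⟩).trans (le_max_left _ _)⟩

lemma exists_lower {f : X → ℝ} (hf : Continuous f) (h0 : ∀ x, 0 < f x) :
    ∃ a : ℝ, 0 < a ∧ ∀ x, a ≤ f x := by
  rcases isEmpty_or_nonempty X with hX | hX
  · exact ⟨1, one_pos, fun x => isEmptyElim x⟩
  · obtain ⟨x, -, hx⟩ := isCompact_univ.exists_isMinOn univ_nonempty hf.continuousOn
    exact ⟨f x, h0 x, fun y => hx (mem_univ y)⟩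

variable (h : LocalModel S p ι T O U δ σ LB LC G C₀ lam)
include h

omit [CompactSpace X] in
lemma iterate_p (n : ℕ) (x : X) : T^[n] (p x) = p (S^[n] x) := iterate_semiconj h.semi n x

omit [CompactSpace X] in
lemma U_ne (x : X) : ι (U x) ≠ 0 := fun e => by
  have := h.one x; rw [e, map_zero] at this; exact zero_ne_one this

/-- The functionals and the unstable vectors are bounded, uniformly on the basic set. -/
lemma exists_bounds : ∃ K : ℝ, 1 ≤ K ∧ (∀ x v, |σ x v| ≤ K * ‖v‖) ∧
    (∀ x v, |σ x (ι v)| ≤ K * ‖v‖) ∧ (∀ x, ‖U x‖ ≤ K) ∧ (∀ x, ‖ι (U x)‖ ≤ K) ∧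
    ∀ v, ‖ι v‖ ≤ K * ‖v‖ := by
  obtain ⟨K₁, h1, hK₁⟩ := exists_upper h.contσ.norm
  obtain ⟨K₂, h2, hK₂⟩ := exists_upper h.contU.norm
  obtain ⟨K₃, h3, hK₃⟩ := exists_upper (ι.continuous.comp h.contU).norm
  have h4 : 0 ≤ ‖ι‖ := norm_nonneg _
  set K := (K₁ + K₂ + K₃) * (1 + ‖ι‖) with hK
  have l1 : K₁ ≤ K := by nlinarith
  have l2 : K₂ ≤ K := by nlinarith
  have l3 : K₃ ≤ K := by nlinarith
  have l4 : ‖ι‖ ≤ K := by nlinarith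
  have l5 : K₁ * ‖ι‖ ≤ K := by nlinarith
  have hσ : ∀ x v, |σ x v| ≤ K₁ * ‖v‖ := fun x v => by
    rw [← Real.norm_eq_abs]; exact (σ x).le_of_opNorm_le (hK₁ x) v
  refine ⟨K, by linarith, fun x v => (hσ x v).trans (by gcongr), fun x v => ?_,
    fun x => (hK₂ x).trans l2, fun x => (hK₃ x).trans l3, fun v => ?_⟩
  · calc _ ≤ K₁ * (‖ι‖ * ‖v‖) := (hσ _ _).trans (by gcongr; exact ι.le_opNorm v)
      _ = K₁ * ‖ι‖ * ‖v‖ := by ring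
      _ ≤ _ := by gcongr
  · exact (ι.le_opNorm v).trans (by gcongr)

omit [CompactSpace X] in
lemma σ_cocycle (n : ℕ) (x : X) (v : C) :
    σ (S^[n] x) (cocycle S LC n x v) = growth S δ n x * σ x v := by
  induction n generalizing x v with
  | zero => simp
  | succ n ih =>
    rw [cocycle_succ, Function.iterate_succ_apply, ContinuousLinearMap.comp_apply, ih, h.invariant,
      add_comm n 1, growth_add, growth_one, Function.iterate_one]
    ring

omit [CompactSpace X] in
lemma cocycle_inter (n : ℕ) (x : X) (v : B) :
    ι (cocycle S LB n x v) = cocycle S LC n x (ι v) := cocycle_intertwine h.inter n x v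

omit [CompactSpace X] in
lemma exists_rate (a : ℝ) : ∃ m₀ : ℕ, ∀ m, m₀ ≤ m → a ≤ C₀ * lam ^ m := by
  have := (tendsto_pow_atTop_atTop_of_one_lt h.one_lt).const_mul_atTop h.const_pos
  exact eventually_atTop.1 (this.eventually_ge_atTop a)

/-- The cone estimates in `B`. In a cone around the unstable direction the unstable coordinate of
the difference of `y` and `f` expands; outside that cone the difference contracts. -/
theorem cone_step : ∃ N₀ : ℕ, ∀ N, N₀ ≤ N → ∃ η r : ℝ, 0 < η ∧ 0 < r ∧
    (∀ x, η * ‖U x‖ ≤ 1 / 6) ∧ ∀ x, ∀ f ∈ G r x, ∀ y ∈ Metric.ball (p x) r,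
    (η * ‖y - f‖ ≤ |σ x (ι (y - f))| →
      0 ≤ σ x (ι (y - f)) * σ (S^[N] x) (ι (T^[N] y - T^[N] f)) ∧
      2 * |σ x (ι (y - f))| ≤ |σ (S^[N] x) (ι (T^[N] y - T^[N] f))| ∧
      η * ‖T^[N] y - T^[N] f‖ ≤ |σ (S^[N] x) (ι (T^[N] y - T^[N] f))|) ∧
    (|σ x (ι (y - f))| ≤ η * ‖y - f‖ → ‖T^[N] y - T^[N] f‖ ≤ 1 / 2 * ‖y - f‖) := by
  obtain ⟨K, hK, hσC, hσB, hU, hUC, hι⟩ := h.exists_bounds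
  obtain ⟨m₁, hm₁⟩ := h.approxG
  obtain ⟨m₂, hm₂⟩ := h.exists_rate 8
  obtain ⟨c, θ, hc, hθ0, hθ1, hrate⟩ := h.rateB
  obtain ⟨m₃, hm₃⟩ : ∃ m₃, ∀ m, m₃ ≤ m → c * θ ^ m * (1 + K * K) < 1 / 12 := by
    have : Tendsto (fun m : ℕ => c * θ ^ m * (1 + K * K)) atTop (𝓝 0) := by
      simpa using ((tendsto_pow_atTop_nhds_zero_of_lt_one hθ0.le hθ1).const_mul c).mul_const
        (1 + K * K)
    exact eventually_atTop.1 (this.eventually (gt_mem_nhds (by norm_num)))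
  refine ⟨m₁ + m₂ + m₃ + 1, fun N hN => ?_⟩
  obtain ⟨Λ, hΛ, hgrow⟩ := exists_upper (continuous_growth h.contS h.contδ N)
  -- `Λ * K` bounds the expansion of the unstable component over `N` steps; with this `η`, that
  -- component contributes at most `1 / 6 * ‖w‖` outside the cone.
  set η : ℝ := 1 / (6 * (Λ * K)) with hη
  have hη0 : 0 < η := by positivity
  have hηΛ : η * (Λ * K) = 1 / 6 := by rw [hη]; field_simp
  obtain ⟨r₁, hr₁, hG⟩ := hm₁ N (by omega)
  obtain ⟨r₂, hr₂, hap⟩ := h.approx N (by omega) (η / K) (by positivity)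
  obtain ⟨r₃, hr₃, hGs⟩ := h.small_G r₂ hr₂
  refine ⟨η, min r₁ (min r₂ r₃), hη0, by positivity, fun x => ?_, fun x f hf y hy => ?_⟩
  · calc η * ‖U x‖ ≤ η * (Λ * K) := by
          gcongr; exact (hU x).trans (le_mul_of_one_le_left (by linarith) hΛ)
      _ = 1 / 6 := hηΛ
  have hf1 := h.mono_G _ _ (min_le_left _ _) x hf
  have hf2 := hGs x (h.mono_G _ _ ((min_le_right _ _).trans (min_le_right _ _)) x hf)
  have hy1 : y ∈ Metric.ball (p x) r₁ := Metric.ball_subset_ball (min_le_left _ _) hy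
  have hy2 : y ∈ Metric.ball (p x) r₂ :=
    Metric.ball_subset_ball ((min_le_right _ _).trans (min_le_left _ _)) hy
  -- split `w` into its unstable and its stable component, the latter being contracted by `rateB`
  have hLw₀ : ∀ w : B, ‖cocycle S LB N x w‖ ≤ Λ * K * |σ x (ι w)| + 1 / 12 * ‖w‖ := by
    intro w
    set s := σ x (ι w) with hs
    have e : cocycle S LB N x w
        = (s * growth S δ N x) • U (S^[N] x) + cocycle S LB N x (w - s • U x) := by
      rw [map_sub, map_smul, cocycle_unstable h.map, smul_smul]; abel
    have hker : σ x (ι (w - s • U x)) = 0 := by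
      rw [map_sub, map_smul, map_sub, map_smul, h.one, smul_eq_mul, mul_one, hs, sub_self]
    have hn : ‖w - s • U x‖ ≤ (1 + K * K) * ‖w‖ := by
      calc _ ≤ ‖w‖ + |s| * ‖U x‖ := by
            refine (norm_sub_le _ _).trans ?_
            rw [norm_smul, Real.norm_eq_abs]
        _ ≤ ‖w‖ + K * ‖w‖ * K := by gcongr; exacts [hσB _ _, hU x]
        _ = _ := by ring
    rw [e]
    refine (norm_add_le _ _).trans (add_le_add ?_ ?_)
    · rw [norm_smul, norm_mul, Real.norm_eq_abs,
        Real.norm_of_nonneg (growth_pos h.pos N x).le]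
      calc _ ≤ |s| * Λ * K := by gcongr; exacts [hgrow x, hU _]
        _ = _ := by ring
    · calc _ ≤ c * θ ^ N * ((1 + K * K) * ‖w‖) := (hrate N x _ hker).trans (by gcongr)
        _ = c * θ ^ N * (1 + K * K) * ‖w‖ := by ring
        _ ≤ _ := by gcongr; exact (hm₃ N (by omega)).le
  set w := y - f with hw
  set w' := T^[N] y - T^[N] f with hw'
  set s := σ x (ι w) with hs
  have hg8 : 8 ≤ growth S δ N x := (hm₂ N (by omega)).trans (h.lower N x (by omega))
  have hLw := hLw₀ w
  have hw'n : ‖w'‖ ≤ 1 / 3 * ‖w‖ + Λ * K * |s| := by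
    have := hG x f hf1 y hy1
    have e : w' = (w' - cocycle S LB N x w) + cocycle S LB N x w := by abel
    calc ‖w'‖ ≤ ‖w' - cocycle S LB N x w‖ + ‖cocycle S LB N x w‖ := by
          conv_lhs => rw [e]
          exact norm_add_le _ _
      _ ≤ 1 / 4 * ‖w‖ + (Λ * K * |s| + 1 / 12 * ‖w‖) := add_le_add this hLw
      _ = _ := by ring
  have hσ' : |σ (S^[N] x) (ι w') - growth S δ N x * s| ≤ η * ‖w‖ := by
    have := hap x y hy2 f hf2
    rw [← h.σ_cocycle, ← h.cocycle_inter, ← map_sub, ← map_sub]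
    calc _ ≤ K * (η / K * ‖w‖) := (hσC _ _).trans (by gcongr)
      _ = _ := by field_simp
  have hη2 : η * ‖w'‖ ≤ η * (1 / 3 * ‖w‖) + 1 / 6 * |s| := by
    calc _ ≤ η * (1 / 3 * ‖w‖ + Λ * K * |s|) := by gcongr
      _ = η * (1 / 3 * ‖w‖) + η * (Λ * K) * |s| := by ring
      _ = _ := by rw [hηΛ]
  constructor
  · intro hcone
    have h1 : 7 * |s| ≤ |σ (S^[N] x) (ι w')| := by
      have h2 : |growth S δ N x * s| = growth S δ N x * |s| := by
        rw [abs_mul, abs_of_nonneg (by linarith : 0 ≤ growth S δ N x)]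
      have h3 : |growth S δ N x * s| ≤ |σ (S^[N] x) (ι w')| + η * ‖w‖ := by
        have := abs_sub_abs_le_abs_sub (growth S δ N x * s) (σ (S^[N] x) (ι w'))
        rw [abs_sub_comm] at this
        linarith
      nlinarith [abs_nonneg s]
    refine ⟨?_, by linarith [abs_nonneg s], by nlinarith [abs_nonneg s]⟩
    have h4 := (abs_le.1 hσ').1
    have h5 := (abs_le.1 hσ').2
    rcases le_total 0 s with h6 | h6
    · rw [abs_of_nonneg h6] at hcone
      exact mul_nonneg h6 (by nlinarith)
    · rw [abs_of_nonpos h6] at hcone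
      exact mul_nonneg_of_nonpos_of_nonpos h6 (by nlinarith)
  · intro hcone
    have : Λ * K * |s| ≤ 1 / 6 * ‖w‖ := by
      calc _ ≤ Λ * K * (η * ‖w‖) := by gcongr
        _ = η * (Λ * K) * ‖w‖ := by ring
        _ = _ := by rw [hηΛ]
    linarith

omit [CompactSpace X] h in
/-- The algebra behind the cone estimates in `C`. The vectors `W₁`, `W₂` are the images of a vector
with unstable coordinate `s₀` and remaining part of norm `E₀`, at two consecutive times, and `s₁`,
`E₁` are the data of `W₁`. As `W₂` is estimated from both preceding times, the change of the
unstable coordinate is controlled without reference to the norms of the projections. -/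
lemma block_algebra {W₁ W₂ u₁ u₂ : C} {g₁ g₂ s₀ s₁ E₀ τ η a : ℝ} (ha : 0 < a) (ha1 : a ≤ 1)
    (hg₁ : 1 ≤ g₁) (hg₂ : 1 ≤ g₂) (hE₀ : 0 ≤ E₀) (hη : η = a / 10) (hτ : τ = a * η / 100)
    (hu₂ : a ≤ ‖u₂‖) (hu : ‖u₁‖ ≤ 2 * ‖u₂‖)
    (h1 : ‖W₁ - (g₁ * s₀) • u₁‖ ≤ τ * |s₀| + 13 / 100 * g₁ * E₀)
    (h2 : ‖W₂ - (g₁ * g₂ * s₀) • u₂‖ ≤ τ * |s₀| + 13 / 100 * (g₁ * g₂) * E₀)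
    (h3 : ‖W₂ - (g₂ * s₁) • u₂‖ ≤ τ * |s₁| + 13 / 100 * g₂ * ‖W₁ - s₁ • u₁‖) :
    (E₀ ≤ η * |s₀| → ‖W₁ - s₁ • u₁‖ ≤ η * |s₁| ∧ 9 / 10 * g₁ * |s₀| ≤ |s₁|) ∧
    (η * |s₁| < ‖W₁ - s₁ • u₁‖ → ‖W₁ - s₁ • u₁‖ ≤ 4 / 5 * g₁ * E₀) := by
  set E₁ := ‖W₁ - s₁ • u₁‖ with hE₁
  have hE₁0 : 0 ≤ E₁ := norm_nonneg _
  have hη0 : 0 < η := by rw [hη]; positivity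
  have hτ0 : 0 < τ := by rw [hτ]; positivity
  set D := |s₁ - g₁ * s₀| with hD
  have hD0 : 0 ≤ D := abs_nonneg _
  have hs0 : 0 ≤ |s₀| := abs_nonneg _
  have hs1 : 0 ≤ |s₁| := abs_nonneg _
  have hDu : D * ‖u₂‖ ≤ 13 / 100 * (g₁ * E₀ + E₁) + τ * (|s₀| + |s₁|) := by
    have e : (g₂ * (s₁ - g₁ * s₀)) • u₂ = (W₂ - (g₁ * g₂ * s₀) • u₂) - (W₂ - (g₂ * s₁) • u₂) := by
      rw [sub_sub_sub_cancel_left, ← sub_smul]; congr 1; ring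
    have h4 : g₂ * (D * ‖u₂‖) ≤ (τ * |s₀| + 13 / 100 * (g₁ * g₂) * E₀)
        + (τ * |s₁| + 13 / 100 * g₂ * E₁) := by
      calc _ = ‖(g₂ * (s₁ - g₁ * s₀)) • u₂‖ := by
            rw [norm_smul, norm_mul, Real.norm_of_nonneg (by linarith), Real.norm_eq_abs, mul_assoc]
        _ ≤ _ := by rw [e]; exact (norm_sub_le _ _).trans (add_le_add h2 h3)
    have h5 : g₂ * (D * ‖u₂‖) ≤ g₂ * (13 / 100 * (g₁ * E₀ + E₁) + τ * (|s₀| + |s₁|)) := by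
      have : τ * (|s₀| + |s₁|) ≤ g₂ * (τ * (|s₀| + |s₁|)) :=
        le_mul_of_one_le_left (by positivity) hg₂
      nlinarith
    exact le_of_mul_le_mul_left h5 (by linarith)
  have hE : E₁ ≤ τ * |s₀| + 13 / 100 * g₁ * E₀ + 2 * (D * ‖u₂‖) := by
    have e : W₁ - s₁ • u₁ = (W₁ - (g₁ * s₀) • u₁) - (s₁ - g₁ * s₀) • u₁ := by
      rw [sub_smul]; abel
    calc E₁ ≤ ‖W₁ - (g₁ * s₀) • u₁‖ + ‖(s₁ - g₁ * s₀) • u₁‖ := by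
          rw [hE₁, e]; exact norm_sub_le _ _
      _ ≤ (τ * |s₀| + 13 / 100 * g₁ * E₀) + D * (2 * ‖u₂‖) := by
          rw [norm_smul, Real.norm_eq_abs]; gcongr
      _ = _ := by ring
  have hE' : 74 / 100 * E₁ ≤ 39 / 100 * (g₁ * E₀) + 3 * (τ * (|s₀| + |s₁|)) := by
    nlinarith
  have hDa : D * a ≤ 13 / 100 * (g₁ * E₀ + E₁) + τ * (|s₀| + |s₁|) :=
    (mul_le_mul_of_nonneg_left hu₂ hD0).trans hDu
  have hs1D : |s₁| ≤ g₁ * |s₀| + D := by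
    have := abs_add_le (g₁ * s₀) (s₁ - g₁ * s₀)
    rw [add_sub_cancel, abs_mul, abs_of_nonneg (by linarith : 0 ≤ g₁)] at this
    exact this
  have hs1D' : g₁ * |s₀| ≤ |s₁| + D := by
    have := abs_add_le s₁ (-(s₁ - g₁ * s₀))
    rw [abs_neg, show s₁ + -(s₁ - g₁ * s₀) = g₁ * s₀ by ring, abs_mul,
      abs_of_nonneg (by linarith : 0 ≤ g₁)] at this
    exact this
  have hg0 : |s₀| ≤ g₁ * |s₀| := le_mul_of_one_le_left hs0 hg₁
  have key : E₀ ≤ η * |s₀| → E₁ ≤ η * |s₁| ∧ 9 / 10 * g₁ * |s₀| ≤ |s₁| := by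
    intro hc
    have hgE : g₁ * E₀ ≤ η * (g₁ * |s₀|) := by nlinarith
    set Z := g₁ * |s₀| with hZ
    have hZ0 : 0 ≤ Z := by positivity
    have hτs : τ * (|s₀| + |s₁|) ≤ τ * (2 * Z + D) :=
      mul_le_mul_of_nonneg_left (by linarith) hτ0.le
    -- everything is expressed through `Z` and `D`, with `τ = a η / 100`, `η = a / 10`
    have hτa : τ ≤ a / 1000 := by
      rw [hτ, hη]; nlinarith
    have hτη : τ ≤ η / 100 := by rw [hτ]; nlinarith
    have hP : 0 ≤ η * Z := by positivity
    have hQ : 0 ≤ τ * (2 * Z + D) := by positivity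
    have h6 : E₁ ≤ 53 / 100 * (η * Z) + 5 * (τ * (2 * Z + D)) := by linarith
    have h7 : D * a ≤ 2 / 10 * (η * Z) + 2 * (τ * (2 * Z + D)) := by linarith
    have h8 : τ * (2 * Z + D) ≤ a / 1000 * (2 * Z + D) := by gcongr
    have h9 : D ≤ 1 / 10 * Z := by
      have hZa : η * Z = a * Z / 10 := by rw [hη]; ring
      have h10 : a * D ≤ a * (1 / 50 * Z + 1 / 250 * Z + D / 500) := by linarith
      have h10 : D ≤ 1 / 50 * Z + 1 / 250 * Z + D / 500 := le_of_mul_le_mul_left h10 ha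
      linarith
    have h11 : τ * (2 * Z + D) ≤ η / 100 * (2 * Z + D) := by gcongr
    refine ⟨?_, by linarith⟩
    have h12 : η * (9 / 10 * Z) ≤ η * |s₁| := by gcongr; linarith
    have h13 : η * D ≤ η * (1 / 10 * Z) := by gcongr
    linarith
  refine ⟨key, fun hc => ?_⟩
  have h0 : η * |s₀| < E₀ := by
    by_contra! h0
    exact absurd (key h0).1 (not_le.2 hc)
  have hτη : τ ≤ η / 100 := by rw [hτ]; nlinarith
  have h15 : τ * |s₀| ≤ 1 / 100 * E₀ := by
    have : τ * |s₀| ≤ η / 100 * |s₀| := by gcongr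
    linarith
  have h16 : τ * |s₁| ≤ 1 / 100 * E₁ := by
    have : τ * |s₁| ≤ η / 100 * |s₁| := by gcongr
    linarith
  have h17 : E₀ ≤ g₁ * E₀ := le_mul_of_one_le_left hE₀ hg₁
  linarith

/-- Cone estimates in `C` for the differences of two orbits. After a time `m`, which depends on the
point of the basic set, a narrow cone around the unstable direction is mapped into itself, with
expansion of the unstable coordinate; for differences which are outside the cone at time `m`, the
part `‖w - σ(w) u‖` grows more slowly than the unstable vectors.

The bound in `approxC` is not small compared with the norms of the projections. The time `m` is
therefore chosen so that the norm in `C` of the unstable vector does not drop by more than a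
factor `2` during the next `N` steps, which makes `block_algebra` applicable. -/
theorem block_step : ∃ N M : ℕ, 0 < N ∧ ∃ η₀ : ℝ, 0 < η₀ ∧ ∃ r : ℝ, 0 < r ∧
    ∀ x, ∃ m, N ≤ m ∧ m ≤ M ∧ 8 ≤ growth S δ m x ∧ ∀ y z : B,
      (∀ i ≤ M + N, T^[i] y ∈ Metric.ball (p (S^[i] x)) r ∧
        T^[i] z ∈ Metric.ball (p (S^[i] x)) r) →
      (‖ι (y - z) - σ x (ι (y - z)) • ι (U x)‖ ≤ η₀ * |σ x (ι (y - z))| →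
        ‖ι (T^[m] y - T^[m] z) - σ (S^[m] x) (ι (T^[m] y - T^[m] z)) • ι (U (S^[m] x))‖
          ≤ η₀ * |σ (S^[m] x) (ι (T^[m] y - T^[m] z))| ∧
        9 / 10 * growth S δ m x * |σ x (ι (y - z))|
          ≤ |σ (S^[m] x) (ι (T^[m] y - T^[m] z))|) ∧
      (η₀ * |σ (S^[m] x) (ι (T^[m] y - T^[m] z))|
          < ‖ι (T^[m] y - T^[m] z) - σ (S^[m] x) (ι (T^[m] y - T^[m] z)) • ι (U (S^[m] x))‖ →
        ‖ι (T^[m] y - T^[m] z) - σ (S^[m] x) (ι (T^[m] y - T^[m] z)) • ι (U (S^[m] x))‖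
          ≤ 4 / 5 * growth S δ m x * ‖ι (y - z) - σ x (ι (y - z)) • ι (U x)‖) := by
  obtain ⟨K, hK, -, -, -, hUC, -⟩ := h.exists_bounds
  obtain ⟨a', ha', hau⟩ := exists_lower (ι.continuous.comp h.contU).norm
    (fun x => norm_pos_iff.2 (h.U_ne x))
  set a := min a' 1 with haa
  have ha : 0 < a := by positivity
  have hau : ∀ x, a ≤ ‖ι (U x)‖ := fun x => (min_le_left _ _).trans (hau x)
  obtain ⟨m₁, hm₁⟩ := h.approxC
  obtain ⟨m₂, hm₂⟩ := h.exists_rate 8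
  obtain ⟨c, μ, hc, hμ0, hμl, hrate⟩ := h.rateC
  have hC₀ := h.const_pos
  have hlam : 0 < lam := hμ0.trans hμl
  obtain ⟨m₃, hm₃⟩ : ∃ m₃, ∀ m, m₃ ≤ m → c * (μ / lam) ^ m < C₀ / 200 := by
    have : Tendsto (fun m : ℕ => c * (μ / lam) ^ m) atTop (𝓝 0) := by
      simpa using ((tendsto_pow_atTop_nhds_zero_of_lt_one (by positivity)
        ((div_lt_one hlam).2 hμl)).const_mul c)
    exact eventually_atTop.1 (this.eventually (gt_mem_nhds (by positivity)))
  set N := m₁ + m₂ + m₃ + 1 with hN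
  -- the number of blocks after which the norm of the unstable vector cannot have dropped each time
  obtain ⟨J, hJ⟩ : ∃ J : ℕ, K * (1 / 2) ^ J < a := by
    have : Tendsto (fun m : ℕ => K * (1 / 2 : ℝ) ^ m) atTop (𝓝 0) := by
      simpa using (tendsto_pow_atTop_nhds_zero_of_lt_one (r := (1 / 2 : ℝ)) (by norm_num)
        (by norm_num)).const_mul K
    exact (this.eventually (gt_mem_nhds ha)).exists
  set η : ℝ := a / 10 with hη
  set τ : ℝ := a * η / 100 with hτ
  have hη0 : 0 < η := by positivity
  have hτ0 : 0 < τ := by positivity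
  -- a radius which serves all times in question
  obtain ⟨r, hr, hap⟩ : ∃ r, 0 < r ∧ ∀ m, N ≤ m → m ≤ (J + 1) * N + N → ∀ x,
      ∀ y ∈ Metric.ball (p x) r, ∀ z ∈ Metric.ball (p x) r,
      ‖ι (T^[m] y - T^[m] z - cocycle S LB m x (y - z))‖ ≤ τ * |σ x (ι (y - z))|
        + C₀ / 8 * lam ^ m * ‖ι (y - z) - σ x (ι (y - z)) • ι (U x)‖ := by
    have h1 : ∀ m, ∃ r, 0 < r ∧ (N ≤ m → ∀ x, ∀ y ∈ Metric.ball (p x) r,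
        ∀ z ∈ Metric.ball (p x) r,
        ‖ι (T^[m] y - T^[m] z - cocycle S LB m x (y - z))‖ ≤ τ * |σ x (ι (y - z))|
          + C₀ / 8 * lam ^ m * ‖ι (y - z) - σ x (ι (y - z)) • ι (U x)‖) := by
      intro m
      by_cases hm : N ≤ m
      · obtain ⟨r, hr, h2⟩ := hm₁ m (by omega) τ hτ0
        exact ⟨r, hr, fun _ => h2⟩
      · exact ⟨1, one_pos, fun h => absurd h hm⟩
    choose ρ hρ0 hρ using h1
    obtain ⟨i, hi, hmin⟩ := (Finset.range ((J + 1) * N + N + 1)).exists_min_image ρ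
      ⟨0, by simp⟩
    refine ⟨ρ i, hρ0 i, fun m hm hm' x y hy z hz => hρ m hm x y ?_ z ?_⟩
    · exact Metric.ball_subset_ball (hmin m (by simp; omega)) hy
    · exact Metric.ball_subset_ball (hmin m (by simp; omega)) hz
  refine ⟨N, (J + 1) * N, by omega, η, hη0, r, hr, fun x => ?_⟩
  obtain ⟨j, hj1, hj2, hdrop⟩ : ∃ j, 1 ≤ j ∧ j ≤ J + 1 ∧
      ‖ι (U (S^[j * N] x))‖ ≤ 2 * ‖ι (U (S^[(j + 1) * N] x))‖ := by
    by_contra! hcon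
    have hall : ∀ i ≤ J, ‖ι (U (S^[(i + 1) * N] x))‖ ≤ K * (1 / 2) ^ i := by
      intro i
      induction i with
      | zero => intro _; simpa using hUC _
      | succ i ih =>
        intro hi
        have h1 := ih (by omega)
        have h2 := hcon (i + 1) (by omega) (by omega)
        rw [pow_succ]; linarith
    have := hall J le_rfl
    have := hau (S^[(J + 1) * N] x)
    linarith
  have hgr : ∀ m, N ≤ m → ∀ x, 8 ≤ growth S δ m x := fun m hm x =>
    (hm₂ m (by omega)).trans (h.lower m x (by omega))
  have hjN : N ≤ j * N := Nat.le_mul_of_pos_left N hj1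
  have hjM : j * N ≤ (J + 1) * N := Nat.mul_le_mul_right N hj2
  refine ⟨j * N, hjN, hjM, hgr _ hjN x, fun y z hyz => ?_⟩
  -- the basic estimate of the image of a difference
  have hbasic : ∀ m, N ≤ m → m ≤ (J + 1) * N + N → ∀ x, ∀ y ∈ Metric.ball (p x) r,
      ∀ z ∈ Metric.ball (p x) r,
      ‖ι (T^[m] y - T^[m] z) - (growth S δ m x * σ x (ι (y - z))) • ι (U (S^[m] x))‖
        ≤ τ * |σ x (ι (y - z))|
          + 13 / 100 * growth S δ m x * ‖ι (y - z) - σ x (ι (y - z)) • ι (U x)‖ := by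
    intro m hm hm' x y hy z hz
    set w := y - z with hw
    set e := ι w - σ x (ι w) • ι (U x) with he
    have hker : σ x e = 0 := by
      rw [he, map_sub, map_smul, h.one, smul_eq_mul, mul_one, sub_self]
    have h1 : ι (cocycle S LB m x w) = (growth S δ m x * σ x (ι w)) • ι (U (S^[m] x))
        + cocycle S LC m x e := by
      have h2 : ι w = σ x (ι w) • ι (U x) + e := by rw [he]; abel
      rw [h.cocycle_inter]
      conv_lhs => rw [h2]
      rw [map_add, map_smul, ← h.cocycle_inter, cocycle_unstable h.map, map_smul, smul_smul,
        mul_comm (σ x (ι w))]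
    have h3 : ι (T^[m] y - T^[m] z) - (growth S δ m x * σ x (ι w)) • ι (U (S^[m] x))
        = ι (T^[m] y - T^[m] z - cocycle S LB m x w) + cocycle S LC m x e := by
      rw [map_sub ι _ (cocycle S LB m x w), h1]; abel
    have h4 : ‖cocycle S LC m x e‖ ≤ 1 / 200 * growth S δ m x * ‖e‖ := by
      have h5 : c * μ ^ m ≤ C₀ / 200 * lam ^ m := by
        have := (hm₃ m (by omega)).le
        rw [div_pow, mul_div_assoc', div_le_iff₀ (by positivity)] at this
        exact this
      calc _ ≤ c * μ ^ m * ‖e‖ := hrate _ _ _ hker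
        _ ≤ C₀ / 200 * lam ^ m * ‖e‖ := by gcongr
        _ = 1 / 200 * (C₀ * lam ^ m) * ‖e‖ := by ring
        _ ≤ _ := by gcongr; exact h.lower m x (by omega)
    have h6 : C₀ / 8 * lam ^ m * ‖e‖ ≤ 1 / 8 * growth S δ m x * ‖e‖ := by
      calc _ = 1 / 8 * (C₀ * lam ^ m) * ‖e‖ := by ring
        _ ≤ _ := by gcongr; exact h.lower m x (by omega)
    have h7 : 0 ≤ growth S δ m x * ‖e‖ :=
      mul_nonneg (growth_pos h.pos m x).le (norm_nonneg _)
    rw [h3]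
    refine (norm_add_le _ _).trans ((add_le_add (hap m hm hm' x y hy z hz) h4).trans ?_)
    nlinarith
  have hj3 : (j + 1) * N = j * N + N := by ring
  have hS : S^[N] (S^[j * N] x) = S^[(j + 1) * N] x := by
    rw [← Function.iterate_add_apply, hj3, add_comm]
  have hTN : ∀ y, T^[(j + 1) * N] y = T^[N] (T^[j * N] y) := fun y => by
    rw [← Function.iterate_add_apply, hj3, add_comm]
  have h1 := hbasic (j * N) hjN (by omega) x y (hyz 0 (by omega)).1 z (hyz 0 (by omega)).2
  have h2 := hbasic ((j + 1) * N) (by omega) (by omega) x y (hyz 0 (by omega)).1 z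
    (hyz 0 (by omega)).2
  have h3 := hbasic N le_rfl (by omega) (S^[j * N] x) (T^[j * N] y) (hyz (j * N) (by omega)).1
    (T^[j * N] z) (hyz (j * N) (by omega)).2
  have hgg : growth S δ ((j + 1) * N) x = growth S δ (j * N) x * growth S δ N (S^[j * N] x) := by
    rw [hj3, growth_add]
  rw [hS, ← hTN, ← hTN] at h3
  rw [hgg] at h2
  exact block_algebra ha (min_le_right _ _) (by linarith [hgr _ hjN x])
    (by linarith [hgr _ le_rfl (S^[j * N] x)]) (norm_nonneg _) hη hτ (hau _) hdrop h1 h2 h3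

end LocalModel

/-! ### Orbits that shadow the basic set -/

/-- The points whose whole orbit stays `r`-close to the orbit of `p x`. -/
def shadow {X B : Type*} [NormedAddCommGroup B] (S : X → X) (p : X → B) (T : B → B) (r : ℝ)
    (x : X) : Set B := {y | ∀ n : ℕ, T^[n] y ∈ Metric.ball (p (S^[n] x)) r}

lemma shadow_mono {X B : Type*} [NormedAddCommGroup B] {S : X → X} {p : X → B} {T : B → B}
    {r r' : ℝ} (h : r ≤ r') (x : X) : shadow S p T r x ⊆ shadow S p T r' x :=
  fun _ hy n => Metric.ball_subset_ball h (hy n)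

lemma shadow_iterate {X B : Type*} [NormedAddCommGroup B] {S : X → X} {p : X → B} {T : B → B}
    {r : ℝ} {x : X} {y : B} (hy : y ∈ shadow S p T r x) (m : ℕ) :
    T^[m] y ∈ shadow S p T r (S^[m] x) := fun n => by
  rw [← Function.iterate_add_apply, ← Function.iterate_add_apply]; exact hy _

namespace LocalModel

variable {X B C : Type*} [TopologicalSpace X] [CompactSpace X]
    [NormedAddCommGroup B] [NormedSpace ℝ B] [NormedAddCommGroup C] [NormedSpace ℝ C]
    {S : X → X} {p : X → B} {ι : B →L[ℝ] C} {T : B → B} {O : Set B} {U : X → B} {δ : X → ℝ}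
    {σ : X → C →L[ℝ] ℝ} {LB : X → B →L[ℝ] B} {LC : X → C →L[ℝ] C} {G : ℝ → X → Set B}
    {C₀ lam : ℝ}

omit [TopologicalSpace X] [CompactSpace X] in
lemma eq_zero_of_cone {η : ℝ} (hη : 0 < η) {x : X} {w : B} (h : η * ‖w‖ ≤ |σ x (ι w)|)
    (h0 : |σ x (ι w)| ≤ 0) : w = 0 := by
  have : ‖w‖ ≤ 0 := by
    by_contra! h1
    have := mul_pos hη h1
    linarith
  simpa using this

variable (h : LocalModel S p ι T O U δ σ LB LC G C₀ lam)
include h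

omit [CompactSpace X] in
lemma lip_upto (N : ℕ) : ∃ r c : ℝ, 0 < r ∧ 1 ≤ c ∧ ∀ m ≤ N, ∀ x, ∀ f ∈ G r x,
    ∀ y ∈ Metric.ball (p x) r, ‖T^[m] y - T^[m] f‖ ≤ c * ‖y - f‖ := by
  induction N with
  | zero =>
    refine ⟨1, 1, one_pos, le_rfl, fun m hm x f _ y _ => ?_⟩
    obtain rfl : m = 0 := by omega
    simp
  | succ N ih =>
    obtain ⟨r, c, hr, hc, hN⟩ := ih
    obtain ⟨r', c', hr', hc', hN'⟩ := h.lipG (N + 1)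
    refine ⟨min r r', max c c', by positivity, hc.trans (le_max_left _ _),
      fun m hm x f hf y hy => ?_⟩
    rcases Nat.le_succ_iff.1 hm with hm | rfl
    · exact (hN m hm x f (h.mono_G _ _ (min_le_left _ _) x hf) y
        (Metric.ball_subset_ball (min_le_left _ _) hy)).trans (by gcongr; exact le_max_left _ _)
    · exact (hN' x f (h.mono_G _ _ (min_le_right _ _) x hf) y
        (Metric.ball_subset_ball (min_le_right _ _) hy)).trans (by gcongr; exact le_max_right _ _)

/-- Fixed choices of a number of steps, a cone and a radius for the cone estimates in `B`. -/
theorem exists_cone : ∃ N : ℕ, 0 < N ∧ ∃ η r c : ℝ, 0 < η ∧ 0 < r ∧ 1 ≤ c ∧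
    (∀ x, η * ‖U x‖ ≤ 1 / 6) ∧
    (∀ x, ∀ f ∈ G r x, ∀ y ∈ Metric.ball (p x) r,
    (η * ‖y - f‖ ≤ |σ x (ι (y - f))| →
      0 ≤ σ x (ι (y - f)) * σ (S^[N] x) (ι (T^[N] y - T^[N] f)) ∧
      2 * |σ x (ι (y - f))| ≤ |σ (S^[N] x) (ι (T^[N] y - T^[N] f))| ∧
      η * ‖T^[N] y - T^[N] f‖ ≤ |σ (S^[N] x) (ι (T^[N] y - T^[N] f))|) ∧
    (|σ x (ι (y - f))| ≤ η * ‖y - f‖ → ‖T^[N] y - T^[N] f‖ ≤ 1 / 2 * ‖y - f‖)) ∧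
    ∀ m ≤ N, ∀ x, ∀ f ∈ G r x, ∀ y ∈ Metric.ball (p x) r,
      ‖T^[m] y - T^[m] f‖ ≤ c * ‖y - f‖ := by
  obtain ⟨N₀, hN₀⟩ := h.cone_step
  obtain ⟨η, r₁, hη, hr₁, hU, hstep⟩ := hN₀ (N₀ + 1) (by omega)
  obtain ⟨r₂, c, hr₂, hc, hlip⟩ := h.lip_upto (N₀ + 1)
  refine ⟨N₀ + 1, by omega, η, min r₁ r₂, c, hη, by positivity, hc, hU, fun x f hf y hy => ?_,
    fun m hm x f hf y hy => ?_⟩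
  · exact hstep x f (h.mono_G _ _ (min_le_left _ _) x hf) y
      (Metric.ball_subset_ball (min_le_left _ _) hy)
  · exact hlip m hm x f (h.mono_G _ _ (min_le_right _ _) x hf) y
      (Metric.ball_subset_ball (min_le_right _ _) hy)

/-- Points which shadow an orbit of the basic set are attracted to it exponentially fast. -/
theorem shadow_contract : ∃ r c θ : ℝ, 0 < r ∧ 0 < c ∧ 0 < θ ∧ θ < 1 ∧
    ∀ x, ∀ y ∈ shadow S p T r x, ∀ n, ‖T^[n] y - p (S^[n] x)‖ ≤ c * θ ^ n * ‖y - p x‖ := by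
  obtain ⟨K, hK, -, hσB, -, -, -⟩ := h.exists_bounds
  obtain ⟨N, hN, η, r, c, hη, hr, hc, -, hcone, hlip⟩ := h.exists_cone
  obtain ⟨θ, hθ0, hθ1, hgeo⟩ := exists_geometric_of_blocks N
  have hG := h.mem_G r hr
  refine ⟨r, c * 4, θ, hr, by positivity, hθ0, hθ1, fun x y hy n => ?_⟩
  -- the unstable coordinate of the difference cannot be large, as it would grow
  have hbad : ∀ k : ℕ, ∀ x, ∀ y ∈ shadow S p T r x, η * ‖y - p x‖ ≤ |σ x (ι (y - p x))| →
      2 ^ k * |σ x (ι (y - p x))| ≤ K * r := by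
    intro k
    induction k with
    | zero =>
      intro x y hy _
      have h0 := hy 0
      simp only [Function.iterate_zero, id_eq, mem_ball_iff_norm] at h0
      calc _ = |σ x (ι (y - p x))| := by ring
        _ ≤ K * ‖y - p x‖ := hσB _ _
        _ ≤ _ := by gcongr
    | succ k ih =>
      intro x y hy hc
      obtain ⟨-, h1, h2⟩ := (hcone x _ (hG x) y (hy 0)).1 hc
      rw [h.iterate_p] at h1 h2
      have := ih _ _ (shadow_iterate hy N) h2
      rw [pow_succ]
      have h3 : (0 : ℝ) < 2 ^ k := by positivity
      nlinarith
  have hhalf : ∀ x, ∀ y ∈ shadow S p T r x, ‖T^[N] y - p (S^[N] x)‖ ≤ 1 / 2 * ‖y - p x‖ := by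
    intro x y hy
    rw [← h.iterate_p]
    refine (hcone x _ (hG x) y (hy 0)).2 ?_
    rcases le_total (|σ x (ι (y - p x))|) (η * ‖y - p x‖) with h1 | h1
    · exact h1
    · have h2 : |σ x (ι (y - p x))| ≤ 0 := by
        have hlim : Tendsto (fun k : ℕ => K * r * (1 / 2 : ℝ) ^ k) atTop (𝓝 0) := by
          simpa using (tendsto_pow_atTop_nhds_zero_of_lt_one (r := (1 / 2 : ℝ)) (by norm_num)
            (by norm_num)).const_mul (K * r)
        refine ge_of_tendsto' hlim fun k => ?_
        have := hbad k x y hy h1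
        rw [one_div, inv_pow, ← div_eq_mul_inv, le_div_iff₀ (by positivity)]
        linarith
      exact h2.trans (by positivity)
  have hblock : ∀ k : ℕ, ∀ x, ∀ y ∈ shadow S p T r x,
      ‖T^[N * k] y - p (S^[N * k] x)‖ ≤ (1 / 2) ^ k * ‖y - p x‖ := by
    intro k
    induction k with
    | zero => intro x y _; simp
    | succ k ih =>
      intro x y hy
      have := ih _ _ (shadow_iterate hy N)
      rw [← Function.iterate_add_apply, ← Function.iterate_add_apply] at this
      rw [mul_add, mul_one, pow_succ, mul_assoc]
      exact this.trans (by gcongr; exact hhalf x y hy)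
  obtain ⟨k, i, hi, rfl⟩ : ∃ k i, i < N ∧ n = N * k + i :=
    ⟨n / N, n % N, Nat.mod_lt _ hN, (Nat.div_add_mod n N).symm⟩
  have h1 := hlip i hi.le _ _ (hG (S^[N * k] x)) _ (hy (N * k))
  rw [h.iterate_p, ← Function.iterate_add_apply, ← Function.iterate_add_apply, add_comm i] at h1
  calc _ ≤ c * ((1 / 2) ^ k * ‖y - p x‖) := h1.trans (by gcongr; exact hblock k x y hy)
    _ ≤ c * ((4 * θ ^ (N * k + i)) * ‖y - p x‖) := by gcongr; exact hgeo k i hi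
    _ = _ := by ring

/-- Forward comparison with an orbit in `A`: if the final difference is not close to the unstable
direction, the differences decay exponentially all along. -/
theorem forward_contract : ∃ η r c θ : ℝ, 0 < η ∧ 0 < r ∧ 0 < c ∧ 0 < θ ∧ θ < 1 ∧
    ∀ n x y f, (∀ i ≤ n, T^[i] y ∈ Metric.ball (p (S^[i] x)) r ∧ T^[i] f ∈ G r (S^[i] x)) →
      |σ (S^[n] x) (ι (T^[n] y - T^[n] f))| ≤ η * ‖T^[n] y - T^[n] f‖ →
      ∀ j ≤ n, ‖T^[j] y - T^[j] f‖ ≤ c * θ ^ j * ‖y - f‖ := by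
  obtain ⟨N, hN, η, r, c, hη, hr, hc, -, hcone, hlip⟩ := h.exists_cone
  obtain ⟨θ, hθ0, hθ1, hgeo⟩ := exists_geometric_of_blocks N
  -- if the final difference is outside the open cone, so are all earlier ones
  have key : ∀ k x y f, (∀ i ≤ N * k, T^[i] y ∈ Metric.ball (p (S^[i] x)) r ∧
      T^[i] f ∈ G r (S^[i] x)) →
      (|σ (S^[N * k] x) (ι (T^[N * k] y - T^[N * k] f))| < η * ‖T^[N * k] y - T^[N * k] f‖ ∨
        T^[N * k] y - T^[N * k] f = 0) →
      (|σ x (ι (y - f))| < η * ‖y - f‖ ∨ y - f = 0) ∧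
        ‖T^[N * k] y - T^[N * k] f‖ ≤ (1 / 2) ^ k * ‖y - f‖ := by
    intro k
    induction k with
    | zero => intro x y f _ h1; simpa using h1
    | succ k ih =>
      intro x y f hcl h1
      have e : N * (k + 1) = N * k + N := by ring
      rw [e, Function.iterate_add_apply, Function.iterate_add_apply,
        Function.iterate_add_apply] at h1
      rw [e, Function.iterate_add_apply, Function.iterate_add_apply]
      obtain ⟨h2, h3⟩ := ih (S^[N] x) (T^[N] y) (T^[N] f) (fun i hi => by
        rw [← Function.iterate_add_apply, ← Function.iterate_add_apply,
          ← Function.iterate_add_apply]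
        exact hcl _ (by rw [e]; omega)) h1
      obtain ⟨h4, h5⟩ := hcone x f (hcl 0 (by omega)).2 y (hcl 0 (by omega)).1
      have h6 : |σ x (ι (y - f))| < η * ‖y - f‖ ∨ y - f = 0 := by
        by_contra! h7
        obtain ⟨-, h8, h9⟩ := h4 h7.1
        rcases h2 with h2 | h2
        · exact absurd h9 (not_le.2 h2)
        · rw [h2, map_zero, map_zero, abs_zero] at h8
          exact h7.2 (eq_zero_of_cone hη h7.1 (by linarith))
      refine ⟨h6, h3.trans ?_⟩
      rw [pow_succ, mul_assoc]
      gcongr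
      refine h5 (h6.elim le_of_lt fun h7 => ?_)
      rw [h7]; simp
  have hθN := pow_pos hθ0 N
  refine ⟨η / 2, r, c * (4 * c) * ((θ ^ N)⁻¹ * (θ ^ N)⁻¹) + c * (θ ^ N)⁻¹, θ, by positivity, hr,
    by positivity, hθ0, hθ1, fun n x y f hcl hfin j hj => ?_⟩
  obtain ⟨k, i, hi, rfl⟩ : ∃ k i, i < N ∧ n = N * k + i :=
    ⟨n / N, n % N, Nat.mod_lt _ hN, (Nat.div_add_mod n N).symm⟩
  have hlt : |σ (S^[N * k + i] x) (ι (T^[N * k + i] y - T^[N * k + i] f))|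
      < η * ‖T^[N * k + i] y - T^[N * k + i] f‖ ∨ T^[N * k + i] y - T^[N * k + i] f = 0 := by
    rcases eq_or_ne (T^[N * k + i] y - T^[N * k + i] f) 0 with h0 | h0
    · exact Or.inr h0
    · have h0' := norm_pos_iff.2 h0
      exact Or.inl (hfin.trans_lt (by nlinarith))
  have hpow : ∀ m l, l < N → θ ^ m ≤ θ ^ (m + l) * (θ ^ N)⁻¹ := by
    intro m l hl
    rw [pow_add, mul_assoc]
    refine le_mul_of_one_le_right (by positivity) ?_
    rw [← div_eq_mul_inv, one_le_div hθN]
    exact pow_le_pow_of_le_one hθ0.le hθ1.le hl.le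
  have hlip' : ∀ a l, l < N → a + l ≤ N * k + i → ‖T^[a + l] y - T^[a + l] f‖
      ≤ c * ‖T^[a] y - T^[a] f‖ := by
    intro a l hl hal
    rw [add_comm a l, Function.iterate_add_apply, Function.iterate_add_apply]
    exact hlip l hl.le (S^[a] x) _ (hcl a (by omega)).2 _ (hcl a (by omega)).1
  have h0 := norm_nonneg (y - f)
  rcases lt_or_ge j i with hji | hji
  · have h1 := hlip' 0 j (by omega) (by omega)
    have h2 := hpow 0 j (by omega)
    rw [zero_add] at h1 h2
    rw [pow_zero] at h2
    calc _ ≤ c * ‖y - f‖ * 1 := by rw [mul_one]; exact h1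
      _ ≤ c * ‖y - f‖ * (θ ^ j * (θ ^ N)⁻¹) := by gcongr
      _ = 0 + c * (θ ^ N)⁻¹ * θ ^ j * ‖y - f‖ := by ring
      _ ≤ c * (4 * c) * ((θ ^ N)⁻¹ * (θ ^ N)⁻¹) * θ ^ j * ‖y - f‖
          + c * (θ ^ N)⁻¹ * θ ^ j * ‖y - f‖ := by gcongr; positivity
      _ = _ := by ring
  · obtain ⟨a, l, hl, rfl⟩ : ∃ a l, l < N ∧ j = N * a + i + l :=
      ⟨(j - i) / N, (j - i) % N, Nat.mod_lt _ hN, by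
        have := Nat.div_add_mod (j - i) N; omega⟩
    have hak : a ≤ k := by
      by_contra! h1
      have : N * (k + 1) ≤ N * a := Nat.mul_le_mul_left N h1
      rw [mul_add] at this
      omega
    obtain ⟨d, rfl⟩ := Nat.exists_eq_add_of_le hak
    have e : N * (a + d) + i = N * d + (N * a + i) := by ring
    rw [e] at hlt hcl
    rw [Function.iterate_add_apply _ (N * d), Function.iterate_add_apply _ (N * d),
      Function.iterate_add_apply _ (N * d)] at hlt
    have h1 := (key d (S^[N * a + i] x) (T^[N * a + i] y) (T^[N * a + i] f) (fun j hj => by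
      rw [← Function.iterate_add_apply, ← Function.iterate_add_apply,
        ← Function.iterate_add_apply]
      exact hcl _ (by omega)) hlt).1
    rw [Function.iterate_add_apply _ (N * a), Function.iterate_add_apply _ (N * a),
      Function.iterate_add_apply _ (N * a)] at h1
    have h2 := (key a (S^[i] x) (T^[i] y) (T^[i] f) (fun j hj => by
      rw [← Function.iterate_add_apply, ← Function.iterate_add_apply,
        ← Function.iterate_add_apply]
      exact hcl _ (by omega)) h1).2
    rw [← Function.iterate_add_apply, ← Function.iterate_add_apply] at h2
    have h3 := hlip' (N * a + i) l hl (by omega)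
    have h4 := hlip' 0 i hi (by omega)
    rw [zero_add] at h4
    have h5 := hgeo a 0 hN
    have h6 := hpow (N * a) i hi
    have h7 := hpow (N * a + i) l hl
    calc _ ≤ c * ((1 / 2) ^ a * (c * ‖y - f‖)) := by
          refine h3.trans ?_
          gcongr
          refine h2.trans ?_
          gcongr
          exact h4
      _ ≤ c * ((4 * (θ ^ (N * a + i + l) * (θ ^ N)⁻¹ * (θ ^ N)⁻¹)) * (c * ‖y - f‖)) := by
          gcongr
          refine h5.trans ?_
          rw [add_zero]
          gcongr
          refine h6.trans ?_
          gcongr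
      _ = c * (4 * c) * ((θ ^ N)⁻¹ * (θ ^ N)⁻¹) * θ ^ (N * a + i + l) * ‖y - f‖ + 0 := by ring
      _ ≤ c * (4 * c) * ((θ ^ N)⁻¹ * (θ ^ N)⁻¹) * θ ^ (N * a + i + l) * ‖y - f‖
          + c * (θ ^ N)⁻¹ * θ ^ (N * a + i + l) * ‖y - f‖ := by gcongr; positivity
      _ = _ := by ring

omit [TopologicalSpace X] [CompactSpace X] h in
lemma iterate_backward {E : Type*} {F : E → E} {z : ℕ → E} (hz : ∀ n, F (z (n + 1)) = z n)
    (n m : ℕ) : F^[m] (z (n + m)) = z n := by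
  induction m with
  | zero => rfl
  | succ m ih => rw [Function.iterate_succ_apply, ← add_assoc, hz, ih]

/-- Comparison of a backward orbit in `B` with a backward orbit in `A`, both of which stay close to
a backward orbit in the basic set: their distance decays exponentially, and they coincide if the
difference of their end points is not close to the unstable direction. -/
theorem backward_contract : ∃ η r c θ : ℝ, 0 < η ∧ 0 < r ∧ 0 < c ∧ 0 < θ ∧ θ < 1 ∧
    ∀ (b : ℕ → X) (y f : ℕ → B), (∀ n, S (b (n + 1)) = b n) → (∀ n, T (y (n + 1)) = y n) →
      (∀ n, T (f (n + 1)) = f n) → (∀ n, y n ∈ Metric.ball (p (b n)) r) →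
      (∀ n, f n ∈ G r (b n)) →
      (∀ n, ‖y n - f n‖ ≤ c * θ ^ n * ‖y 0 - f 0‖) ∧
      (|σ (b 0) (ι (y 0 - f 0))| ≤ η * ‖y 0 - f 0‖ → ∀ n, y n = f n) := by
  obtain ⟨K, hK, -, hσB, -, -, -⟩ := h.exists_bounds
  obtain ⟨N, hN, η, r₁, c, hη, hr₁, hc, -, hcone, hlip⟩ := h.exists_cone
  obtain ⟨θ, hθ0, hθ1, hgeo⟩ := exists_geometric_of_blocks N
  obtain ⟨r₂, hr₂, hG₂⟩ := h.small_G r₁ hr₁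
  refine ⟨η / 2, min r₁ r₂, c * (η⁻¹ * (K * 4)), θ, by positivity, by positivity, by positivity,
    hθ0, hθ1, fun b y f hb hy hf hyb hfb => ?_⟩
  have hy1 : ∀ n, y n ∈ Metric.ball (p (b n)) r₁ := fun n =>
    Metric.ball_subset_ball (min_le_left _ _) (hyb n)
  have hf1 : ∀ n, f n ∈ G r₁ (b n) := fun n => h.mono_G _ _ (min_le_left _ _) _ (hfb n)
  have hf2 : ∀ n, f n ∈ Metric.ball (p (b n)) r₁ := fun n =>
    hG₂ _ (h.mono_G _ _ (min_le_right _ _) _ (hfb n))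
  have hd : ∀ n, ‖y n - f n‖ ≤ 2 * r₁ := fun n => by
    have h1 := mem_ball_iff_norm.1 (hy1 n)
    have h2 := mem_ball_iff_norm.1 (hf2 n)
    calc _ = ‖(y n - p (b n)) - (f n - p (b n))‖ := by rw [sub_sub_sub_cancel_right]
      _ ≤ _ := (norm_sub_le _ _).trans (by linarith)
  have hstep : ∀ n, (η * ‖y (n + N) - f (n + N)‖ ≤ |σ (b (n + N)) (ι (y (n + N) - f (n + N)))| →
      2 * |σ (b (n + N)) (ι (y (n + N) - f (n + N)))| ≤ |σ (b n) (ι (y n - f n))| ∧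
      η * ‖y n - f n‖ ≤ |σ (b n) (ι (y n - f n))|) ∧
      (|σ (b (n + N)) (ι (y (n + N) - f (n + N)))| ≤ η * ‖y (n + N) - f (n + N)‖ →
        ‖y n - f n‖ ≤ 1 / 2 * ‖y (n + N) - f (n + N)‖) := by
    intro n
    have := hcone (b (n + N)) _ (hf1 (n + N)) _ (hy1 (n + N))
    rw [iterate_backward hb, iterate_backward hy, iterate_backward hf] at this
    exact ⟨fun hh => (this.1 hh).2, this.2⟩
  -- outside the cone, the difference contracts from an arbitrarily distant past, so it vanishes
  have hzero : ∀ n, |σ (b n) (ι (y n - f n))| < η * ‖y n - f n‖ → y n - f n = 0 := by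
    intro n hn
    have h1 : ∀ k : ℕ, |σ (b (n + N * k)) (ι (y (n + N * k) - f (n + N * k)))|
        < η * ‖y (n + N * k) - f (n + N * k)‖ ∧
        ‖y n - f n‖ ≤ (1 / 2) ^ k * ‖y (n + N * k) - f (n + N * k)‖ := by
      intro k
      induction k with
      | zero => simpa using hn
      | succ k ih =>
        have e : n + N * (k + 1) = n + N * k + N := by ring
        obtain ⟨h2, h3⟩ := hstep (n + N * k)
        rw [← e] at h2 h3
        have h4 : |σ (b (n + N * (k + 1))) (ι (y (n + N * (k + 1)) - f (n + N * (k + 1))))|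
            < η * ‖y (n + N * (k + 1)) - f (n + N * (k + 1))‖ := by
          by_contra! h5
          exact absurd (h2 h5).2 (not_le.2 ih.1)
        refine ⟨h4, ih.2.trans ?_⟩
        rw [pow_succ, mul_assoc]
        gcongr
        exact h3 h4.le
    have hlim : Tendsto (fun k : ℕ => (1 / 2 : ℝ) ^ k * (2 * r₁)) atTop (𝓝 0) := by
      simpa using (tendsto_pow_atTop_nhds_zero_of_lt_one (r := (1 / 2 : ℝ)) (by norm_num)
        (by norm_num)).mul_const (2 * r₁)
    have h2 : ‖y n - f n‖ ≤ 0 := ge_of_tendsto' hlim fun k =>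
      (h1 k).2.trans (by gcongr; exact hd _)
    simpa using h2
  have hblock : ∀ k : ℕ, ‖y (N * k) - f (N * k)‖ ≤ η⁻¹ * ((1 / 2) ^ k * (K * ‖y 0 - f 0‖)) := by
    intro k
    by_cases h0 : η * ‖y (N * k) - f (N * k)‖ ≤ |σ (b (N * k)) (ι (y (N * k) - f (N * k)))|
    · have h1 : ∀ k : ℕ, η * ‖y (N * k) - f (N * k)‖ ≤ |σ (b (N * k)) (ι (y (N * k) - f (N * k)))| →
          2 ^ k * |σ (b (N * k)) (ι (y (N * k) - f (N * k)))| ≤ |σ (b 0) (ι (y 0 - f 0))| := by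
        intro k
        induction k with
        | zero => intro _; simp
        | succ k ih =>
          intro h2
          rw [mul_add, mul_one] at h2 ⊢
          obtain ⟨h3, h4⟩ := (hstep (N * k)).1 h2
          have := ih h4
          rw [pow_succ]
          have h5 : (0 : ℝ) < 2 ^ k := by positivity
          nlinarith
      have h2 := h1 k h0
      have h3 := h2.trans (hσB (b 0) (y 0 - f 0))
      rw [← div_eq_inv_mul, le_div_iff₀ hη, one_div, inv_pow, ← div_eq_inv_mul,
        le_div_iff₀ (by positivity)]
      have h5 : (0 : ℝ) < 2 ^ k := by positivity
      nlinarith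
    · rw [hzero _ (not_le.1 h0), norm_zero]; positivity
  have hdecay : ∀ n, ‖y n - f n‖ ≤ c * (η⁻¹ * (K * 4)) * θ ^ n * ‖y 0 - f 0‖ := by
    intro n
    obtain ⟨k, i, hi, rfl⟩ : ∃ k i, i < N ∧ n = N * k + i :=
      ⟨n / N, n % N, Nat.mod_lt _ hN, (Nat.div_add_mod n N).symm⟩
    -- step back to the next multiple of `N`, from where the differences are bounded by `c`
    have e : N * (k + 1) = N * k + i + (N - i) := by rw [mul_add, mul_one]; omega
    have h1 := hlip (N - i) (by omega) _ _ (hf1 (N * (k + 1))) _ (hy1 (N * (k + 1)))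
    rw [e, iterate_backward hy, iterate_backward hf, ← e] at h1
    have h2 : (1 / 2 : ℝ) ^ (k + 1) ≤ 4 * θ ^ (N * k + i) :=
      (pow_le_pow_of_le_one (by norm_num) (by norm_num) (Nat.le_succ k)).trans (hgeo k i hi)
    calc _ ≤ c * (η⁻¹ * ((1 / 2) ^ (k + 1) * (K * ‖y 0 - f 0‖))) :=
          h1.trans (by gcongr; exact hblock (k + 1))
      _ ≤ c * (η⁻¹ * ((4 * θ ^ (N * k + i)) * (K * ‖y 0 - f 0‖))) := by gcongr
      _ = _ := by ring
  refine ⟨hdecay, fun h1 => ?_⟩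
  have h2 : y 0 - f 0 = 0 := by
    by_contra h3
    have h4 : 0 < ‖y 0 - f 0‖ := norm_pos_iff.2 h3
    exact h3 (hzero 0 (h1.trans_lt (by nlinarith)))
  intro n
  have := hdecay n
  rw [h2, norm_zero, mul_zero] at this
  exact sub_eq_zero.1 (norm_le_zero_iff.1 this)

end LocalModel

namespace LocalModel

variable {X B C : Type*} [TopologicalSpace X] [CompactSpace X]
    [NormedAddCommGroup B] [NormedSpace ℝ B] [NormedAddCommGroup C] [NormedSpace ℝ C]
    {S : X → X} {p : X → B} {ι : B →L[ℝ] C} {T : B → B} {O : Set B} {U : X → B} {δ : X → ℝ}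
    {σ : X → C →L[ℝ] ℝ} {LB : X → B →L[ℝ] B} {LC : X → C →L[ℝ] C} {G : ℝ → X → Set B}
    {C₀ lam : ℝ}

/-! ### Iterated cone estimates in the weaker norm -/

variable (h : LocalModel S p ι T O U δ σ LB LC G C₀ lam)
include h

/-- `k`-fold iteration of the cone estimates in `C`. The time `n` depends on `k` and on the point of
the basic set. -/
theorem cone_iterate : ∃ M M₁ : ℕ, ∃ η₀ r : ℝ, 0 < η₀ ∧ 0 < r ∧ ∀ k x, ∃ n, n ≤ k * M ∧
    8 ^ k ≤ growth S δ n x ∧ ∀ y z : B,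
      (∀ i ≤ k * M + M₁, T^[i] y ∈ Metric.ball (p (S^[i] x)) r ∧
        T^[i] z ∈ Metric.ball (p (S^[i] x)) r) →
      (‖ι (y - z) - σ x (ι (y - z)) • ι (U x)‖ ≤ η₀ * |σ x (ι (y - z))| →
        ‖ι (T^[n] y - T^[n] z) - σ (S^[n] x) (ι (T^[n] y - T^[n] z)) • ι (U (S^[n] x))‖
          ≤ η₀ * |σ (S^[n] x) (ι (T^[n] y - T^[n] z))| ∧
        (9 / 10) ^ k * growth S δ n x * |σ x (ι (y - z))|
          ≤ |σ (S^[n] x) (ι (T^[n] y - T^[n] z))|) ∧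
      (η₀ * |σ (S^[n] x) (ι (T^[n] y - T^[n] z))|
          < ‖ι (T^[n] y - T^[n] z) - σ (S^[n] x) (ι (T^[n] y - T^[n] z)) • ι (U (S^[n] x))‖ →
        ‖ι (T^[n] y - T^[n] z) - σ (S^[n] x) (ι (T^[n] y - T^[n] z)) • ι (U (S^[n] x))‖
          ≤ (4 / 5) ^ k * growth S δ n x * ‖ι (y - z) - σ x (ι (y - z)) • ι (U x)‖) := by
  obtain ⟨N, M, hN, η₀, hη₀, r, hr, hblock⟩ := h.block_step
  refine ⟨M, M + N, η₀, r, hη₀, hr, fun k => ?_⟩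
  induction k with
  | zero =>
    exact fun x => ⟨0, by simp, by simp, fun y z _ => ⟨fun hc => ⟨hc, by simp⟩, fun _ => by simp⟩⟩
  | succ k ih =>
    intro x
    obtain ⟨m, hm1, hm2, hg, hstep⟩ := hblock x
    obtain ⟨n, hn, hgn, hih⟩ := ih (S^[m] x)
    have hgr : growth S δ (n + m) x = growth S δ m x * growth S δ n (S^[m] x) := by
      rw [add_comm, growth_add]
    have hp1 := growth_pos h.pos m x (S := S)
    have hp2 := growth_pos h.pos n (S^[m] x) (S := S)
    refine ⟨n + m, by rw [add_mul]; omega, ?_, fun y z hyz => ?_⟩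
    · rw [hgr, pow_succ, mul_comm]
      gcongr
    rw [add_mul, one_mul] at hyz
    obtain ⟨h1, h2⟩ := hstep y z fun i hi => hyz i (by omega)
    obtain ⟨h3, h4⟩ := hih (T^[m] y) (T^[m] z) fun i hi => by
      rw [← Function.iterate_add_apply, ← Function.iterate_add_apply, ← Function.iterate_add_apply]
      exact hyz _ (by omega)
    rw [← Function.iterate_add_apply, ← Function.iterate_add_apply,
      ← Function.iterate_add_apply] at h3 h4
    refine ⟨fun hc => ?_, fun hc => ?_⟩
    · obtain ⟨h5, h6⟩ := h1 hc
      obtain ⟨h7, h8⟩ := h3 h5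
      refine ⟨h7, le_trans ?_ h8⟩
      rw [hgr]
      calc _ = (9 / 10) ^ k * growth S δ n (S^[m] x)
            * (9 / 10 * growth S δ m x * |σ x (ι (y - z))|) := by ring
        _ ≤ _ := by gcongr
    · have h5 : η₀ * |σ (S^[m] x) (ι (T^[m] y - T^[m] z))| <
          ‖ι (T^[m] y - T^[m] z) - σ (S^[m] x) (ι (T^[m] y - T^[m] z)) • ι (U (S^[m] x))‖ := by
        by_contra! h6
        exact absurd (h3 h6).1 (not_le.2 hc)
      refine (h4 hc).trans ?_
      rw [hgr]
      calc _ ≤ (4 / 5) ^ k * growth S δ n (S^[m] x) * (4 / 5 * growth S δ m x *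
              ‖ι (y - z) - σ x (ι (y - z)) • ι (U x)‖) := by gcongr; exact h2 h5
        _ = _ := by ring

/-- If two orbits stay close to the same orbit of the basic set for a long time, and their initial
difference lies in the unstable cone, then it is exponentially small. -/
theorem cone_decay : ∃ η₀ r c θ : ℝ, 0 < η₀ ∧ 0 < r ∧ 0 < c ∧ 0 < θ ∧ θ < 1 ∧ ∀ n x y z,
    (∀ i ≤ n, T^[i] y ∈ Metric.ball (p (S^[i] x)) r ∧ T^[i] z ∈ Metric.ball (p (S^[i] x)) r) →
    ‖ι (y - z) - σ x (ι (y - z)) • ι (U x)‖ ≤ η₀ * |σ x (ι (y - z))| →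
    |σ x (ι (y - z))| ≤ c * θ ^ n := by
  obtain ⟨K, hK, -, hσB, -, -, -⟩ := h.exists_bounds
  obtain ⟨M, M₁, η₀, r, hη₀, hr, hcone⟩ := h.cone_iterate
  obtain ⟨θ, hθ0, hθ1, hgeo⟩ := exists_geometric_of_blocks (M + M₁ + 1)
  refine ⟨η₀, r, 2 * (K * (2 * r)) * 4, θ, hη₀, hr, by positivity, hθ0, hθ1,
    fun n x y z hyz hc => ?_⟩
  have hbd : ∀ i ≤ n, |σ (S^[i] x) (ι (T^[i] y - T^[i] z))| ≤ K * (2 * r) := fun i hi => by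
    refine (hσB _ _).trans ?_
    have h1 := mem_ball_iff_norm.1 (hyz i hi).1
    have h2 := mem_ball_iff_norm.1 (hyz i hi).2
    have h3 : ‖T^[i] y - T^[i] z‖ ≤ 2 * r := by
      calc _ = ‖(T^[i] y - p (S^[i] x)) - (T^[i] z - p (S^[i] x))‖ := by
            rw [sub_sub_sub_cancel_right]
        _ ≤ _ := (norm_sub_le _ _).trans (by linarith)
    gcongr
  obtain ⟨k, i, hi, rfl⟩ : ∃ k i, i < M + M₁ + 1 ∧ n = (M + M₁ + 1) * k + i :=
    ⟨n / (M + M₁ + 1), n % (M + M₁ + 1), Nat.mod_lt _ (by omega), (Nat.div_add_mod n _).symm⟩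
  have hg := hgeo k i hi
  -- the unstable coordinate doubles in each block, and remains bounded
  have key : |σ x (ι (y - z))| ≤ 2 * (K * (2 * r)) * (1 / 2) ^ k := by
    rcases k with _ | k
    · have := hbd 0 (by omega)
      simp only [Function.iterate_zero, id_eq] at this
      rw [pow_zero]
      have : 0 < K * (2 * r) := by positivity
      linarith
    · obtain ⟨n', hn', hgn, hst⟩ := hcone k x
      have hle : k * M + M₁ ≤ (M + M₁ + 1) * (k + 1) + i := by nlinarith
      obtain ⟨-, h2⟩ := (hst y z fun i hi => hyz i (by omega)).1 hc
      have h3 := h2.trans (hbd n' (by omega))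
      have h4 : (2 : ℝ) ^ k ≤ (9 / 10) ^ k * growth S δ n' x := by
        calc (2 : ℝ) ^ k ≤ (9 / 10 * 8) ^ k := pow_le_pow_left₀ (by norm_num) (by norm_num) k
          _ = (9 / 10) ^ k * 8 ^ k := mul_pow _ _ _
          _ ≤ _ := by gcongr
      have h5 : 2 ^ k * |σ x (ι (y - z))| ≤ K * (2 * r) := le_trans (by gcongr) h3
      rw [pow_succ, one_div, inv_pow]
      have h6 : (0 : ℝ) < 2 ^ k := by positivity
      have h7 : |σ x (ι (y - z))| ≤ K * (2 * r) * (2 ^ k)⁻¹ := by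
        rw [← div_eq_mul_inv, le_div_iff₀ h6]; linarith
      linarith
  refine key.trans ?_
  rw [mul_assoc (2 * (K * (2 * r)))]
  gcongr

/-- Points which shadow the same orbit, with difference in the unstable cone, coincide. In general,
the differences of points which shadow the same orbit grow more slowly, in the norm of `C`, than
the unstable vectors. -/
theorem shadow_slow : ∃ M M₁ : ℕ, ∃ η₀ r : ℝ, 0 < η₀ ∧ 0 < r ∧
    (∀ x, ∀ y ∈ shadow S p T r x, ∀ z ∈ shadow S p T r x,
      ‖ι (y - z) - σ x (ι (y - z)) • ι (U x)‖ ≤ η₀ * |σ x (ι (y - z))| → y = z) ∧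
    ∀ k x, ∃ n, n ≤ k * M ∧ 8 ^ k ≤ growth S δ n x ∧
    (∀ y z : B, (∀ i ≤ k * M + M₁, T^[i] y ∈ Metric.ball (p (S^[i] x)) r ∧
        T^[i] z ∈ Metric.ball (p (S^[i] x)) r) →
      ‖ι (y - z) - σ x (ι (y - z)) • ι (U x)‖ ≤ η₀ * |σ x (ι (y - z))| →
        (9 / 10) ^ k * growth S δ n x * |σ x (ι (y - z))|
          ≤ |σ (S^[n] x) (ι (T^[n] y - T^[n] z))|) ∧
    ∀ y ∈ shadow S p T r x, ∀ z ∈ shadow S p T r x,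
      η₀ * |σ (S^[n] x) (ι (T^[n] y - T^[n] z))| ≤
        (4 / 5) ^ k * growth S δ n x * ‖ι (y - z) - σ x (ι (y - z)) • ι (U x)‖ := by
  obtain ⟨K, hK, -, hσB, -, -, -⟩ := h.exists_bounds
  obtain ⟨M, M₁, η₀, r, hη₀, hr, hcone⟩ := h.cone_iterate
  have heq : ∀ x, ∀ y ∈ shadow S p T r x, ∀ z ∈ shadow S p T r x,
      ‖ι (y - z) - σ x (ι (y - z)) • ι (U x)‖ ≤ η₀ * |σ x (ι (y - z))| → y = z := by
    intro x y hy z hz hc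
    have hlim : Tendsto (fun k : ℕ => (1 / 2 : ℝ) ^ k * (K * (2 * r))) atTop (𝓝 0) := by
      simpa using (tendsto_pow_atTop_nhds_zero_of_lt_one (r := (1 / 2 : ℝ)) (by norm_num)
        (by norm_num)).mul_const (K * (2 * r))
    have h1 : |σ x (ι (y - z))| ≤ 0 := by
      refine ge_of_tendsto' hlim fun k => ?_
      obtain ⟨n, -, hg, hst⟩ := hcone k x
      have h2 := ((hst y z fun i _ => ⟨hy i, hz i⟩).1 hc).2
      have h3 : ‖T^[n] y - T^[n] z‖ ≤ 2 * r := by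
        have h1 := mem_ball_iff_norm.1 (hy n)
        have h2 := mem_ball_iff_norm.1 (hz n)
        calc _ = ‖(T^[n] y - p (S^[n] x)) - (T^[n] z - p (S^[n] x))‖ := by
              rw [sub_sub_sub_cancel_right]
          _ ≤ _ := (norm_sub_le _ _).trans (by linarith)
      have h4 : (2 : ℝ) ^ k ≤ (9 / 10) ^ k * growth S δ n x := by
        calc (2 : ℝ) ^ k ≤ (9 / 10 * 8) ^ k := pow_le_pow_left₀ (by norm_num) (by norm_num) k
          _ = (9 / 10) ^ k * 8 ^ k := mul_pow _ _ _
          _ ≤ _ := by gcongr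
      have h5 : 2 ^ k * |σ x (ι (y - z))| ≤ K * (2 * r) :=
        calc _ ≤ (9 / 10) ^ k * growth S δ n x * |σ x (ι (y - z))| := by gcongr
          _ ≤ _ := h2
          _ ≤ K * ‖T^[n] y - T^[n] z‖ := hσB _ _
          _ ≤ _ := by gcongr
      rw [one_div, inv_pow, inv_mul_eq_div, le_div_iff₀ (by positivity)]
      linarith
    have h2 : σ x (ι (y - z)) = 0 := by simpa using h1
    rw [h2] at hc
    have h3 : ι (y - z) = 0 := by simpa using hc
    exact sub_eq_zero.1 (h.inj (by rw [h3, map_zero]))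
  refine ⟨M, M₁, η₀, r, hη₀, hr, heq, fun k x => ?_⟩
  obtain ⟨n, hn, hg, hst⟩ := hcone k x
  refine ⟨n, hn, hg, fun y z hyz hc => ((hst y z hyz).1 hc).2, fun y hy z hz => ?_⟩
  rcases le_or_gt ‖ι (T^[n] y - T^[n] z) - σ (S^[n] x) (ι (T^[n] y - T^[n] z)) • ι (U (S^[n] x))‖
    (η₀ * |σ (S^[n] x) (ι (T^[n] y - T^[n] z))|) with h1 | h1
  · rw [heq _ _ (shadow_iterate hy n) _ (shadow_iterate hz n) h1, sub_self, map_zero, map_zero,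
      abs_zero, mul_zero]
    have := growth_pos h.pos n x (S := S)
    positivity
  · exact h1.le.trans ((hst y z fun i _ => ⟨hy i, hz i⟩).2 h1)

end LocalModel

/-! ### Existence of points on the stable leaves -/

/-- The points of the ball of radius `b` around `p x` whose unstable coordinates, at the times `N j`
with `j < k`, are less than `a`. -/
def tube {X B C : Type*} [NormedAddCommGroup B] [NormedSpace ℝ B] [NormedAddCommGroup C]
    [NormedSpace ℝ C] (S : X → X) (p : X → B) (ι : B →L[ℝ] C) (T : B → B) (σ : X → C →L[ℝ] ℝ)
    (N : ℕ) (b a : ℝ) (k : ℕ) (x : X) : Set B :=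
  {y | y ∈ Metric.ball (p x) b ∧
    ∀ j < k, |σ (S^[N * j] x) (ι (T^[N * j] y - p (S^[N * j] x)))| < a}

namespace LocalModel

variable {X B C : Type*} [TopologicalSpace X] [CompactSpace X]
    [NormedAddCommGroup B] [NormedSpace ℝ B] [NormedAddCommGroup C] [NormedSpace ℝ C]
    {S : X → X} {p : X → B} {ι : B →L[ℝ] C} {T : B → B} {O : Set B} {U : X → B} {δ : X → ℝ}
    {σ : X → C →L[ℝ] ℝ} {LB : X → B →L[ℝ] B} {LC : X → C →L[ℝ] C} {G : ℝ → X → Set B}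
    {C₀ lam : ℝ}

variable (h : LocalModel S p ι T O U δ σ LB LC G C₀ lam)
include h

/-- The operator need not be continuous on `B`, but the unstable coordinates of its iterates are, and
they control the distances; this makes the tubes open. A point which leaves a tube in the positive
direction cannot also leave it in the negative direction. -/
theorem exists_tube : ∃ N : ℕ, 0 < N ∧ ∃ η c b₀ : ℝ, 0 < η ∧ 1 ≤ c ∧ 0 < b₀ ∧
    (∀ x, η * ‖U x‖ ≤ 1 / 6) ∧ ∀ b, 0 < b → b ≤ b₀ →
    (∀ k x, IsOpen (tube S p ι T σ N (2 * b) (2 * (η * b)) k x)) ∧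
    (∀ k x, tube S p ι T σ N (2 * b) (2 * (η * b)) k x ⊆ iterDomain T O (N * k)) ∧
    (∀ k x, ∀ y ∈ tube S p ι T σ N (2 * b) (2 * (η * b)) k x, ∀ i ≤ N * k,
      T^[i] y ∈ Metric.ball (p (S^[i] x)) (2 * b * c)) ∧
    ∀ x y k l, ‖y - p x‖ ≤ b → y ∈ tube S p ι T σ N (2 * b) (2 * (η * b)) k x →
      y ∈ tube S p ι T σ N (2 * b) (2 * (η * b)) l x →
      η * b < σ (S^[N * k] x) (ι (T^[N * k] y - p (S^[N * k] x))) →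
      ¬ σ (S^[N * l] x) (ι (T^[N * l] y - p (S^[N * l] x))) < -(η * b) := by
  obtain ⟨N, hN, η, r, c, hη, hr, hc, hU, hcone, hlip⟩ := h.exists_cone
  obtain ⟨r', hr', hdom⟩ := h.domain 1 one_pos
  have hdomO : ∀ x, Metric.ball (p x) r' ⊆ O := fun x y hy => (interior_subset (hdom x hy)).1
  have hG := h.mem_G r hr
  refine ⟨N, hN, η, c, min (r / 2) (r' / (2 * c)), hη, hc, by positivity, hU, fun b hb hb₀ => ?_⟩
  have hbr : 2 * b ≤ r := by have := hb₀.trans (min_le_left _ _); linarith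
  have hbr' : 2 * b * c ≤ r' := by
    have := hb₀.trans (min_le_right _ _)
    rw [le_div_iff₀ (by positivity)] at this
    linarith
  have hstep : ∀ x y j, ‖T^[N * j] y - p (S^[N * j] x)‖ < 2 * b →
      (η * ‖T^[N * j] y - p (S^[N * j] x)‖ ≤ |σ (S^[N * j] x) (ι (T^[N * j] y - p (S^[N * j] x)))| →
        0 ≤ σ (S^[N * j] x) (ι (T^[N * j] y - p (S^[N * j] x))) *
          σ (S^[N * (j + 1)] x) (ι (T^[N * (j + 1)] y - p (S^[N * (j + 1)] x))) ∧
        2 * |σ (S^[N * j] x) (ι (T^[N * j] y - p (S^[N * j] x)))| ≤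
          |σ (S^[N * (j + 1)] x) (ι (T^[N * (j + 1)] y - p (S^[N * (j + 1)] x)))| ∧
        η * ‖T^[N * (j + 1)] y - p (S^[N * (j + 1)] x)‖ ≤
          |σ (S^[N * (j + 1)] x) (ι (T^[N * (j + 1)] y - p (S^[N * (j + 1)] x)))|) ∧
      (|σ (S^[N * j] x) (ι (T^[N * j] y - p (S^[N * j] x)))| ≤
          η * ‖T^[N * j] y - p (S^[N * j] x)‖ →
        ‖T^[N * (j + 1)] y - p (S^[N * (j + 1)] x)‖ ≤
          1 / 2 * ‖T^[N * j] y - p (S^[N * j] x)‖) := by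
    intro x y j hj
    have := hcone (S^[N * j] x) _ (hG _) (T^[N * j] y) (mem_ball_iff_norm.2 (hj.trans_le hbr))
    have e : N * (j + 1) = N + N * j := by ring
    rwa [h.iterate_p, ← Function.iterate_add_apply, ← Function.iterate_add_apply, ← e] at this
  -- at the times `N j` the distance is controlled by the unstable coordinate
  have hdist : ∀ k x, ∀ y ∈ tube S p ι T σ N (2 * b) (2 * (η * b)) k x, ∀ j, j < k ∨ j = 0 →
      ‖T^[N * j] y - p (S^[N * j] x)‖ < 2 * b := by
    intro k x y hy j
    induction j with
    | zero => intro _; simpa using mem_ball_iff_norm.1 hy.1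
    | succ j ih =>
      intro hj
      have hjk : j + 1 < k := by omega
      have h1 := ih (by omega)
      obtain ⟨h2, h3⟩ := hstep x y j h1
      rcases le_total (η * ‖T^[N * j] y - p (S^[N * j] x)‖)
        (|σ (S^[N * j] x) (ι (T^[N * j] y - p (S^[N * j] x)))|) with h4 | h4
      · have h5 := (h2 h4).2.2.trans_lt (hy.2 (j + 1) hjk)
        exact lt_of_mul_lt_mul_left (by linarith : η * _ < η * (2 * b)) hη.le
      · linarith [h3 h4]
  have hnear : ∀ k x, ∀ y ∈ tube S p ι T σ N (2 * b) (2 * (η * b)) k x, ∀ i ≤ N * k,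
      T^[i] y ∈ Metric.ball (p (S^[i] x)) (2 * b * c) := by
    intro k x y hy i hi
    obtain ⟨j, i', hj, hi', rfl⟩ : ∃ j i', (j < k ∨ j = 0) ∧ i' ≤ N ∧ i = i' + N * j := by
      rcases Nat.lt_or_ge i (N * k) with h1 | h1
      · exact ⟨i / N, i % N, Or.inl (Nat.div_lt_of_lt_mul h1), (Nat.mod_lt _ hN).le,
          (Nat.mod_add_div i N).symm⟩
      · obtain rfl : i = N * k := le_antisymm hi h1
        rcases k with _ | k
        · exact ⟨0, 0, Or.inr rfl, by omega, by simp⟩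
        · exact ⟨k, N, Or.inl (by omega), le_rfl, by ring⟩
    have h1 := hdist k x y hy j hj
    have h2 := hlip i' hi' _ _ (hG (S^[N * j] x)) (T^[N * j] y)
      (mem_ball_iff_norm.2 (h1.trans_le hbr))
    rw [h.iterate_p, ← Function.iterate_add_apply, ← Function.iterate_add_apply] at h2
    rw [mem_ball_iff_norm]
    nlinarith
  have hsub : ∀ k x, IsOpen (tube S p ι T σ N (2 * b) (2 * (η * b)) k x) →
      tube S p ι T σ N (2 * b) (2 * (η * b)) k x ⊆ iterDomain T O (N * k) := by
    intro k x ho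
    refine interior_maximal (fun y hy => ?_) ho
    have h1 : ∀ i ≤ N * k, T^[i] y ∈ O := fun i hi =>
      hdomO _ (Metric.ball_subset_ball hbr' (hnear k x y hy i hi))
    exact ⟨h1 0 (by omega), fun i hi => h1 i hi.le⟩
  have hopen : ∀ k x, IsOpen (tube S p ι T σ N (2 * b) (2 * (η * b)) k x) := by
    intro k x
    induction k with
    | zero =>
      convert Metric.isOpen_ball (x := p x) (ε := 2 * b) using 1
      ext y; simp [tube]
    | succ k ih =>
      have hcont : ContinuousOn (fun y => |σ (S^[N * k] x) (ι (T^[N * k] y - p (S^[N * k] x)))|)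
          (tube S p ι T σ N (2 * b) (2 * (η * b)) k x) := by
        have h1 : ContinuousOn (ι ∘ T^[N * k]) (tube S p ι T σ N (2 * b) (2 * (η * b)) k x) := by
          rcases Nat.eq_zero_or_pos k with rfl | hk
          · exact ι.continuous.continuousOn
          · exact (h.contDiff (N * k) (by positivity)).continuousOn.mono (hsub k x ih)
        simp only [map_sub]
        exact (((σ _).continuous.comp_continuousOn h1).sub continuousOn_const).abs
      have h2 := hcont.isOpen_inter_preimage ih (isOpen_Iio (a := 2 * (η * b)))
      convert h2 using 1
      ext y
      simp only [tube, mem_ofPred_eq, mem_inter_iff, mem_preimage, mem_Iio, and_assoc]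
      refine and_congr_right fun _ => ⟨fun h3 => ⟨fun j hj => h3 j (by omega), h3 k (by omega)⟩,
        fun h3 j hj => ?_⟩
      rcases Nat.lt_succ_iff_lt_or_eq.1 hj with h4 | rfl
      exacts [h3.1 j h4, h3.2]
  refine ⟨hopen, fun k x => hsub k x (hopen k x), hnear, fun x y k l hyb hk hl hpos hneg => ?_⟩
  set s : ℕ → ℝ := fun j => σ (S^[N * j] x) (ι (T^[N * j] y - p (S^[N * j] x))) with hs
  set w : ℕ → ℝ := fun j => ‖T^[N * j] y - p (S^[N * j] x)‖ with hw
  have hηb : 0 < η * b := by positivity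
  -- the first time at which the coordinate is not small
  have hex : ∃ j, η * b < |s j| := ⟨k, hpos.trans_le (le_abs_self _)⟩
  classical
  set q := Nat.find hex with hq
  have hq1 : η * b < |s q| := Nat.find_spec hex
  have hq2 : ∀ j < q, |s j| ≤ η * b := fun j hj => not_lt.1 (Nat.find_min hex hj)
  have hqk : q ≤ k := Nat.find_min' hex (hpos.trans_le (le_abs_self _))
  have hql : q ≤ l := Nat.find_min' hex (by
    have : -s l ≤ |s l| := neg_le_abs _
    have : s l < -(η * b) := hneg
    linarith)
  have hqc : η * w q ≤ |s q| := by
    rcases Nat.eq_zero_or_pos q with h0 | h0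
    · have : w q ≤ b := by rw [h0]; simpa [hw] using hyb
      nlinarith
    · obtain ⟨j, hj⟩ : ∃ j, q = j + 1 := ⟨q - 1, by omega⟩
      have hwj : w j < 2 * b := hdist k x y hk j (Or.inl (by omega))
      obtain ⟨h2, h3⟩ := hstep x y j hwj
      rw [hj]
      rcases le_total (η * w j) (|s j|) with h4 | h4
      · exact (h2 h4).2.2
      · have h5 : w (j + 1) ≤ 1 / 2 * w j := h3 h4
        have h6 : η * w (j + 1) ≤ η * b := by gcongr; linarith
        rw [hj] at hq1
        linarith
  -- the tube is left at this time or at the next, and the sign does not change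
  have hsign : ∀ m, q ≤ m → y ∈ tube S p ι T σ N (2 * b) (2 * (η * b)) m x →
      η * b < |s m| → 0 < s q * s m := by
    intro m hqm hm hsm
    rcases eq_or_lt_of_le hqm with h1 | h1
    · rw [← h1]
      have : s q ≠ 0 := fun h2 => by rw [h2, abs_zero] at hq1; linarith
      exact mul_self_pos.2 this
    · obtain ⟨h2, h3, -⟩ := (hstep x y q (hdist m x y hm q (Or.inl h1))).1 hqc
      have h4 : m = q + 1 := by
        by_contra h5
        have h6 : |s (q + 1)| < 2 * (η * b) := hm.2 (q + 1) (by omega)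
        have h7 : 2 * |s q| ≤ |s (q + 1)| := h3
        linarith
      have h5 : 0 ≤ s q * s m := by rw [h4]; exact h2
      refine lt_of_le_of_ne h5 (Ne.symm (mul_ne_zero ?_ ?_)) <;> intro h6
      · rw [h6, abs_zero] at hq1; linarith
      · rw [h6, abs_zero] at hsm; linarith
  have h1 := hsign k hqk hk (hpos.trans_le (le_abs_self _))
  have hneg' : s l < -(η * b) := hneg
  have hpos' : η * b < s k := hpos
  have h2 := hsign l hql hl (by have : -s l ≤ |s l| := neg_le_abs _; linarith)
  rcases le_total 0 (s q) with h3 | h3 <;> nlinarith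

/-- In a small neighbourhood of a shadowing point the iterates, up to a given time, are defined and
stay close to the orbit of the basic set. -/
theorem shadow_eventually : ∃ c r₀ : ℝ, 1 ≤ c ∧ 0 < r₀ ∧ ∀ r ≤ r₀, ∀ x, ∀ y ∈ shadow S p T r x,
    ∀ n, ∀ᶠ y' in 𝓝 y, y' ∈ iterDomain T O n ∧
      ∀ i ≤ n, T^[i] y' ∈ Metric.ball (p (S^[i] x)) (c * r) := by
  obtain ⟨K, hK, -, hσB, -, -, -⟩ := h.exists_bounds
  obtain ⟨N, hN, η, c, b₀, hη, hc, hb₀, -, htube⟩ := h.exists_tube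
  -- `b = a r` is such that the points of the shadow satisfy the conditions of the tube
  set a : ℝ := 1 + K / η with ha
  have ha1 : 1 ≤ a := by rw [ha]; have : 0 < K / η := by positivity
                         linarith
  refine ⟨2 * a * c, b₀ / a, by nlinarith, by positivity, fun r hr x y hy n => ?_⟩
  have hr0 : 0 < r := (norm_nonneg _).trans_lt (mem_ball_iff_norm.1 (hy 0))
  have hb : a * r ≤ b₀ := by rw [le_div_iff₀ (by positivity)] at hr; linarith
  obtain ⟨hopen, hsub, hnear, -⟩ := htube (a * r) (by positivity) hb
  have hmem : y ∈ tube S p ι T σ N (2 * (a * r)) (2 * (η * (a * r))) n x := by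
    refine ⟨Metric.ball_subset_ball (by nlinarith) (hy 0), fun j _ => ?_⟩
    have h1 := mem_ball_iff_norm.1 (hy (N * j))
    have h2 : η * a = η + K := by rw [ha]; field_simp
    calc _ ≤ K * ‖T^[N * j] y - p (S^[N * j] x)‖ := hσB _ _
      _ ≤ K * r := by gcongr
      _ < 2 * (η * a * r) := by rw [h2]; nlinarith
      _ = _ := by ring
  have hnN : n ≤ N * n := Nat.le_mul_of_pos_left n hN
  filter_upwards [(hopen n x).mem_nhds hmem] with y' hy'
  refine ⟨?_, fun i hi => ?_⟩
  · have h1 := hsub n x hy'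
    exact interior_mono (t := {f | f ∈ O ∧ ∀ i < n, T^[i] f ∈ O})
      (fun z hz => ⟨hz.1, fun i hi => hz.2 i (by omega)⟩) h1
  · have := hnear n x y' hy' i (by omega)
    rwa [show 2 * (a * r) * c = 2 * a * c * r by ring] at this

/-- On each segment in a direction close to the unstable one there is a point which shadows the orbit
of `x`: the points from which the orbit leaves a tube upwards, and those from which it leaves
downwards, form disjoint open sets, which do not cover the segment. -/
theorem exists_shadow : ∃ c r₀ : ℝ, 1 ≤ c ∧ 0 < r₀ ∧ ∀ r, 0 < r → r ≤ r₀ → ∀ x x₀ q,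
    ‖q - p x‖ ≤ r → 1 / 2 ≤ σ x (ι (U x₀)) →
    ∃ t : ℝ, |t| ≤ c * r ∧ q + t • U x₀ ∈ shadow S p T (c * r) x := by
  obtain ⟨K, hK, -, hσB, -, -, -⟩ := h.exists_bounds
  obtain ⟨N, hN, η, c, b₀, hη, hc, hb₀, hU, htube⟩ := h.exists_tube
  set a : ℝ := 2 + 4 * K / η with ha
  have ha2 : 2 ≤ a := by rw [ha]; have : 0 < 4 * K / η := by positivity
                         linarith
  have hηa : η * a = 2 * η + 4 * K := by rw [ha]; field_simp
  refine ⟨max (2 * a * c) (3 * η * a), b₀ / a, le_max_of_le_left (by nlinarith), by positivity,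
    fun r hr hr₀ x x₀ q hq hd => ?_⟩
  have hb : a * r ≤ b₀ := by rw [le_div_iff₀ (by positivity)] at hr₀; linarith
  obtain ⟨hopen, hsub, hnear, hexit⟩ := htube (a * r) (by positivity) hb
  set b := a * r with hbdef
  have hb0 : 0 < b := by positivity
  set Tm : ℝ := 3 * (η * b) with hTm
  have hTm0 : 0 < Tm := by positivity
  set γ : ℝ → B := fun t => q + t • U x₀ with hγ
  have hγc : Continuous γ := by fun_prop
  have hγb : ∀ t ∈ Icc (-Tm) Tm, ‖γ t - p x‖ ≤ b := by
    intro t ht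
    have h1 : |t| ≤ Tm := abs_le.2 ht
    have h2 : ‖t • U x₀‖ ≤ b / 2 := by
      rw [norm_smul, Real.norm_eq_abs]
      calc _ ≤ Tm * ‖U x₀‖ := by gcongr
        _ = 3 * b * (η * ‖U x₀‖) := by rw [hTm]; ring
        _ ≤ 3 * b * (1 / 6) := by gcongr; exact hU x₀
        _ = _ := by ring
    calc _ = ‖(q - p x) + t • U x₀‖ := by simp only [hγ]; congr 1; abel
      _ ≤ r + b / 2 := (norm_add_le _ _).trans (add_le_add hq h2)
      _ ≤ b := by nlinarith
  set s : ℕ → B → ℝ := fun j y => σ (S^[N * j] x) (ι (T^[N * j] y - p (S^[N * j] x))) with hs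
  set Ω : ℕ → Set B := fun k => tube S p ι T σ N (2 * b) (2 * (η * b)) k x with hΩ
  have hcont : ∀ k, ContinuousOn (s k) (Ω k) := by
    intro k
    have h1 : ContinuousOn (ι ∘ T^[N * k]) (Ω k) := by
      rcases Nat.eq_zero_or_pos k with rfl | hk
      · exact ι.continuous.continuousOn
      · exact (h.contDiff (N * k) (by positivity)).continuousOn.mono (hsub k x)
    simp only [hs, map_sub]
    exact ((σ _).continuous.comp_continuousOn h1).sub continuousOn_const
  -- the parameters of the points whose orbits leave the tube upwards, respectively downwards
  set P : Set ℝ := γ ⁻¹' ⋃ k, (Ω k ∩ s k ⁻¹' Ioi (η * b)) with hP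
  set M : Set ℝ := γ ⁻¹' ⋃ k, (Ω k ∩ s k ⁻¹' Iio (-(η * b))) with hM
  have hPo : IsOpen P := (isOpen_iUnion fun k =>
    (hcont k).isOpen_inter_preimage (hopen k x) isOpen_Ioi).preimage hγc
  have hMo : IsOpen M := (isOpen_iUnion fun k =>
    (hcont k).isOpen_inter_preimage (hopen k x) isOpen_Iio).preimage hγc
  have hs0 : ∀ t, s 0 (γ t) = σ x (ι (q - p x)) + t * σ x (ι (U x₀)) := fun t => by
    simp only [hs, hγ, mul_zero, Function.iterate_zero, id_eq]
    rw [show q + t • U x₀ - p x = (q - p x) + t • U x₀ by abel, map_add, map_add, map_smul,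
      map_smul, smul_eq_mul]
  have hqs : |σ x (ι (q - p x))| ≤ η * b / 4 := by
    calc _ ≤ K * r := (hσB _ _).trans (by gcongr)
      _ ≤ η * a * r / 4 := by rw [hηa]; nlinarith
      _ = _ := by rw [hbdef]; ring
  have hηb : 0 < η * b := by positivity
  have hΩ0 : ∀ t ∈ Icc (-Tm) Tm, γ t ∈ Ω 0 := fun t ht =>
    ⟨mem_ball_iff_norm.2 ((hγb t ht).trans_lt (by linarith)), fun j hj => absurd hj (Nat.not_lt_zero j)⟩
  have hPne : (Icc (-Tm) Tm ∩ P).Nonempty := by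
    have hmem : Tm ∈ Icc (-Tm) Tm := ⟨by linarith, le_rfl⟩
    refine ⟨Tm, hmem, mem_iUnion.2 ⟨0, hΩ0 _ hmem, ?_⟩⟩
    rw [mem_preimage, hs0, mem_Ioi]
    have := (abs_le.1 hqs).1
    nlinarith
  have hMne : (Icc (-Tm) Tm ∩ M).Nonempty := by
    have hmem : -Tm ∈ Icc (-Tm) Tm := ⟨le_rfl, by linarith⟩
    refine ⟨-Tm, hmem, mem_iUnion.2 ⟨0, hΩ0 _ hmem, ?_⟩⟩
    rw [mem_preimage, hs0, mem_Iio]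
    have := (abs_le.1 hqs).2
    nlinarith
  obtain ⟨t, ht, htn⟩ : ∃ t ∈ Icc (-Tm) Tm, t ∉ P ∪ M := by
    by_contra! hcov
    obtain ⟨t, ht, htP, htM⟩ := isPreconnected_Icc P M hPo hMo hcov hPne hMne
    obtain ⟨k, hk, hk'⟩ := mem_iUnion.1 htP
    obtain ⟨l, hl, hl'⟩ := mem_iUnion.1 htM
    exact hexit x (γ t) k l (hγb t ht) hk hl hk' hl'
  -- an orbit which leaves in neither direction stays in the tube forever
  have hall : ∀ k, γ t ∈ Ω k := by
    intro k
    induction k with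
    | zero => exact hΩ0 t ht
    | succ k ih =>
      refine ⟨ih.1, fun j hj => ?_⟩
      rcases Nat.lt_succ_iff_lt_or_eq.1 hj with h1 | rfl
      · exact ih.2 j h1
      · have h1 : ¬ η * b < s j (γ t) := fun h2 => htn (Or.inl (mem_iUnion.2 ⟨j, ih, h2⟩))
        have h2 : ¬ s j (γ t) < -(η * b) := fun h2 => htn (Or.inr (mem_iUnion.2 ⟨j, ih, h2⟩))
        have h3 : |s j (γ t)| ≤ η * b := abs_le.2 ⟨not_lt.1 h2, not_lt.1 h1⟩
        exact h3.trans_lt (by linarith)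
  refine ⟨t, (abs_le.2 ht).trans ?_, fun n => ?_⟩
  · calc Tm = 3 * η * a * r := by rw [hTm, hbdef]; ring
      _ ≤ _ := by gcongr; exact le_max_right _ _
  · refine Metric.ball_subset_ball ?_ (hnear n x _ (hall n) n (Nat.le_mul_of_pos_left n hN))
    calc 2 * b * c = 2 * a * c * r := by rw [hbdef]; ring
      _ ≤ _ := by gcongr; exact le_max_left _ _

end LocalModel

/-! ### Functions which are uniformly approximated by linear functionals -/

section UniformDerivative

variable {E : Type*} [NormedAddCommGroup E] [NormedSpace ℝ E]

lemma opNorm_sub_le_of_approx {f : E → ℝ} {v : E} {a b : ℝ} {ℓ ℓ' : E →L[ℝ] ℝ} (ha : 0 ≤ a)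
    (hb : 0 ≤ b) (h1 : ∀ᶠ v' in 𝓝 v, |f v' - f v - ℓ (v' - v)| ≤ a * ‖v' - v‖)
    (h2 : ∀ᶠ v' in 𝓝 v, |f v' - f v - ℓ' (v' - v)| ≤ b * ‖v' - v‖) : ‖ℓ - ℓ'‖ ≤ a + b := by
  refine ContinuousLinearMap.opNorm_le_of_nhds_zero (by positivity) ?_
  have hadd : Tendsto (fun w : E => v + w) (𝓝 0) (𝓝 v) := by
    have : Continuous fun w : E => v + w := by fun_prop
    simpa using this.tendsto 0
  filter_upwards [hadd.eventually h1, hadd.eventually h2] with w hw1 hw2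
  rw [add_sub_cancel_left] at hw1 hw2
  have e : (ℓ - ℓ') w = (f (v + w) - f v - ℓ' w) - (f (v + w) - f v - ℓ w) := by
    rw [_root_.sub_apply]; ring
  rw [e, Real.norm_eq_abs]
  refine (abs_sub _ _).trans ?_
  linarith

/-- A function which is approximated to first order, up to arbitrarily small errors, by bounded linear
functionals is differentiable: the functionals form a Cauchy sequence. -/
lemma differentiableAt_of_approx {f : E → ℝ} {v : E}
    (h : ∀ ε : ℝ, 0 < ε → ∃ ℓ : E →L[ℝ] ℝ,
      ∀ᶠ v' in 𝓝 v, |f v' - f v - ℓ (v' - v)| ≤ ε * ‖v' - v‖) : DifferentiableAt ℝ f v := by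
  have hpos : ∀ n : ℕ, (0 : ℝ) < 1 / ((n : ℝ) + 1) := fun n => by positivity
  choose ℓ hℓ using fun n : ℕ => h (1 / ((n : ℝ) + 1)) (hpos n)
  have hc : CauchySeq ℓ := by
    refine cauchySeq_of_le_tendsto_0 (fun n : ℕ => 2 * (1 / ((n : ℝ) + 1))) (fun n m N hn hm => ?_) ?_
    · rw [dist_eq_norm]
      refine (opNorm_sub_le_of_approx (hpos n).le (hpos m).le (hℓ n) (hℓ m)).trans ?_
      have h1 : 1 / ((n : ℝ) + 1) ≤ 1 / ((N : ℝ) + 1) := by gcongr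
      have h2 : 1 / ((m : ℝ) + 1) ≤ 1 / ((N : ℝ) + 1) := by gcongr
      linarith
    · simpa using (tendsto_one_div_add_atTop_nhds_zero_nat (𝕜 := ℝ)).const_mul 2
  obtain ⟨L, hL⟩ := cauchySeq_tendsto_of_complete hc
  have : HasFDerivAt f L v := by
    refine HasFDerivAt.of_isLittleO (Asymptotics.isLittleO_iff.2 fun ε hε => ?_)
    have h1 : ∀ᶠ n in atTop, ‖ℓ n - L‖ < ε / 2 := by
      have := (tendsto_iff_norm_sub_tendsto_zero.1 hL).eventually (gt_mem_nhds (half_pos hε))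
      exact this
    have h2 : ∀ᶠ n : ℕ in atTop, 1 / ((n : ℝ) + 1) < ε / 2 :=
      (tendsto_one_div_add_atTop_nhds_zero_nat (𝕜 := ℝ)).eventually (gt_mem_nhds (half_pos hε))
    obtain ⟨n, h3, h4⟩ := (h1.and h2).exists
    filter_upwards [hℓ n] with v' hv'
    have e : f v' - f v - L (v' - v) = (f v' - f v - ℓ n (v' - v)) + (ℓ n - L) (v' - v) := by
      rw [_root_.sub_apply]; ring
    rw [e]
    refine (norm_add_le _ _).trans ?_
    have h5 : ‖(ℓ n - L) (v' - v)‖ ≤ ε / 2 * ‖v' - v‖ := (ℓ n - L).le_of_opNorm_le h3.le _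
    have h6 : 1 / ((n : ℝ) + 1) * ‖v' - v‖ ≤ ε / 2 * ‖v' - v‖ := by gcongr
    rw [Real.norm_eq_abs] at h5
    rw [Real.norm_eq_abs, Real.norm_eq_abs]
    linarith
  exact this.differentiableAt

/-- Suppose that the functions `F a` are approximated to first order by linear functionals, uniformly in
the ball of radius `R₁` and in `a`. Then they are continuously differentiable, and their uniform
convergence implies the uniform convergence of their derivatives on smaller balls. -/
theorem uniform_fderiv {I : Type*} {F : I → E → ℝ} {J : Set I} {R R₁ : ℝ} (hR : R < R₁)
    (hF : ∀ ε : ℝ, 0 < ε → ∃ s : ℝ, 0 < s ∧ ∀ a ∈ J, ∀ v ∈ Metric.ball (0 : E) R₁,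
      ∃ ℓ : E →L[ℝ] ℝ, ∀ v' ∈ Metric.ball (0 : E) R₁, ‖v' - v‖ < s →
        |F a v' - F a v - ℓ (v' - v)| ≤ ε * ‖v' - v‖) :
    (∀ a ∈ J, ContDiffOn ℝ 1 (F a) (Metric.ball 0 R)) ∧
    ∀ (l : Filter I) (a), a ∈ J → (∀ᶠ b in l, b ∈ J) →
      TendstoUniformlyOn F (F a) l (Metric.ball 0 R₁) →
      TendstoUniformlyOn (fun b => fderiv ℝ (F b)) (fderiv ℝ (F a)) l (Metric.ball 0 R) := by
  have hnhds : ∀ v ∈ Metric.ball (0 : E) R₁, ∀ s : ℝ, 0 < s →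
      ∀ᶠ v' in 𝓝 v, v' ∈ Metric.ball (0 : E) R₁ ∧ ‖v' - v‖ < s := fun v hv s hs =>
    by filter_upwards [Metric.isOpen_ball.mem_nhds hv, Metric.ball_mem_nhds v hs] with v' h1 h2
      using ⟨h1, mem_ball_iff_norm.1 h2⟩
  have hdiff : ∀ a ∈ J, ∀ v ∈ Metric.ball (0 : E) R₁, DifferentiableAt ℝ (F a) v := by
    intro a ha v hv
    refine differentiableAt_of_approx fun ε hε => ?_
    obtain ⟨s, hs, h1⟩ := hF ε hε
    obtain ⟨ℓ, hℓ⟩ := h1 a ha v hv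
    exact ⟨ℓ, (hnhds v hv s hs).mono fun v' hv' => hℓ v' hv'.1 hv'.2⟩
  have hun : ∀ ε : ℝ, 0 < ε → ∃ s : ℝ, 0 < s ∧ ∀ a ∈ J, ∀ v ∈ Metric.ball (0 : E) R₁,
      ∀ v' ∈ Metric.ball (0 : E) R₁, ‖v' - v‖ < s →
        |F a v' - F a v - fderiv ℝ (F a) v (v' - v)| ≤ ε * ‖v' - v‖ := by
    intro ε hε
    obtain ⟨s, hs, h1⟩ := hF (ε / 3) (by positivity)
    refine ⟨s, hs, fun a ha v hv v' hv' hvv => ?_⟩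
    obtain ⟨ℓ, hℓ⟩ := h1 a ha v hv
    have h2 : ∀ᶠ v' in 𝓝 v, |F a v' - F a v - ℓ (v' - v)| ≤ ε / 3 * ‖v' - v‖ :=
      (hnhds v hv s hs).mono fun v' hv' => hℓ v' hv'.1 hv'.2
    have h3 : ∀ᶠ v' in 𝓝 v, |F a v' - F a v - fderiv ℝ (F a) v (v' - v)| ≤ ε / 3 * ‖v' - v‖ := by
      have := Asymptotics.isLittleO_iff.1 (hdiff a ha v hv).hasFDerivAt.isLittleO
        (show (0 : ℝ) < ε / 3 by positivity)
      exact this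
    have h4 := opNorm_sub_le_of_approx (by positivity) (by positivity) h2 h3
    have h5 := hℓ v' hv' hvv
    have h6 := (ℓ - fderiv ℝ (F a) v).le_of_opNorm_le h4 (v' - v)
    have e : F a v' - F a v - fderiv ℝ (F a) v (v' - v) = (F a v' - F a v - ℓ (v' - v))
        + (ℓ - fderiv ℝ (F a) v) (v' - v) := by
      rw [_root_.sub_apply]; ring
    rw [e]
    refine (abs_add_le _ _).trans ?_
    rw [Real.norm_eq_abs] at h6
    linarith
  have hRs : 0 < R₁ - R := by linarith
  -- test vectors of length `s / 2` stay in the larger ball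
  have hball : ∀ v ∈ Metric.ball (0 : E) R, ∀ s : ℝ, s ≤ R₁ - R → ∀ e : E, ‖e‖ ≤ s →
      v + e ∈ Metric.ball (0 : E) R₁ := by
    intro v hv s hs e he
    rw [mem_ball_zero_iff] at hv ⊢
    exact (norm_add_le _ _).trans_lt (by linarith)
  have hsub : Metric.ball (0 : E) R ⊆ Metric.ball (0 : E) R₁ := Metric.ball_subset_ball hR.le
  have hop : ∀ (A : E →L[ℝ] ℝ) (s c : ℝ), 0 < s → 0 ≤ c → (∀ e : E, ‖e‖ = s → |A e| ≤ c * s) →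
      ‖A‖ ≤ c := by
    intro A s c hs hc hA
    refine A.opNorm_le_bound hc fun e => ?_
    rcases eq_or_ne e 0 with rfl | he
    · simp
    have he' : 0 < ‖e‖ := norm_pos_iff.2 he
    have h1 := hA ((s / ‖e‖) • e) (by
      rw [norm_smul, norm_div, norm_norm, Real.norm_of_nonneg hs.le]; field_simp)
    rw [map_smul, smul_eq_mul, abs_mul, abs_of_nonneg (by positivity)] at h1
    rw [Real.norm_eq_abs]
    rw [div_mul_eq_mul_div, div_le_iff₀ he'] at h1
    exact le_of_mul_le_mul_left (by linarith) hs
  constructor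
  · intro a ha
    rw [show (1 : WithTop ℕ∞) = 0 + 1 by rw [zero_add],
      contDiffOn_succ_iff_fderiv_of_isOpen Metric.isOpen_ball]
    refine ⟨fun v hv => (hdiff a ha v (hsub hv)).differentiableWithinAt, by simp,
      contDiffOn_zero.2 fun v hv => ContinuousAt.continuousWithinAt ?_⟩
    rw [Metric.continuousAt_iff]
    intro ε hε
    obtain ⟨s, hs, h1⟩ := hun (ε / 5) (by positivity)
    set τ := min (s / 4) (R₁ - R) with hτ
    have hτ0 : 0 < τ := by positivity
    have hτs : τ ≤ s / 4 := min_le_left _ _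
    have hvR : 0 < R - ‖v‖ := by have := mem_ball_zero_iff.1 hv; linarith
    refine ⟨min τ (R - ‖v‖), by positivity, fun v' hv' => ?_⟩
    rw [dist_eq_norm] at hv' ⊢
    have hv'1 : ‖v' - v‖ < τ := hv'.trans_le (min_le_left _ _)
    have hv'R : v' ∈ Metric.ball (0 : E) R := by
      rw [mem_ball_zero_iff]
      have h2 := norm_add_le v (v' - v)
      rw [add_sub_cancel] at h2
      have := hv'.trans_le (min_le_right _ _)
      linarith
    refine lt_of_le_of_lt (hop _ τ (4 * (ε / 5)) hτ0 (by positivity) fun e he => ?_) (by linarith)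
    have hz := hball v' hv'R τ (min_le_right _ _) e he.le
    have i1 : ‖v' + e - v‖ ≤ 2 * τ := by
      rw [show v' + e - v = (v' - v) + e by abel]
      exact (norm_add_le _ _).trans (by linarith)
    have h2 := h1 a ha v (hsub hv) _ hz (by linarith)
    have h3 := h1 a ha v' (hsub hv'R) _ hz (by rw [add_sub_cancel_left]; linarith)
    have h4 := h1 a ha v (hsub hv) v' (hsub hv'R) (by linarith)
    rw [add_sub_cancel_left, he] at h3
    have h5 : ε / 5 * ‖v' + e - v‖ ≤ ε / 5 * (2 * τ) := by gcongr
    have h6 : ε / 5 * ‖v' - v‖ ≤ ε / 5 * τ := by gcongr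
    rw [show v' + e - v = (v' - v) + e by abel, map_add] at h2
    rw [show v' - v + e = v' + e - v by abel] at h2
    rw [_root_.sub_apply]
    rw [abs_le] at *
    constructor <;> linarith [h2.1, h2.2, h3.1, h3.2, h4.1, h4.2]
  · intro l a ha hl hconv
    rw [Metric.tendstoUniformlyOn_iff] at hconv ⊢
    intro ε hε
    obtain ⟨s, hs, h1⟩ := hun (ε / 5) (by positivity)
    set τ := min (s / 2) (R₁ - R) with hτ
    have hτ0 : 0 < τ := by positivity
    have hτs : τ ≤ s / 2 := min_le_left _ _
    filter_upwards [hl, hconv (ε / 5 * τ) (by positivity)] with b hb hab v hv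
    rw [dist_eq_norm]
    refine lt_of_le_of_lt (hop _ τ (4 * (ε / 5)) hτ0 (by positivity) fun e he => ?_) (by linarith)
    have hz := hball v hv τ (min_le_right _ _) e he.le
    have h2 := h1 a ha v (hsub hv) _ hz (by rw [add_sub_cancel_left]; linarith)
    have h3 := h1 b hb v (hsub hv) _ hz (by rw [add_sub_cancel_left]; linarith)
    have h4 := hab v (hsub hv)
    have h5 := hab _ hz
    rw [add_sub_cancel_left, he] at h2 h3
    rw [_root_.sub_apply]
    rw [Real.dist_eq] at h4 h5
    replace h4 := abs_lt.1 h4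
    replace h5 := abs_lt.1 h5
    rw [abs_le] at *
    constructor <;> linarith [h2.1, h2.2, h3.1, h3.2, h4.1, h4.2, h5.1, h5.2]

end UniformDerivative

namespace LocalModel

variable {X B C : Type*} [TopologicalSpace X] [CompactSpace X]
    [NormedAddCommGroup B] [NormedSpace ℝ B] [NormedAddCommGroup C] [NormedSpace ℝ C]
    {S : X → X} {p : X → B} {ι : B →L[ℝ] C} {T : B → B} {O : Set B} {U : X → B} {δ : X → ℝ}
    {σ : X → C →L[ℝ] ℝ} {LB : X → B →L[ℝ] B} {LC : X → C →L[ℝ] C} {G : ℝ → X → Set B}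
    {C₀ lam : ℝ}

/-! ### Hölder estimates for the iterates -/

omit [TopologicalSpace X] [CompactSpace X] in
lemma rpow_le_mul {a b ρ : ℝ} (ha : 0 ≤ a) (hab : a ≤ b) (hρ : 1 < ρ) :
    a ^ ρ ≤ b ^ (ρ - 1) * a := by
  rcases ha.eq_or_lt with rfl | ha
  · rw [Real.zero_rpow (by linarith), mul_zero]
  · calc a ^ ρ = a ^ (ρ - 1) * a := by
          rw [← Real.rpow_add_one ha.ne']; congr 1; ring
      _ ≤ _ := by gcongr

variable (h : LocalModel S p ι T O U δ σ LB LC G C₀ lam)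
include h

/-- The iterates are Hölder-differentiable in the norm of `C`. The estimate is stated without the
derivative, which is recovered in the limit `τ → 0`. -/
theorem holder_iterate_aux : ∃ r ρ : ℝ, 0 < r ∧ 1 < ρ ∧ ∀ n, ∃ c : ℝ, 0 < c ∧ ∀ x y y',
    (∀ i ≤ n, T^[i] y ∈ Metric.ball (p (S^[i] x)) r ∧ T^[i] y' ∈ Metric.ball (p (S^[i] x)) r) →
    ‖ι (T^[n] y' - T^[n] y)‖ ≤ c * ‖ι (y' - y)‖ ∧
    ∀ τ : ℝ, 0 < τ → τ ≤ 1 → (∀ i ≤ n, T^[i] (y + τ • (y' - y)) ∈ Metric.ball (p (S^[i] x)) r) →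
      ‖ι (T^[n] y' - T^[n] y) - τ⁻¹ • ι (T^[n] (y + τ • (y' - y)) - T^[n] y)‖
        ≤ c * ‖ι (y' - y)‖ ^ ρ := by
  obtain ⟨K, hK, -, -, -, -, hι⟩ := h.exists_bounds
  obtain ⟨r, c, ρ, hr, hc, hρ, hhol⟩ := h.holder
  refine ⟨r, ρ, hr, hρ, fun n => ?_⟩
  have hdiff : ∀ (x : X) (y z : B), y ∈ Metric.ball (p x) r → z ∈ Metric.ball (p x) r →
      ‖ι (z - y)‖ ≤ K * (2 * r) := fun x y z hy hz => by
    rw [mem_ball_iff_norm] at hy hz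
    refine (hι _).trans ?_
    have : ‖z - y‖ ≤ 2 * r := by
      calc _ = ‖(z - p x) - (y - p x)‖ := by rw [sub_sub_sub_cancel_right]
        _ ≤ _ := (norm_sub_le _ _).trans (by linarith)
    gcongr
  induction n with
  | zero =>
    refine ⟨1, one_pos, fun x y y' _ => ⟨by simp, fun τ hτ _ _ => ?_⟩⟩
    simp only [Function.iterate_zero, id_eq, add_sub_cancel_left, map_smul]
    rw [inv_smul_smul₀ hτ.ne', sub_self, norm_zero]
    positivity
  | succ n ih =>
    obtain ⟨a, ha, hn⟩ := ih
    set b := c + c * (K * (2 * r)) ^ (ρ - 1) with hb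
    have hb0 : 0 < b := by positivity
    refine ⟨b * a + (c * a + c * a ^ ρ + c * a ^ ρ), by positivity, fun x y y' hyy => ?_⟩
    have hbase := fun (u : B) (hu : ∀ i ≤ n + 1, T^[i] u ∈ Metric.ball (p (S^[i] x)) r) =>
      hn x y u fun i hi => ⟨(hyy i (by omega)).1, hu i (by omega)⟩
    obtain ⟨D, hD, hDz⟩ := hhol (S^[n] x) (T^[n] y) (hyy n (by omega)).1
    have hA := (hbase y' fun i hi => (hyy i hi).2).1
    simp only [Function.iterate_succ_apply']
    set W := T^[n] y' - T^[n] y with hW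
    have hQ := hDz (T^[n] y') (hyy n (by omega)).2
    have hWb := hdiff _ _ _ (hyy n (by omega)).1 (hyy n (by omega)).2
    have hN : 0 ≤ ‖ι (y' - y)‖ := norm_nonneg _
    have hNρ : 0 ≤ ‖ι (y' - y)‖ ^ ρ := by positivity
    constructor
    · have h1 : ‖ι (T (T^[n] y') - T (T^[n] y))‖ ≤ b * ‖ι W‖ := by
        have h2 := norm_add_le (ι (T (T^[n] y') - T (T^[n] y)) - D W) (D W)
        rw [sub_add_cancel] at h2
        have h3 := rpow_le_mul (norm_nonneg _) hWb hρ
        have h4 : c * ‖ι W‖ ^ ρ ≤ c * ((K * (2 * r)) ^ (ρ - 1) * ‖ι W‖) := by gcongr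
        have h5 := hD W
        rw [hb]; linarith
      have h2 : 0 < c * a + c * a ^ ρ + c * a ^ ρ := by positivity
      have h3 : b * ‖ι W‖ ≤ b * (a * ‖ι (y' - y)‖) := by gcongr
      nlinarith
    · intro τ hτ hτ1 hcl
      set y'' := y + τ • (y' - y) with hy''
      have h1 := (hbase y' fun i hi => (hyy i hi).2).2 τ hτ hτ1 fun i hi => hcl i (by omega)
      have h2 := (hbase y'' hcl).1
      have h3 := hDz (T^[n] y'') (hcl n (by omega))
      set w := T^[n] y'' - T^[n] y with hw
      have h4 : ‖ι (y'' - y)‖ = τ * ‖ι (y' - y)‖ := by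
        rw [hy'', add_sub_cancel_left, map_smul, norm_smul, Real.norm_of_nonneg hτ.le]
      rw [h4] at h2
      -- the errors made in the last step at the two points, and the image under `D` of the error
      -- made in the first `n` steps
      have e : ι (T (T^[n] y') - T (T^[n] y)) - τ⁻¹ • ι (T (T^[n] y'') - T (T^[n] y))
          = (ι (T (T^[n] y') - T (T^[n] y)) - D W)
            - τ⁻¹ • (ι (T (T^[n] y'') - T (T^[n] y)) - D w) + D (W - τ⁻¹ • w) := by
        rw [map_sub D W, map_smul D, smul_sub]; abel
      have h5 : ‖D (W - τ⁻¹ • w)‖ ≤ c * (a * ‖ι (y' - y)‖ ^ ρ) := by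
        refine (hD _).trans ?_
        rw [map_sub ι W, map_smul ι τ⁻¹]
        gcongr
      have h6 : ‖ι W‖ ^ ρ ≤ a ^ ρ * ‖ι (y' - y)‖ ^ ρ := by
        rw [← Real.mul_rpow ha.le hN]
        gcongr
      have h7 : τ⁻¹ * ‖ι w‖ ^ ρ ≤ a ^ ρ * ‖ι (y' - y)‖ ^ ρ := by
        have h8 : ‖ι w‖ ^ ρ ≤ a ^ ρ * ‖ι (y' - y)‖ ^ ρ * τ := by
          calc _ ≤ (τ * (a * ‖ι (y' - y)‖)) ^ ρ := by
                gcongr; linarith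
            _ = τ ^ ρ * (a ^ ρ * ‖ι (y' - y)‖ ^ ρ) := by
                rw [Real.mul_rpow hτ.le (by positivity), Real.mul_rpow ha.le hN]
            _ ≤ τ * (a ^ ρ * ‖ι (y' - y)‖ ^ ρ) := by
                gcongr
                calc τ ^ ρ ≤ τ ^ (1 : ℝ) :=
                      Real.rpow_le_rpow_of_exponent_ge hτ hτ1 hρ.le
                  _ = τ := Real.rpow_one τ
            _ = _ := by ring
        rw [inv_mul_le_iff₀ hτ]; linarith
      rw [e]
      have h9 : ‖τ⁻¹ • (ι (T (T^[n] y'') - T (T^[n] y)) - D w)‖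
          ≤ c * (a ^ ρ * ‖ι (y' - y)‖ ^ ρ) := by
        rw [norm_smul, Real.norm_of_nonneg (by positivity)]
        calc _ ≤ τ⁻¹ * (c * ‖ι w‖ ^ ρ) := by gcongr
          _ = c * (τ⁻¹ * ‖ι w‖ ^ ρ) := by ring
          _ ≤ _ := by gcongr
      have h10 : c * ‖ι W‖ ^ ρ ≤ c * (a ^ ρ * ‖ι (y' - y)‖ ^ ρ) := by gcongr
      have h11 : 0 ≤ b * a * ‖ι (y' - y)‖ ^ ρ := by positivity
      refine (norm_add_le _ _).trans ((add_le_add (norm_sub_le _ _) le_rfl).trans ?_)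
      linarith

/-- At shadowing points, the iterates are Hölder-differentiable in the norm of `C`. -/
theorem holder_iterate : ∃ r ρ : ℝ, 0 < r ∧ 1 < ρ ∧ ∀ n, ∃ c : ℝ, 0 < c ∧ ∀ x,
    ∀ y ∈ shadow S p T r x, DifferentiableAt ℝ (ι ∘ T^[n]) y ∧ ∀ y' ∈ shadow S p T r x,
    ‖ι (T^[n] y' - T^[n] y) - fderiv ℝ (ι ∘ T^[n]) y (y' - y)‖ ≤ c * ‖ι (y' - y)‖ ^ ρ := by
  obtain ⟨r₁, ρ, hr₁, hρ, haux⟩ := h.holder_iterate_aux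
  obtain ⟨c₂, r₂, hc₂, hr₂, hev⟩ := h.shadow_eventually
  refine ⟨min (r₁ / c₂) r₂, ρ, by positivity, hρ, fun n => ?_⟩
  have hle : c₂ * min (r₁ / c₂) r₂ ≤ r₁ := by
    calc _ ≤ c₂ * (r₁ / c₂) := by gcongr; exact min_le_left _ _
      _ = _ := by field_simp
  have hle' : min (r₁ / c₂) r₂ ≤ r₁ :=
    (min_le_left _ _).trans (div_le_self hr₁.le hc₂)
  obtain ⟨c, hc, hn⟩ := haux n
  refine ⟨c, hc, fun x y hy => ?_⟩
  have hev' := hev _ (min_le_right _ _) x y hy n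
  have hdiff : DifferentiableAt ℝ (ι ∘ T^[n]) y := by
    rcases Nat.eq_zero_or_pos n with rfl | hn0
    · exact ι.differentiableAt
    · exact ((h.contDiff n hn0).differentiableOn one_ne_zero).differentiableAt
        (isOpen_interior.mem_nhds hev'.self_of_nhds.1)
  refine ⟨hdiff, fun y' hy' => ?_⟩
  have hlim := (hdiff.hasFDerivAt.hasLineDerivAt (y' - y)).tendsto_slope_zero_right
  have hlim2 := (hlim.const_sub (ι (T^[n] y' - T^[n] y))).norm
  refine le_of_tendsto hlim2 ?_
  have hpath : Tendsto (fun τ : ℝ => y + τ • (y' - y)) (𝓝[>] 0) (𝓝 y) := by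
    have : Continuous fun τ : ℝ => y + τ • (y' - y) := by fun_prop
    simpa using (this.tendsto 0).mono_left nhdsWithin_le_nhds
  filter_upwards [hpath.eventually hev', self_mem_nhdsWithin,
    nhdsWithin_le_nhds (Iio_mem_nhds one_pos)] with τ h1 h2 h3
  have h4 := (hn x y y' fun i _ => ⟨Metric.ball_subset_ball hle' (hy i),
    Metric.ball_subset_ball hle' (hy' i)⟩).2 τ h2 (le_of_lt h3) fun i hi =>
      Metric.ball_subset_ball hle (h1.2 i hi)
  simpa only [Function.comp_apply, map_sub] using h4

end LocalModel

namespace LocalModel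

variable {X B C : Type*} [TopologicalSpace X] [CompactSpace X]
    [NormedAddCommGroup B] [NormedSpace ℝ B] [NormedAddCommGroup C] [NormedSpace ℝ C]
    {S : X → X} {p : X → B} {ι : B →L[ℝ] C} {T : B → B} {O : Set B} {U : X → B} {δ : X → ℝ}
    {σ : X → C →L[ℝ] ℝ} {LB : X → B →L[ℝ] B} {LC : X → C →L[ℝ] C} {G : ℝ → X → Set B}
    {C₀ lam : ℝ}

/-! ### Comparison of points on a stable leaf -/

/-- A strict inequality which holds on the diagonal of a compact space holds uniformly near it. -/
lemma exists_near_diagonal {E : Type*} [NormedAddCommGroup E] {p : X → E} (hp : Continuous p)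
    (hinj : Function.Injective p) {f : X → X → ℝ} (hf : Continuous (Function.uncurry f)) {ε : ℝ}
    (hd : ∀ x, f x x < ε) : ∃ r, 0 < r ∧ ∀ x y, ‖p x - p y‖ < r → f x y < ε := by
  have hA : IsCompact {z : X × X | ε ≤ f z.1 z.2} :=
    (isClosed_le continuous_const hf).isCompact
  rcases ({z : X × X | ε ≤ f z.1 z.2}).eq_empty_or_nonempty with h0 | h0
  · refine ⟨1, one_pos, fun x y _ => ?_⟩
    by_contra! h1
    exact (h0 ▸ h1 : (x, y) ∈ (∅ : Set (X × X)))
  · have hc : Continuous fun z : X × X => ‖p z.1 - p z.2‖ := by fun_prop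
    obtain ⟨⟨a, b⟩, hab, hmin⟩ := hA.exists_isMinOn h0 hc.continuousOn
    refine ⟨‖p a - p b‖, ?_, fun x y hxy => ?_⟩
    · rw [norm_pos_iff, sub_ne_zero]
      intro h1
      have h2 : ε ≤ f a b := hab
      rw [← hinj h1] at h2
      exact absurd (hd a) (not_lt.2 h2)
    · by_contra! h1
      exact absurd hxy (not_lt.2 (hmin (a := (x, y)) h1))

variable (h : LocalModel S p ι T O U δ σ LB LC G C₀ lam)
include h

/-- For close points of the basic set, the unstable vectors are close. -/
lemma exists_chart {η : ℝ} (hη : 0 < η) : ∃ r, 0 < r ∧ ∀ x x₀, ‖p x - p x₀‖ < r →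
    1 / 2 ≤ σ x (ι (U x₀)) ∧ ‖ι (U x₀) - σ x (ι (U x₀)) • ι (U x)‖ ≤ η := by
  have c1 : Continuous fun z : X × X => σ z.1 (ι (U z.2)) :=
    (h.contσ.comp continuous_fst).clm_apply (ι.continuous.comp (h.contU.comp continuous_snd))
  have cU : Continuous fun z : X × X => ι (U z.1) := ι.continuous.comp (h.contU.comp continuous_fst)
  have cU' : Continuous fun z : X × X => ι (U z.2) := ι.continuous.comp (h.contU.comp continuous_snd)
  obtain ⟨r₁, hr₁, h1⟩ := exists_near_diagonal h.contp h.injp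
    (f := fun x x₀ => -σ x (ι (U x₀))) (ε := -(1 / 2)) c1.neg
    (fun x => by simp only [h.one]; norm_num)
  obtain ⟨r₂, hr₂, h2⟩ := exists_near_diagonal h.contp h.injp
    (f := fun x x₀ => ‖ι (U x₀) - σ x (ι (U x₀)) • ι (U x)‖) (ε := η) (cU'.sub (c1.smul cU)).norm
    (fun x => by simp only [h.one, one_smul, sub_self, norm_zero]; exact hη)
  refine ⟨min r₁ r₂, by positivity, fun x x₀ hx => ⟨?_, (h2 x x₀ (hx.trans_le (min_le_right _ _))).le⟩⟩
  have := h1 x x₀ (hx.trans_le (min_le_left _ _))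
  linarith

/-- In a chart, the unstable coordinate of the difference of two points of a stable leaf is controlled
by the other one. -/
theorem leaf_lipschitz : ∃ r₁ r c : ℝ, 0 < r₁ ∧ 0 < r ∧ 0 < c ∧ ∀ x x₀, ‖p x - p x₀‖ < r₁ →
    ∀ y ∈ shadow S p T r x, ∀ v (t : ℝ), y + v + t • U x₀ ∈ shadow S p T r x → |t| ≤ c * ‖v‖ := by
  obtain ⟨K, hK, hσC, hσB, -, hUC, hι⟩ := h.exists_bounds
  obtain ⟨M, M₁, η₀, r, hη₀, hr, heq, -⟩ := h.shadow_slow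
  obtain ⟨r₁, hr₁, hchart⟩ := h.exists_chart (η := η₀ / 8) (by positivity)
  refine ⟨r₁, r, 2 * K + 8 * (K + K * K + η₀ * K) / (3 * η₀), hr₁, hr, by positivity,
    fun x x₀ hx y hy v t hyt => ?_⟩
  obtain ⟨hβ, hβ'⟩ := hchart x x₀ hx
  set β := σ x (ι (U x₀)) with hβd
  set w := v + t • U x₀ with hw
  have hyw : y + v + t • U x₀ - y = w := by rw [hw]; abel
  have hs : σ x (ι w) = σ x (ι v) + t * β := by
    rw [hw, map_add, map_add, map_smul, map_smul, smul_eq_mul]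
  have hv0 := norm_nonneg v
  have hsv := hσB x v
  have ht0 := abs_nonneg t
  have h3 : |t| * β = |t * β| := by rw [abs_mul, abs_of_nonneg (by linarith : 0 ≤ β)]
  have hdiv : 0 ≤ 8 * (K + K * K + η₀ * K) / (3 * η₀) * ‖v‖ := by positivity
  -- in the cone, the two points coincide; outside it, the unstable coordinate of the difference
  -- is controlled by the other one
  rcases le_or_gt ‖ι w - σ x (ι w) • ι (U x)‖ (η₀ * |σ x (ι w)|) with h1 | h1
  · have h2 := heq x _ hyt y hy (by rw [hyw]; exact h1)
    rw [← sub_eq_zero, hyw] at h2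
    rw [h2, map_zero, map_zero] at hs
    have h4 : |t * β| = |σ x (ι v)| := by
      rw [show t * β = -σ x (ι v) by linarith, abs_neg]
    nlinarith
  · have e : ι w - σ x (ι w) • ι (U x)
        = (ι v - σ x (ι v) • ι (U x)) + t • (ι (U x₀) - β • ι (U x)) := by
      rw [hs, hw, map_add, map_smul, add_smul, smul_sub, smul_smul]; abel
    have h4 : ‖ι w - σ x (ι w) • ι (U x)‖ ≤ (K + K * K) * ‖v‖ + |t| * (η₀ / 8) := by
      rw [e]
      refine (norm_add_le _ _).trans (add_le_add ((norm_sub_le _ _).trans ?_) ?_)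
      · rw [norm_smul, Real.norm_eq_abs]
        calc _ ≤ K * ‖v‖ + K * ‖v‖ * K := by gcongr; exacts [hι v, hUC x]
          _ = _ := by ring
      · rw [norm_smul, Real.norm_eq_abs]; gcongr
    have h5 : |t| * (1 / 2) - K * ‖v‖ ≤ |σ x (ι w)| := by
      have := abs_sub_abs_le_abs_sub (t * β) (-σ x (ι v))
      rw [abs_neg, sub_neg_eq_add, add_comm (t * β), ← hs, ← h3] at this
      nlinarith
    have h6 : η₀ * (|t| * (1 / 2) - K * ‖v‖) ≤ η₀ * |σ x (ι w)| := by gcongr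
    have h7 : |t| * (3 * η₀) ≤ 8 * (K + K * K + η₀ * K) * ‖v‖ := by nlinarith
    have h8 : |t| ≤ 8 * (K + K * K + η₀ * K) / (3 * η₀) * ‖v‖ := by
      rw [div_mul_eq_mul_div, le_div_iff₀ (by positivity)]; exact h7
    have : 0 ≤ 2 * K * ‖v‖ := by positivity
    rw [add_mul]; linarith

set_option maxHeartbeats 1000000 in
/-- The stable leaves are approximated to first order, up to errors which are as small as desired and
uniform, by linear functionals: the derivative of a high iterate expands the unstable direction more
than differences of points of a leaf. -/
theorem leaf_approx : ∃ r₁ r : ℝ, 0 < r₁ ∧ 0 < r ∧ ∀ ε : ℝ, 0 < ε → ∃ s : ℝ, 0 < s ∧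
    ∀ x x₀, ‖p x - p x₀‖ < r₁ → ∀ y ∈ shadow S p T r x, ∃ ℓ : B →L[ℝ] ℝ, ∀ v (t : ℝ),
      y + v + t • U x₀ ∈ shadow S p T r x → ‖v‖ < s → |t - ℓ v| ≤ ε * ‖v‖ := by
  obtain ⟨K, hK, hσC, hσB, hU, hUC, hι⟩ := h.exists_bounds
  obtain ⟨M, M₁, η₀, ra, hη₀, hra, -, hslow⟩ := h.shadow_slow
  obtain ⟨rb, ρ, hrb, hρ, hhol⟩ := h.holder_iterate
  obtain ⟨rc, rd, cL, hrc, hrd, hcL, hlip⟩ := h.leaf_lipschitz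
  obtain ⟨ce, re, hce, hre, hev⟩ := h.shadow_eventually
  obtain ⟨rf, hrf, hchart⟩ := h.exists_chart (η := η₀ / 2) (by positivity)
  choose cn hcn hcn' using hhol
  set r := min (min (ra / ce) rb) (min rd re) with hr
  have hr0 : 0 < r := by positivity
  have hrra : ce * r ≤ ra := by
    calc _ ≤ ce * (ra / ce) := by gcongr; exact (min_le_left _ _).trans (min_le_left _ _)
      _ = _ := by field_simp
  have hra' : r ≤ ra := ((min_le_left _ _).trans (min_le_left _ _)).trans (div_le_self hra.le hce)
  have hrb' : r ≤ rb := (min_le_left _ _).trans (min_le_right _ _)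
  have hrd' : r ≤ rd := (min_le_right _ _).trans (min_le_left _ _)
  have hre' : r ≤ re := (min_le_right _ _).trans (min_le_right _ _)
  refine ⟨min rc rf, r, by positivity, hr0, fun ε hε => ?_⟩
  set Q := 1 + cL * K with hQ
  have hQ0 : 0 < Q := by positivity
  -- the number of blocks
  obtain ⟨k, hk⟩ : ∃ k : ℕ, 2 * (η₀⁻¹ * (K + K * K) * Q) * (8 / 9) ^ k < ε / 2 := by
    have : Tendsto (fun k : ℕ => 2 * (η₀⁻¹ * (K + K * K) * Q) * (8 / 9 : ℝ) ^ k) atTop (𝓝 0) := by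
      simpa using (tendsto_pow_atTop_nhds_zero_of_lt_one (r := (8 / 9 : ℝ)) (by norm_num)
        (by norm_num)).const_mul (2 * (η₀⁻¹ * (K + K * K) * Q))
    exact (this.eventually (gt_mem_nhds (half_pos hε))).exists
  set cm := ∑ n ∈ Finset.range (k * M + 1), cn n with hcm
  have hcm' : ∀ n ≤ k * M, cn n ≤ cm := fun n hn =>
    Finset.single_le_sum (fun i _ => (hcn i).le) (Finset.mem_range.2 (by omega))
  have hcm0 : 0 < cm := (hcn 0).trans_le (hcm' 0 (by omega))
  set A := 2 * (K * cm * (K * Q) ^ ρ) with hA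
  have hA0 : 0 < A := by positivity
  refine ⟨(ε / (2 * A)) ^ (ρ - 1)⁻¹, by positivity, fun x x₀ hx y hy => ?_⟩
  obtain ⟨hβ, hβ'⟩ := hchart x x₀ (hx.trans_le (min_le_right _ _))
  set β := σ x (ι (U x₀)) with hβd
  obtain ⟨n, hn, hg8, hexp, hsl⟩ := hslow k x
  have hg0 := growth_pos h.pos n x (S := S)
  obtain ⟨hdiff, hder⟩ := hcn' n x y (shadow_mono hrb' x hy)
  set D := fderiv ℝ (ι ∘ T^[n]) y with hD
  set d := σ (S^[n] x) (D (U x₀)) with hd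
  -- the derivative expands the unstable direction
  have hdlow : (9 / 10) ^ k * growth S δ n x * β ≤ |d| := by
    have hlim := (hdiff.hasFDerivAt.hasLineDerivAt (U x₀)).tendsto_slope_zero_right
    have hlim2 := (((σ (S^[n] x)).continuous.tendsto _).comp hlim).abs
    refine ge_of_tendsto hlim2 ?_
    have hpath : Tendsto (fun τ : ℝ => y + τ • U x₀) (𝓝[>] 0) (𝓝 y) := by
      have : Continuous fun τ : ℝ => y + τ • U x₀ := by fun_prop
      simpa using (this.tendsto 0).mono_left nhdsWithin_le_nhds
    filter_upwards [hpath.eventually (hev r hre' x y hy (k * M + M₁)), self_mem_nhdsWithin]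
      with τ h1 h2
    have h2' : 0 < τ := h2
    have h3 := hexp (y + τ • U x₀) y (fun i hi => ⟨Metric.ball_subset_ball hrra (h1.2 i hi),
      Metric.ball_subset_ball hra' (hy i)⟩) (by
        rw [add_sub_cancel_left, map_smul, map_smul, smul_eq_mul, mul_smul, ← smul_sub, norm_smul,
          abs_mul, Real.norm_eq_abs]
        have : |β| = β := abs_of_nonneg (by linarith)
        rw [← hβd, this]
        have h4 : η₀ / 2 ≤ η₀ * β := by nlinarith
        calc _ ≤ |τ| * (η₀ * β) := by gcongr; exact hβ'.trans h4
          _ = _ := by ring)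
    rw [add_sub_cancel_left, map_smul, map_smul, smul_eq_mul, ← hβd, abs_mul, abs_of_pos h2',
      abs_of_nonneg (by linarith : 0 ≤ β)] at h3
    simp only [Function.comp_apply, map_smul, smul_eq_mul, abs_mul]
    rw [abs_of_nonneg (by positivity), ← map_sub ι]
    rw [inv_mul_eq_div, le_div_iff₀ h2']
    linarith
  have hgk : 1 ≤ (9 / 10) ^ k * growth S δ n x := by
    calc (1 : ℝ) ≤ (9 / 10 * 8) ^ k := one_le_pow₀ (by norm_num)
      _ = (9 / 10) ^ k * 8 ^ k := mul_pow _ _ _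
      _ ≤ _ := by gcongr
  have hd2 : (9 / 10) ^ k * growth S δ n x ≤ 2 * |d| := by nlinarith
  have hd0 : d ≠ 0 := fun h0 => by rw [h0, abs_zero] at hd2; linarith
  refine ⟨-(d⁻¹ • (σ (S^[n] x)).comp D), fun v t hyt hv => ?_⟩
  set w := v + t • U x₀ with hw
  have hyw : y + v + t • U x₀ - y = w := by rw [hw]; abel
  have ht := hlip x x₀ (hx.trans_le (min_le_left _ _)) y (shadow_mono hrd' x hy) v t
    (shadow_mono hrd' x hyt)
  have hwn : ‖w‖ ≤ Q * ‖v‖ := by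
    calc _ ≤ ‖v‖ + |t| * ‖U x₀‖ := by
          refine (norm_add_le _ _).trans ?_
          rw [norm_smul, Real.norm_eq_abs]
      _ ≤ ‖v‖ + cL * ‖v‖ * K := by gcongr; exact hU _
      _ = _ := by rw [hQ]; ring
  have h1 := hder _ (shadow_mono hrb' x hyt)
  rw [hyw] at h1
  have h2 := hsl _ (shadow_mono hra' x hyt) y (shadow_mono hra' x hy)
  rw [hyw] at h2
  set z := ι (T^[n] (y + v + t • U x₀) - T^[n] y) with hz
  have h3 : |t * d + σ (S^[n] x) (D v)| ≤ |σ (S^[n] x) z| + K * (cm * ‖ι w‖ ^ ρ) := by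
    have e : t * d + σ (S^[n] x) (D v) = σ (S^[n] x) z - σ (S^[n] x) (z - D w) := by
      rw [hw, map_sub, map_add D, map_smul D, map_add, map_smul, smul_eq_mul]; ring
    rw [e]
    refine (abs_sub _ _).trans (add_le_add le_rfl ((hσC _ _).trans ?_))
    gcongr
    exact h1.trans (by gcongr; exact hcm' n hn)
  have h4 : |σ (S^[n] x) z| ≤ η₀⁻¹ * ((4 / 5) ^ k * growth S δ n x * ((K + K * K) * (Q * ‖v‖))) := by
    rw [inv_mul_eq_div, le_div_iff₀ hη₀, mul_comm]
    refine h2.trans ?_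
    gcongr
    calc _ ≤ K * ‖w‖ + K * ‖w‖ * K := by
          refine (norm_sub_le _ _).trans ?_
          rw [norm_smul, Real.norm_eq_abs]
          gcongr
          exacts [hι w, hσB x w, hUC x]
      _ = (K + K * K) * ‖w‖ := by ring
      _ ≤ _ := by gcongr
  have h5 : ‖ι w‖ ^ ρ ≤ (K * Q) ^ ρ * (ε / (2 * A) * ‖v‖) := by
    calc ‖ι w‖ ^ ρ ≤ (K * Q * ‖v‖) ^ ρ := by
          gcongr
          calc _ ≤ K * ‖w‖ := hι w
            _ ≤ K * (Q * ‖v‖) := by gcongr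
            _ = _ := by ring
      _ = (K * Q) ^ ρ * ‖v‖ ^ ρ := Real.mul_rpow (by positivity) (norm_nonneg _)
      _ ≤ _ := by
          gcongr
          have := rpow_le_mul (norm_nonneg v) hv.le hρ
          rwa [Real.rpow_inv_rpow (by positivity) (by linarith)] at this
  have e1 : t - (-(d⁻¹ • (σ (S^[n] x)).comp D)) v = (t * d + σ (S^[n] x) (D v)) / d := by
    simp only [neg_apply, smul_apply, ContinuousLinearMap.comp_apply, smul_eq_mul]
    field_simp
    ring
  rw [e1, abs_div, div_le_iff₀ (abs_pos.2 hd0)]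
  refine h3.trans ?_
  have h6 : K * (cm * ‖ι w‖ ^ ρ) ≤ ε / 4 * ‖v‖ := by
    calc _ ≤ K * (cm * ((K * Q) ^ ρ * (ε / (2 * A) * ‖v‖))) := by gcongr
      _ = A * (ε / (2 * A)) / 2 * ‖v‖ := by rw [hA]; ring
      _ = _ := by field_simp; ring
  have h7 : η₀⁻¹ * ((4 / 5) ^ k * growth S δ n x * ((K + K * K) * (Q * ‖v‖)))
      ≤ ε / 4 * ‖v‖ * ((9 / 10) ^ k * growth S δ n x) := by
    have e2 : (4 / 5 : ℝ) ^ k = (8 / 9) ^ k * (9 / 10) ^ k := by rw [← mul_pow]; norm_num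
    calc _ = 2 * (η₀⁻¹ * (K + K * K) * Q) * (8 / 9) ^ k / 2 * (‖v‖ *
          ((9 / 10) ^ k * growth S δ n x)) := by rw [e2]; ring
      _ ≤ ε / 2 / 2 * (‖v‖ * ((9 / 10) ^ k * growth S δ n x)) := by gcongr
      _ = _ := by ring
  have hv0 : 0 ≤ ε / 4 * ‖v‖ := by positivity
  have h8 : ε / 4 * ‖v‖ ≤ ε / 4 * ‖v‖ * (2 * |d|) := by nlinarith
  have h9 : ε / 4 * ‖v‖ * ((9 / 10) ^ k * growth S δ n x) ≤ ε / 4 * ‖v‖ * (2 * |d|) := by gcongr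
  linarith

/-- The stable leaves depend continuously on the point of the basic set. -/
theorem leaf_continuous : ∃ r₁ r : ℝ, 0 < r₁ ∧ 0 < r ∧ ∀ ε : ℝ, 0 < ε → ∀ x, ∀ᶠ x' in 𝓝 x,
    ∀ x₀, ‖p x - p x₀‖ < r₁ → ∀ q (t t' : ℝ), q + t • U x₀ ∈ shadow S p T r x →
      q + t' • U x₀ ∈ shadow S p T r x' → |t - t'| ≤ ε := by
  obtain ⟨η₁, rd, c, θ, hη₁, hrd, hc, hθ0, hθ1, hdec⟩ := h.cone_decay
  obtain ⟨r₁, hr₁, hchart⟩ := h.exists_chart (η := η₁ / 2) (by positivity)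
  refine ⟨r₁, rd / 2, hr₁, by positivity, fun ε hε x => ?_⟩
  obtain ⟨n, hn⟩ : ∃ n : ℕ, 2 * c * θ ^ n < ε := by
    have : Tendsto (fun n : ℕ => 2 * c * θ ^ n) atTop (𝓝 0) := by
      simpa using (tendsto_pow_atTop_nhds_zero_of_lt_one hθ0.le hθ1).const_mul (2 * c)
    exact (this.eventually (gt_mem_nhds hε)).exists
  have hev : ∀ᶠ x' in 𝓝 x, ∀ i ≤ n, ‖p (S^[i] x') - p (S^[i] x)‖ < rd / 2 := by
    have h1 : ∀ i ∈ Finset.range (n + 1), ∀ᶠ x' in 𝓝 x,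
        ‖p (S^[i] x') - p (S^[i] x)‖ < rd / 2 := by
      intro i _
      have h2 : Continuous fun x' => ‖p (S^[i] x') - p (S^[i] x)‖ :=
        ((h.contp.comp (h.contS.iterate i)).sub continuous_const).norm
      have h3 := h2.tendsto x
      simp only [sub_self, norm_zero] at h3
      exact h3.eventually (gt_mem_nhds (by positivity))
    filter_upwards [(Finset.eventually_all _).2 h1] with x' hx' i hi
    exact hx' i (Finset.mem_range.2 (by omega))
  filter_upwards [hev] with x' hx' x₀ hx q t t' ht ht'
  obtain ⟨hβ, hβ'⟩ := hchart x x₀ hx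
  set β := σ x (ι (U x₀)) with hβd
  have e : q + t • U x₀ - (q + t' • U x₀) = (t - t') • U x₀ := by
    rw [add_sub_add_left_eq_sub, sub_smul]
  have hs : σ x (ι ((t - t') • U x₀)) = (t - t') * β := by
    rw [map_smul, map_smul, smul_eq_mul]
  have hβa : |β| = β := abs_of_nonneg (by linarith)
  have h1 := hdec n x (q + t • U x₀) (q + t' • U x₀) (fun i hi => ⟨Metric.ball_subset_ball
    (by linarith) (ht i), by
      have h2 := mem_ball_iff_norm.1 (ht' i)
      rw [mem_ball_iff_norm]
      have h3 := norm_add_le (T^[i] (q + t' • U x₀) - p (S^[i] x')) (p (S^[i] x') - p (S^[i] x))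
      rw [sub_add_sub_cancel] at h3
      have h4 := hx' i hi
      linarith⟩) (by
      rw [e, hs, map_smul, mul_smul, ← smul_sub, norm_smul, Real.norm_eq_abs, abs_mul, hβa]
      have h4 : η₁ / 2 ≤ η₁ * β := by nlinarith
      calc _ ≤ |t - t'| * (η₁ * β) := by gcongr; exact hβ'.trans h4
        _ = _ := by ring)
  rw [e, hs, abs_mul, hβa] at h1
  nlinarith [abs_nonneg (t - t')]

/-- The stable leaf of `x` is tangent at `p x` to the stable space. -/
theorem leaf_tangent : ∃ r : ℝ, 0 < r ∧ ∀ ε : ℝ, 0 < ε → ∃ s : ℝ, 0 < s ∧ ∀ x v (t : ℝ),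
    σ x (ι v) = 0 → p x + v + t • U x ∈ shadow S p T r x → ‖v‖ < s → |t| ≤ ε * ‖v‖ := by
  obtain ⟨K, hK, hσC, hσB, hU, hUC, hι⟩ := h.exists_bounds
  obtain ⟨M, M₁, η₀, ra, hη₀, hra, -, hslow⟩ := h.shadow_slow
  obtain ⟨rc, rd, cL, hrc, hrd, hcL, hlip⟩ := h.leaf_lipschitz
  refine ⟨min ra rd, by positivity, fun ε hε => ?_⟩
  set Q := 1 + cL * K with hQ
  have hQ0 : 0 < Q := by positivity
  have hmem : ∀ r, 0 < r → ∀ x, p x ∈ shadow S p T r x := fun r hr x n => by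
    rw [h.iterate_p]; exact Metric.mem_ball_self hr
  -- after `k` blocks the difference of two points of the leaf has lost a factor `(4 / 5) ^ k`
  -- compared with the unstable vectors
  obtain ⟨k, hk⟩ : ∃ k : ℕ, η₀⁻¹ * (K + K * K) * Q * (4 / 5) ^ k < ε / 2 := by
    have : Tendsto (fun k : ℕ => η₀⁻¹ * (K + K * K) * Q * (4 / 5 : ℝ) ^ k) atTop (𝓝 0) := by
      simpa using (tendsto_pow_atTop_nhds_zero_of_lt_one (r := (4 / 5 : ℝ)) (by norm_num)
        (by norm_num)).const_mul (η₀⁻¹ * (K + K * K) * Q)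
    exact (this.eventually (gt_mem_nhds (half_pos hε))).exists
  have hap : ∀ m, ∃ r, 0 < r ∧ (0 < m → ∀ x, ∀ y ∈ Metric.ball (p x) r,
      ∀ z ∈ Metric.ball (p x) r, ‖ι (T^[m] y - T^[m] z - cocycle S LB m x (y - z))‖
        ≤ ε / (2 * K * Q) * ‖y - z‖) := by
    intro m
    rcases Nat.eq_zero_or_pos m with rfl | hm
    · exact ⟨1, one_pos, fun h0 => absurd h0 (lt_irrefl 0)⟩
    · obtain ⟨r, hr, h1⟩ := h.approx m hm (ε / (2 * K * Q)) (by positivity)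
      exact ⟨r, hr, fun _ => h1⟩
  choose rm hrm hrm' using hap
  -- the time `n` chosen below depends on `x`, but is at most `(k + 1) * M`
  obtain ⟨i₀, -, hmin⟩ := (Finset.range ((k + 1) * M + 1)).exists_min_image rm ⟨0, by simp⟩
  refine ⟨rm i₀ / Q, by have := hrm i₀; positivity, fun x v t hv0 hyt hv => ?_⟩
  obtain ⟨n, hn, hg8, -, hsl⟩ := hslow (k + 1) x
  have hg0 := growth_pos h.pos n x (S := S)
  have hg1 : 1 ≤ growth S δ n x := le_trans (one_le_pow₀ (by norm_num)) hg8
  have hn0 : 0 < n := by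
    rcases Nat.eq_zero_or_pos n with rfl | h0
    · rw [growth_zero] at hg8
      have : (1 : ℝ) < 8 ^ (k + 1) := one_lt_pow₀ (by norm_num) (by omega)
      linarith
    · exact h0
  set w := v + t • U x with hw
  have hyw : p x + v + t • U x - p x = w := by rw [hw]; abel
  have ht := hlip x x (by simpa using hrc) (p x) (hmem _ hrd x) v t
    (shadow_mono (min_le_right _ _) x hyt)
  have hwn : ‖w‖ ≤ Q * ‖v‖ := by
    calc _ ≤ ‖v‖ + |t| * ‖U x‖ := by
          refine (norm_add_le _ _).trans ?_
          rw [norm_smul, Real.norm_eq_abs]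
      _ ≤ ‖v‖ + cL * ‖v‖ * K := by gcongr; exact hU _
      _ = _ := by rw [hQ]; ring
  have hst : σ x (ι w) = t := by
    rw [hw, map_add, map_add, hv0, map_smul, map_smul, h.one, smul_eq_mul, mul_one, zero_add]
  have hri : rm i₀ ≤ rm n := hmin n (Finset.mem_range.2 (by omega))
  have h1 := hrm' n hn0 x (p x + v + t • U x) (by
    rw [mem_ball_iff_norm, hyw]
    rw [lt_div_iff₀ hQ0] at hv
    linarith) (p x) (Metric.mem_ball_self (hrm n))
  have h2 := hsl _ (shadow_mono (min_le_left _ _) x hyt) (p x) (hmem _ hra x)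
  rw [hyw] at h1 h2
  set z := T^[n] (p x + v + t • U x) - T^[n] (p x) with hz
  have e : growth S δ n x * t = σ (S^[n] x) (ι z) - σ (S^[n] x) (ι (z - cocycle S LB n x w)) := by
    rw [map_sub ι z, map_sub (σ _) (ι z), h.cocycle_inter, h.σ_cocycle, hst]; ring
  have h4 : |σ (S^[n] x) (ι z)| ≤ ε / 2 * ‖v‖ * growth S δ n x := by
    have h5 : |σ (S^[n] x) (ι z)| ≤
        η₀⁻¹ * ((4 / 5) ^ (k + 1) * growth S δ n x * ((K + K * K) * (Q * ‖v‖))) := by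
      rw [inv_mul_eq_div, le_div_iff₀ hη₀, mul_comm]
      refine h2.trans ?_
      gcongr
      calc _ ≤ K * ‖w‖ + K * ‖w‖ * K := by
            refine (norm_sub_le _ _).trans ?_
            rw [norm_smul, Real.norm_eq_abs]
            gcongr
            exacts [hι w, hσB x w, hUC x]
        _ = (K + K * K) * ‖w‖ := by ring
        _ ≤ _ := by gcongr
    have h6 : (4 / 5 : ℝ) ^ (k + 1) ≤ (4 / 5) ^ k :=
      pow_le_pow_of_le_one (by norm_num) (by norm_num) (Nat.le_succ k)
    calc _ ≤ η₀⁻¹ * ((4 / 5) ^ (k + 1) * growth S δ n x * ((K + K * K) * (Q * ‖v‖))) := h5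
      _ ≤ η₀⁻¹ * ((4 / 5) ^ k * growth S δ n x * ((K + K * K) * (Q * ‖v‖))) := by gcongr
      _ = η₀⁻¹ * (K + K * K) * Q * (4 / 5) ^ k * (‖v‖ * growth S δ n x) := by ring
      _ ≤ ε / 2 * (‖v‖ * growth S δ n x) := by gcongr
      _ = _ := by ring
  have h5 : |σ (S^[n] x) (ι (z - cocycle S LB n x w))| ≤ ε / 2 * ‖v‖ * growth S δ n x := by
    calc _ ≤ K * (ε / (2 * K * Q) * (Q * ‖v‖)) := (hσC _ _).trans (by
          gcongr; exact h1.trans (by gcongr))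
      _ = ε / 2 * ‖v‖ := by field_simp
      _ ≤ _ := le_mul_of_one_le_right (by positivity) hg1
  have h6 : growth S δ n x * |t| ≤ growth S δ n x * (ε * ‖v‖) := by
    rw [← abs_of_pos hg0, ← abs_mul, abs_of_pos hg0, e]
    refine (abs_sub _ _).trans ?_
    linarith
  exact le_of_mul_le_mul_left h6 hg0

end LocalModel

/-! ### The stable lamination -/

/-- The function whose graph, in the coordinates centred at `p x₀`, is the stable leaf of `x`: the point
over `v` is the one which shadows the orbit of `x`. -/
noncomputable def leaf {X B : Type*} [NormedAddCommGroup B] [NormedSpace ℝ B] (S : X → X) (p : X → B)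
    (T : B → B) (U : X → B) (r : ℝ) (x₀ x : X) (v : B) : ℝ :=
  Classical.epsilon fun t : ℝ => p x₀ + v + t • U x₀ ∈ shadow S p T r x

namespace LocalModel

variable {X B C : Type*} [TopologicalSpace X] [CompactSpace X]
    [NormedAddCommGroup B] [NormedSpace ℝ B] [NormedAddCommGroup C] [NormedSpace ℝ C]
    {S : X → X} {p : X → B} {ι : B →L[ℝ] C} {T : B → B} {O : Set B} {U : X → B} {δ : X → ℝ}
    {σ : X → C →L[ℝ] ℝ} {LB : X → B →L[ℝ] B} {LC : X → C →L[ℝ] C} {G : ℝ → X → Set B}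
    {C₀ lam : ℝ}

lemma tendsto_const_mul_pow_mul {c θ a : ℝ} (h0 : 0 < θ) (h1 : θ < 1) :
    Tendsto (fun n : ℕ => c * θ ^ n * a) atTop (𝓝 0) := by
  simpa using ((tendsto_pow_atTop_nhds_zero_of_lt_one h0.le h1).const_mul c).mul_const a

variable (h : LocalModel S p ι T O U δ σ LB LC G C₀ lam)
include h

omit [CompactSpace X] in
lemma mem_shadow_self {r : ℝ} (hr : 0 < r) (x : X) : p x ∈ shadow S p T r x := fun n => by
  rw [h.iterate_p]; exact Metric.mem_ball_self hr

omit [CompactSpace X] in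
lemma localStable_subset_shadow (ε : ℝ) (x : X) :
    localStable T O ε (p x) ⊆ shadow S p T ε x := fun y hy n => by
  have := (hy.1 n).2
  rwa [h.iterate_p] at this

omit [CompactSpace X] in
lemma exists_ball_subset : ∃ r, 0 < r ∧ ∀ x, Metric.ball (p x) r ⊆ O := by
  obtain ⟨r, hr, hdom⟩ := h.domain 1 one_pos
  exact ⟨r, hr, fun x y hy => (interior_subset (hdom x hy)).1⟩

/-- The projection to the stable space along the unstable direction. -/
lemma exists_decomp : ∃ a : ℝ, 1 ≤ a ∧ ∀ x w, ‖w - σ x (ι w) • U x‖ ≤ a * ‖w‖ ∧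
    σ x (ι (w - σ x (ι w) • U x)) = 0 := by
  obtain ⟨K, hK, -, hσB, hU, -, -⟩ := h.exists_bounds
  refine ⟨1 + K * K, by nlinarith, fun x w => ⟨?_, ?_⟩⟩
  · calc _ ≤ ‖w‖ + K * ‖w‖ * K := by
          refine (norm_sub_le _ _).trans ?_
          rw [norm_smul, Real.norm_eq_abs]
          gcongr
          exacts [hσB x w, hU x]
      _ = _ := by ring
  · rw [map_sub, map_sub, map_smul, map_smul, h.one, smul_eq_mul, mul_one, sub_self]

/-- Points which shadow the orbit of `x` belong to the local stable set, of a comparable size. -/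
theorem shadow_localStable : ∃ r c θ : ℝ, 0 < r ∧ 1 ≤ c ∧ 0 < θ ∧ θ < 1 ∧ ∀ x, ∀ y ∈ shadow S p T r x,
    (∀ n, ‖T^[n] y - p (S^[n] x)‖ ≤ c * θ ^ n * ‖y - p x‖) ∧
    ∀ ε, (∀ n, T^[n] y ∈ Metric.ball (p (S^[n] x)) ε) → y ∈ localStable T O ε (p x) := by
  obtain ⟨r₁, c, θ, hr₁, hc, hθ0, hθ1, hcon⟩ := h.shadow_contract
  obtain ⟨r₂, hr₂, hO⟩ := h.exists_ball_subset
  refine ⟨min r₁ r₂, c + 1, θ, by positivity, by linarith, hθ0, hθ1, fun x y hy => ?_⟩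
  have h1 := hcon x y (shadow_mono (min_le_left _ _) x hy)
  refine ⟨fun n => (h1 n).trans (by gcongr; linarith), fun ε hε => ⟨fun n => ⟨?_, ?_⟩, ?_⟩⟩
  · exact hO _ (Metric.ball_subset_ball (min_le_right _ _) (hy n))
  · rw [h.iterate_p]; exact hε n
  · refine squeeze_zero (fun n => norm_nonneg _) (fun n => ?_)
      (tendsto_const_mul_pow_mul (c := c) (a := ‖y - p x‖) hθ0 hθ1)
    rw [h.iterate_p]; exact h1 n

/-- Contraction on the local stable sets, and, with constants which depend on the point, on the global
ones. -/
theorem localStable_contract : ∃ ε₁ c θ : ℝ, 0 < ε₁ ∧ 1 ≤ c ∧ 0 < θ ∧ θ < 1 ∧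
    (∀ ε ≤ ε₁, ∀ x, ∀ y ∈ localStable T O ε (p x), ∀ m : ℕ,
      ‖T^[m] (p x) - T^[m] y‖ ≤ c * θ ^ m * ‖p x - y‖) ∧
    ∀ x, ∀ y ∈ globalStable T O (p x), ∃ C' : ℝ, 0 ≤ C' ∧ ∀ m : ℕ,
      ‖T^[m] (p x) - T^[m] y‖ ≤ C' * θ ^ m * ‖p x - y‖ := by
  obtain ⟨r, c, θ, hr, hc, hθ0, hθ1, hcon⟩ := h.shadow_localStable
  refine ⟨r, c, θ, hr, hc, hθ0, hθ1, fun ε hε x y hy m => ?_, fun x y hy => ?_⟩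
  · rw [norm_sub_rev, norm_sub_rev (p x), h.iterate_p]
    exact (hcon x y (shadow_mono hε x (h.localStable_subset_shadow ε x hy))).1 m
  rcases eq_or_ne (p x) y with h0 | h0
  · exact ⟨0, le_rfl, fun m => by rw [h0]; simp⟩
  have hd : 0 < ‖p x - y‖ := norm_pos_iff.2 (sub_ne_zero.2 h0)
  -- after a finite time the orbit is shadowed
  obtain ⟨m₁, hm₁⟩ := eventually_atTop.1 (hy.2.eventually (gt_mem_nhds hr))
  have hsh : T^[m₁] y ∈ shadow S p T r (S^[m₁] x) := fun n => by
    rw [← Function.iterate_add_apply, ← Function.iterate_add_apply, mem_ball_iff_norm, ← h.iterate_p]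
    exact hm₁ _ (by omega)
  have h1 := (hcon _ _ hsh).1
  set a : ℕ → ℝ := fun m => ‖T^[m] (p x) - T^[m] y‖ with ha
  refine ⟨(∑ m ∈ Finset.range m₁, a m / θ ^ m + c * a m₁ / θ ^ m₁) / ‖p x - y‖, ?_, fun m => ?_⟩
  · have : 0 ≤ ∑ m ∈ Finset.range m₁, a m / θ ^ m :=
      Finset.sum_nonneg fun i _ => div_nonneg (norm_nonneg _) (by positivity)
    positivity
  have e : (∑ m ∈ Finset.range m₁, a m / θ ^ m + c * a m₁ / θ ^ m₁) / ‖p x - y‖ * θ ^ m * ‖p x - y‖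
      = (∑ m ∈ Finset.range m₁, a m / θ ^ m + c * a m₁ / θ ^ m₁) * θ ^ m := by
    field_simp
  rw [e]
  have hnn : ∀ i ∈ Finset.range m₁, 0 ≤ a i / θ ^ i := fun i _ =>
    div_nonneg (norm_nonneg _) (by positivity)
  have hlast : 0 ≤ c * a m₁ / θ ^ m₁ := by positivity
  have hpm : 0 < θ ^ m := by positivity
  rcases lt_or_ge m m₁ with hm | hm
  · have h2 := Finset.single_le_sum hnn (Finset.mem_range.2 hm)
    calc a m = a m / θ ^ m * θ ^ m := by field_simp
      _ ≤ _ := by gcongr; linarith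
  · obtain ⟨k, rfl⟩ := Nat.exists_eq_add_of_le' hm
    have h2 := h1 k
    rw [← Function.iterate_add_apply, ← Function.iterate_add_apply, ← h.iterate_p,
      ← h.iterate_p, norm_sub_rev, norm_sub_rev _ (T^[m₁] (p x))] at h2
    have h3 : 0 ≤ ∑ i ∈ Finset.range m₁, a i / θ ^ i := Finset.sum_nonneg hnn
    calc a (k + m₁) ≤ c * θ ^ k * a m₁ := h2
      _ = c * a m₁ / θ ^ m₁ * θ ^ (k + m₁) := by rw [pow_add]; field_simp
      _ ≤ _ := by gcongr; linarith

/-- A point whose orbit stays close to the orbit of `x` for a long time is close to the local stable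
set of `x`. -/
theorem infDist_localStable : ∃ ε₁ c θ κ : ℝ, 0 < ε₁ ∧ 0 < c ∧ 0 < θ ∧ θ < 1 ∧ 1 ≤ κ ∧
    ∀ ε, 0 < ε → ε ≤ ε₁ → ∀ x y (m : ℕ), (∀ i ≤ m, T^[i] y ∈ Metric.ball (p (S^[i] x)) ε) →
      Metric.infDist y (localStable T O (κ * ε) (p x)) ≤ c * θ ^ m := by
  obtain ⟨K, hK, -, -, hU, -, -⟩ := h.exists_bounds
  obtain ⟨a, ha, hdec⟩ := h.exists_decomp
  obtain ⟨ce, re, hce, hre, hex⟩ := h.exists_shadow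
  obtain ⟨η₁, rd, cd, θ, hη₁, hrd, hcd, hθ0, hθ1, hcone⟩ := h.cone_decay
  obtain ⟨rf, cf, θf, hrf, -, -, -, hloc⟩ := h.shadow_localStable
  have hκ : 1 ≤ ce * a := by nlinarith
  refine ⟨min (re / a) (min (rd / (ce * a)) (rf / (ce * a))), K * cd, θ, ce * a, by positivity,
    by positivity, hθ0, hθ1, hκ, fun ε hε hε₁ x y m hy => ?_⟩
  have i1 : a * ε ≤ re := by
    have := hε₁.trans (min_le_left _ _)
    rw [le_div_iff₀ (by positivity)] at this; linarith
  have i2 : ce * a * ε ≤ rd := by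
    have := hε₁.trans ((min_le_right _ _).trans (min_le_left _ _))
    rw [le_div_iff₀ (by positivity)] at this; linarith
  have i3 : ce * a * ε ≤ rf := by
    have := hε₁.trans ((min_le_right _ _).trans (min_le_right _ _))
    rw [le_div_iff₀ (by positivity)] at this; linarith
  set t₀ := σ x (ι (y - p x)) with ht₀
  have hy0 : ‖y - p x‖ < ε := by simpa using mem_ball_iff_norm.1 (hy 0 (by omega))
  obtain ⟨t, -, ht⟩ := hex (a * ε) (by positivity) i1 x x (y - t₀ • U x) (by
    rw [show y - t₀ • U x - p x = (y - p x) - t₀ • U x by abel]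
    exact (hdec x (y - p x)).1.trans (by gcongr)) (by rw [h.one]; norm_num)
  rw [← mul_assoc] at ht
  set y' := y - t₀ • U x + t • U x with hy'
  have hmem : y' ∈ localStable T O (ce * a * ε) (p x) :=
    (hloc x y' (shadow_mono i3 x ht)).2 _ ht
  have e : y - y' = (t₀ - t) • U x := by rw [hy', sub_smul]; abel
  have hs : σ x (ι (y - y')) = t₀ - t := by
    rw [e, map_smul, map_smul, h.one, smul_eq_mul, mul_one]
  have h1 := hcone m x y y' (fun i hi => ⟨Metric.ball_subset_ball (by nlinarith) (hy i hi),
    Metric.ball_subset_ball i2 (ht i)⟩) (by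
      rw [hs, e, map_smul, sub_self, norm_zero]; positivity)
  calc _ ≤ dist y y' := Metric.infDist_le_dist_of_mem hmem
    _ = |t₀ - t| * ‖U x‖ := by rw [dist_eq_norm, e, norm_smul, Real.norm_eq_abs]
    _ ≤ cd * θ ^ m * K := by gcongr; exacts [hs ▸ h1, hU x]
    _ = _ := by ring

set_option maxHeartbeats 1000000 in
/-- The leaves `leaf S p T U ρ` are graphs of functions of class `C¹`, since they are approximated by
linear functionals (`leaf_approx`). Points of a local stable set shadow the orbit, and therefore lie
on the leaf, by uniqueness (`leaf_lipschitz`); conversely, points of a leaf which are close to `p x`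
lie in the local stable set, by `shadow_localStable`. -/
theorem stableLamination {Uf : B → B} {σf : B → B →L[ℝ] ℝ} (hUf : ∀ x, Uf (p x) = U x)
    (hσf : ∀ x, σf (p x) = (σ x).comp ι) :
    ∃ ε₁, 0 < ε₁ ∧ ∀ ε₀ ≤ ε₁, StableLamination T O (range p) Uf σf ε₀ := by
  rcases isEmpty_or_nonempty X with hX | hX
  · refine ⟨1, one_pos, fun ε₀ _ => ⟨1, one_pos, 1, one_pos, fun _ _ _ => 0, ?_⟩⟩
    have : range p = ∅ := range_eq_empty p
    simp only [this, mem_empty_iff_false, false_imp_iff, implies_true, true_and, and_true]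
    exact fun _ _ _ => ⟨1, one_pos⟩
  obtain ⟨a, ha, hdec⟩ := h.exists_decomp
  obtain ⟨qa, ra, cL, hqa, hra, hcL, hlip⟩ := h.leaf_lipschitz
  obtain ⟨qb, rb, hqb, hrb, happ⟩ := h.leaf_approx
  obtain ⟨qc, rc, hqc, hrc, hcont⟩ := h.leaf_continuous
  obtain ⟨rd, hrd, htan⟩ := h.leaf_tangent
  obtain ⟨ce, re, hce, hre, hex⟩ := h.exists_shadow
  obtain ⟨rf, cf, θ, hrf, hcf, hθ0, hθ1, hloc⟩ := h.shadow_localStable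
  obtain ⟨qg, hqg, hchart⟩ := h.exists_chart one_pos
  -- the radius for the definition of the leaves; uniqueness holds for a larger one
  set ρ := min (ra / 3) (min (min rb rc) (min rd rf)) with hρ
  have hρ0 : 0 < ρ := by positivity
  have hρa : 3 * ρ ≤ ra := by
    have : ρ ≤ ra / 3 := min_le_left _ _
    linarith
  have hρb : ρ ≤ rb := ((min_le_right _ _).trans (min_le_left _ _)).trans (min_le_left _ _)
  have hρc : ρ ≤ rc := ((min_le_right _ _).trans (min_le_left _ _)).trans (min_le_right _ _)
  have hρd : ρ ≤ rd := ((min_le_right _ _).trans (min_le_right _ _)).trans (min_le_left _ _)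
  have hρf : ρ ≤ rf := ((min_le_right _ _).trans (min_le_right _ _)).trans (min_le_right _ _)
  set re' := min re (ρ / ce) with hre'
  have hre'0 : 0 < re' := by positivity
  have hceρ : ce * re' ≤ ρ := by
    calc _ ≤ ce * (ρ / ce) := by gcongr; exact min_le_right _ _
      _ = _ := by field_simp
  set R := re' / 4 with hR
  have hR0 : 0 < R := by positivity
  set R₁ := re' / 2 with hR₁
  set r₀ := min (min (min qa qb) (min qc qg)) (min R (R / (2 * a))) with hr₀
  have hr₀0 : 0 < r₀ := by positivity
  have hr₀a : r₀ ≤ qa := ((min_le_left _ _).trans (min_le_left _ _)).trans (min_le_left _ _)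
  have hr₀b : r₀ ≤ qb := ((min_le_left _ _).trans (min_le_left _ _)).trans (min_le_right _ _)
  have hr₀c : r₀ ≤ qc := ((min_le_left _ _).trans (min_le_right _ _)).trans (min_le_left _ _)
  have hr₀g : r₀ ≤ qg := ((min_le_left _ _).trans (min_le_right _ _)).trans (min_le_right _ _)
  have hr₀R : r₀ ≤ R := (min_le_right _ _).trans (min_le_left _ _)
  have hr₀R' : r₀ ≤ R / (2 * a) := (min_le_right _ _).trans (min_le_right _ _)
  set f := leaf S p T U ρ with hf
  have hmemf : ∀ x₀ x, ‖p x - p x₀‖ < r₀ → ∀ v, ‖v‖ < R₁ →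
      p x₀ + v + f x₀ x v • U x₀ ∈ shadow S p T ρ x := by
    intro x₀ x hx v hv
    obtain ⟨t, -, ht⟩ := hex re' hre'0 (min_le_left _ _) x x₀ (p x₀ + v) (by
      rw [show p x₀ + v - p x = v - (p x - p x₀) by abel]
      exact (norm_sub_le _ _).trans (by linarith)) (hchart x x₀ (hx.trans_le hr₀g)).1
    exact Classical.epsilon_spec (p := fun t : ℝ => p x₀ + v + t • U x₀ ∈ shadow S p T ρ x)
      ⟨t, shadow_mono hceρ x ht⟩
  have huniq : ∀ x₀ x, ‖p x - p x₀‖ < r₀ → ∀ q (t t' : ℝ), q + t • U x₀ ∈ shadow S p T (3 * ρ) x →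
      q + t' • U x₀ ∈ shadow S p T (3 * ρ) x → t = t' := by
    intro x₀ x hx q t t' ht ht'
    have h1 := hlip x x₀ (hx.trans_le hr₀a) _ (shadow_mono hρa x ht) 0 (t' - t) (by
      rw [add_zero, sub_smul, add_add_sub_cancel]
      exact shadow_mono hρa x ht')
    rw [norm_zero, mul_zero] at h1
    have := abs_nonpos_iff.1 h1
    linarith
  have h3ρ : ρ ≤ 3 * ρ := by linarith
  have hinv : ∀ x, Function.invFun p (p x) = x := Function.leftInverse_invFun h.injp
  refine ⟨min ρ (R / (2 * a)), by positivity, fun ε₀ hε₀ => ⟨r₀, hr₀0, R, hR0,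
    fun b₀ b v => f (Function.invFun p b₀) (Function.invFun p b) v, ?_⟩⟩
  have hRR₁ : R < R₁ := by rw [hR, hR₁]; linarith
  have hball : ∀ {x₀ : X} {r : ℝ} (v : (σf (p x₀)).ker), v ∈ Metric.ball 0 r ↔ ‖(v : B)‖ < r :=
    fun v => by rw [mem_ball_zero_iff]; rfl
  have hunif := fun x₀ => uniform_fderiv (E := (σf (p x₀)).ker) (I := X)
    (F := fun x v => f x₀ x v) (J := {x | ‖p x - p x₀‖ < r₀}) hRR₁ (by
      intro ε hε
      obtain ⟨s, hs, h1⟩ := happ ε hε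
      refine ⟨s, hs, fun x hx v hv => ?_⟩
      rw [hball] at hv
      obtain ⟨ℓ, hℓ⟩ := h1 x x₀ (lt_of_lt_of_le hx hr₀b) _
        (shadow_mono hρb x (hmemf x₀ x hx v hv))
      refine ⟨ℓ.comp (Submodule.subtypeL _), fun v' hv' hvv => ?_⟩
      rw [hball] at hv'
      refine hℓ ((v' - v : (σf (p x₀)).ker) : B) _ ?_ hvv
      have e : p x₀ + v + f x₀ x v • U x₀ + ((v' - v : (σf (p x₀)).ker) : B)
          + (f x₀ x v' - f x₀ x v) • U x₀ = p x₀ + v' + f x₀ x v' • U x₀ := by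
        rw [Submodule.coe_sub, sub_smul]; abel
      rw [e]
      exact shadow_mono hρb x (hmemf x₀ x hx v' hv'))
  refine ⟨?_, ?_, ?_, ?_, ?_, ?_⟩
  · rintro _ ⟨x₀, rfl⟩ _ ⟨x, rfl⟩ hx
    simp only [hinv]
    exact (hunif x₀).1 x hx
  · rintro _ ⟨x, rfl⟩
    simp only [hinv]
    have hx : ‖p x - p x‖ < r₀ := by simpa using hr₀0
    have h0 : f x x 0 = 0 := huniq x x hx (p x) _ _
      (by simpa using shadow_mono h3ρ x (hmemf x x hx 0 (by simp; linarith)))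
      (by simpa using h.mem_shadow_self (by positivity) x)
    refine ⟨h0, HasFDerivAt.of_isLittleO (Asymptotics.isLittleO_iff.2 fun ε hε => ?_)⟩
    obtain ⟨s, hs, h1⟩ := htan ε hε
    filter_upwards [Metric.ball_mem_nhds (0 : (σf (p x)).ker) (show 0 < min s R₁ by positivity)]
      with v hv
    rw [hball] at hv
    have h2 := h1 x v (f x x v) (by
      have h3 : σf (p x) (v : B) = 0 := v.2
      exact (DFunLike.congr_fun (hσf x) (v : B)).symm.trans h3)
      (shadow_mono hρd x (hmemf x x hx v (hv.trans_le (min_le_right _ _)))) (hv.trans_le (min_le_left _ _))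
    simpa [h0] using h2
  · rintro ε hε hεε _ ⟨x₀, rfl⟩ _ ⟨x, rfl⟩ hx y hy
    simp only [stableGraph, hinv, hUf]
    have hys := h.localStable_subset_shadow ε x hy
    have hy0 : ‖y - p x‖ < ε := by simpa using mem_ball_iff_norm.1 (hys 0)
    set t := σ x₀ (ι (y - p x₀)) with ht
    obtain ⟨h1, h2⟩ := hdec x₀ (y - p x₀)
    rw [← ht] at h1 h2
    set v : (σf (p x₀)).ker := ⟨y - p x₀ - t • U x₀, by
      rw [LinearMap.mem_ker]; change σf (p x₀) _ = 0; rw [hσf]; exact h2⟩ with hv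
    have hvn : ‖(v : B)‖ < R := by
      have h3 : ‖y - p x₀‖ < ε + r₀ := by
        rw [show y - p x₀ = (y - p x) + (p x - p x₀) by abel]
        exact (norm_add_le _ _).trans_lt (by linarith)
      have h4 : ε ≤ R / (2 * a) := (hεε.trans hε₀).trans (min_le_right _ _)
      calc _ ≤ a * ‖y - p x₀‖ := h1
        _ < a * (R / (2 * a) + R / (2 * a)) := by gcongr; linarith
        _ = R := by field_simp; ring
    have e : y = p x₀ + v + t • U x₀ := by
      change y = p x₀ + (y - p x₀ - t • U x₀) + t • U x₀
      abel
    refine ⟨v, (hball v).2 hvn, ?_⟩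
    have h5 : t = f x₀ x v := huniq x₀ x hx (p x₀ + v) _ _ (by
      rw [← e]
      exact shadow_mono ((hεε.trans hε₀).trans ((min_le_left _ _).trans h3ρ)) x hys)
      (shadow_mono h3ρ x (hmemf x₀ x hx v (hvn.trans hRR₁)))
    rw [← h5]; exact e
  · intro ε hε hεε
    refine ⟨ε / cf, by positivity, ?_⟩
    rintro _ ⟨x₀, rfl⟩ _ ⟨x, rfl⟩ hx y ⟨⟨v, hv, hyv⟩, hyr⟩
    simp only [hinv, hUf] at hyv
    rw [hball] at hv
    have hys := shadow_mono hρf x (hmemf x₀ x hx v (hv.trans hRR₁))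
    rw [← hyv] at hys
    obtain ⟨h1, h2⟩ := hloc x y hys
    refine h2 ε fun n => ?_
    rw [mem_ball_iff_norm] at hyr ⊢
    rw [lt_div_iff₀ (by positivity)] at hyr
    have h3 : θ ^ n ≤ 1 := pow_le_one₀ hθ0.le hθ1.le
    calc _ ≤ cf * θ ^ n * ‖y - p x‖ := h1 n
      _ ≤ cf * 1 * ‖y - p x‖ := by gcongr
      _ < ε := by linarith
  · rintro _ ⟨x₀, rfl⟩ _ ⟨x, rfl⟩ _ ⟨x', rfl⟩ hx hx'
    simp only [hinv]
    rintro ⟨v, hv, hvv⟩ v' hv'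
    rw [hball] at hv hv'
    have h1 := hmemf x₀ x hx v (hv.trans hRR₁)
    have h2 := hmemf x₀ x' hx' v (hv.trans hRR₁)
    rw [← hvv] at h2
    -- the common point shows that the two orbits in the basic set stay close
    have h3 : ∀ n, ‖p (S^[n] x) - p (S^[n] x')‖ < 2 * ρ := fun n => by
      have h4 := mem_ball_iff_norm.1 (h1 n)
      have h5 := mem_ball_iff_norm.1 (h2 n)
      set z := T^[n] (p x₀ + v + f x₀ x v • U x₀)
      calc _ = ‖(z - p (S^[n] x')) - (z - p (S^[n] x))‖ := by rw [sub_sub_sub_cancel_left]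
        _ < _ := (norm_sub_le _ _).trans_lt (by linarith)
    refine huniq x₀ x' hx' (p x₀ + v') _ _ (fun n => ?_)
      (shadow_mono h3ρ x' (hmemf x₀ x' hx' v' (hv'.trans hRR₁)))
    have h4 := mem_ball_iff_norm.1 (hmemf x₀ x hx v' (hv'.trans hRR₁) n)
    rw [mem_ball_iff_norm]
    have h5 := norm_add_le (T^[n] (p x₀ + v' + f x₀ x v' • U x₀) - p (S^[n] x))
      (p (S^[n] x) - p (S^[n] x'))
    rw [sub_add_sub_cancel] at h5
    have := h3 n
    linarith
  · rintro _ ⟨x₀, rfl⟩ _ ⟨x, rfl⟩ hx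
    have hnh : 𝓝[range p] (p x) = Filter.map p (𝓝 x) :=
      ((h.contp.isClosedEmbedding h.injp).isEmbedding.map_nhds_eq x).symm
    have hopen : ∀ᶠ x' in 𝓝 x, ‖p x' - p x₀‖ < r₀ :=
      (isOpen_lt (h.contp.sub continuous_const).norm continuous_const).mem_nhds hx
    have hconv : TendstoUniformlyOn (fun x' (v : (σf (p x₀)).ker) => f x₀ x' v)
        (fun v => f x₀ x v) (𝓝 x) (Metric.ball 0 R₁) := by
      rw [Metric.tendstoUniformlyOn_iff]
      intro ε hε
      filter_upwards [hopen, hcont (ε / 2) (by positivity) x] with x' hx' hc v hv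
      rw [hball] at hv
      rw [Real.dist_eq]
      refine lt_of_le_of_lt (hc x₀ (lt_of_lt_of_le hx hr₀c) (p x₀ + v) _ _
        (shadow_mono hρc x (hmemf x₀ x hx v hv))
        (shadow_mono hρc x' (hmemf x₀ x' hx' v hv))) (by linarith)
    have hder := (hunif x₀).2 (𝓝 x) x hx hopen hconv
    rw [hnh]
    constructor
    · rw [Metric.tendstoUniformlyOn_iff] at hconv ⊢
      intro ε hε
      rw [eventually_map]
      filter_upwards [hconv ε hε] with x' hx' v hv
      simp only [hinv]
      exact hx' v (Metric.ball_subset_ball hRR₁.le hv)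
    · intro w hw
      rw [eventually_map]
      filter_upwards [hder w hw] with x' hx' v hv
      simp only [hinv]
      exact hx' v hv

end LocalModel

end Robust

namespace Robust

open scoped BoundedContinuousFunction Pointwise

/-! ### Superposition operators on spaces of functions vanishing at infinity -/

section Superposition

set_option linter.unusedSectionVars false

universe w

variable {Z : Type*} [TopologicalSpace Z] {A G : Type w} [NormedAddCommGroup A] [NormedSpace ℝ A]
  [NormedAddCommGroup G] [NormedSpace ℝ G] {H : Type*} [NormedAddCommGroup H] [NormedSpace ℝ H]

/-- The Banach space `C₀(Z, G)` of continuous functions vanishing at infinity, with the sup norm. -/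
def Vanishing (Z G : Type*) [TopologicalSpace Z] [NormedAddCommGroup G] : Type _ :=
  ZeroAtInftyContinuousMap Z G

namespace Vanishing

noncomputable instance : NormedAddCommGroup (Vanishing Z G) :=
  inferInstanceAs (NormedAddCommGroup (ZeroAtInftyContinuousMap Z G))

noncomputable instance : NormedSpace ℝ (Vanishing Z G) :=
  inferInstanceAs (NormedSpace ℝ (ZeroAtInftyContinuousMap Z G))

instance [CompleteSpace G] : CompleteSpace (Vanishing Z G) :=
  inferInstanceAs (CompleteSpace (ZeroAtInftyContinuousMap Z G))

instance : FunLike (Vanishing Z G) Z G :=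
  inferInstanceAs (FunLike (ZeroAtInftyContinuousMap Z G) Z G)

@[ext] lemma ext {f g : Vanishing Z G} (h : ∀ z, f z = g z) : f = g := DFunLike.ext f g h

lemma add_apply (f g : Vanishing Z G) (z : Z) : (f + g) z = f z + g z := rfl

lemma sub_apply (f g : Vanishing Z G) (z : Z) : (f - g) z = f z - g z := rfl

lemma smul_apply (c : ℝ) (f : Vanishing Z G) (z : Z) : (c • f) z = c • f z := rfl

lemma zero_apply (z : Z) : (0 : Vanishing Z G) z = 0 := rfl

@[continuity, fun_prop]
lemma continuous (f : Vanishing Z G) : Continuous f :=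
  ContinuousMap.continuous (ZeroAtInftyContinuousMap.toContinuousMap f)

lemma tendsto (f : Vanishing Z G) : Tendsto f (cocompact Z) (𝓝 0) := f.zero_at_infty'

/-- A continuous function vanishing at infinity as an element of `Vanishing Z G`. -/
def mk (f : Z → G) (h1 : Continuous f) (h2 : Tendsto f (cocompact Z) (𝓝 0)) : Vanishing Z G :=
  (⟨⟨f, h1⟩, h2⟩ : ZeroAtInftyContinuousMap Z G)

lemma mk_apply {f : Z → G} (h1 : Continuous f) (h2 : Tendsto f (cocompact Z) (𝓝 0)) (z : Z) :
    mk f h1 h2 z = f z := rfl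

/-- The function which `f` is, as a bounded continuous function. -/
noncomputable def toBCF (f : Vanishing Z G) : Z →ᵇ G := ZeroAtInftyContinuousMap.toBCF f

lemma toBCF_apply (f : Vanishing Z G) (z : Z) : f.toBCF z = f z := rfl

end Vanishing

lemma norm_apply_le_norm (f : Vanishing Z G) (z : Z) : ‖f z‖ ≤ ‖f‖ :=
  f.toBCF.norm_coe_le_norm z

lemma norm_le_of_forall_apply {f : Vanishing Z G} {c : ℝ} (hc : 0 ≤ c) (h : ∀ z, ‖f z‖ ≤ c) :
    ‖f‖ ≤ c :=
  (BoundedContinuousFunction.norm_le (f := f.toBCF) hc).2 h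

/-- The function `f` as an element of `Vanishing Z G`, with value `0` if it does not belong to that
space. -/
noncomputable def toVanishing (f : Z → G) : Vanishing Z G :=
  open Classical in
  if h : Continuous f ∧ Tendsto f (cocompact Z) (𝓝 0) then
    .mk f h.1 h.2 else 0

lemma toVanishing_apply {f : Z → G} (h1 : Continuous f) (h2 : Tendsto f (cocompact Z) (𝓝 0)) (z : Z) :
    toVanishing f z = f z := by
  rw [toVanishing, dif_pos ⟨h1, h2⟩]; rfl

lemma tendsto_apply_zero {W : Z → A →L[ℝ] G} {c : ℝ} (hW : ∀ z, ‖W z‖ ≤ c) {ξ : Z → A} {l : Filter Z}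
    (hξ : Tendsto ξ l (𝓝 0)) : Tendsto (fun z => W z (ξ z)) l (𝓝 0) := by
  refine squeeze_zero_norm (fun z => (W z).le_of_opNorm_le (hW z) _) ?_
  simpa using hξ.norm.const_mul c

/-- The inclusion of `Vanishing Z G` in the space of bounded continuous functions. -/
noncomputable def inclBCF : Vanishing Z G →L[ℝ] (Z →ᵇ G) :=
  ⟨⟨⟨fun f => f.toBCF, fun _ _ => rfl⟩, fun _ _ => rfl⟩,
    ZeroAtInftyContinuousMap.isometry_toBCF.continuous⟩

/-- The multiplication operator by a bounded function with values in a space `H` of operators, that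
is, in a space with a bounded bilinear pairing `H × A → G`. -/
noncomputable def multiplier (b : H →L[ℝ] A →L[ℝ] G) :
    (Z →ᵇ H) →L[ℝ] Vanishing Z A →L[ℝ] Vanishing Z G :=
  LinearMap.mkContinuous₂
    (LinearMap.mk₂ ℝ (fun (W : Z →ᵇ H) (ξ : Vanishing Z A) =>
      Vanishing.mk (fun z => b (W z) (ξ z)) (by fun_prop)
        (tendsto_apply_zero (fun z => (b.le_opNorm _).trans (mul_le_mul_of_nonneg_left
          (W.norm_coe_le_norm z) (norm_nonneg b))) ξ.tendsto))
      (fun W W' ξ => Vanishing.ext fun z => b.map_add₂ (W z) (W' z) (ξ z))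
      (fun c W ξ => Vanishing.ext fun z => b.map_smul₂ c (W z) (ξ z))
      (fun W ξ ζ => Vanishing.ext fun z => (b (W z)).map_add (ξ z) (ζ z))
      (fun c W ξ => Vanishing.ext fun z => (b (W z)).map_smul c (ξ z)))
    ‖b‖ (fun W ξ => norm_le_of_forall_apply
      (mul_nonneg (mul_nonneg (norm_nonneg b) (norm_nonneg W)) (norm_nonneg ξ)) fun z =>
        (b.le_opNorm₂ _ _).trans (mul_le_mul (mul_le_mul_of_nonneg_left (W.norm_coe_le_norm z)
          (norm_nonneg b)) (norm_apply_le_norm ξ z) (norm_nonneg _)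
          (mul_nonneg (norm_nonneg b) (norm_nonneg W))))

lemma multiplier_apply (b : H →L[ℝ] A →L[ℝ] G) (W : Z →ᵇ H) (ξ : Vanishing Z A) (z : Z) :
    multiplier b W ξ z = b (W z) (ξ z) := rfl

lemma contDiffOn_multiplier (b : H →L[ℝ] A →L[ℝ] G) {n : WithTop ℕ∞} {E : Type*}
    [NormedAddCommGroup E] [NormedSpace ℝ E] {s : Set E} {ψ : E → Vanishing Z H}
    (hψ : ContDiffOn ℝ n ψ s) (f : Z →ᵇ H) :
    ContDiffOn ℝ n (fun ξ => multiplier b ((ψ ξ).toBCF + f)) s := by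
  have h1 : ContDiffOn ℝ n (fun ξ => inclBCF (ψ ξ) + f) s :=
    (inclBCF.contDiff.comp_contDiffOn hψ).add contDiffOn_const
  exact (multiplier b).contDiff.comp_contDiffOn h1

/-- The superposition operator `ξ ↦ F ∘ (β + ξ) - F ∘ β`. -/
noncomputable def superposition (β : Z → A) (F : A → G) (ξ : Vanishing Z A) : Vanishing Z G :=
  toVanishing fun z => F (β z + ξ z) - F (β z)

variable {K O : Set A} {β : Z → A} {r : ℝ} {F : A → G}

lemma exists_uniform_of_isCompact (hO : IsOpen O) {Q : Set A} (hQ : IsCompact Q) (hQO : Q ⊆ O)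
    (hF : ContinuousOn F O) {ε : ℝ} (hε : 0 < ε) :
    ∃ s, 0 < s ∧ ∀ a ∈ Q, ∀ y, ‖y - a‖ < s → ‖F y - F a‖ < ε := by
  have h1 := hQ.uniformContinuousAt_of_continuousAt F
    (fun a ha => hF.continuousAt (hO.mem_nhds (hQO ha))) (Metric.dist_mem_uniformity hε)
  obtain ⟨s, hs, h2⟩ := Metric.mem_uniformity_dist.1 h1
  refine ⟨s, hs, fun a ha y hy => ?_⟩
  have := h2 (a := a) (b := y) (by rwa [dist_comm, dist_eq_norm]) ha
  rw [← dist_eq_norm, dist_comm]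
  exact this

section

variable (hO : IsOpen O) (hK : IsCompact K) (hβ : Continuous β) (hβK : ∀ z, β z ∈ K)
  (hr : ∀ a ∈ K, ∀ v, ‖v‖ < r → a + v ∈ O)
include hO hK hβ hβK hr

omit hO hβ in
/-- The values of `β + ξ` lie in a compact subset of the domain: this is where it matters that `ξ`
vanishes at infinity. -/
lemma exists_isCompact_range {ξ : Vanishing Z A} (hξ : ‖ξ‖ < r) :
    ∃ Q ⊆ O, IsCompact Q ∧ ∀ z, β z + ξ z ∈ Q := by
  refine ⟨K + insert 0 (range ξ), ?_, hK.add
    (ξ.tendsto.isCompact_insert_range_of_cocompact ξ.continuous), fun z =>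
    add_mem_add (hβK z) (Or.inr ⟨z, rfl⟩)⟩
  rintro _ ⟨a, ha, v, hv, rfl⟩
  refine hr a ha v ?_
  rcases hv with rfl | ⟨z, rfl⟩
  · rw [norm_zero]; exact (norm_nonneg _).trans_lt hξ
  · exact (norm_apply_le_norm ξ z).trans_lt hξ

lemma superposition_apply (hF : ContinuousOn F O) {ξ : Vanishing Z A} (hξ : ‖ξ‖ < r) (z : Z) :
    superposition β F ξ z = F (β z + ξ z) - F (β z) := by
  have hr0 : 0 < r := (norm_nonneg _).trans_lt hξ
  have hKO : K ⊆ O := fun a ha => by simpa using hr a ha 0 (by simpa using hr0)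
  obtain ⟨Q, hQO, -, hQ⟩ := exists_isCompact_range hK hβK hr hξ
  refine toVanishing_apply ?_ ?_ z
  · refine (hF.comp_continuous (hβ.add ξ.continuous) fun z => hQO (hQ z)).sub
      (hF.comp_continuous hβ fun z => hKO (hβK z))
  · rw [Metric.tendsto_nhds]
    intro ε hε
    obtain ⟨s, hs, h1⟩ := exists_uniform_of_isCompact hO hK hKO hF hε
    have h2 := Metric.tendsto_nhds.1 ξ.tendsto s hs
    filter_upwards [h2] with z hz
    rw [dist_zero_right] at hz ⊢
    exact h1 _ (hβK z) _ (by rwa [add_sub_cancel_left])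

lemma continuousOn_superposition (hF : ContinuousOn F O) :
    ContinuousOn (superposition β F) (Metric.ball 0 r) := by
  intro ξ hξ
  rw [mem_ball_zero_iff] at hξ
  refine ContinuousAt.continuousWithinAt (Metric.continuousAt_iff.2 fun ε hε => ?_)
  obtain ⟨Q, hQO, hQc, hQ⟩ := exists_isCompact_range hK hβK hr hξ
  obtain ⟨s, hs, h1⟩ := exists_uniform_of_isCompact hO hQc hQO hF (half_pos hε)
  refine ⟨min s (r - ‖ξ‖), by have := sub_pos.2 hξ; positivity, fun ζ hζ => ?_⟩
  rw [dist_eq_norm] at hζ ⊢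
  have hζr : ‖ζ‖ < r := by
    have := norm_add_le (ζ - ξ) ξ
    rw [sub_add_cancel] at this
    linarith [hζ.trans_le (min_le_right _ _)]
  refine lt_of_le_of_lt (norm_le_of_forall_apply (half_pos hε).le fun z => ?_) (half_lt_self hε)
  rw [Vanishing.sub_apply, superposition_apply hO hK hβ hβK hr hF hξ,
    superposition_apply hO hK hβ hβK hr hF hζr, sub_sub_sub_cancel_right]
  refine (h1 _ (hQ z) _ ?_).le
  rw [add_sub_add_left_eq_sub]
  exact ((norm_apply_le_norm (ζ - ξ) z).trans_lt hζ).trans_le (min_le_left _ _)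

/-- A continuous function on the domain, composed with `β`, is bounded. -/
lemma exists_bounded_base (hr0 : 0 < r) (hF : ContinuousOn F O) : ∃ f : Z →ᵇ G, ∀ z, f z = F (β z) := by
  have hKO : K ⊆ O := fun a ha => by simpa using hr a ha 0 (by simpa using hr0)
  obtain ⟨M, hM⟩ := (hK.image_of_continuousOn (hF.mono hKO)).isBounded.exists_norm_le
  exact ⟨BoundedContinuousFunction.ofNormedAddCommGroup (fun z => F (β z))
    (hF.comp_continuous hβ fun z => hKO (hβK z)) M fun z => hM _ ⟨_, hβK z, rfl⟩, fun z => rfl⟩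

/-- The derivative at `ξ` is the multiplication by `F' (β z + ξ z)`, written as the sum of a function
vanishing at infinity and of the bounded function `F' ∘ β`. -/
lemma hasFDerivAt_superposition (hF : ContDiffOn ℝ 1 F O) {f' : Z →ᵇ (A →L[ℝ] G)}
    (hf' : ∀ z, f' z = fderiv ℝ F (β z)) {ξ : Vanishing Z A} (hξ : ‖ξ‖ < r) :
    HasFDerivAt (superposition β F)
      (multiplier (.id ℝ (A →L[ℝ] G)) ((superposition β (fderiv ℝ F) ξ).toBCF + f')) ξ := by
  have hF' : ContinuousOn (fderiv ℝ F) O := hF.continuousOn_fderiv_of_isOpen hO le_rfl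
  refine HasFDerivAt.of_isLittleO (Asymptotics.isLittleO_iff.2 fun ε hε => ?_)
  obtain ⟨Q, hQO, hQc, hQ⟩ := exists_isCompact_range hK hβK hr hξ
  obtain ⟨s, hs, h1⟩ := exists_uniform_of_isCompact hO hQc hQO hF' hε
  obtain ⟨s', hs', h2⟩ : ∃ s', 0 < s' ∧ ∀ a ∈ Q, Metric.ball a s' ⊆ O := by
    obtain ⟨s', hs', h2⟩ := hQc.exists_thickening_subset_open hO hQO
    exact ⟨s', hs', fun a ha => (Metric.ball_subset_thickening ha s').trans h2⟩
  have hpos : 0 < min (min s s') (r - ‖ξ‖) := by have := sub_pos.2 hξ; positivity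
  filter_upwards [Metric.ball_mem_nhds ξ hpos] with ζ hζ
  rw [mem_ball_iff_norm] at hζ
  have hζr : ‖ζ‖ < r := by
    have := norm_add_le (ζ - ξ) ξ
    rw [sub_add_cancel] at this
    linarith [hζ.trans_le (min_le_right _ _)]
  refine norm_le_of_forall_apply (by positivity) fun z => ?_
  rw [Vanishing.sub_apply, Vanishing.sub_apply, multiplier_apply,
    superposition_apply hO hK hβ hβK hr hF.continuousOn hξ,
    superposition_apply hO hK hβ hβK hr hF.continuousOn hζr, sub_sub_sub_cancel_right,
    BoundedContinuousFunction.add_apply, hf']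
  have e : (superposition β (fderiv ℝ F) ξ).toBCF z + fderiv ℝ F (β z)
      = fderiv ℝ F (β z + ξ z) := by
    change superposition β (fderiv ℝ F) ξ z + _ = _
    rw [superposition_apply hO hK hβ hβK hr hF' hξ, sub_add_cancel]
  rw [e]
  set a := β z + ξ z with ha
  have hd : ‖β z + ζ z - a‖ ≤ ‖ζ - ξ‖ := by
    rw [ha, add_sub_add_left_eq_sub]; exact norm_apply_le_norm (ζ - ξ) z
  have hlt := hd.trans_lt (hζ.trans_le (min_le_left _ _))
  have hpos' : 0 < min s s' := by positivity
  have h3 := (convex_ball a (min s s')).norm_image_sub_le_of_norm_fderiv_le' (f := F)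
    (φ := fderiv ℝ F a) (C := ε) (x := a) (y := β z + ζ z)
    (fun y hy => (hF.differentiableOn one_ne_zero).differentiableAt (hO.mem_nhds
      (h2 a (hQ z) (Metric.ball_subset_ball (min_le_right _ _) hy))))
    (fun y hy => (h1 a (hQ z) y (mem_ball_iff_norm.1
      (Metric.ball_subset_ball (min_le_left _ _) hy))).le)
    (Metric.mem_ball_self hpos') (mem_ball_iff_norm.2 hlt)
  rw [ha, add_sub_add_left_eq_sub] at h3
  refine h3.trans ?_
  gcongr
  exact norm_apply_le_norm (ζ - ξ) z

end

/-- The superposition operator of a function of class `C^j` is of class `C^j`. -/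
theorem contDiffOn_superposition (hO : IsOpen O) (hK : IsCompact K) (hβ : Continuous β)
    (hβK : ∀ z, β z ∈ K) (hr0 : 0 < r) (hr : ∀ a ∈ K, ∀ v, ‖v‖ < r → a + v ∈ O) (j : ℕ) :
    ∀ {G : Type w} [NormedAddCommGroup G] [NormedSpace ℝ G] {F : A → G}, ContDiffOn ℝ j F O →
      ContDiffOn ℝ j (superposition β F) (Metric.ball 0 r) := by
  induction j with
  | zero =>
    intro G _ _ F hF
    rw [Nat.cast_zero, contDiffOn_zero] at hF ⊢
    exact continuousOn_superposition hO hK hβ hβK hr hF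
  | succ j ih =>
    intro G _ _ F hF
    have h1 : ContDiffOn ℝ 1 F O := hF.of_le (by
      rw [Nat.cast_add, Nat.cast_one]; exact le_add_self)
    have hF' : ContinuousOn (fderiv ℝ F) O := h1.continuousOn_fderiv_of_isOpen hO le_rfl
    obtain ⟨f', hf'⟩ := exists_bounded_base hO hK hβ hβK hr hr0 hF'
    rw [Nat.cast_add, Nat.cast_one, contDiffOn_succ_iff_fderiv_of_isOpen Metric.isOpen_ball]
    rw [Nat.cast_add, Nat.cast_one, contDiffOn_succ_iff_fderiv_of_isOpen hO] at hF
    have hder : ∀ ξ ∈ Metric.ball (0 : Vanishing Z A) r, HasFDerivAt (superposition β F)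
        (multiplier (.id ℝ (A →L[ℝ] G)) ((superposition β (fderiv ℝ F) ξ).toBCF + f')) ξ := fun ξ hξ =>
      hasFDerivAt_superposition hO hK hβ hβK hr h1 hf' (mem_ball_zero_iff.1 hξ)
    refine ⟨fun ξ hξ => (hder ξ hξ).differentiableAt.differentiableWithinAt,
      fun h0 => absurd h0 (WithTop.coe_ne_top), ?_⟩
    have h2 := ih hF.2.2
    have h3 := contDiffOn_multiplier (.id ℝ (A →L[ℝ] G)) h2 f'
    exact h3.congr fun ξ hξ => (hder ξ hξ).fderiv

end Superposition

end Robust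

namespace Robust

open scoped BoundedContinuousFunction Pointwise Nat NNReal ENNReal

/-! ### Superposition operators of real analytic functions -/

section Analytic

variable {A G : Type*} [NormedAddCommGroup A] [NormedSpace ℝ A]
  [NormedAddCommGroup G] [NormedSpace ℝ G]

/-- The Taylor series of `F` at the points of `s` satisfy a common Cauchy estimate and converge to
`F` on balls of a common radius. -/
def UniformlyAnalytic (F : A → G) (s : Set A) : Prop :=
  ∃ M r : ℝ, 0 < r ∧ ∀ a ∈ s, (∀ k, ‖iteratedFDeriv ℝ k F a‖ * r ^ k ≤ k ! * M) ∧
    ∀ y, ‖y‖ < r → HasSum (fun k => (k ! : ℝ)⁻¹ • iteratedFDeriv ℝ k F a fun _ => y) (F (a + y))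

lemma UniformlyAnalytic.mono {F : A → G} {s t : Set A} (h : UniformlyAnalytic F t) (hst : s ⊆ t) :
    UniformlyAnalytic F s := by
  obtain ⟨M, r, hr, h⟩ := h
  exact ⟨M, r, hr, fun a ha => h a (hst ha)⟩

lemma UniformlyAnalytic.union {F : A → G} {s t : Set A} (hs : UniformlyAnalytic F s)
    (ht : UniformlyAnalytic F t) : UniformlyAnalytic F (s ∪ t) := by
  obtain ⟨M, r, hr, h⟩ := hs
  obtain ⟨M', r', hr', h'⟩ := ht
  refine ⟨max M M', min r r', by positivity, fun a ha => ⟨fun k => ?_, fun y hy => ?_⟩⟩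
  · have hp : 0 ≤ min r r' := by positivity
    rcases ha with ha | ha
    · calc _ ≤ ‖iteratedFDeriv ℝ k F a‖ * r ^ k := by gcongr; exact min_le_left _ _
        _ ≤ k ! * M := (h a ha).1 k
        _ ≤ _ := by gcongr; exact le_max_left _ _
    · calc _ ≤ ‖iteratedFDeriv ℝ k F a‖ * r' ^ k := by gcongr; exact min_le_right _ _
        _ ≤ k ! * M' := (h' a ha).1 k
        _ ≤ _ := by gcongr; exact le_max_right _ _
  · rcases ha with ha | ha
    · exact (h a ha).2 y (hy.trans_le (min_le_left _ _))
    · exact (h' a ha).2 y (hy.trans_le (min_le_right _ _))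

/-- The Taylor series at the points near `a₀` are obtained from the one at `a₀` by changing the origin,
which gives common bounds. -/
lemma exists_uniformlyAnalytic_ball [CompleteSpace G] {F : A → G} {a₀ : A} (h : AnalyticAt ℝ F a₀) :
    ∃ ρ > 0, UniformlyAnalytic F (Metric.ball a₀ ρ) := by
  obtain ⟨p, R, hp⟩ := h
  obtain ⟨ρ, hρ0, hρR⟩ := ENNReal.lt_iff_exists_nnreal_btwn.1 (ENNReal.half_pos hp.r_pos.ne')
  have hρ : 0 < ρ := by exact_mod_cast hρ0
  have h2ρ : (ρ : ℝ≥0∞) + ρ < R := by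
    rw [← ENNReal.add_halves R]; exact ENNReal.add_lt_add hρR hρR
  have hsum := p.changeOriginSeries_summable_aux₁ (h2ρ.trans_le hp.r_le)
  -- the sum which bounds the coefficients of all the series obtained by moving the origin by at
  -- most `ρ`, times the powers of `ρ`
  set S : ℝ≥0 := ∑' s : Σ k l : ℕ, { s : Finset (Fin (k + l)) // s.card = l },
    ‖p (s.1 + s.2.1)‖₊ * ρ ^ s.2.1 * ρ ^ s.1 with hS
  refine ⟨ρ, by exact_mod_cast hρ, S, ρ, by exact_mod_cast hρ, fun a ha => ?_⟩
  have hx : ‖a - a₀‖₊ ≤ ρ := by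
    rw [mem_ball_iff_norm] at ha; exact_mod_cast ha.le
  have hxR : (‖a - a₀‖₊ : ℝ≥0∞) < R := by
    refine lt_of_le_of_lt ?_ h2ρ
    exact (ENNReal.coe_le_coe.2 hx).trans le_self_add
  have hq := hp.changeOrigin hxR
  rw [add_sub_cancel] at hq
  have hbound : ∀ k, ‖p.changeOrigin (a - a₀) k‖ * (ρ : ℝ) ^ k ≤ S := by
    intro k
    have h1 : ‖p.changeOrigin (a - a₀) k‖₊ * ρ ^ k ≤ S := by
      have h2 : Summable fun s : Σ l : ℕ, { s : Finset (Fin (k + l)) // s.card = l } =>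
          ‖p (k + s.1)‖₊ * ρ ^ s.1 := p.changeOriginSeries_summable_aux₂
        (lt_of_le_of_lt le_self_add (h2ρ.trans_le hp.r_le)) k
      calc _ ≤ (∑' s : Σ l : ℕ, { s : Finset (Fin (k + l)) // s.card = l },
              ‖p (k + s.1)‖₊ * ‖a - a₀‖₊ ^ s.1) * ρ ^ k := by
            gcongr
            exact p.nnnorm_changeOrigin_le k (hxR.trans_le hp.r_le)
        _ ≤ (∑' s : Σ l : ℕ, { s : Finset (Fin (k + l)) // s.card = l },
              ‖p (k + s.1)‖₊ * ρ ^ s.1) * ρ ^ k := by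
            gcongr ?_ * _
            have h3 : ∀ s : Σ l : ℕ, { s : Finset (Fin (k + l)) // s.card = l },
                ‖p (k + s.1)‖₊ * ‖a - a₀‖₊ ^ s.1 ≤ ‖p (k + s.1)‖₊ * ρ ^ s.1 := fun s => by gcongr
            exact (NNReal.summable_of_le h3 h2).tsum_le_tsum h3 h2
        _ = ∑' s : Σ l : ℕ, { s : Finset (Fin (k + l)) // s.card = l },
              ‖p (k + s.1)‖₊ * ρ ^ s.1 * ρ ^ k := (NNReal.tsum_mul_right _ _).symm
        _ ≤ S := NNReal.tsum_comp_le_tsum_of_inj hsum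
            (i := fun s : Σ l : ℕ, { s : Finset (Fin (k + l)) // s.card = l } => ⟨k, s⟩)
            (fun s s' h => by simpa using h)
    exact_mod_cast h1
  refine ⟨fun k => ?_, fun y hy => hq.hasSum_iteratedFDeriv ?_⟩
  · have h4 : ‖iteratedFDeriv ℝ k F a‖ ≤ k ! * ‖p.changeOrigin (a - a₀) k‖ := by
      refine ContinuousMultilinearMap.opNorm_le_bound (by positivity) fun v => ?_
      rw [hq.iteratedFDeriv_eq_sum_of_completeSpace]
      refine (norm_sum_le _ _).trans ?_
      calc _ ≤ ∑ _e : Equiv.Perm (Fin k), ‖p.changeOrigin (a - a₀) k‖ * ∏ i, ‖v i‖ := by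
            refine Finset.sum_le_sum fun e _ => ?_
            refine ((p.changeOrigin (a - a₀) k).le_opNorm _).trans_eq ?_
            rw [Equiv.prod_comp e (fun i => ‖v i‖)]
        _ = _ := by
            rw [Finset.sum_const, Finset.card_univ, Fintype.card_perm, Fintype.card_fin, nsmul_eq_mul,
              mul_assoc]
    calc _ ≤ (k ! * ‖p.changeOrigin (a - a₀) k‖) * (ρ : ℝ) ^ k := by gcongr
      _ = k ! * (‖p.changeOrigin (a - a₀) k‖ * (ρ : ℝ) ^ k) := by ring
      _ ≤ _ := by gcongr; exact hbound k
  · rw [mem_eball_zero_iff]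
    refine lt_tsub_iff_right.2 (lt_of_le_of_lt ?_ h2ρ)
    refine add_le_add ?_ (ENNReal.coe_le_coe.2 hx)
    have : ‖y‖₊ ≤ ρ := by exact_mod_cast hy.le
    exact_mod_cast this

theorem uniformlyAnalytic_of_isCompact [CompleteSpace G] {F : A → G} {O K : Set A} (hO : IsOpen O)
    (hF : ContDiffOn ℝ ω F O) (hK : IsCompact K) (hKO : K ⊆ O) : UniformlyAnalytic F K := by
  refine hK.induction_on (p := UniformlyAnalytic F) ⟨0, 1, one_pos, by simp⟩
    (fun _ _ hst ht => ht.mono hst) (fun _ _ => UniformlyAnalytic.union) fun a ha => ?_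
  obtain ⟨ρ, hρ, h⟩ := exists_uniformlyAnalytic_ball
    ((hF.contDiffAt (hO.mem_nhds (hKO ha))).analyticAt)
  exact ⟨_, mem_nhdsWithin_of_mem_nhds (Metric.ball_mem_nhds a hρ), h⟩

variable {Z : Type*} [TopologicalSpace Z]

/-- A bounded continuous family of multilinear maps acts pointwise on functions vanishing at infinity.
The maps have at least one argument, so that the result vanishes at infinity as well. -/
lemma exists_multilinear_multiplier {k : ℕ} {W : Z → A [×(k + 1)]→L[ℝ] G} (hW : Continuous W)
    {c : ℝ} (hc : 0 ≤ c) (hWc : ∀ z, ‖W z‖ ≤ c) :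
    ∃ q : Vanishing Z A [×(k + 1)]→L[ℝ] Vanishing Z G, ‖q‖ ≤ c ∧ ∀ ξ z, q ξ z = W z fun i => ξ i z := by
  have happ : ∀ (ξ : Fin (k + 1) → Vanishing Z A) (z : Z),
      toVanishing (fun z => W z fun i => ξ i z) z = W z fun i => ξ i z := by
    intro ξ z
    refine toVanishing_apply (by fun_prop) ?_ z
    have h0 := (ξ 0).tendsto.norm.const_mul (c * ∏ i : Fin k, ‖ξ i.succ‖)
    rw [norm_zero, mul_zero] at h0
    refine squeeze_zero_norm (fun z => ?_) h0
    refine ((W z).le_of_opNorm_le (hWc z) _).trans ?_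
    rw [Fin.prod_univ_succ, mul_assoc, mul_comm ‖ξ 0 z‖]
    refine mul_le_mul_of_nonneg_left (mul_le_mul_of_nonneg_right ?_ (norm_nonneg _)) hc
    exact Finset.prod_le_prod (fun _ _ => norm_nonneg _) fun i _ => norm_apply_le_norm _ _
  have hupd : ∀ [DecidableEq (Fin (k + 1))] (ξ : Fin (k + 1) → Vanishing Z A) (i : Fin (k + 1))
      (x : Vanishing Z A) (z : Z), (fun l => Function.update ξ i x l z)
        = Function.update (fun l => ξ l z) i (x z) := by
    intro _ ξ i x z
    funext l
    by_cases h : l = i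
    · subst h; simp
    · simp [h]
  refine ⟨MultilinearMap.mkContinuous
    { toFun := fun ξ => toVanishing fun z => W z fun i => ξ i z
      map_update_add' := fun ξ i x y => Vanishing.ext fun z => ?_
      map_update_smul' := fun ξ i s x => Vanishing.ext fun z => ?_ } c fun ξ => ?_,
    MultilinearMap.mkContinuous_norm_le _ hc _, happ⟩
  · rw [Vanishing.add_apply, happ, happ, happ, hupd, hupd, hupd]
    exact (W z).map_update_add _ i _ _
  · rw [Vanishing.smul_apply, happ, happ, hupd, hupd]
    exact (W z).map_update_smul _ i _ _
  · refine norm_le_of_forall_apply (by positivity) fun z => ?_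
    change ‖toVanishing (fun z => W z fun i => ξ i z) z‖ ≤ _
    rw [happ]
    refine ((W z).le_of_opNorm_le (hWc z) _).trans (mul_le_mul_of_nonneg_left ?_ hc)
    exact Finset.prod_le_prod (fun _ _ => norm_nonneg _) fun i _ => norm_apply_le_norm _ _

end Analytic

section

universe w

variable {Z : Type*} [TopologicalSpace Z] {A G : Type w} [NormedAddCommGroup A] [NormedSpace ℝ A]
  [NormedAddCommGroup G] [NormedSpace ℝ G]

/-- The superposition operator of a real analytic function is real analytic at the origin: its
Taylor series is assembled from those of the function along `β`. -/
theorem contDiffAt_superposition_omega [CompleteSpace G] {K O : Set A} {β : Z → A} {r : ℝ} {F : A → G}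
    (hO : IsOpen O) (hK : IsCompact K) (hβ : Continuous β) (hβK : ∀ z, β z ∈ K) (hr0 : 0 < r)
    (hr : ∀ a ∈ K, ∀ v, ‖v‖ < r → a + v ∈ O) (hF : ContDiffOn ℝ ω F O) :
    ContDiffAt ℝ ω (superposition β F) 0 := by
  have hKO : K ⊆ O := fun a ha => by simpa using hr a ha 0 (by simpa using hr0)
  obtain ⟨M₀, t, ht, hM₀⟩ := uniformlyAnalytic_of_isCompact hO hF hK hKO
  obtain ⟨M, hM0, hM⟩ : ∃ M, 0 ≤ M ∧ ∀ a ∈ K, ∀ k, ‖iteratedFDeriv ℝ k F a‖ * t ^ k ≤ k ! * M :=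
    ⟨max M₀ 0, le_max_right _ _, fun a ha k => ((hM₀ a ha).1 k).trans (by
      gcongr; exact le_max_left _ _)⟩
  have hser := fun a ha => (hM₀ a ha).2
  have hbd : ∀ z k, ‖((k ! : ℝ)⁻¹ • iteratedFDeriv ℝ k F (β z))‖ ≤ M * (t ^ k)⁻¹ := by
    intro z k
    have := hM _ (hβK z) k
    rw [norm_smul, norm_inv, Real.norm_of_nonneg (by positivity), ← div_eq_mul_inv,
      le_div_iff₀ (by positivity), mul_assoc, inv_mul_le_iff₀ (by positivity)]
    exact this
  have hcont : ∀ k : ℕ, Continuous fun z => (k ! : ℝ)⁻¹ • iteratedFDeriv ℝ k F (β z) := by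
    intro k
    suffices h0 : Continuous fun z => iteratedFDeriv ℝ k F (β z) by
      exact (lipschitzWith_smul (β := A [×k]→L[ℝ] G) ((k ! : ℝ)⁻¹)).continuous.comp h0
    rw [continuous_iff_continuousAt]
    intro z
    have h1 : ContinuousAt (iteratedFDeriv ℝ k F) (β z) :=
      ((hF.contDiffAt (hO.mem_nhds (hKO (hβK z)))).iteratedFDeriv_right (m := 0) (i := k)
        le_top).continuousAt
    exact ContinuousAt.comp_of_eq h1 hβ.continuousAt rfl
  choose q hq1 hq2 using fun k : ℕ => exists_multilinear_multiplier (A := A) (G := G)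
    (hcont (k + 1))
    (by positivity : 0 ≤ M * (t ^ (k + 1))⁻¹) (fun z => hbd z (k + 1))
  -- there is no constant term, since the superposition operator maps `0` to `0`
  let Q : FormalMultilinearSeries ℝ (Vanishing Z A) (Vanishing Z G) := fun k => Nat.casesOn k 0 q
  have hQ0 : Q 0 = 0 := rfl
  have hQs : ∀ k, Q (k + 1) = q k := fun k => rfl
  have hQn : ∀ k, ‖Q k‖ ≤ M * (t ^ k)⁻¹ := by
    intro k
    cases k with
    | zero => rw [hQ0, norm_zero]; positivity
    | succ k => exact hq1 k
  have hpos : 0 < min t r := by positivity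
  have hball : HasFPowerSeriesOnBall (superposition β F) Q 0 (min t r).toNNReal := by
    refine ⟨Q.le_radius_of_bound M fun k => ?_, by
      exact_mod_cast Real.toNNReal_pos.2 hpos, fun {ξ} hξ => ?_⟩
    · rw [Real.coe_toNNReal _ hpos.le]
      calc _ ≤ (M * (t ^ k)⁻¹) * t ^ k := by
            gcongr
            · exact hQn k
            · exact min_le_left _ _
        _ = M := by field_simp
    · have hξ' : ‖ξ‖ < min t r := by
        rw [mem_eball_zero_iff, ← ofReal_norm, ← ENNReal.ofReal,
          ENNReal.ofReal_lt_ofReal_iff hpos] at hξ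
        exact hξ
      have hξt := hξ'.trans_le (min_le_left _ _)
      have hξr := hξ'.trans_le (min_le_right _ _)
      rw [zero_add]
      have hsm : Summable fun k => Q k fun _ => ξ := by
        have hg : Summable fun k : ℕ => M * (‖ξ‖ / t) ^ k :=
          (summable_geometric_of_lt_one (by positivity) ((div_lt_one ht).2 hξt)).mul_left M
        refine hg.of_norm_bounded fun k => ?_
        refine ((Q k).le_opNorm _).trans ?_
        rw [Finset.prod_const, Finset.card_univ, Fintype.card_fin, div_pow]
        calc _ ≤ (M * (t ^ k)⁻¹) * ‖ξ‖ ^ k := by gcongr; exact hQn k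
          _ = _ := by ring
      have hval : superposition β F ξ = ∑' k, Q k fun _ => ξ := by
        refine Vanishing.ext fun z => ?_
        rw [superposition_apply hO hK hβ hβK hr hF.continuousOn hξr]
        have h1 : HasSum (fun k => (Q k fun _ => ξ) z) ((∑' k, Q k fun _ => ξ) z) := by
          let ev : Vanishing Z G →+ G := ⟨⟨fun f => f z, rfl⟩, fun _ _ => rfl⟩
          have hev : Continuous ev := by
            refine AddMonoidHomClass.continuous_of_bound ev 1 fun f => ?_
            rw [one_mul]; exact norm_apply_le_norm f z
          exact hsm.hasSum.map ev hev
        have h2 := hser _ (hβK z) (ξ z) ((norm_apply_le_norm ξ z).trans_lt hξt)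
        have h3 := (hasSum_nat_add_iff' 1).2 h2
        have h4 := (hasSum_nat_add_iff' 1).2 h1
        rw [Finset.sum_range_one] at h3 h4
        have h5 : (fun k => (Q (k + 1) fun _ => ξ) z)
            = fun k => ((k + 1)! : ℝ)⁻¹ • iteratedFDeriv ℝ (k + 1) F (β z) fun _ => ξ z := by
          funext k
          rw [hQs, hq2]; rfl
        rw [h5] at h4
        have h6 := h3.unique h4
        have h7 : ((Q 0 fun _ => ξ) : Vanishing Z G) z = 0 := by rw [hQ0]; rfl
        rw [h7, sub_zero] at h6
        rw [← h6]
        simp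
      rw [hval]
      exact hsm.hasSum
  exact hball.analyticAt.contDiffAt

end

end Robust

namespace Robust

open scoped BoundedContinuousFunction

/-! ### The linearized equation for backward orbits -/

lemma isUnit_one_sub_of_pow {R : Type*} [NormedRing R] [CompleteSpace R] {a : R} {k : ℕ}
    (h : ‖a ^ k‖ < 1) : IsUnit (1 - a) := by
  have h1 := isUnit_one_sub_of_norm_lt_one h
  rw [← mul_neg_geom_sum] at h1
  refine ((Commute.isUnit_mul_iff ?_).1 h1).1
  rw [Commute, SemiconjBy, mul_neg_geom_sum, geom_sum_mul_neg]

section Shift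

variable {Z₀ A : Type*} [TopologicalSpace Z₀] [CompactSpace Z₀] [NormedAddCommGroup A]
  [NormedSpace ℝ A]

lemma cocompact_prod_nat : cocompact (Z₀ × ℕ) = comap Prod.snd atTop := by
  rw [← Filter.coprod_cocompact, Filter.cocompact_eq_bot, bot_coprod, cocompact_eq_atTop]

omit [NormedSpace ℝ A] in
lemma tendsto_cocompact_prod_nat {f : Z₀ × ℕ → A} {g : ℕ → ℝ} (hg : Tendsto g atTop (𝓝 0))
    (h : ∀ z, ‖f z‖ ≤ g z.2) : Tendsto f (cocompact (Z₀ × ℕ)) (𝓝 0) := by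
  rw [cocompact_prod_nat]
  exact squeeze_zero_norm h (hg.comp tendsto_comap)

/-- The shift `η ↦ ((z, m) ↦ η (z, m + 1))`. -/
noncomputable def shiftLeft : Vanishing (Z₀ × ℕ) A →L[ℝ] Vanishing (Z₀ × ℕ) A :=
  LinearMap.mkContinuous
    { toFun := fun η => .mk (fun z => η (z.1, z.2 + 1)) (by fun_prop) (by
        have h := η.tendsto
        rw [cocompact_prod_nat] at h ⊢
        refine h.comp (tendsto_comap_iff.2 ?_)
        exact (tendsto_add_atTop_nat 1).comp tendsto_comap)
      map_add' := fun _ _ => rfl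
      map_smul' := fun _ _ => rfl } 1 fun η => by
        rw [one_mul]
        exact norm_le_of_forall_apply (norm_nonneg _) fun z => norm_apply_le_norm η _

lemma shiftLeft_apply (η : Vanishing (Z₀ × ℕ) A) (z : Z₀) (m : ℕ) :
    shiftLeft η (z, m) = η (z, m + 1) := rfl

/-- The shift `η ↦ ((z, m) ↦ η (z, m - 1))`, with value `0` for `m = 0`. -/
noncomputable def shiftRight : Vanishing (Z₀ × ℕ) A →L[ℝ] Vanishing (Z₀ × ℕ) A :=
  have hc : ∀ η : Vanishing (Z₀ × ℕ) A,
      Continuous fun z : Z₀ × ℕ => (if z.2 = 0 then 0 else η (z.1, z.2 - 1) : A) := fun η => by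
    refine continuous_prod_of_discrete_right.2 fun m => ?_
    by_cases hm : m = 0
    · simp only [hm, if_true]; exact continuous_const
    · simp only [hm, if_false]; fun_prop
  LinearMap.mkContinuous
    { toFun := fun η => .mk (fun z => if z.2 = 0 then 0 else η (z.1, z.2 - 1)) (hc η) (by
        have h := η.tendsto
        rw [cocompact_prod_nat] at h ⊢
        have h1 : Tendsto (fun z : Z₀ × ℕ => η (z.1, z.2 - 1)) (comap Prod.snd atTop) (𝓝 0) := by
          refine h.comp (tendsto_comap_iff.2 ?_)
          exact (tendsto_sub_atTop_nat 1).comp tendsto_comap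
        refine h1.congr' ?_
        filter_upwards [tendsto_comap.eventually (eventually_gt_atTop 0)] with z hz
        rw [if_neg (Nat.pos_iff_ne_zero.1 hz)])
      map_add' := fun η ζ => Vanishing.ext fun z => by
        simp only [Vanishing.mk_apply, Vanishing.add_apply]; split_ifs <;> simp
      map_smul' := fun c η => Vanishing.ext fun z => by
        simp only [Vanishing.mk_apply, Vanishing.smul_apply, RingHom.id_apply]
        split_ifs <;> simp } 1 fun η => by
        rw [one_mul]
        refine norm_le_of_forall_apply (norm_nonneg _) fun z => ?_
        change ‖(if z.2 = 0 then 0 else η (z.1, z.2 - 1) : A)‖ ≤ _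
        split_ifs
        · simp
        · exact norm_apply_le_norm η _

lemma shiftRight_apply_zero (η : Vanishing (Z₀ × ℕ) A) (z : Z₀) : shiftRight η (z, 0) = 0 := rfl

lemma shiftRight_apply_succ (η : Vanishing (Z₀ × ℕ) A) (z : Z₀) (m : ℕ) :
    shiftRight η (z, m + 1) = η (z, m) := rfl

end Shift

lemma continuous_smulRight {X A G : Type*} [TopologicalSpace X] [NormedAddCommGroup A]
    [NormedSpace ℝ A] [NormedAddCommGroup G] [NormedSpace ℝ G] {s : X → A →L[ℝ] ℝ} {u : X → G}
    (hs : Continuous s) (hu : Continuous u) : Continuous fun x => (s x).smulRight (u x) :=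
  ((ContinuousLinearMap.smulRightL ℝ A G).continuous.comp hs).clm_apply hu

lemma exists_pointwise {Z A : Type*} [TopologicalSpace Z] [NormedAddCommGroup A] [NormedSpace ℝ A]
    {W : Z → A →L[ℝ] A} (hW : Continuous W) {c : ℝ} (hc : ∀ z, ‖W z‖ ≤ c) :
    ∃ M : Vanishing Z A →L[ℝ] Vanishing Z A, ∀ η z, M η z = W z (η z) :=
  ⟨multiplier (.id ℝ (A →L[ℝ] A)) (BoundedContinuousFunction.ofNormedAddCommGroup W hW c hc),
    fun _ _ => rfl⟩

lemma exists_norm_bound {X G : Type*} [TopologicalSpace X] [CompactSpace X] [NormedAddCommGroup G]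
    {f : X → G} (hf : Continuous f) : ∃ M : ℝ, 0 < M ∧ ∀ x, ‖f x‖ ≤ M := by
  obtain ⟨M, hM⟩ := (isCompact_range hf).isBounded.exists_norm_le
  exact ⟨max M 1, by positivity, fun x => (hM _ ⟨x, rfl⟩).trans (le_max_left _ _)⟩

section Linear

variable {X Z₀ A : Type*} [TopologicalSpace X] [CompactSpace X] [TopologicalSpace Z₀]
  [CompactSpace Z₀] [NormedAddCommGroup A] [NormedSpace ℝ A] [CompleteSpace A]
  {S : X → X} {L : X → A →L[ℝ] A} {u : X → A} {δ : X → ℝ} {s : X → A →L[ℝ] ℝ} {θ C₀ lam : ℝ}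
  {b : Z₀ → ℕ → X} {τ : Z₀ → A →L[ℝ] ℝ}

omit [TopologicalSpace X] [CompactSpace X] [TopologicalSpace Z₀] [CompactSpace Z₀]
  [CompleteSpace A] in
lemma component_iterate (hinv : ∀ x v, s (S x) (L x v) = δ x * s x v) (n : ℕ) (x : X) (v : A) :
    s (S^[n] x) (cocycle S L n x v) = growth S δ n x * s x v := by
  induction n with
  | zero => simp
  | succ n ih =>
    rw [cocycle_add, cocycle_one, Function.iterate_succ_apply', hinv, ih, growth_add, growth_one]
    ring

variable (hA : IsSplitCocycle S L u δ s θ C₀ lam) (hθ : θ < 1)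
  (hinv : ∀ x v, s (S x) (L x v) = δ x * s x v)
  (hb : ∀ z m, S (b z (m + 1)) = b z m)
include hA hθ hinv hb

omit [TopologicalSpace X] [CompactSpace X] [TopologicalSpace Z₀] [CompactSpace Z₀] [CompleteSpace A]
  hA hθ hinv in
lemma iterate_back (z : Z₀) (m n : ℕ) : S^[n] (b z (m + n)) = b z m := by
  induction n with
  | zero => rfl
  | succ n ih => rw [Function.iterate_succ_apply, ← add_assoc, hb, ih]

omit [TopologicalSpace X] [CompactSpace X] [CompactSpace Z₀] [CompleteSpace A] in
/-- A bounded solution of the homogeneous linear equation is determined by its unstable component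
at the end point. -/
lemma eq_zero_of_homogeneous {η : Vanishing (Z₀ × ℕ) A}
    (h1 : ∀ z m, η (z, m) = L (b z (m + 1)) (η (z, m + 1))) (h2 : ∀ z, s (b z 0) (η (z, 0)) = 0) :
    η = 0 := by
  have h3 : ∀ n z m, η (z, m) = cocycle S L n (b z (m + n)) (η (z, m + n)) := by
    intro n z m
    induction n with
    | zero => simp
    | succ n ih =>
      rw [ih, h1 z (m + n), cocycle_succ, ← add_assoc, hb]; rfl
  -- the stable component vanishes, because it is contracted from an arbitrarily distant past
  have h4 : ∀ z m, η (z, m) = s (b z m) (η (z, m)) • u (b z m) := by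
    intro z m
    obtain ⟨c, hc, hcon⟩ := hA.contract
    rw [← sub_eq_zero, ← norm_le_zero_iff]
    have h5 : ∀ n : ℕ, ‖η (z, m) - s (b z m) (η (z, m)) • u (b z m)‖ ≤ c * ‖η‖ * θ ^ n := by
      intro n
      have h6 := hcon n (b z (m + n)) (η (z, m + n))
      rw [map_sub, map_smul, cocycle_unstable hA.map, iterate_back hb, ← h3, smul_smul] at h6
      have h7 := component_iterate hinv n (b z (m + n)) (η (z, m + n))
      rw [iterate_back hb, ← h3] at h7
      rw [h7, mul_comm (growth _ _ _ _)]
      refine h6.trans ?_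
      have := norm_apply_le_norm η (z, m + n)
      have hθ0 := hA.rate_pos
      calc _ ≤ c * θ ^ n * ‖η‖ := by gcongr
        _ = _ := by ring
    have h8 : Tendsto (fun n : ℕ => c * ‖η‖ * θ ^ n) atTop (𝓝 (c * ‖η‖ * 0)) :=
      (tendsto_pow_atTop_nhds_zero_of_lt_one hA.rate_pos.le hθ).const_mul _
    rw [mul_zero] at h8
    exact ge_of_tendsto' h8 h5
  refine Vanishing.ext fun ⟨z, m⟩ => ?_
  rw [h4, Vanishing.zero_apply]
  have h5 := component_iterate hinv m (b z (0 + m)) (η (z, 0 + m))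
  rw [iterate_back hb, ← h3, h2, zero_add] at h5
  rcases mul_eq_zero.1 h5.symm with h6 | h6
  · exact absurd h6 (growth_pos hA.pos _ _).ne'
  · rw [h6, zero_smul]

variable (hbc : ∀ m, Continuous fun z => b z m) (hL : Continuous L) (hu : Continuous u)
  (hs : Continuous s) (hδ : Continuous δ)
include hbc hL hu hs hδ

/-- The inhomogeneous linear equation has a solution. -/
lemma exists_inhomogeneous (hS : Continuous S) (g : Vanishing (Z₀ × ℕ) A) :
    ∃ η : Vanishing (Z₀ × ℕ) A, ∀ z m, η (z, m) - L (b z (m + 1)) (η (z, m + 1)) = g (z, m) := by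
  have hbb : Continuous fun z : Z₀ × ℕ => b z.1 z.2 := continuous_prod_of_discrete_right.2 hbc
  obtain ⟨ML, -, hML⟩ := exists_norm_bound hL
  have hPc : Continuous fun x => ContinuousLinearMap.id ℝ A - (s x).smulRight (u x) :=
    continuous_const.sub (continuous_smulRight hs hu)
  obtain ⟨MP, -, hMP⟩ := exists_norm_bound hPc
  have hVc : Continuous fun x => ((δ x)⁻¹ • s (S x)).smulRight (u x) :=
    continuous_smulRight ((hδ.inv₀ fun x => (hA.pos x).ne').smul (hs.comp hS)) hu
  obtain ⟨MV, -, hMV⟩ := exists_norm_bound hVc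
  obtain ⟨WL, hWL⟩ := exists_pointwise (hL.comp hbb) (fun z => hML _)
  obtain ⟨PS, hPS⟩ := exists_pointwise (hPc.comp hbb) (fun z => hMP _)
  obtain ⟨WV, hWV⟩ := exists_pointwise (hVc.comp hbb) (fun z => hMV _)
  have hPS : ∀ η z m, PS η (z, m) = η (z, m) - s (b z m) (η (z, m)) • u (b z m) := by
    intro η z m; rw [hPS]; rfl
  obtain ⟨N, hN⟩ : ∃ N : Vanishing (Z₀ × ℕ) A →L[ℝ] Vanishing (Z₀ × ℕ) A, ∀ η z m,
      N η (z, m) = L (b z (m + 1))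
        (η (z, m + 1) - s (b z (m + 1)) (η (z, m + 1)) • u (b z (m + 1))) := by
    refine ⟨shiftLeft.comp (WL.comp PS), fun η z m => ?_⟩
    change shiftLeft (WL (PS η)) (z, m) = _
    rw [shiftLeft_apply, hWL, hPS]; rfl
  obtain ⟨V, hV0, hV⟩ : ∃ V : Vanishing (Z₀ × ℕ) A →L[ℝ] Vanishing (Z₀ × ℕ) A,
      (∀ η z, V η (z, 0) = 0) ∧ ∀ η z m, V η (z, m + 1)
        = ((δ (b z (m + 1)))⁻¹ * s (b z m) (η (z, m))) • u (b z (m + 1)) := by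
    refine ⟨WV.comp shiftRight, fun η z => ?_, fun η z m => ?_⟩
    · change WV (shiftRight η) (z, 0) = 0
      rw [hWV, shiftRight_apply_zero, map_zero]
    · change WV (shiftRight η) (z, m + 1) = _
      rw [hWV, shiftRight_apply_succ]
      simp [hb]
  obtain ⟨Q, hQ, hsQ⟩ := hA.bound
  obtain ⟨c, hc, hcon⟩ := hA.contract
  -- the powers of `N` are contractions, being given by the cocycle on the stable spaces
  have hNpow : ∀ j η z m, (N ^ (j + 1)) η (z, m) = cocycle S L (j + 1) (b z (m + (j + 1)))
      (η (z, m + (j + 1)) - s (b z (m + (j + 1))) (η (z, m + (j + 1))) •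
        u (b z (m + (j + 1)))) := by
    intro j
    induction j with
    | zero => intro η z m; rw [pow_one, hN, cocycle_one]
    | succ j ih =>
      intro η z m
      rw [pow_succ]
      change (N ^ (j + 1)) (N η) (z, m) = _
      rw [ih, hN]
      have e : m + (j + 1 + 1) = m + (j + 1) + 1 := by ring
      rw [e]
      generalize η (z, m + (j + 1) + 1) = v
      have h1 : s (b z (m + (j + 1))) (L (b z (m + (j + 1) + 1))
          (v - s (b z (m + (j + 1) + 1)) v • u (b z (m + (j + 1) + 1)))) = 0 := by
        have := hinv (b z (m + (j + 1) + 1)) (v - s (b z (m + (j + 1) + 1)) v •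
          u (b z (m + (j + 1) + 1)))
        rw [hb] at this
        rw [this, map_sub, map_smul, hA.one, smul_eq_mul, mul_one, sub_self, mul_zero]
      rw [h1, zero_smul, sub_zero, cocycle_succ S L (j + 1), hb]
      rfl
  have hVlow : ∀ j η z m, m ≤ j → (V ^ (j + 1)) η (z, m) = 0 := by
    intro j
    induction j with
    | zero => intro η z m hm; rw [Nat.le_zero.1 hm, pow_one, hV0]
    | succ j ih =>
      intro η z m hm
      rw [pow_succ']
      change V ((V ^ (j + 1)) η) (z, m) = 0
      cases m with
      | zero => rw [hV0]
      | succ m => rw [hV, ih η z m (by omega), map_zero, mul_zero, zero_smul]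
  have hVpow : ∀ j η z m, (V ^ (j + 1)) η (z, m + (j + 1))
      = ((growth S δ (j + 1) (b z (m + (j + 1))))⁻¹ * s (b z m) (η (z, m))) •
        u (b z (m + (j + 1))) := by
    intro j
    induction j with
    | zero => intro η z m; rw [pow_one, hV, growth_one]
    | succ j ih =>
      intro η z m
      rw [pow_succ']
      change V ((V ^ (j + 1)) η) (z, m + (j + 1) + 1) = _
      rw [hV, ih, map_smul, hA.one, smul_eq_mul, mul_one, ← mul_assoc, ← mul_inv]
      have e : m + (j + 1 + 1) = m + (j + 1) + 1 := by ring
      rw [e, show j + 1 + 1 = 1 + (j + 1) by ring, growth_add S δ 1, growth_one,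
        Function.iterate_one, hb]
  obtain ⟨j, hj⟩ : ∃ j : ℕ, ‖N ^ (j + 1)‖ < 1 := by
    have h1 : Tendsto (fun j : ℕ => c * θ ^ (j + 1)) atTop (𝓝 (c * 0)) :=
      ((tendsto_pow_atTop_nhds_zero_of_lt_one hA.rate_pos.le hθ).comp
        (tendsto_add_atTop_nat 1)).const_mul _
    rw [mul_zero] at h1
    obtain ⟨j, hj⟩ := (h1.eventually (gt_mem_nhds one_pos)).exists
    refine ⟨j, lt_of_le_of_lt (ContinuousLinearMap.opNorm_le_bound _ ?_ fun η => ?_) hj⟩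
    · have := hA.rate_pos; positivity
    · have hθ0 := hA.rate_pos
      refine norm_le_of_forall_apply (by positivity) fun ⟨z, m⟩ => ?_
      rw [hNpow]
      refine (hcon _ _ _).trans ?_
      gcongr
      exact norm_apply_le_norm _ _
  obtain ⟨i, hi⟩ : ∃ i : ℕ, ‖V ^ (i + 1)‖ < 1 := by
    have hl := hA.one_lt
    have hC := hA.const_pos
    have h1 : Tendsto (fun j : ℕ => C₀⁻¹ * Q * (lam⁻¹) ^ (j + 1)) atTop (𝓝 (C₀⁻¹ * Q * 0)) :=
      ((tendsto_pow_atTop_nhds_zero_of_lt_one (by positivity) (inv_lt_one_of_one_lt₀ hl)).comp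
        (tendsto_add_atTop_nat 1)).const_mul _
    rw [mul_zero] at h1
    obtain ⟨j, hj⟩ := (h1.eventually (gt_mem_nhds one_pos)).exists
    refine ⟨j, lt_of_le_of_lt (ContinuousLinearMap.opNorm_le_bound _ (by positivity) fun η => ?_) hj⟩
    refine norm_le_of_forall_apply (by positivity) fun ⟨z, m⟩ => ?_
    rcases le_or_gt m j with hm | hm
    · rw [hVlow j η z m hm, norm_zero]; positivity
    · obtain ⟨k, rfl⟩ : ∃ k, m = k + (j + 1) := ⟨m - (j + 1), by omega⟩
      rw [hVpow, norm_smul, norm_mul, norm_inv, Real.norm_of_nonneg (growth_pos hA.pos _ _).le]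
      have h2 := hA.lower (j + 1) (b z (k + (j + 1)))
      calc _ ≤ (C₀ * lam ^ (j + 1))⁻¹ * (Q * ‖η‖) * 1 := by
            gcongr
            · exact (hsQ _ _).trans (by gcongr; exact norm_apply_le_norm _ _)
            · exact hA.unit _
        _ = _ := by rw [mul_inv, inv_pow]; ring
  obtain ⟨e, he⟩ := (isUnit_one_sub_of_pow hj)
  obtain ⟨f, hf⟩ := (isUnit_one_sub_of_pow hi)
  have h1 : ((e⁻¹ : _ˣ) : Vanishing (Z₀ × ℕ) A →L[ℝ] Vanishing (Z₀ × ℕ) A) g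
      - N ((e⁻¹ : _ˣ).val g) = g := by
    have : ((1 - N) * (e⁻¹ : _ˣ).val) g = g := by rw [← he, Units.mul_inv]; rfl
    exact this
  have h2 : ((f⁻¹ : _ˣ) : Vanishing (Z₀ × ℕ) A →L[ℝ] Vanishing (Z₀ × ℕ) A) g
      - V ((f⁻¹ : _ˣ).val g) = g := by
    have : ((1 - V) * (f⁻¹ : _ˣ).val) g = g := by rw [← hf, Units.mul_inv]; rfl
    exact this
  set h : Vanishing (Z₀ × ℕ) A := (e⁻¹ : _ˣ).val g
  set k : Vanishing (Z₀ × ℕ) A := (f⁻¹ : _ˣ).val g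
  refine ⟨PS h - V k, fun z m => ?_⟩
  have e1 : h (z, m) - N h (z, m) = g (z, m) := by rw [← Vanishing.sub_apply, h1]
  have e2 : k (z, m) - V k (z, m) = g (z, m) := by rw [← Vanishing.sub_apply, h2]
  rw [hN] at e1
  rw [Vanishing.sub_apply, Vanishing.sub_apply, hPS, hPS, hV, map_sub (L _), map_smul, hA.map, hb,
    smul_smul, mul_right_comm, inv_mul_cancel₀ (hA.pos _).ne', one_mul]
  -- the unstable components of the two equations
  have e3 : s (b z m) (h (z, m)) = s (b z m) (g (z, m)) := by
    rw [← e1, map_sub (s (b z m))]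
    have := hinv (b z (m + 1)) (h (z, m + 1) - s (b z (m + 1)) (h (z, m + 1)) • u (b z (m + 1)))
    rw [hb, map_sub (s (b z (m + 1))), map_smul, hA.one, smul_eq_mul, mul_one, sub_self,
      mul_zero] at this
    rw [this, sub_zero]
  have e4 : s (b z m) (V k (z, m)) • u (b z m) = V k (z, m) := by
    cases m with
    | zero => rw [hV0, map_zero, zero_smul]
    | succ m => rw [hV, map_smul, hA.one, smul_eq_mul, mul_one]
  have e5 : s (b z m) (k (z, m)) = s (b z m) (g (z, m)) + s (b z m) (V k (z, m)) := by
    rw [← map_add, ← e2, sub_add_cancel]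
  rw [e3, e5, add_smul, e4]
  rw [← e1]
  rw [← e1] at e3
  abel

end Linear

/-! ### Existence of the unstable curves -/

open scoped BoundedContinuousFunction

section Linear

variable {X Z₀ A : Type*} [TopologicalSpace X] [CompactSpace X] [TopologicalSpace Z₀]
  [CompactSpace Z₀] [NormedAddCommGroup A] [NormedSpace ℝ A]
  {S : X → X} {L : X → A →L[ℝ] A} {u : X → A} {δ : X → ℝ} {s : X → A →L[ℝ] ℝ} {θ C₀ lam : ℝ}
  {b : Z₀ → ℕ → X} {τ : Z₀ → A →L[ℝ] ℝ}

omit [CompactSpace X] in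
/-- The solutions of the homogeneous linear equation in the unstable direction. -/
lemma exists_homogeneous (hA : IsSplitCocycle S L u δ s θ C₀ lam)
    (hbc : ∀ m, Continuous fun z => b z m) (hu : Continuous u) (hδ : Continuous δ)
    (hS : Continuous S) (a : Z₀ →ᵇ ℝ) :
    ∃ η : Vanishing (Z₀ × ℕ) A, ∀ z m,
      η (z, m) = (a z * (growth S δ m (b z m))⁻¹) • u (b z m) := by
  have hC := hA.const_pos
  have hl := hA.one_lt
  have hg : Tendsto (fun m : ℕ => ‖a‖ * C₀⁻¹ * (lam⁻¹) ^ m) atTop (𝓝 0) := by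
    rw [← mul_zero (‖a‖ * C₀⁻¹)]
    exact (tendsto_pow_atTop_nhds_zero_of_lt_one (by positivity)
      (inv_lt_one_of_one_lt₀ hl)).const_mul _
  have hcont : Continuous fun z : Z₀ × ℕ =>
      (a z.1 * (growth S δ z.2 (b z.1 z.2))⁻¹) • u (b z.1 z.2) := by
    refine continuous_prod_of_discrete_right.2 fun m => ?_
    have h1 : Continuous fun z => (growth S δ m (b z m))⁻¹ :=
      ((continuous_growth hS hδ m).comp (hbc m)).inv₀ fun z => (growth_pos hA.pos _ _).ne'
    exact (a.continuous.mul h1).smul (hu.comp (hbc m))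
  refine ⟨.mk _ hcont (tendsto_cocompact_prod_nat hg fun z => ?_), fun z m => rfl⟩
  rw [norm_smul, norm_mul, norm_inv, Real.norm_of_nonneg (growth_pos hA.pos _ _).le]
  have h2 := hA.lower z.2 (b z.1 z.2)
  calc _ ≤ ‖a‖ * (C₀ * lam ^ z.2)⁻¹ * 1 := by
        gcongr
        · exact inv_nonneg.2 (growth_pos hA.pos _ _).le
        · exact a.norm_coe_le_norm _
        · exact hA.unit _
    _ = _ := by rw [mul_inv, inv_pow]; ring

/-- The evaluation `η ↦ (z ↦ τ z (η (z, 0)))`. -/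
lemma exists_endpoint (hτ : Continuous τ) : ∃ κ : Vanishing (Z₀ × ℕ) A →L[ℝ] (Z₀ →ᵇ ℝ),
    ∀ η z, κ η z = τ z (η (z, 0)) := by
  obtain ⟨M, hM, hMτ⟩ := exists_norm_bound hτ
  refine ⟨LinearMap.mkContinuous
    { toFun := fun η => BoundedContinuousFunction.mkOfCompact ⟨fun z => τ z (η (z, 0)), by fun_prop⟩
      map_add' := fun η ζ => BoundedContinuousFunction.ext fun z =>
        (τ z).map_add (η (z, 0)) (ζ (z, 0))
      map_smul' := fun c η => BoundedContinuousFunction.ext fun z =>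
        (τ z).map_smul c (η (z, 0)) } M fun η => ?_, fun η z => rfl⟩
  refine (BoundedContinuousFunction.norm_le (by positivity)).2 fun z => ?_
  exact ((τ z).le_of_opNorm_le (hMτ z) _).trans (by gcongr; exact norm_apply_le_norm _ _)

/-- The linearization of the equation for backward orbits is an isomorphism. -/
lemma bijective_linearization [CompleteSpace A]
    (hA : IsSplitCocycle S L u δ s θ C₀ lam) (hθ : θ < 1)
    (hinv : ∀ x v, s (S x) (L x v) = δ x * s x v)
    (hb : ∀ z m, S (b z (m + 1)) = b z m) (hbc : ∀ m, Continuous fun z => b z m)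
    (hL : Continuous L) (hu : Continuous u) (hs : Continuous s) (hδ : Continuous δ)
    (hS : Continuous S) (hτ : Continuous τ) (hτ0 : ∀ z, 0 < τ z (u (b z 0)))
    {D : Vanishing (Z₀ × ℕ) A →L[ℝ] Vanishing (Z₀ × ℕ) A × (Z₀ →ᵇ ℝ)}
    (hD1 : ∀ η z m, (D η).1 (z, m) = η (z, m) - L (b z (m + 1)) (η (z, m + 1)))
    (hD2 : ∀ η z, (D η).2 z = τ z (η (z, 0))) :
    Function.Bijective D ∧ ∀ (a : Z₀ →ᵇ ℝ), ∃ η, D η = (0, a) ∧ ∀ z m, η (z, m)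
      = (a z * (τ z (u (b z 0)))⁻¹ * (growth S δ m (b z m))⁻¹) • u (b z m) := by
  have hker : ∀ a : Z₀ →ᵇ ℝ, ∃ η, D η = (0, a) ∧ ∀ z m, η (z, m)
      = (a z * (τ z (u (b z 0)))⁻¹ * (growth S δ m (b z m))⁻¹) • u (b z m) := by
    intro a
    have hc : Continuous fun z => a z * (τ z (u (b z 0)))⁻¹ := by
      refine a.continuous.mul (Continuous.inv₀ ?_ fun z => (hτ0 z).ne')
      exact hτ.clm_apply (hu.comp (hbc 0))
    obtain ⟨η, hη⟩ := exists_homogeneous hA hbc hu hδ hS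
      (BoundedContinuousFunction.mkOfCompact ⟨_, hc⟩)
    replace hη : ∀ z m, η (z, m)
      = (a z * (τ z (u (b z 0)))⁻¹ * (growth S δ m (b z m))⁻¹) • u (b z m) := hη
    refine ⟨η, Prod.ext (Vanishing.ext fun ⟨z, m⟩ => ?_)
      (BoundedContinuousFunction.ext fun z => ?_), hη⟩
    · rw [hD1, hη, hη, map_smul, hA.map, hb, smul_smul, add_comm m 1, growth_add, growth_one,
        Function.iterate_one, add_comm 1 m, hb, mul_inv, Vanishing.zero_apply, sub_eq_zero]
      congr 1
      have := (hA.pos (b z (m + 1))).ne'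
      field_simp
    · rw [hD2, hη, map_smul, growth_zero, inv_one, mul_one, smul_eq_mul, mul_assoc,
        inv_mul_cancel₀ (hτ0 z).ne', mul_one]
  refine ⟨⟨?_, fun y => ?_⟩, hker⟩
  · rw [injective_iff_map_eq_zero]
    intro η hη
    have h1 : ∀ z m, η (z, m) = L (b z (m + 1)) (η (z, m + 1)) := by
      intro z m
      rw [← sub_eq_zero, ← hD1, hη]; rfl
    have h2 : ∀ z, τ z (η (z, 0)) = 0 := by
      intro z
      rw [← hD2, hη]; rfl
    obtain ⟨a, ha⟩ : ∃ a : Z₀ →ᵇ ℝ, ∀ z, a z = s (b z 0) (η (z, 0)) * τ z (u (b z 0)) := by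
      refine ⟨BoundedContinuousFunction.mkOfCompact ⟨_, ?_⟩, fun z => rfl⟩
      have h3 : Continuous fun z => η (z, 0) := by fun_prop
      exact ((hs.comp (hbc 0)).clm_apply h3).mul (hτ.clm_apply (hu.comp (hbc 0)))
    obtain ⟨ζ, hζ, hζ'⟩ := hker a
    -- subtract the homogeneous solution with the same unstable component at the end point
    have h4 : η - ζ = 0 := by
      refine eq_zero_of_homogeneous hA hθ hinv hb (fun z m => ?_) fun z => ?_
      · have h5 := hD1 ζ z m
        rw [hζ] at h5
        rw [Vanishing.sub_apply, Vanishing.sub_apply, map_sub, ← h1, ← sub_eq_zero]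
        have h6 : (0 : A) = ζ (z, m) - L (b z (m + 1)) (ζ (z, m + 1)) := h5
        rw [sub_sub_sub_cancel_left, ← neg_sub, ← h6, neg_zero]
      · rw [Vanishing.sub_apply, map_sub, hζ', map_smul, hA.one, ha, growth_zero, inv_one, mul_one,
          smul_eq_mul, mul_one, mul_assoc, mul_inv_cancel₀ (hτ0 z).ne', mul_one, sub_self]
    rw [sub_eq_zero] at h4
    have h5 : a = 0 := by
      refine BoundedContinuousFunction.ext fun z => ?_
      have h6 : (D ζ).2 z = a z := by rw [hζ]
      rw [← h6, hD2, ← h4, h2]; rfl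
    rw [h4]
    refine Vanishing.ext fun ⟨z, m⟩ => ?_
    rw [hζ', h5]
    simp [Vanishing.zero_apply]
  · obtain ⟨η, hη⟩ := exists_inhomogeneous hA hθ hinv hb hbc hL hu hs hδ hS y.1
    obtain ⟨ζ, hζ, -⟩ := hker (y.2 - (D η).2)
    refine ⟨η + ζ, ?_⟩
    rw [map_add, hζ]
    refine Prod.ext ?_ (by simp)
    rw [Prod.fst_add, add_zero]
    exact Vanishing.ext fun ⟨z, m⟩ => by rw [hD1, hη]

end Linear

/-- The unstable curves of a hyperbolic basic set: the backward orbits `m ↦ p (b z m) + g t (z, m)`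
near the given backward orbits `b z` of the basic set, parametrized by a linear coordinate of their
end points, depend on the parameter as smoothly as the operator. -/
theorem exists_unstable_family {X Z₀ A : Type*} [TopologicalSpace X] [CompactSpace X]
    [TopologicalSpace Z₀] [CompactSpace Z₀] [NormedAddCommGroup A] [NormedSpace ℝ A]
    [CompleteSpace A] {S : X → X} {u : X → A} {δ : X → ℝ} {s : X → A →L[ℝ] ℝ} {θ C₀ lam : ℝ}
    {b : Z₀ → ℕ → X} {τ : Z₀ → A →L[ℝ] ℝ} {p : X → A} {T : A → A} {O : Set A} {n : WithTop ℕ∞}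
    (hn : (∃ k : ℕ, 2 ≤ k ∧ n = (k : WithTop ℕ∞)) ∨ n = ω)
    (hO : IsOpen O) (hT : ContDiffOn ℝ n T O) (hp : Continuous p) (hpO : ∀ x, p x ∈ O)
    (hsemi : ∀ x, T (p x) = p (S x))
    (hA : IsSplitCocycle S (fun x => fderiv ℝ T (p x)) u δ s θ C₀ lam) (hθ : θ < 1)
    (hinv : ∀ x v, s (S x) (fderiv ℝ T (p x) v) = δ x * s x v)
    (hb : ∀ z m, S (b z (m + 1)) = b z m) (hbc : ∀ m, Continuous fun z => b z m)
    (hu : Continuous u) (hs : Continuous s) (hδ : Continuous δ)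
    (hS : Continuous S) (hτ : Continuous τ) (hτ0 : ∀ z, 0 < τ z (u (b z 0))) :
    ∃ R₀ : ℝ, 0 < R₀ ∧ ∃ g : ℝ → Vanishing (Z₀ × ℕ) A, ContDiffOn ℝ n g (Ioo (-R₀) R₀) ∧ g 0 = 0 ∧
      (∀ t ∈ Ioo (-R₀) R₀, ∀ z m, p (b z (m + 1)) + g t (z, m + 1) ∈ O ∧
        T (p (b z (m + 1)) + g t (z, m + 1)) = p (b z m) + g t (z, m)) ∧
      (∀ t ∈ Ioo (-R₀) R₀, ∀ z, τ z (g t (z, 0)) = t) ∧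
      ∀ ε, 0 < ε → ∃ R, 0 < R ∧ R ≤ R₀ ∧ ∀ t ∈ Ioo (-R) R, ∀ t' ∈ Ioo (-R) R, ∀ z m,
        ‖g t (z, m) - g t' (z, m) - ((t - t') * ((τ z (u (b z 0)))⁻¹ *
          (growth S δ m (b z m))⁻¹)) • u (b z m)‖ ≤ ε * |t - t'| := by
  set K : Set A := range p
  set β : Z₀ × ℕ → A := fun z => p (b z.1 z.2) with hβdef
  have hK : IsCompact K := isCompact_range hp
  have hKO : K ⊆ O := range_subset_iff.2 hpO
  have hβ : Continuous β := continuous_prod_of_discrete_right.2 fun m => hp.comp (hbc m)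
  have hβK : ∀ z, β z ∈ K := fun z => ⟨_, rfl⟩
  obtain ⟨r, hr0, hrO⟩ := hK.exists_thickening_subset_open hO hKO
  have hr : ∀ a ∈ K, ∀ v, ‖v‖ < r → a + v ∈ O := fun a ha v hv =>
    hrO (Metric.ball_subset_thickening ha r (by simpa [mem_ball_iff_norm] using hv))
  have hn0 : n ≠ 0 := by
    rcases hn with ⟨k, hk, rfl⟩ | rfl
    · exact_mod_cast (by omega : k ≠ 0)
    · simp
  have hninf : n ≠ ∞ := by
    rcases hn with ⟨k, hk, rfl⟩ | rfl
    · exact_mod_cast (ENat.natCast_ne_top k)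
    · simp
  have hn1 : 1 ≤ n := ENat.one_le_iff_ne_zero_withTop.2 hn0
  have hT1 : ContDiffOn ℝ 1 T O := hT.of_le hn1
  have hN : ContDiffAt ℝ n (superposition β T) 0 := by
    rcases hn with ⟨k, hk, rfl⟩ | rfl
    · exact (contDiffOn_superposition hO hK hβ hβK hr0 hr k hT).contDiffAt
        (Metric.ball_mem_nhds _ hr0)
    · exact contDiffAt_superposition_omega hO hK hβ hβK hr0 hr hT
  have hL : Continuous fun x => fderiv ℝ T (p x) :=
    (hT1.continuousOn_fderiv_of_isOpen hO le_rfl).comp_continuous hp hpO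
  obtain ⟨f', hf'⟩ := exists_bounded_base hO hK hβ hβK hr hr0
    (hT1.continuousOn_fderiv_of_isOpen hO le_rfl)
  have hN' := hasFDerivAt_superposition hO hK hβ hβK hr hT1 hf' (ξ := 0) (by simpa using hr0)
  set M := multiplier (.id ℝ (A →L[ℝ] A)) ((superposition β (fderiv ℝ T) 0).toBCF + f') with hM
  have hMapp : ∀ η z m, M η (z, m) = fderiv ℝ T (p (b z m)) (η (z, m)) := by
    intro η z m
    rw [hM, multiplier_apply, BoundedContinuousFunction.add_apply, Vanishing.toBCF_apply,
      superposition_apply hO hK hβ hβK hr (hT1.continuousOn_fderiv_of_isOpen hO le_rfl)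
      (by simpa using hr0), hf', Vanishing.zero_apply, add_zero, sub_self, zero_add]
    rfl
  obtain ⟨κ, hκ⟩ := exists_endpoint (A := A) hτ
  -- `Φ ξ = (0, a)` holds if `p ∘ b + ξ` consists of backward orbits, with end points at the
  -- coordinates `a`; the curves are the images of the constant functions `a` under the local inverse
  let Φ : Vanishing (Z₀ × ℕ) A → Vanishing (Z₀ × ℕ) A × (Z₀ →ᵇ ℝ) := fun ξ =>
    (ξ - shiftLeft (superposition β T ξ), κ ξ)
  let D : Vanishing (Z₀ × ℕ) A →L[ℝ] Vanishing (Z₀ × ℕ) A × (Z₀ →ᵇ ℝ) :=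
    (ContinuousLinearMap.id ℝ _ - shiftLeft.comp M).prod κ
  have hΦ : ContDiffAt ℝ n Φ 0 :=
    (contDiffAt_id.sub (shiftLeft.contDiff.contDiffAt.comp 0 hN)).prodMk κ.contDiff.contDiffAt
  have hΦ' : HasFDerivAt Φ D 0 :=
    ((hasFDerivAt_id 0).sub (shiftLeft.hasFDerivAt.comp 0 hN')).prodMk κ.hasFDerivAt
  have hN0 : superposition β T 0 = 0 := by
    refine Vanishing.ext fun z => ?_
    rw [superposition_apply hO hK hβ hβK hr hT.continuousOn (by simpa using hr0),
      Vanishing.zero_apply, add_zero, sub_self]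
  have hΦ0 : Φ 0 = 0 := by
    change ((0 : Vanishing (Z₀ × ℕ) A) - shiftLeft (superposition β T 0), κ 0) = 0
    rw [hN0, map_zero, map_zero, sub_zero]; rfl
  obtain ⟨hbij, hker⟩ := bijective_linearization (D := D) hA hθ hinv hb hbc hL hu hs hδ hS hτ hτ0
    (fun η z m => by
      change η (z, m) - shiftLeft (M η) (z, m) = _
      rw [shiftLeft_apply, hMapp]) hκ
  let E := ContinuousLinearEquiv.ofBijective D (LinearMap.ker_eq_bot.2 hbij.1)
    (LinearMap.range_eq_top.2 hbij.2)
  have hE : ∀ η, E η = D η := fun η => rfl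
  have hΦE : HasFDerivAt Φ (E : _ →L[ℝ] _) 0 := hΦ'
  set Ψ := hΦ.localInverse hΦE hn0 with hΨ
  have hstrict := hΦ.hasStrictFDerivAt' hΦE hn0
  have h1 : ContDiffAt ℝ n Ψ (0 : Vanishing (Z₀ × ℕ) A × (Z₀ →ᵇ ℝ)) := by
    rw [← hΦ0]; exact hΦ.to_localInverse hΦE hn0
  have h2 : HasStrictFDerivAt Ψ (E.symm : _ →L[ℝ] _) (0 : Vanishing (Z₀ × ℕ) A × (Z₀ →ᵇ ℝ)) := by
    rw [← hΦ0]; exact hstrict.to_localInverse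
  have h3 : ∀ᶠ y in 𝓝 (0 : Vanishing (Z₀ × ℕ) A × (Z₀ →ᵇ ℝ)), Φ (Ψ y) = y := by
    rw [← hΦ0]; exact hstrict.eventually_right_inverse
  have h4 : Ψ 0 = 0 := by
    rw [← hΦ0]; exact hΦ.localInverse_apply_image hΦE hn0
  set e₀ : Vanishing (Z₀ × ℕ) A × (Z₀ →ᵇ ℝ) := (0, BoundedContinuousFunction.const Z₀ 1) with he₀
  let l : ℝ →L[ℝ] Vanishing (Z₀ × ℕ) A × (Z₀ →ᵇ ℝ) := ContinuousLinearMap.toSpanSingleton ℝ e₀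
  have hl : ∀ t, l t = t • e₀ := fun t => rfl
  have hl0 : l 0 = 0 := map_zero l
  let g : ℝ → Vanishing (Z₀ × ℕ) A := fun t => Ψ (l t)
  have hg0 : g 0 = 0 := by change Ψ (l 0) = 0; rw [hl0, h4]
  have hgC : ContDiffAt ℝ n g 0 := ContDiffAt.comp 0 (by rw [hl0]; exact h1) l.contDiff.contDiffAt
  obtain ⟨η₀, hη₀, hη₀'⟩ := hker (BoundedContinuousFunction.const Z₀ 1)
  have hsymm : E.symm e₀ = η₀ := by rw [ContinuousLinearEquiv.symm_apply_eq, hE, hη₀]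
  obtain ⟨W, hW, hgS⟩ : ∃ W : ℝ →L[ℝ] Vanishing (Z₀ × ℕ) A, (∀ t, W t = t • η₀) ∧
      HasStrictFDerivAt g W 0 := by
    refine ⟨(E.symm : _ →L[ℝ] _).comp l, fun t => ?_,
      HasStrictFDerivAt.comp 0 (by rw [hl0]; exact h2) l.hasStrictFDerivAt⟩
    change E.symm (l t) = _
    rw [hl, map_smul, hsymm]
  have hev : ∀ᶠ t in 𝓝 (0 : ℝ), Φ (g t) = l t ∧ ‖g t‖ < r ∧ ContDiffAt ℝ n g t := by
    refine ((l.continuous.tendsto' 0 0 hl0).eventually h3).and (Filter.Eventually.and ?_ ?_)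
    · have h5 : Tendsto (fun t => ‖g t‖) (𝓝 0) (𝓝 0) := by
        have := hgC.continuousAt.norm
        rw [ContinuousAt, hg0, norm_zero] at this
        exact this
      exact h5.eventually (gt_mem_nhds hr0)
    · exact hgC.eventually hninf
  obtain ⟨R₀, hR₀, hball⟩ := Metric.eventually_nhds_iff_ball.1 hev
  rw [Real.ball_eq_Ioo, zero_sub, zero_add] at hball
  refine ⟨R₀, hR₀, g, fun t ht => (hball t ht).2.2.contDiffWithinAt, hg0, fun t ht z m => ?_,
    fun t ht z => ?_, fun ε hε => ?_⟩
  · obtain ⟨h5, h6, -⟩ := hball t ht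
    refine ⟨hr _ (hβK (z, m + 1)) _ ((norm_apply_le_norm _ _).trans_lt h6), ?_⟩
    have h7 : g t - shiftLeft (superposition β T (g t)) = 0 := by
      have := congrArg Prod.fst h5
      rw [hl, he₀] at this
      simpa using this
    have h8 : (g t - shiftLeft (superposition β T (g t))) (z, m) = 0 := by rw [h7]; rfl
    rw [Vanishing.sub_apply, shiftLeft_apply,
      superposition_apply hO hK hβ hβK hr hT.continuousOn h6, sub_eq_zero] at h8
    rw [h8, hβdef]
    simp only [hsemi, hb]
    abel
  · obtain ⟨h5, -, -⟩ := hball t ht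
    have h6 : κ (g t) z = (l t).2 z := by rw [← h5]
    rw [← hκ, h6, hl, he₀]
    simp
  · have h5 : ∀ᶠ q : ℝ × ℝ in 𝓝 (0, 0), ‖g q.1 - g q.2 - W (q.1 - q.2)‖ ≤ ε * ‖q.1 - q.2‖ :=
      Asymptotics.isLittleO_iff.1 hgS.isLittleO hε
    obtain ⟨R, hR, hb2⟩ := Metric.eventually_nhds_iff_ball.1 h5
    refine ⟨min R R₀, by positivity, min_le_right _ _, fun t ht t' ht' z m => ?_⟩
    have h6 : (t, t') ∈ Metric.ball ((0, 0) : ℝ × ℝ) R := by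
      rw [← ball_prod_same, Real.ball_eq_Ioo, zero_sub, zero_add]
      exact ⟨⟨by linarith [ht.1, min_le_left R R₀], by linarith [ht.2, min_le_left R R₀]⟩,
        ⟨by linarith [ht'.1, min_le_left R R₀], by linarith [ht'.2, min_le_left R R₀]⟩⟩
    have h7 : ‖g t - g t' - W (t - t')‖ ≤ ε * ‖t - t'‖ := hb2 (t, t') h6
    rw [hW] at h7
    have h9 := (norm_apply_le_norm _ (z, m)).trans h7
    rw [Vanishing.sub_apply, Vanishing.sub_apply, Vanishing.smul_apply, hη₀', smul_smul] at h9
    simpa using h9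

/-! ### The local unstable sets -/

/-- A family of unstable curves for a local model, over backward orbits of the basic set. For `x`
close to `x₀`, the sequence `m ↦ f x₀ x t m` is a backward orbit close to the backward orbit
`m ↦ R^m x` in the basic set, and `t` is the unstable coordinate of its end point
`f x₀ x t 0`, in the chart at `x₀` but relative to `p x`. -/
structure UnstableFamily {X B C : Type*} [TopologicalSpace X]
    [NormedAddCommGroup B] [NormedSpace ℝ B] [NormedAddCommGroup C] [NormedSpace ℝ C]
    (S : X → X) (p : X → B) (ι : B →L[ℝ] C) (T : B → B) (U : X → B) (δ : X → ℝ)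
    (σ : X → C →L[ℝ] ℝ) (G : ℝ → X → Set B) (R : X → X) (n : WithTop ℕ∞) (r₀ R₀ : ℝ)
    (f : X → X → ℝ → ℕ → B) : Prop where
  right : ∀ x, S (R x) = x
  left : ∀ x, R (S x) = x
  radius_pos : 0 < r₀
  length_pos : 0 < R₀
  orbit : ∀ x₀ x, ‖p x - p x₀‖ < r₀ → ∀ t ∈ Ioo (-R₀) R₀, ∀ m, T (f x₀ x t (m + 1)) = f x₀ x t m
  base : ∀ x₀ x, ‖p x - p x₀‖ < r₀ → ∀ m, f x₀ x 0 m = p (R^[m] x)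
  near : ∀ ε, 0 < ε → ∃ R₁, 0 < R₁ ∧ ∀ x₀ x, ‖p x - p x₀‖ < r₀ → ∀ t ∈ Ioo (-R₁) R₁, ∀ m,
    f x₀ x t m ∈ G ε (R^[m] x)
  coord : ∀ x₀ x, ‖p x - p x₀‖ < r₀ → ∀ t ∈ Ioo (-R₀) R₀, σ x₀ (ι (f x₀ x t 0 - p x)) = t
  straight : ∀ ε, 0 < ε → ∃ R₁, 0 < R₁ ∧ ∀ x₀ x, ‖p x - p x₀‖ < r₀ → ∀ t ∈ Ioo (-R₁) R₁,
    ∀ t' ∈ Ioo (-R₁) R₁, ∀ m, ‖f x₀ x t m - f x₀ x t' m - ((t - t') *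
      ((σ x₀ (ι (U x)))⁻¹ * (growth S δ m (R^[m] x))⁻¹)) • U (R^[m] x)‖ ≤ ε * |t - t'|
  smooth : ∀ x₀ x, ‖p x - p x₀‖ < r₀ → ContDiffOn ℝ n (fun t => f x₀ x t 0) (Ioo (-R₀) R₀)
  cont : ∀ x₀, ContinuousOn (fun q : X × ℝ => f x₀ q.1 q.2 0)
    ({x | ‖p x - p x₀‖ < r₀} ×ˢ Ioo (-R₀) R₀)
  cont_deriv : ∀ x₀, ContinuousOn (fun q : X × ℝ => deriv (fun t => f x₀ q.1 t 0) q.2)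
    ({x | ‖p x - p x₀‖ < r₀} ×ˢ Ioo (-R₀) R₀)

/-- Along a curve which is nearly straight, the distance to the base point grows. -/
lemma norm_add_le_of_straight {E : Type*} [NormedAddCommGroup E] [NormedSpace ℝ E] {w : ℝ → E}
    {e : E} {ε s t : ℝ} (hε : 6 * ε ≤ ‖e‖) (h0 : w 0 = 0) (hs0 : 0 ≤ s) (hs1 : s ≤ 1)
    (h1 : ‖w t - w (s * t) - (t - s * t) • e‖ ≤ ε * |t - s * t|)
    (h2 : ‖w t - w 0 - (t - 0) • e‖ ≤ ε * |t - 0|) :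
    ‖w (s * t)‖ + 1 / 2 * ‖e‖ * ((1 - s) * |t|) ≤ ‖w t‖ := by
  rw [h0, sub_zero, sub_zero] at h2
  have e1 : t - s * t = (1 - s) * t := by ring
  rw [e1, abs_mul, abs_of_nonneg (sub_nonneg.2 hs1)] at h1
  have h3 : ‖e‖ * |t| ≤ ‖w t‖ + ε * |t| := by
    calc ‖e‖ * |t| = ‖w t - (w t - t • e)‖ := by
          rw [sub_sub_cancel, norm_smul, Real.norm_eq_abs, mul_comm]
      _ ≤ _ := (norm_sub_le _ _).trans (by gcongr)
  have h4 : ‖w (s * t)‖ ≤ s * ‖w t‖ + (1 - s) * (ε * |t|) + ε * ((1 - s) * |t|) := by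
    have e2 : w (s * t) = s • w t + (1 - s) • (w t - t • e)
        - (w t - w (s * t) - ((1 - s) * t) • e) := by
      module
    calc ‖w (s * t)‖ = _ := congrArg norm e2
      _ ≤ ‖s • w t‖ + ‖(1 - s) • (w t - t • e)‖ + ε * ((1 - s) * |t|) :=
          (norm_sub_le _ _).trans (add_le_add (norm_add_le _ _) h1)
      _ ≤ _ := by
          rw [norm_smul, norm_smul, Real.norm_of_nonneg hs0, Real.norm_of_nonneg (sub_nonneg.2 hs1)]
          gcongr
  have h5 : 0 ≤ (1 - s) * |t| := mul_nonneg (sub_nonneg.2 hs1) (abs_nonneg _)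
  have h6 : (1 - s) * (‖e‖ * |t|) ≤ (1 - s) * (‖w t‖ + ε * |t|) :=
    mul_le_mul_of_nonneg_left h3 (sub_nonneg.2 hs1)
  have h7 : 6 * ε * ((1 - s) * |t|) ≤ ‖e‖ * ((1 - s) * |t|) := mul_le_mul_of_nonneg_right hε h5
  linarith

namespace LocalModel

variable {X B C : Type*} [TopologicalSpace X] [CompactSpace X]
    [NormedAddCommGroup B] [NormedSpace ℝ B] [NormedAddCommGroup C] [NormedSpace ℝ C]
    {S : X → X} {p : X → B} {ι : B →L[ℝ] C} {T : B → B} {O : Set B} {U : X → B} {δ : X → ℝ}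
    {σ : X → C →L[ℝ] ℝ} {LB : X → B →L[ℝ] B} {LC : X → C →L[ℝ] C} {G : ℝ → X → Set B}
    {C₀ lam : ℝ} {R : X → X} {n : WithTop ℕ∞} {r₀ R₀ : ℝ} {f : X → X → ℝ → ℕ → B}

variable (h : LocalModel S p ι T O U δ σ LB LC G C₀ lam)
include h

lemma exists_functional_close {η : ℝ} (hη : 0 < η) : ∃ r, 0 < r ∧ ∀ x x₀, ‖p x - p x₀‖ < r →
    ∀ v, |σ x (ι v) - σ x₀ (ι v)| ≤ η * ‖v‖ := by
  obtain ⟨r, hr, h1⟩ := exists_near_diagonal h.contp h.injp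
    (f := fun x y => ‖(σ x).comp ι - (σ y).comp ι‖) (ε := η) (by
      have c1 : Continuous fun z : X × X => (σ z.1).comp ι :=
        (h.contσ.comp continuous_fst).clm_comp continuous_const
      have c2 : Continuous fun z : X × X => (σ z.2).comp ι :=
        (h.contσ.comp continuous_snd).clm_comp continuous_const
      exact (c1.sub c2).norm) (fun x => by simpa using hη)
  refine ⟨r, hr, fun x x₀ hx v => ?_⟩
  rw [← Real.norm_eq_abs]
  exact ((σ x).comp ι - (σ x₀).comp ι).le_of_opNorm_le (h1 x x₀ hx).le v

omit [CompactSpace X] in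
lemma exists_ball_subset_domain : ∃ r, 0 < r ∧ ∀ x, Metric.ball (p x) r ⊆ O := by
  obtain ⟨r, hr, h1⟩ := h.domain 1 one_pos
  exact ⟨r, hr, fun x y hy => (interior_subset (h1 x hy)).1⟩

variable (hF : UnstableFamily S p ι T U δ σ G R n r₀ R₀ f)
include hF

omit [CompactSpace X] in
lemma backIter_eq (m : ℕ) (x : X) : backIter T (range p) m (p x) = p (R^[m] x) := by
  induction m with
  | zero => rfl
  | succ m ih =>
    rw [backIter, Function.iterate_succ_apply']
    change Function.invFunOn T (range p) (backIter T (range p) m (p x)) = _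
    rw [ih, Function.iterate_succ_apply']
    have hex : ∃ a ∈ range p, T a = p (R^[m] x) := ⟨_, ⟨R (R^[m] x), rfl⟩, by rw [h.semi, hF.right]⟩
    obtain ⟨y, hy⟩ := Function.invFunOn_mem hex
    have h1 := Function.invFunOn_eq hex
    rw [← hy, h.semi] at h1
    rw [← hy, ← h.injp h1, hF.left]

omit [CompactSpace X] h in
lemma back_succ (x : X) (m : ℕ) : S (R^[m + 1] x) = R^[m] x := by
  rw [Function.iterate_succ_apply', hF.right]

/-- The local unstable sets are parametrized by the curves of an unstable family. -/
theorem localUnstable_param : ∃ ε₁ r₁ R₁ c θ : ℝ, 0 < ε₁ ∧ 0 < r₁ ∧ r₁ ≤ r₀ ∧ 0 < R₁ ∧ R₁ ≤ R₀ ∧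
    1 ≤ c ∧ 0 < θ ∧ θ < 1 ∧ ∀ x₀ x, ‖p x - p x₀‖ < r₁ →
      (∀ t ∈ Ioo (-R₁) R₁, ∀ m,
        ‖f x₀ x t m - p (R^[m] x)‖ ≤ c * θ ^ m * ‖f x₀ x t 0 - p x‖) ∧
      ∀ ε ≤ ε₁, (∀ t ∈ Ioo (-R₁) R₁, (∀ m, ‖f x₀ x t m - p (R^[m] x)‖ < ε) →
          f x₀ x t 0 ∈ localUnstable T O (range p) ε (p x)) ∧
        ∀ z, IsBackwardOrbit T O (range p) ε (p x) z →
          |σ x₀ (ι (z 0 - p x))| < R₁ ∧ ∀ m, z m = f x₀ x (σ x₀ (ι (z 0 - p x))) m := by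
  obtain ⟨K, hK, -, hσB, -, -, -⟩ := h.exists_bounds
  obtain ⟨η, r, c, θ, hη, hr, hc, hθ0, hθ1, hback⟩ := h.backward_contract
  obtain ⟨r₂, hr₂, hclose⟩ := h.exists_functional_close hη
  obtain ⟨r₃, hr₃, hdom⟩ := h.exists_ball_subset_domain
  obtain ⟨r₄, hr₄, hsmall⟩ := h.small_G r hr
  obtain ⟨R₂, hR₂, hnear⟩ := hF.near (min r r₄) (by positivity)
  have hR₀ := hF.length_pos
  have hr₀ := hF.radius_pos
  have hR : 0 < min R₀ R₂ := by positivity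
  refine ⟨min (min r r₃) (min R₀ R₂ / K), min r₀ r₂, min R₀ R₂, max c 1, θ, by positivity,
    by positivity, min_le_left _ _, hR, min_le_left _ _, le_max_right _ _, hθ0, hθ1,
    fun x₀ x hx => ?_⟩
  have hx0 := hx.trans_le (min_le_left _ _)
  have hx2 := hx.trans_le (min_le_right _ _)
  have hI0 : Ioo (-(min R₀ R₂)) (min R₀ R₂) ⊆ Ioo (-R₀) R₀ :=
    Ioo_subset_Ioo (neg_le_neg (min_le_left _ _)) (min_le_left _ _)
  have hI2 : Ioo (-(min R₀ R₂)) (min R₀ R₂) ⊆ Ioo (-R₂) R₂ :=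
    Ioo_subset_Ioo (neg_le_neg (min_le_right _ _)) (min_le_right _ _)
  have hG : ∀ t ∈ Ioo (-(min R₀ R₂)) (min R₀ R₂), ∀ m, f x₀ x t m ∈ G r (R^[m] x) := fun t ht m =>
    h.mono_G _ _ (min_le_left _ _) _ (hnear x₀ x hx0 t (hI2 ht) m)
  have hdecay : ∀ t ∈ Ioo (-(min R₀ R₂)) (min R₀ R₂), ∀ m,
      ‖f x₀ x t m - p (R^[m] x)‖ ≤ max c 1 * θ ^ m * ‖f x₀ x t 0 - p x‖ := by
    intro t ht m
    refine ((hback (fun m => R^[m] x) (f x₀ x t) (fun m => p (R^[m] x)) (back_succ hF x)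
      (hF.orbit x₀ x hx0 t (hI0 ht)) (fun m => by rw [h.semi, back_succ hF]) (fun m => ?_)
      (fun m => h.mem_G r hr _)).1 m).trans ?_
    · exact hsmall _ (h.mono_G _ _ (min_le_right _ _) _ (hnear x₀ x hx0 t (hI2 ht) m))
    · gcongr
      · exact le_max_left _ _
      · exact le_rfl
  refine ⟨hdecay, fun ε hε => ⟨fun t ht hlt => ?_, fun z hz => ?_⟩⟩
  · refine ⟨f x₀ x t, rfl, fun m => ?_, fun m => ⟨?_, hF.orbit x₀ x hx0 t (hI0 ht) m⟩, ?_⟩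
    · rw [h.backIter_eq hF, mem_ball_iff_norm]; exact hlt m
    · refine hdom _ (mem_ball_iff_norm.2 ((hlt (m + 1)).trans_le (hε.trans ?_)))
      exact (min_le_left _ _).trans (min_le_right _ _)
    · simp only [h.backIter_eq hF]
      have h1 : Tendsto (fun m : ℕ => max c 1 * θ ^ m * ‖f x₀ x t 0 - p x‖) atTop (𝓝 0) := by
        simpa using ((tendsto_pow_atTop_nhds_zero_of_lt_one hθ0.le hθ1).const_mul
          (max c 1)).mul_const ‖f x₀ x t 0 - p x‖
      exact squeeze_zero (fun _ => norm_nonneg _) (hdecay t ht) h1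
  · obtain ⟨hz1, hz2, -⟩ := hz
    simp only [h.backIter_eq hF, mem_ball_iff_norm] at hz1
    have hK0 : 0 < K := by linarith
    have ht : |σ x₀ (ι (z 0 - p x))| < min R₀ R₂ := by
      calc _ ≤ K * ‖z 0 - p x‖ := hσB _ _
        _ < K * ε := by gcongr; exact hz1 0
        _ ≤ K * (min R₀ R₂ / K) := by gcongr; exact hε.trans (min_le_right _ _)
        _ = _ := by field_simp
    set t := σ x₀ (ι (z 0 - p x)) with htd
    have htI : t ∈ Ioo (-(min R₀ R₂)) (min R₀ R₂) := abs_lt.1 ht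
    -- the backward orbit and the curve have end points with the same coordinate, hence coincide
    refine ⟨ht, (hback (fun m => R^[m] x) z (f x₀ x t) (back_succ hF x) (fun m => (hz2 m).2)
      (hF.orbit x₀ x hx0 t (hI0 htI)) (fun m => ?_) (fun m => hG t htI m)).2 ?_⟩
    · exact mem_ball_iff_norm.2 ((hz1 m).trans_le
        (hε.trans ((min_le_left _ _).trans (min_le_left _ _))))
    · have h1 : σ x₀ (ι (z 0 - f x₀ x t 0)) = 0 := by
        have e : z 0 - f x₀ x t 0 = (z 0 - p x) - (f x₀ x t 0 - p x) := by abel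
        rw [e, map_sub, map_sub, hF.coord x₀ x hx0 t (hI0 htI), ← htd, sub_self]
      have h2 := hclose x x₀ hx2 (z 0 - f x₀ x t 0)
      rw [h1, sub_zero] at h2
      exact h2

/-- Contraction along backward orbits, injectivity, and overflowing. -/
theorem localUnstable_contract : ∃ ε₁ c θ : ℝ, 0 < ε₁ ∧ 0 < c ∧ 0 < θ ∧ θ < 1 ∧ ∀ ε ≤ ε₁, ∀ x,
    localUnstable T O (range p) ε (T (p x)) ⊆ T '' localUnstable T O (range p) ε (p x) ∧
    InjOn T (localUnstable T O (range p) ε (p x)) ∧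
    ∀ z, IsBackwardOrbit T O (range p) ε (p x) z → ∀ m,
      ‖backIter T (range p) m (p x) - z m‖ ≤ c * θ ^ m * ‖p x - z 0‖ := by
  obtain ⟨η, r, c, θ, hη, hr, hc, hθ0, hθ1, hback⟩ := h.backward_contract
  obtain ⟨ε₁, r₁, R₁, cp, θp, hε₁, hr₁, hr₁₀, hR₁, hR₁₀, -, -, -, hparam⟩ := h.localUnstable_param hF
  obtain ⟨K, hK, -, hσB, -, -, -⟩ := h.exists_bounds
  obtain ⟨r₂, hr₂, hmap⟩ := h.map_G r hr
  obtain ⟨r₃, hr₃, hsmall⟩ := h.small_G r hr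
  obtain ⟨r₄, hr₄, hmap'⟩ := h.map_G r₃ hr₃
  obtain ⟨R₂, hR₂, hnear⟩ := hF.near (min r (min r₂ r₄)) (by positivity)
  have hself : ∀ x, ‖p x - p x‖ < r₁ := fun x => by rw [sub_self, norm_zero]; exact hr₁
  have hK0 : 0 < K := by linarith
  refine ⟨min (min ε₁ r) (R₂ / K), c, θ, by positivity, hc, hθ0, hθ1,
    fun ε hε x => ⟨?_, ?_, fun z hz m => ?_⟩⟩
  · rintro y ⟨z, rfl, hz1, hz2, hz3⟩
    rw [h.semi] at hz1 hz3
    simp only [h.backIter_eq hF] at hz1 hz3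
    have e : ∀ m, R^[m + 1] (S x) = R^[m] x := fun m => by
      rw [Function.iterate_succ_apply, hF.left]
    refine ⟨z 1, ⟨fun m => z (m + 1), rfl, fun m => ?_, fun m => hz2 (m + 1), ?_⟩, (hz2 0).2⟩
    · rw [h.backIter_eq hF, ← e]; exact hz1 (m + 1)
    · have := hz3.comp (tendsto_add_atTop_nat 1)
      refine this.congr fun m => ?_
      simp only [Function.comp, h.backIter_eq hF, e]
  · rintro y ⟨z, rfl, hz⟩ y' ⟨z', rfl, hz'⟩ hyy
    have hε₁' := hε.trans ((min_le_left _ _).trans (min_le_left _ _))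
    have hG : ∀ m, z' m ∈ G (min r (min r₂ r₄)) (R^[m] x) := by
      intro m
      rw [((hparam x x (hself x)).2 ε hε₁').2 z' hz' |>.2 m]
      refine hnear x x ((hself x).trans_le hr₁₀) _ (abs_lt.1 ?_) m
      have := hz'.1 0
      rw [h.backIter_eq hF, mem_ball_iff_norm] at this
      calc _ ≤ K * ‖z' 0 - p x‖ := hσB _ _
        _ < K * ε := by gcongr; exact this
        _ ≤ K * (R₂ / K) := by gcongr; exact hε.trans (min_le_right _ _)
        _ = _ := by field_simp
    have hT1 : T (z' 0) ∈ G r (S x) :=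
      hmap x _ (h.mono_G _ _ ((min_le_right _ _).trans (min_le_left _ _)) _ (hG 0))
    have hT2 : T (z' 0) ∈ Metric.ball (p (S x)) r := hsmall _ (hmap' x _
      (h.mono_G _ _ ((min_le_right _ _).trans (min_le_right _ _)) _ (hG 0)))
    -- extend both backward orbits by the common image, so that their end points coincide
    have h1 := (hback (fun m => Nat.casesOn m (S x) fun m => R^[m] x)
      (fun m => Nat.casesOn m (T (z 0)) z) (fun m => Nat.casesOn m (T (z' 0)) z')
      (fun m => by cases m with | zero => rfl | succ m => exact back_succ hF x m)
      (fun m => by cases m with | zero => rfl | succ m => exact (hz.2.1 m).2)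
      (fun m => by cases m with | zero => rfl | succ m => exact (hz'.2.1 m).2)
      (fun m => by
        cases m with
        | zero => change T (z 0) ∈ _; rw [hyy]; exact hT2
        | succ m =>
          have := hz.1 m
          rw [h.backIter_eq hF] at this
          exact Metric.ball_subset_ball (hε.trans ((min_le_left _ _).trans (min_le_right _ _))) this)
      (fun m => by
        cases m with
        | zero => exact hT1
        | succ m => exact h.mono_G _ _ (min_le_left _ _) _ (hG m))).2 (by
          change |σ (S x) (ι (T (z 0) - T (z' 0)))| ≤ η * ‖T (z 0) - T (z' 0)‖
          rw [hyy, sub_self, map_zero, map_zero, abs_zero, norm_zero, mul_zero])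
    exact h1 1
  · obtain ⟨hz1, hz2, -⟩ := hz
    rw [norm_sub_rev, norm_sub_rev (p x), h.backIter_eq hF]
    simp only [h.backIter_eq hF] at hz1
    refine (hback (fun m => R^[m] x) z (fun m => p (R^[m] x)) (back_succ hF x) (fun m => (hz2 m).2)
      (fun m => by rw [h.semi, back_succ hF]) (fun m => ?_) (fun m => h.mem_G r hr _)).1 m
    exact Metric.ball_subset_ball (hε.trans ((min_le_left _ _).trans (min_le_right _ _))) (hz1 m)

end LocalModel

/-! ### The graphs of the unstable curves -/

/-- The projection onto `ker σ` along `U`; zero if `U` is not normalized by `σ U = 1`. -/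
noncomputable def kerProj {E : Type*} [NormedAddCommGroup E] [NormedSpace ℝ E] (σ : E →L[ℝ] ℝ) (U : E) :
    E →L[ℝ] σ.ker :=
  open Classical in
  if hU : σ U = 1 then (ContinuousLinearMap.id ℝ E - σ.smulRight U).codRestrict σ.ker fun v => by
    simp [hU]
  else 0

lemma kerProj_apply {E : Type*} [NormedAddCommGroup E] [NormedSpace ℝ E] {σ : E →L[ℝ] ℝ} {U : E}
    (hU : σ U = 1) (v : E) : (kerProj σ U v : E) = v - σ v • U := by
  rw [kerProj, dif_pos hU]; simp

/-- Uniform convergence on a compact set, transported along an embedding of the parameter space. -/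
lemma tendstoUniformlyOn_of_continuousOn {X E F : Type*} [TopologicalSpace X] [TopologicalSpace E]
    [NormedAddCommGroup F] {p : X → E} (hp : IsEmbedding p) {g : E → ℝ → F} {J : Set X} {x : X}
    (hJ : J ∈ 𝓝 x) {k : Set ℝ} (hk : IsCompact k)
    (hg : ContinuousOn (fun q : X × ℝ => g (p q.1) q.2) (J ×ˢ k)) :
    TendstoUniformlyOn g (g (p x)) (𝓝[range p] (p x)) k := by
  rw [← hp.map_nhds_eq x]
  intro u hu
  rw [eventually_map]
  obtain ⟨v, hv, h1⟩ := hk.mem_uniformity_of_prod (f := fun x' t => g (p x') t) hg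
    (mem_of_mem_nhds hJ) (symm_le_uniformity hu)
  rw [nhdsWithin_eq_nhds.2 hJ] at hv
  filter_upwards [hv] with x' hx' t ht
  exact h1 x' hx' t ht

namespace LocalModel

variable {X B C : Type*} [TopologicalSpace X] [CompactSpace X]
    [NormedAddCommGroup B] [NormedSpace ℝ B] [NormedAddCommGroup C] [NormedSpace ℝ C]
    {S : X → X} {p : X → B} {ι : B →L[ℝ] C} {T : B → B} {O : Set B} {U : X → B} {δ : X → ℝ}
    {σ : X → C →L[ℝ] ℝ} {LB : X → B →L[ℝ] B} {LC : X → C →L[ℝ] C} {G : ℝ → X → Set B}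
    {C₀ lam : ℝ} {R : X → X} {n : WithTop ℕ∞} {r₀ R₀ : ℝ} {f : X → X → ℝ → ℕ → B}

variable (h : LocalModel S p ι T O U δ σ LB LC G C₀ lam)
  (hF : UnstableFamily S p ι T U δ σ G R n r₀ R₀ f)
include h hF

/-- The backward iterates of an unstable curve are nearly straight. -/
theorem exists_straight (N : ℕ) : ∃ r₁ R₁ a b : ℝ, 0 < r₁ ∧ r₁ ≤ r₀ ∧ 0 < R₁ ∧ R₁ ≤ R₀ ∧ 0 < a ∧
    0 < b ∧ ∀ x₀ x, ‖p x - p x₀‖ < r₁ →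
      (∀ t ∈ Ioo (-R₁) R₁, ∀ s, 0 ≤ s → s ≤ 1 → ∀ m ≤ N,
        ‖f x₀ x (s * t) m - p (R^[m] x)‖ + a * ((1 - s) * |t|) ≤ ‖f x₀ x t m - p (R^[m] x)‖) ∧
      ∀ t ∈ Ioo (-R₁) R₁, ∀ t' ∈ Ioo (-R₁) R₁, ∀ m, ‖f x₀ x t m - f x₀ x t' m‖ ≤ b * |t - t'| := by
  obtain ⟨K, hK, -, hσB, hU, -, -⟩ := h.exists_bounds
  obtain ⟨Λ, hΛ, hδ⟩ := exists_upper h.contδ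
  obtain ⟨r₁, hr₁, hchart⟩ := h.exists_chart one_pos
  have hK0 : 0 < K := by linarith
  have hC₀ := h.const_pos
  -- a lower bound for the velocities of the first `N` backward iterates of the curves
  set e₀ : ℝ := (K * K)⁻¹ * (Λ ^ N)⁻¹ * K⁻¹ with he₀
  have he₀0 : 0 < e₀ := by positivity
  obtain ⟨R₁, hR₁, hstr⟩ := hF.straight (e₀ / 6) (by positivity)
  have hR₀ := hF.length_pos
  have hr₀ := hF.radius_pos
  refine ⟨min r₀ r₁, min R₀ R₁, e₀ / 2, 2 * (1 + C₀⁻¹) * K + e₀ / 6, by positivity, min_le_left _ _,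
    by positivity, min_le_left _ _, by positivity, by positivity, fun x₀ x hx => ?_⟩
  have hx0 := hx.trans_le (min_le_left _ _)
  have hρ := (hchart x₀ x (by rw [norm_sub_rev]; exact hx.trans_le (min_le_right _ _))).1
  have hI : Ioo (-(min R₀ R₁)) (min R₀ R₁) ⊆ Ioo (-R₁) R₁ :=
    Ioo_subset_Ioo (neg_le_neg (min_le_right _ _)) (min_le_right _ _)
  have hg : ∀ m, 0 < growth S δ m (R^[m] x) := fun m => growth_pos h.pos _ _
  have hnorm : ∀ m, ‖((σ x₀ (ι (U x)))⁻¹ * (growth S δ m (R^[m] x))⁻¹) • U (R^[m] x)‖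
      = (σ x₀ (ι (U x)))⁻¹ * (growth S δ m (R^[m] x))⁻¹ * ‖U (R^[m] x)‖ := by
    intro m
    have := hg m
    rw [norm_smul, Real.norm_of_nonneg (by positivity)]
  refine ⟨fun t ht s hs0 hs1 m hm => ?_, fun t ht t' ht' m => ?_⟩
  · have hst : s * t ∈ Ioo (-R₁) R₁ := by
      have := abs_lt.2 ⟨(hI ht).1, (hI ht).2⟩
      refine abs_lt.1 ?_
      rw [abs_mul, abs_of_nonneg hs0]
      nlinarith [abs_nonneg t]
    have h1 := hstr x₀ x hx0 t (hI ht) (s * t) hst m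
    have h2 := hstr x₀ x hx0 t (hI ht) 0 ⟨by linarith, by linarith⟩ m
    rw [mul_smul] at h1 h2
    set e := ((σ x₀ (ι (U x)))⁻¹ * (growth S δ m (R^[m] x))⁻¹) • U (R^[m] x) with he
    have hle : e₀ ≤ ‖e‖ := by
      have h3 : σ x₀ (ι (U x)) ≤ K * K := (le_abs_self _).trans ((hσB _ _).trans (by
        gcongr; exact hU x))
      have h4 : growth S δ m (R^[m] x) ≤ Λ ^ N := by
        calc _ ≤ ∏ _i ∈ Finset.range m, Λ :=
              Finset.prod_le_prod (fun _ _ => (h.pos _).le) fun _ _ => hδ _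
          _ = Λ ^ m := by rw [Finset.prod_const, Finset.card_range]
          _ ≤ Λ ^ N := pow_le_pow_right₀ hΛ hm
      have h5 : K⁻¹ ≤ ‖U (R^[m] x)‖ := by
        have h6 := hσB (R^[m] x) (U (R^[m] x))
        rw [h.one, abs_one] at h6
        rw [inv_le_iff_one_le_mul₀' hK0]
        exact h6
      rw [he, hnorm, he₀]
      have := hg m
      have h7 : 0 < σ x₀ (ι (U x)) := by linarith
      gcongr
    have h3 := norm_add_le_of_straight (w := fun t => f x₀ x t m - p (R^[m] x)) (e := e)
      (ε := e₀ / 6) (s := s) (t := t) (by linarith) (by simp only [hF.base x₀ x hx0, sub_self])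
      hs0 hs1 (by simpa only [sub_sub_sub_cancel_right] using h1)
      (by simpa only [sub_sub_sub_cancel_right] using h2)
    refine le_trans ?_ h3
    have h4 : 0 ≤ (1 - s) * |t| := mul_nonneg (sub_nonneg.2 hs1) (abs_nonneg _)
    gcongr
    linarith
  · have h1 := hstr x₀ x hx0 t (hI ht) t' (hI ht') m
    rw [mul_smul] at h1
    set e := ((σ x₀ (ι (U x)))⁻¹ * (growth S δ m (R^[m] x))⁻¹) • U (R^[m] x) with he
    have hle : ‖e‖ ≤ 2 * (1 + C₀⁻¹) * K := by
      have h3 : (σ x₀ (ι (U x)))⁻¹ ≤ 2 := inv_le_of_inv_le₀ two_pos (by linarith)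
      have h4 : (growth S δ m (R^[m] x))⁻¹ ≤ 1 + C₀⁻¹ := by
        rcases Nat.eq_zero_or_pos m with rfl | hm
        · rw [growth_zero, inv_one]; linarith [inv_pos.2 hC₀]
        · have h5 := h.lower m (R^[m] x) hm
          have h6 : C₀ ≤ growth S δ m (R^[m] x) :=
            (le_mul_of_one_le_right hC₀.le (one_le_pow₀ h.one_lt.le)).trans h5
          linarith [inv_anti₀ hC₀ h6]
      rw [he, hnorm]
      have := hg m
      gcongr
      exact hU _
    calc _ = ‖(f x₀ x t m - f x₀ x t' m - (t - t') • e) + (t - t') • e‖ := by rw [sub_add_cancel]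
      _ ≤ e₀ / 6 * |t - t'| + |t - t'| * (2 * (1 + C₀⁻¹) * K) := by
          refine (norm_add_le _ _).trans (add_le_add h1 ?_)
          rw [norm_smul, Real.norm_eq_abs]
          gcongr
      _ = _ := by ring

omit [CompactSpace X] in
/-- The curves of an unstable family are tangent to the unstable direction at the base point. -/
lemma hasDerivAt_curve (x : X) : HasDerivAt (fun t => f x x t 0) (U x) 0 := by
  have hx : ‖p x - p x‖ < r₀ := by rw [sub_self, norm_zero]; exact hF.radius_pos
  rw [hasDerivAt_iff_isLittleO_nhds_zero, Asymptotics.isLittleO_iff]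
  intro ε hε
  obtain ⟨R₁, hR₁, hstr⟩ := hF.straight ε hε
  filter_upwards [Ioo_mem_nhds (neg_lt_zero.2 hR₁) hR₁] with t ht
  have := hstr x x hx t ht 0 ⟨by linarith, hR₁⟩ 0
  rw [h.one, growth_zero] at this
  simpa using this

/-- The part of the unstable curve on which the local unstable set lives. -/
theorem unstableCurves {Uf : B → B} {σf : B → B →L[ℝ] ℝ} (hn : 1 ≤ n) (hUf : ∀ x, Uf (p x) = U x)
    (hσf : ∀ x, σf (p x) = (σ x).comp ι) :
    ∃ ε₁, 0 < ε₁ ∧ ∀ ε₀ ≤ ε₁, UnstableCurves T O (range p) Uf σf n ε₀ := by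
  rcases isEmpty_or_nonempty X with hX | hX
  · refine ⟨1, one_pos, fun ε₀ _ => ⟨1, one_pos, 1, one_pos, fun _ _ _ => 0, ?_⟩⟩
    have : range p = ∅ := range_eq_empty p
    simp only [this, mem_empty_iff_false, false_imp_iff, implies_true, true_and, and_true]
    exact fun _ _ _ => ⟨1, one_pos⟩
  obtain ⟨K, hK, -, hσB, hU, -, -⟩ := h.exists_bounds
  have hK0 : 0 < K := by linarith
  obtain ⟨ε₁, r₁, R₁, c, θ, hε₁, hr₁, hr₁₀, hR₁, hR₁₀, hc, hθ0, hθ1, hparam⟩ :=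
    h.localUnstable_param hF
  -- beyond the time `N`, closeness of the backward iterates is automatic
  obtain ⟨N, hN⟩ : ∃ N, ∀ m, N ≤ m → c * θ ^ m ≤ 1 := by
    have : Tendsto (fun m : ℕ => c * θ ^ m) atTop (𝓝 (c * 0)) :=
      (tendsto_pow_atTop_nhds_zero_of_lt_one hθ0.le hθ1).const_mul c
    rw [mul_zero] at this
    obtain ⟨N, hN⟩ := eventually_atTop.1 (this.eventually (gt_mem_nhds one_pos))
    exact ⟨N, fun m hm => (hN m hm).le⟩
  obtain ⟨r₂, R₂, a, b, hr₂, hr₂₀, hR₂, hR₂₀, ha, hb, hstr⟩ := h.exists_straight hF N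
  set Q := min R₁ R₂ with hQ
  have hQ0 : 0 < Q := by positivity
  have hQR₁ : Ioo (-Q) Q ⊆ Ioo (-R₁) R₁ :=
    Ioo_subset_Ioo (neg_le_neg (min_le_left _ _)) (min_le_left _ _)
  have hQR₂ : Ioo (-Q) Q ⊆ Ioo (-R₂) R₂ :=
    Ioo_subset_Ioo (neg_le_neg (min_le_right _ _)) (min_le_right _ _)
  have hQR₀ : Ioo (-Q) Q ⊆ Ioo (-R₀) R₀ :=
    hQR₁.trans (Ioo_subset_Ioo (neg_le_neg hR₁₀) hR₁₀)
  set r := min (min r₁ r₂) (Q / (4 * K)) with hr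
  have hr0 : 0 < r := by positivity
  have hrr₁ : r ≤ r₁ := (min_le_left _ _).trans (min_le_left _ _)
  have hrr₂ : r ≤ r₂ := (min_le_left _ _).trans (min_le_right _ _)
  have hrr₀ : r ≤ r₀ := hrr₁.trans hr₁₀
  have hinv : ∀ x, Function.invFun p (p x) = x := Function.leftInverse_invFun h.injp
  set o : X → X → ℝ := fun x₀ x => σ x₀ (ι (p x - p x₀)) with ho
  have hoQ : ∀ x₀ x, ‖p x - p x₀‖ < r → |o x₀ x| < Q / 4 := by
    intro x₀ x hx
    calc _ ≤ K * ‖p x - p x₀‖ := hσB _ _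
      _ < K * r := by gcongr
      _ ≤ K * (Q / (4 * K)) := by gcongr; exact min_le_right _ _
      _ = _ := by field_simp
  have hshift : ∀ x₀ x, ‖p x - p x₀‖ < r → ∀ t ∈ Icc (-(Q / 2)) (Q / 2), t - o x₀ x ∈ Ioo (-Q) Q := by
    intro x₀ x hx t ht
    have := abs_lt.1 (hoQ x₀ x hx)
    constructor <;> linarith [ht.1, ht.2]
  have hIooIcc : Ioo (-(Q / 2)) (Q / 2) ⊆ Icc (-(Q / 2)) (Q / 2) := Ioo_subset_Icc_self
  have hσU : ∀ x₀, σf (p x₀) (Uf (p x₀)) = 1 := fun x₀ => by rw [hσf, hUf]; exact h.one x₀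
  set η : (e₀ : B) → B → ℝ → (σf e₀).ker := fun e₀ e t => kerProj (σf e₀) (Uf e₀)
    (f (Function.invFun p e₀) (Function.invFun p e) (t - o (Function.invFun p e₀)
      (Function.invFun p e)) 0 - p (Function.invFun p e₀)) with hη
  have hηp : ∀ x₀ x t, η (p x₀) (p x) t = kerProj (σf (p x₀)) (Uf (p x₀))
      (f x₀ x (t - o x₀ x) 0 - p x₀) := fun x₀ x t => by simp only [hη, hinv]
  -- the graph of `η` consists of the points of the curve
  have hgraph : ∀ x₀ x, ‖p x - p x₀‖ < r → ∀ t ∈ Ioo (-(Q / 2)) (Q / 2),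
      p x₀ + t • Uf (p x₀) + (η (p x₀) (p x) t : B) = f x₀ x (t - o x₀ x) 0 := by
    intro x₀ x hx t ht
    have h1 : σf (p x₀) (f x₀ x (t - o x₀ x) 0 - p x₀) = t := by
      have h2 := hF.coord x₀ x (hx.trans_le hrr₀) _ (hQR₀ (hshift x₀ x hx t (hIooIcc ht)))
      have e : f x₀ x (t - o x₀ x) 0 - p x₀ = (f x₀ x (t - o x₀ x) 0 - p x) + (p x - p x₀) := by
        abel
      rw [hσf, e]
      change σ x₀ (ι (_ + _)) = t
      rw [map_add, map_add, h2]
      change t - o x₀ x + o x₀ x = t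
      ring
    rw [hηp, kerProj_apply (hσU x₀), h1]
    abel
  have hset : ∀ ε ≤ min ε₁ (Q / (4 * K)), ∀ x₀ x, ‖p x - p x₀‖ < r →
      localUnstable T O (range p) ε (p x) = unstableGraph Uf σf (p x₀)
        {t | t ∈ Ioo (-(Q / 2)) (Q / 2) ∧ ∀ m, ‖f x₀ x (t - o x₀ x) m - p (R^[m] x)‖ < ε}
        (η (p x₀) (p x)) := by
    intro ε hε x₀ x hx
    obtain ⟨-, h1⟩ := hparam x₀ x (hx.trans_le hrr₁)
    obtain ⟨h2, h3⟩ := h1 ε (hε.trans (min_le_left _ _))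
    ext y
    constructor
    · rintro ⟨z, rfl, hz⟩
      obtain ⟨-, h5⟩ := h3 z hz
      have h6 := hz.1
      simp only [h.backIter_eq hF, mem_ball_iff_norm] at h6
      have h7 : |σ x₀ (ι (z 0 - p x))| < Q / 4 := by
        calc _ ≤ K * ‖z 0 - p x‖ := hσB _ _
          _ < K * ε := by gcongr; exact h6 0
          _ ≤ K * (Q / (4 * K)) := by gcongr; exact hε.trans (min_le_right _ _)
          _ = _ := by field_simp
      set t := σ x₀ (ι (z 0 - p x)) with ht
      have h8 := abs_lt.1 (hoQ x₀ x hx)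
      have h9 := abs_lt.1 h7
      have h10 : t + o x₀ x ∈ Ioo (-(Q / 2)) (Q / 2) := ⟨by linarith, by linarith⟩
      refine ⟨t + o x₀ x, ⟨h10, fun m => ?_⟩, ?_⟩
      · rw [add_sub_cancel_right, ← h5]; exact h6 m
      · rw [hgraph x₀ x hx _ h10, add_sub_cancel_right, ← h5]
    · rintro ⟨t, ⟨ht, hlt⟩, rfl⟩
      rw [hgraph x₀ x hx t ht]
      exact h2 _ (hQR₁ (hshift x₀ x hx t (hIooIcc ht))) hlt
  refine ⟨min ε₁ (Q / (4 * K)), by positivity, fun ε₀ hε₀ => ⟨r, hr0, Q / 2, by positivity, η,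
    ?_, ?_, ?_, ?_, ?_⟩⟩
  · rintro _ ⟨x₀, rfl⟩ _ ⟨x, rfl⟩ hx
    have h1 : ContDiffOn ℝ n (fun t => f x₀ x (t - o x₀ x) 0 - p x₀) (Ioo (-(Q / 2)) (Q / 2)) := by
      refine ContDiffOn.sub ?_ contDiffOn_const
      exact (hF.smooth x₀ x (hx.trans_le hrr₀)).comp (contDiff_id.sub contDiff_const).contDiffOn
        fun t ht => hQR₀ (hshift x₀ x hx t (hIooIcc ht))
    have h2 := (kerProj (σf (p x₀)) (Uf (p x₀))).contDiff.comp_contDiffOn h1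
    exact h2.congr fun t ht => hηp x₀ x t
  · rintro _ ⟨x, rfl⟩
    have ho0 : o x x = 0 := by simp [ho]
    have hself : ‖p x - p x‖ < r₀ := by rw [sub_self, norm_zero]; exact hF.radius_pos
    have e : η (p x) (p x) = fun t => kerProj (σf (p x)) (Uf (p x)) (f x x t 0 - p x) := by
      funext t; rw [hηp, ho0, sub_zero]
    rw [e]
    refine ⟨?_, ?_⟩
    · simp only [hF.base x x hself, Function.iterate_zero, id_eq, sub_self, map_zero]
    · have h1 := (kerProj (σf (p x)) (Uf (p x))).hasFDerivAt.comp_hasDerivAt 0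
        ((h.hasDerivAt_curve hF x).sub_const (p x))
      have h2 : kerProj (σf (p x)) (Uf (p x)) (U x) = 0 := by
        refine Subtype.ext ?_
        rw [kerProj_apply (hσU x), ← hUf, hσU x, one_smul, sub_self]; rfl
      rw [h2] at h1
      exact h1
  · rintro ε hε hεε₀ _ ⟨x₀, rfl⟩ _ ⟨x, rfl⟩ hx
    refine ⟨_, fun t ht => ht.1, ?_, ?_, hset ε (hεε₀.trans hε₀) x₀ x hx⟩
    · -- only finitely many of the conditions matter
      have e : {t | t ∈ Ioo (-(Q / 2)) (Q / 2) ∧ ∀ m, ‖f x₀ x (t - o x₀ x) m - p (R^[m] x)‖ < ε}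
          = ⋂ m ∈ Finset.range (N + 1), {t | t ∈ Ioo (-(Q / 2)) (Q / 2) ∧
            ‖f x₀ x (t - o x₀ x) m - p (R^[m] x)‖ < ε} := by
        ext t
        simp only [mem_ofPred_eq, mem_iInter, Finset.mem_range]
        refine ⟨fun ht m _ => ⟨ht.1, ht.2 m⟩, fun ht => ⟨(ht 0 (by omega)).1, fun m => ?_⟩⟩
        rcases lt_or_ge m (N + 1) with hm | hm
        · exact (ht m hm).2
        · have h0 := ht 0 (by omega)
          refine lt_of_le_of_lt ?_ h0.2
          refine ((hparam x₀ x (hx.trans_le hrr₁)).1 _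
            (hQR₁ (hshift x₀ x hx t (hIooIcc h0.1))) m).trans ?_
          exact mul_le_of_le_one_left (norm_nonneg _) (hN m (by omega))
      rw [e]
      refine isOpen_biInter_finset fun m _ => ?_
      have hco : ContinuousOn (fun t => ‖f x₀ x (t - o x₀ x) m - p (R^[m] x)‖)
          (Ioo (-(Q / 2)) (Q / 2)) := by
        refine ContinuousOn.norm (ContinuousOn.sub ?_ continuousOn_const)
        refine LipschitzOnWith.continuousOn (K := b.toNNReal) ?_
        refine LipschitzOnWith.of_dist_le_mul fun t ht t' ht' => ?_
        rw [dist_eq_norm, Real.dist_eq, Real.coe_toNNReal _ hb.le]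
        refine ((hstr x₀ x (hx.trans_le hrr₂)).2 _ (hQR₂ (hshift x₀ x hx t (hIooIcc ht))) _
          (hQR₂ (hshift x₀ x hx t' (hIooIcc ht'))) m).trans_eq ?_
        rw [sub_sub_sub_cancel_right]
      exact hco.isOpen_inter_preimage isOpen_Ioo isOpen_Iio
    · refine ordConnected_iff.2 fun t₁ ht₁ t₂ ht₂ _ t ht => ?_
      have htI : t ∈ Ioo (-(Q / 2)) (Q / 2) := ordConnected_Ioo.out ht₁.1 ht₂.1 ht
      -- the conditions are star-shaped with respect to the base point
      obtain ⟨t₃, ht₃, s, hs0, hs1, hs⟩ : ∃ t₃, (t₃ ∈ Ioo (-(Q / 2)) (Q / 2) ∧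
          ∀ m, ‖f x₀ x (t₃ - o x₀ x) m - p (R^[m] x)‖ < ε) ∧ ∃ s, 0 ≤ s ∧ s ≤ 1 ∧
          t - o x₀ x = s * (t₃ - o x₀ x) := by
        rcases eq_or_ne (t - o x₀ x) 0 with h0 | h0
        · exact ⟨t₁, ht₁, 0, le_rfl, zero_le_one, by rw [h0, zero_mul]⟩
        rcases lt_or_gt_of_ne h0 with h1 | h1
        · have h2 : t₁ - o x₀ x < 0 := by linarith [ht.1]
          refine ⟨t₁, ht₁, (t - o x₀ x) / (t₁ - o x₀ x), (div_pos_of_neg_of_neg h1 h2).le,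
            (div_le_one_of_neg h2).2 (by linarith [ht.1]), (div_mul_cancel₀ _ h2.ne).symm⟩
        · have h2 : 0 < t₂ - o x₀ x := by linarith [ht.2]
          refine ⟨t₂, ht₂, (t - o x₀ x) / (t₂ - o x₀ x), (div_pos h1 h2).le,
            (div_le_one h2).2 (by linarith [ht.2]), (div_mul_cancel₀ _ h2.ne').symm⟩
      have hmono : ∀ m ≤ N, ‖f x₀ x (t - o x₀ x) m - p (R^[m] x)‖ < ε := by
        intro m hm
        have h1 := (hstr x₀ x (hx.trans_le hrr₂)).1 _
          (hQR₂ (hshift x₀ x hx t₃ (hIooIcc ht₃.1))) s hs0 hs1 m hm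
        rw [← hs] at h1
        have h2 : 0 ≤ a * ((1 - s) * |t₃ - o x₀ x|) :=
          mul_nonneg ha.le (mul_nonneg (sub_nonneg.2 hs1) (abs_nonneg _))
        linarith [ht₃.2 m]
      refine ⟨htI, fun m => ?_⟩
      rcases le_or_gt m N with hm | hm
      · exact hmono m hm
      · refine lt_of_le_of_lt ?_ (hmono 0 (Nat.zero_le _))
        refine ((hparam x₀ x (hx.trans_le hrr₁)).1 _
          (hQR₁ (hshift x₀ x hx t (hIooIcc htI))) m).trans ?_
        exact mul_le_of_le_one_left (norm_nonneg _) (hN m hm.le)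
  · intro ε hε hεε₀
    refine ⟨ε / c, by positivity, ?_⟩
    rintro _ ⟨x₀, rfl⟩ _ ⟨x, rfl⟩ hx _ ⟨⟨t, ht, rfl⟩, hball⟩
    rw [hset ε (hεε₀.trans hε₀) x₀ x hx]
    rw [hgraph x₀ x hx t ht, mem_ball_iff_norm] at hball
    refine ⟨t, ⟨ht, fun m => ?_⟩, rfl⟩
    calc _ ≤ c * θ ^ m * ‖f x₀ x (t - o x₀ x) 0 - p x‖ :=
          (hparam x₀ x (hx.trans_le hrr₁)).1 _ (hQR₁ (hshift x₀ x hx t (hIooIcc ht))) m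
      _ ≤ c * 1 * ‖f x₀ x (t - o x₀ x) 0 - p x‖ := by gcongr; exact pow_le_one₀ hθ0.le hθ1.le
      _ < c * 1 * (ε / c) := by gcongr
      _ = ε := by field_simp
  · rintro _ ⟨x₀, rfl⟩ _ ⟨x, rfl⟩ hx
    have hemb := (h.contp.isClosedEmbedding h.injp).isEmbedding
    have hJ : {x | ‖p x - p x₀‖ < r} ∈ 𝓝 x :=
      (isOpen_lt (h.contp.sub continuous_const).norm continuous_const).mem_nhds hx
    have hoc : Continuous fun q : X × ℝ => (q.1, q.2 - o x₀ q.1) := by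
      have := h.contp
      simp only [ho]
      fun_prop
    have hmaps : MapsTo (fun q : X × ℝ => (q.1, q.2 - o x₀ q.1))
        ({x | ‖p x - p x₀‖ < r} ×ˢ Icc (-(Q / 2)) (Q / 2))
        ({x | ‖p x - p x₀‖ < r₀} ×ˢ Ioo (-R₀) R₀) := fun q hq =>
      ⟨lt_of_lt_of_le hq.1 hrr₀, hQR₀ (hshift x₀ q.1 hq.1 q.2 hq.2)⟩
    have hc1 : ContinuousOn (fun q : X × ℝ => η (p x₀) (p q.1) q.2)
        ({x | ‖p x - p x₀‖ < r} ×ˢ Icc (-(Q / 2)) (Q / 2)) := by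
      simp only [hηp]
      exact (kerProj (σf (p x₀)) (Uf (p x₀))).continuous.comp_continuousOn
        (((hF.cont x₀).comp hoc.continuousOn hmaps).sub continuousOn_const)
    have hder : ∀ x', ‖p x' - p x₀‖ < r → ∀ t ∈ Ioo (-(Q / 2)) (Q / 2), deriv (η (p x₀) (p x')) t
        = kerProj (σf (p x₀)) (Uf (p x₀)) (deriv (fun t => f x₀ x' t 0) (t - o x₀ x')) := by
      intro x' hx' t ht
      have h1 : HasDerivAt (fun t => f x₀ x' t 0) (deriv (fun t => f x₀ x' t 0) (t - o x₀ x'))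
          (t - o x₀ x') :=
        ((((hF.smooth x₀ x' (hx'.trans_le hrr₀)).differentiableOn
          (ENat.one_le_iff_ne_zero_withTop.1 hn)).differentiableAt (isOpen_Ioo.mem_nhds
          (hQR₀ (hshift x₀ x' hx' t (hIooIcc ht)))))).hasDerivAt
      have h2 := (kerProj (σf (p x₀)) (Uf (p x₀))).hasFDerivAt.comp_hasDerivAt t
        ((h1.comp_sub_const t (o x₀ x')).sub_const (p x₀))
      have e : η (p x₀) (p x') = fun t => kerProj (σf (p x₀)) (Uf (p x₀))
          (f x₀ x' (t - o x₀ x') 0 - p x₀) := funext fun t => hηp x₀ x' t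
      rw [e]
      exact h2.deriv
    refine ⟨(tendstoUniformlyOn_of_continuousOn hemb hJ isCompact_Icc hc1).mono hIooIcc, ?_⟩
    have hc2 : ContinuousOn (fun q : X × ℝ => kerProj (σf (p x₀)) (Uf (p x₀))
        (deriv (fun t => f x₀ (Function.invFun p (p q.1)) t 0)
          (q.2 - o x₀ (Function.invFun p (p q.1)))))
        ({x | ‖p x - p x₀‖ < r} ×ˢ Icc (-(Q / 2)) (Q / 2)) := by
      simp only [hinv]
      exact (kerProj (σf (p x₀)) (Uf (p x₀))).continuous.comp_continuousOn
        ((hF.cont_deriv x₀).comp hoc.continuousOn hmaps)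
    have h3 := (tendstoUniformlyOn_of_continuousOn (g := fun e t => kerProj (σf (p x₀)) (Uf (p x₀))
        (deriv (fun t => f x₀ (Function.invFun p e) t 0) (t - o x₀ (Function.invFun p e))))
        hemb hJ isCompact_Icc hc2).mono hIooIcc
    refine (h3.congr ?_).congr_right fun t ht => ?_
    · rw [← hemb.map_nhds_eq x, eventually_map]
      filter_upwards [hJ] with x' hx' t ht
      simp only [hinv]
      exact (hder x' hx' t ht).symm
    · simp only [hinv]
      exact (hder x hx t ht).symm

end LocalModel

/-! ### Orbit segments which stay close to the basic set -/

namespace LocalModel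

variable {X B C : Type*} [TopologicalSpace X] [CompactSpace X]
    [NormedAddCommGroup B] [NormedSpace ℝ B] [NormedAddCommGroup C] [NormedSpace ℝ C]
    {S : X → X} {p : X → B} {ι : B →L[ℝ] C} {T : B → B} {O : Set B} {U : X → B} {δ : X → ℝ}
    {σ : X → C →L[ℝ] ℝ} {LB : X → B →L[ℝ] B} {LC : X → C →L[ℝ] C} {G : ℝ → X → Set B}
    {C₀ lam : ℝ} {R : X → X} {n : WithTop ℕ∞} {r₀ R₀ : ℝ} {f : X → X → ℝ → ℕ → B}

variable (h : LocalModel S p ι T O U δ σ LB LC G C₀ lam)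
  (hF : UnstableFamily S p ι T U δ σ G R n r₀ R₀ f)
include h hF

/-- The end point of an orbit segment which stays close to the basic set is exponentially close to
the local unstable set. -/
theorem infDist_localUnstable : ∃ ε₁ c θ : ℝ, 0 < ε₁ ∧ 0 < c ∧ 0 < θ ∧ θ < 1 ∧
    ∀ ε, 0 < ε → ε ≤ ε₁ → ∀ x y m, (∀ i ≤ m, T^[i] y ∈ Metric.ball (T^[i] (p x)) ε) →
      Metric.infDist (T^[m] y) (localUnstable T O (range p) ε (T^[m] (p x))) ≤ c * θ ^ m := by
  obtain ⟨K, hK, -, hσB, -, -, -⟩ := h.exists_bounds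
  have hK0 : 0 < K := by linarith
  obtain ⟨η, r, c, θ, hη, hr, hc, hθ0, hθ1, hfwd⟩ := h.forward_contract
  obtain ⟨ε₁, r₁, R₁, cp, θp, hε₁, hr₁, hr₁₀, hR₁, hR₁₀, hcp, hθp0, hθp1, hparam⟩ :=
    h.localUnstable_param hF
  -- beyond the time `N`, closeness of the backward iterates is automatic
  obtain ⟨N, hN⟩ : ∃ N, ∀ m, N ≤ m → cp * θp ^ m ≤ 1 := by
    have : Tendsto (fun m : ℕ => cp * θp ^ m) atTop (𝓝 (cp * 0)) :=
      (tendsto_pow_atTop_nhds_zero_of_lt_one hθp0.le hθp1).const_mul cp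
    rw [mul_zero] at this
    obtain ⟨N, hN⟩ := eventually_atTop.1 (this.eventually (gt_mem_nhds one_pos))
    exact ⟨N, fun m hm => (hN m hm).le⟩
  obtain ⟨r₂, R₂, a, b, hr₂, hr₂₀, hR₂, hR₂₀, ha, hb, hstr⟩ := h.exists_straight hF N
  obtain ⟨R₃, hR₃, hnear⟩ := hF.near r hr
  set Q := min (min R₁ R₂) R₃ with hQ
  have hQ0 : 0 < Q := by positivity
  have hQR₁ : Ioo (-Q) Q ⊆ Ioo (-R₁) R₁ := by
    have : Q ≤ R₁ := (min_le_left _ _).trans (min_le_left _ _)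
    exact Ioo_subset_Ioo (neg_le_neg this) this
  have hQR₂ : Ioo (-Q) Q ⊆ Ioo (-R₂) R₂ := by
    have : Q ≤ R₂ := (min_le_left _ _).trans (min_le_right _ _)
    exact Ioo_subset_Ioo (neg_le_neg this) this
  have hQR₃ : Ioo (-Q) Q ⊆ Ioo (-R₃) R₃ := by
    have : Q ≤ R₃ := min_le_right _ _
    exact Ioo_subset_Ioo (neg_le_neg this) this
  have hQR₀ : Ioo (-Q) Q ⊆ Ioo (-R₀) R₀ :=
    hQR₁.trans (Ioo_subset_Ioo (neg_le_neg hR₁₀) hR₁₀)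
  set e := min (min ε₁ r) (Q / K) with he
  have he0 : 0 < e := by positivity
  set D := e + cp * (b * Q) with hD
  have hD0 : 0 < D := by positivity
  set M := c * D * (θ ^ N)⁻¹ with hM
  have hM0 : 0 < M := by positivity
  refine ⟨e, c * D + b * (M / a) + e * (θ ^ N)⁻¹, θ, he0, by positivity, hθ0, hθ1,
    fun ε hε hεe x y m hcl => ?_⟩
  simp only [h.iterate_p, mem_ball_iff_norm] at hcl ⊢
  set x' := S^[m] x with hx'
  have hpow : ∀ i, i ≤ m → ∀ k, k ≤ N → m ≤ i + k → θ ^ i ≤ (θ ^ N)⁻¹ * θ ^ m := by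
    intro i hi k hk hik
    rw [inv_mul_eq_div, le_div_iff₀ (by positivity), ← pow_add]
    exact pow_le_pow_of_le_one hθ0.le hθ1.le (by omega)
  have hself : ‖p x' - p x'‖ = 0 := by rw [sub_self, norm_zero]
  have h0Q : (0 : ℝ) ∈ Ioo (-Q) Q := ⟨by linarith, hQ0⟩
  obtain ⟨hdecay, hmem⟩ := hparam x' x' (by rw [hself]; exact hr₁)
  replace hmem := (hmem ε (hεe.trans ((min_le_left _ _).trans (min_le_left _ _)))).1
  obtain ⟨hmono, hlip⟩ := hstr x' x' (by rw [hself]; exact hr₂)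
  have hself0 : ‖p x' - p x'‖ < r₀ := by rw [hself]; exact hF.radius_pos
  have hpx : f x' x' 0 0 = p x' := hF.base x' x' hself0 0
  rcases lt_or_ge m N with hmN | hmN
  · -- short orbit segments
    have h1 : p x' ∈ localUnstable T O (range p) ε (p x') := by
      rw [← hpx]
      convert hmem 0 (hQR₁ h0Q) (fun m => by
        rw [hF.base x' x' hself0, sub_self, norm_zero]; exact hε) using 1
      rw [hpx]
    refine (Metric.infDist_le_dist_of_mem h1).trans ?_
    rw [dist_eq_norm]
    have h2 := hpow 0 (by omega) m hmN.le (by omega)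
    rw [pow_zero] at h2
    calc ‖T^[m] y - p x'‖ ≤ e * 1 := by linarith [hcl m le_rfl]
      _ ≤ e * ((θ ^ N)⁻¹ * θ ^ m) := by gcongr
      _ = e * (θ ^ N)⁻¹ * θ ^ m := by ring
      _ ≤ _ := by gcongr; exact le_add_of_nonneg_left (by positivity)
  · set t := σ x' (ι (T^[m] y - p x')) with ht
    have htQ : t ∈ Ioo (-Q) Q := by
      refine abs_lt.1 ?_
      calc |t| ≤ K * ‖T^[m] y - p x'‖ := hσB _ _
        _ < K * ε := by gcongr; exact hcl m le_rfl
        _ ≤ K * (Q / K) := by gcongr; exact hεe.trans (min_le_right _ _)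
        _ = Q := by field_simp
    have hback : ∀ i j, T^[i] (f x' x' t (j + i)) = f x' x' t j := by
      intro i
      induction i with
      | zero => intro j; rfl
      | succ i ih =>
        intro j
        rw [Function.iterate_succ_apply, ← add_assoc, hF.orbit x' x' hself0 t (hQR₀ htQ), ih]
    have hR : ∀ i j, i + j = m → R^[j] x' = S^[i] x := by
      intro i j hij
      rw [hx', ← hij, add_comm, Function.iterate_add_apply]
      exact Function.LeftInverse.iterate hF.left j _
    have hstart : ‖y - f x' x' t m‖ ≤ D := by
      have h1 := hdecay t (hQR₁ htQ) m
      have h2 := hlip t (hQR₂ htQ) 0 (hQR₂ h0Q) 0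
      rw [hpx, sub_zero] at h2
      rw [hR 0 m (by omega), Function.iterate_zero, id] at h1
      have h3 := hcl 0 (by omega)
      simp only [Function.iterate_zero, id] at h3
      have h4 : θp ^ m ≤ 1 := pow_le_one₀ hθp0.le hθp1.le
      have h5 : |t| ≤ Q := (abs_lt.2 htQ).le
      have h6 : ‖f x' x' t m - p x‖ ≤ cp * (b * Q) := by
        calc _ ≤ cp * θp ^ m * ‖f x' x' t 0 - p x'‖ := h1
          _ ≤ cp * 1 * (b * Q) := by gcongr; exact h2.trans (by gcongr)
          _ = _ := by ring
      calc ‖y - f x' x' t m‖ = ‖(y - p x) - (f x' x' t m - p x)‖ := by congr 1; abel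
        _ ≤ _ := (norm_sub_le _ _).trans (add_le_add (h3.le.trans hεe) h6)
    have hclose : ∀ j k, j + k = m → ‖T^[j] y - f x' x' t k‖ ≤ c * D * θ ^ j := by
      intro j k hjk
      have h1 := hfwd m x y (f x' x' t m) (fun i hi => ⟨?_, ?_⟩) ?_ j (by omega)
      · rw [show m = k + j by omega, hback] at h1
        calc _ ≤ c * θ ^ j * ‖y - f x' x' t m‖ := by rw [show m = k + j by omega]; exact h1
          _ ≤ c * θ ^ j * D := by gcongr
          _ = _ := by ring
      · exact mem_ball_iff_norm.2 ((hcl i hi).trans_le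
          (hεe.trans ((min_le_left _ _).trans (min_le_right _ _))))
      · have h2 := hnear x' x' hself0 t (hQR₃ htQ) (m - i)
        rw [hR i (m - i) (by omega)] at h2
        rw [← hback i (m - i), Nat.sub_add_cancel hi] at h2
        exact h2
      · have e2 : T^[m] (f x' x' t m) = f x' x' t 0 := by simpa using hback m 0
        have e1 : σ x' (ι (T^[m] y - f x' x' t 0)) = 0 := by
          have e3 : T^[m] y - f x' x' t 0 = (T^[m] y - p x') - (f x' x' t 0 - p x') := by abel
          rw [e3, map_sub, map_sub, hF.coord x' x' hself0 t (hQR₀ htQ), ← ht, sub_self]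
        rw [e2, e1, abs_zero]
        positivity
    -- slide along the curve towards the base point until all backward iterates are `ε`-close
    set q := M * θ ^ m / a with hq
    have hq0 : 0 ≤ q := by positivity
    obtain ⟨s, hs0, hs1, hsq, hs⟩ : ∃ s : ℝ, 0 ≤ s ∧ s ≤ 1 ∧ (1 - s) * |t| ≤ q ∧
        (s = 0 ∨ (1 - s) * |t| = q) := by
      rcases le_or_gt (|t|) q with h1 | h1
      · exact ⟨0, le_rfl, zero_le_one, by simpa using h1, Or.inl rfl⟩
      · have h2 : 0 < |t| := hq0.trans_lt h1
        have h3 : q / |t| ≤ 1 := (div_le_one h2).2 h1.le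
        have h4 : (1 - (1 - q / |t|)) * |t| = q := by field_simp; ring
        exact ⟨1 - q / |t|, by linarith, by linarith [div_nonneg hq0 h2.le], h4.le, Or.inr h4⟩
    have hstQ : s * t ∈ Ioo (-Q) Q := by
      refine abs_lt.1 ?_
      rw [abs_mul, abs_of_nonneg hs0]
      exact (mul_le_of_le_one_left (abs_nonneg t) hs1).trans_lt (abs_lt.2 htQ)
    have hfirst : ∀ k ≤ N, ‖f x' x' (s * t) k - p (R^[k] x')‖ < ε := by
      intro k hk
      rcases hs with rfl | hs
      · rw [zero_mul, hF.base x' x' hself0, sub_self, norm_zero]; exact hε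
      · have h1 := hmono t (hQR₂ htQ) s hs0 hs1 k hk
        rw [hs] at h1
        have h2 := hclose (m - k) k (by omega)
        have h3 := hcl (m - k) (by omega)
        rw [← hR (m - k) k (by omega)] at h3
        have h4 : c * D * θ ^ (m - k) ≤ M * θ ^ m := by
          rw [hM, mul_assoc (c * D)]
          gcongr
          exact hpow (m - k) (by omega) k hk (by omega)
        have h5 : a * q = M * θ ^ m := by rw [hq]; field_simp
        have h6 : ‖f x' x' t k - p (R^[k] x')‖
            ≤ ‖T^[m - k] y - p (R^[k] x')‖ + ‖T^[m - k] y - f x' x' t k‖ := by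
          calc _ = ‖(T^[m - k] y - p (R^[k] x')) - (T^[m - k] y - f x' x' t k)‖ := by
                congr 1; abel
            _ ≤ _ := norm_sub_le _ _
        linarith
    have hmemS := hmem (s * t) (hQR₁ hstQ) fun k => by
      rcases le_or_gt k N with hk | hk
      · exact hfirst k hk
      · refine ((hdecay _ (hQR₁ hstQ) k).trans ?_).trans_lt (hfirst 0 (Nat.zero_le _))
        exact mul_le_of_le_one_left (norm_nonneg _) (hN k hk.le)
    refine (Metric.infDist_le_dist_of_mem hmemS).trans ?_
    rw [dist_eq_norm]
    have h1 := hclose m 0 (by omega)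
    have h2 := hlip t (hQR₂ htQ) (s * t) (hQR₂ hstQ) 0
    have h3 : |t - s * t| ≤ q := by
      have e1 : t - s * t = (1 - s) * t := by ring
      rw [e1, abs_mul, abs_of_nonneg (sub_nonneg.2 hs1)]; exact hsq
    have h4 : 0 ≤ e * (θ ^ N)⁻¹ * θ ^ m := by positivity
    calc ‖T^[m] y - f x' x' (s * t) 0‖
        ≤ ‖T^[m] y - f x' x' t 0‖ + ‖f x' x' t 0 - f x' x' (s * t) 0‖ :=
            norm_sub_le_norm_sub_add_norm_sub _ _ _
      _ ≤ c * D * θ ^ m + b * q := add_le_add h1 (h2.trans (by gcongr))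
      _ = (c * D + b * (M / a)) * θ ^ m := by rw [hq]; ring
      _ ≤ _ := by nlinarith

end LocalModel

/-! ### The unstable family of an extended operator -/

lemma continuous_vanishing_eval {Z G : Type*} [TopologicalSpace Z] [NormedAddCommGroup G]
    [NormedSpace ℝ G] : Continuous fun q : Vanishing Z G × Z => q.1 q.2 :=
  (continuous_eval (F := BoundedContinuousFunction Z G)).comp
    ((inclBCF.continuous.comp continuous_fst).prodMk continuous_snd)

/-- The unstable curves of the operator `TA` on `A`, mapped to a larger space `B`, form an unstable
family for every extension `TB` of `TA` to `B`. -/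
theorem exists_unstableFamily {X A B C : Type*} [TopologicalSpace X] [CompactSpace X] [T2Space X]
    [NormedAddCommGroup A] [NormedSpace ℝ A] [CompleteSpace A] [NormedAddCommGroup B]
    [NormedSpace ℝ B] [NormedAddCommGroup C] [NormedSpace ℝ C] {S R : X → X} {u : X → A}
    {δ : X → ℝ} {s : X → A →L[ℝ] ℝ} {θ C₀ lam : ℝ} {p : X → A} {T : A → A} {O : Set A}
    {n : WithTop ℕ∞} {j : A →L[ℝ] B} {ι : B →L[ℝ] C} {TB : B → B} {σ : X → C →L[ℝ] ℝ}
    (hn : (∃ k : ℕ, 2 ≤ k ∧ n = (k : WithTop ℕ∞)) ∨ n = ω)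
    (hO : IsOpen O) (hT : ContDiffOn ℝ n T O) (hp : Continuous p) (hpO : ∀ x, p x ∈ O)
    (hsemi : ∀ x, T (p x) = p (S x))
    (hA : IsSplitCocycle S (fun x => fderiv ℝ T (p x)) u δ s θ C₀ lam) (hθ : θ < 1)
    (hinv : ∀ x v, s (S x) (fderiv ℝ T (p x) v) = δ x * s x v)
    (hright : ∀ x, S (R x) = x) (hleft : ∀ x, R (S x) = x) (hR : Continuous R)
    (hu : Continuous u) (hs : Continuous s) (hδ : Continuous δ) (hS : Continuous S)
    (hinj : Function.Injective fun x => j (p x)) (hTB : ∀ a ∈ O, TB (j a) = j (T a))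
    (hσ : ∀ x v, σ x (ι (j v)) = s x v) :
    ∃ r₀ R₀ f, UnstableFamily S (fun x => j (p x)) ι TB (fun x => j (u x)) δ σ
      (fun r x => j '' Metric.ball (p x) r) R n r₀ R₀ f := by
  have hsu : Continuous fun q : X × X => s q.1 (u q.2) :=
    (hs.comp continuous_fst).clm_apply (hu.comp continuous_snd)
  obtain ⟨r₀, hr₀, hdiag⟩ := LocalModel.exists_near_diagonal (j.continuous.comp hp) hinj
    (f := fun x x₀ => -s x₀ (u x)) (ε := -(1 / 2)) (hsu.comp continuous_swap).neg
    (fun x => by simp only [hA.one]; norm_num)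
  let Z₀ := {q : X × X // 1 / 2 ≤ s q.1 (u q.2)}
  have : CompactSpace Z₀ :=
    isCompact_iff_compactSpace.1 (isClosed_le continuous_const hsu).isCompact
  obtain ⟨R₀, hR₀, g, hg, hg0, horb, hcoord, hstr⟩ := exists_unstable_family (Z₀ := Z₀)
    (b := fun z m => R^[m] z.1.2) (τ := fun z => s z.1.1) hn hO hT hp hpO hsemi hA hθ hinv
    (fun z m => by rw [Function.iterate_succ_apply', hright])
    (fun m => (hR.iterate m).comp (continuous_snd.comp continuous_subtype_val)) hu hs hδ hS
    (hs.comp (continuous_fst.comp continuous_subtype_val))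
    (fun z => lt_of_lt_of_le (by norm_num) z.2)
  have hn1 : 1 ≤ n := by
    rcases hn with ⟨k, hk, rfl⟩ | rfl
    · exact_mod_cast (by omega : 1 ≤ k)
    · exact le_top
  classical
  set f : X → X → ℝ → ℕ → B := fun x₀ x t m =>
    if h : 1 / 2 ≤ s x₀ (u x) then j (p (R^[m] x) + g t (⟨(x₀, x), h⟩, m)) else 0 with hf
  have hclose : ∀ x₀ x, ‖j (p x) - j (p x₀)‖ < r₀ → 1 / 2 ≤ s x₀ (u x) := fun x₀ x hx => by
    have := hdiag x x₀ hx
    linarith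
  have hfe : ∀ x₀ x (hx : ‖j (p x) - j (p x₀)‖ < r₀), ∀ t m,
      f x₀ x t m = j (p (R^[m] x) + g t (⟨(x₀, x), hclose x₀ x hx⟩, m)) := fun x₀ x hx t m => by
    simp only [hf, dif_pos (hclose x₀ x hx)]
  -- evaluation as a continuous linear map
  let ev : Z₀ × ℕ → Vanishing (Z₀ × ℕ) A →L[ℝ] A := fun z =>
    (BoundedContinuousFunction.evalCLM ℝ z).comp inclBCF
  have h0 : (0 : ℝ) ∈ Ioo (-R₀) R₀ := ⟨by linarith, hR₀⟩
  have hdiff : ∀ t ∈ Ioo (-R₀) R₀, HasDerivAt g (deriv g t) t := fun t ht =>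
    ((hg.differentiableOn (ENat.one_le_iff_ne_zero_withTop.1 hn1)).differentiableAt
      (isOpen_Ioo.mem_nhds ht)).hasDerivAt
  have hder : ∀ x₀ x (hx : ‖j (p x) - j (p x₀)‖ < r₀), ∀ t ∈ Ioo (-R₀) R₀,
      deriv (fun t => f x₀ x t 0) t = j (deriv g t (⟨(x₀, x), hclose x₀ x hx⟩, 0)) := by
    intro x₀ x hx t ht
    simp only [hfe x₀ x hx]
    exact (j.hasFDerivAt.comp_hasDerivAt t (((ev (⟨(x₀, x), hclose x₀ x hx⟩, 0)).hasFDerivAt.comp_hasDerivAt t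
      (hdiff t ht)).const_add (p (R^[0] x)))).deriv
  -- evaluation of a curve of functions is jointly continuous
  have hcont : ∀ G : ℝ → Vanishing (Z₀ × ℕ) A, ContinuousOn G (Ioo (-R₀) R₀) → ∀ x₀,
      Continuous fun q : ({x | ‖j (p x) - j (p x₀)‖ < r₀} ×ˢ Ioo (-R₀) R₀ : Set (X × ℝ)) =>
        G q.1.2 (⟨(x₀, q.1.1), hclose x₀ q.1.1 q.2.1⟩, 0) := by
    intro G hG x₀
    have c1 : Continuous fun q : ({x | ‖j (p x) - j (p x₀)‖ < r₀} ×ˢ Ioo (-R₀) R₀ : Set (X × ℝ)) =>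
        G q.1.2 :=
      hG.comp_continuous (continuous_snd.comp continuous_subtype_val) fun q => q.2.2
    refine continuous_vanishing_eval.comp (c1.prodMk ((Continuous.subtype_mk ?_ _).prodMk
      continuous_const))
    exact continuous_const.prodMk (continuous_fst.comp continuous_subtype_val)
  refine ⟨r₀, R₀, f, hright, hleft, hr₀, hR₀, ?_, ?_, ?_, ?_, ?_, ?_, ?_, ?_⟩
  · intro x₀ x hx t ht m
    obtain ⟨h1, h2⟩ := horb t ht ⟨(x₀, x), hclose x₀ x hx⟩ m
    rw [hfe x₀ x hx, hfe x₀ x hx, hTB _ h1, h2]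
  · intro x₀ x hx m
    rw [hfe x₀ x hx, hg0, Vanishing.zero_apply, add_zero]
  · intro ε hε
    have h1 : ∀ᶠ t in 𝓝 0, ‖g t‖ < ε := by
      have := (hdiff 0 h0).continuousAt.norm
      refine this.eventually (gt_mem_nhds ?_)
      change ‖g 0‖ < ε
      rw [hg0, norm_zero]; exact hε
    obtain ⟨R₁, hR₁, h2⟩ := Metric.eventually_nhds_iff.1 h1
    refine ⟨R₁, hR₁, fun x₀ x hx t ht m => ?_⟩
    rw [hfe x₀ x hx]
    refine ⟨_, ?_, rfl⟩
    rw [mem_ball_iff_norm, add_sub_cancel_left]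
    refine (norm_apply_le_norm _ _).trans_lt (h2 ?_)
    rw [Real.dist_0_eq_abs]
    exact abs_lt.2 ht
  · intro x₀ x hx t ht
    rw [hfe x₀ x hx, Function.iterate_zero, id, map_add, add_sub_cancel_left, hσ]
    exact hcoord t ht ⟨(x₀, x), hclose x₀ x hx⟩
  · intro ε hε
    obtain ⟨R₁, hR₁, -, h1⟩ := hstr (ε / (‖j‖ + 1)) (by positivity)
    refine ⟨R₁, hR₁, fun x₀ x hx t ht t' ht' m => ?_⟩
    have h2 := h1 t ht t' ht' ⟨(x₀, x), hclose x₀ x hx⟩ m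
    rw [hfe x₀ x hx, hfe x₀ x hx, hσ, ← map_sub, ← map_smul, ← map_sub, add_sub_add_left_eq_sub]
    refine (j.le_opNorm _).trans ?_
    calc _ ≤ (‖j‖ + 1) * (ε / (‖j‖ + 1) * |t - t'|) := by
          gcongr
          · linarith
          · exact h2
      _ = _ := by field_simp
  · intro x₀ x hx
    simp only [hfe x₀ x hx]
    exact j.contDiff.comp_contDiffOn (contDiffOn_const.add
      ((ev (⟨(x₀, x), hclose x₀ x hx⟩, 0)).contDiff.comp_contDiffOn hg))
  · intro x₀
    rw [continuousOn_iff_continuous_domRestrict]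
    have := hcont g hg.continuousOn x₀
    have h1 : Continuous fun q : ({x | ‖j (p x) - j (p x₀)‖ < r₀} ×ˢ Ioo (-R₀) R₀ : Set (X × ℝ)) =>
        j (p q.1.1 + g q.1.2 (⟨(x₀, q.1.1), hclose x₀ q.1.1 q.2.1⟩, 0)) :=
      j.continuous.comp ((hp.comp (continuous_fst.comp continuous_subtype_val)).add this)
    exact h1.congr fun q => (hfe x₀ q.1.1 q.2.1 q.1.2 0).symm
  · intro x₀
    rw [continuousOn_iff_continuous_domRestrict]
    have := hcont (deriv g) (hg.continuousOn_deriv_of_isOpen isOpen_Ioo hn1) x₀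
    exact (j.continuous.comp this).congr fun q => (hder x₀ q.1.1 q.2.1 q.1.2 q.2.2).symm

/-! ### The cocycles of a compatible pair -/

/-- If `A` is dense, in the norm of `Y`, in the ball of `X`, then an operator on `Y` is determined
on `X` by its values on `A`. -/
lemma eqOn_of_dense {A V Y Z : Type*} [NormedAddCommGroup A] [NormedSpace ℝ A]
    [NormedAddCommGroup V] [NormedSpace ℝ V] [NormedAddCommGroup Y] [NormedSpace ℝ Y]
    [NormedAddCommGroup Z] [NormedSpace ℝ Z] {j : A →L[ℝ] V} {k : V →L[ℝ] Y} {Δ : ℝ}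
    (h4 : ∀ b : V, ‖b‖ < 1 → k b ∈ closure (k '' {b' : V | ‖b'‖ < Δ ∧ b' ∈ range j}))
    {f g : Y →L[ℝ] Z} (hfg : ∀ a, f (k (j a)) = g (k (j a))) (b : V) : f (k b) = g (k b) := by
  have h1 : ∀ b : V, ‖b‖ < 1 → f (k b) = g (k b) := fun b hb => by
    have hcl : IsClosed {y | f y = g y} := isClosed_eq f.continuous g.continuous
    refine hcl.closure_subset_iff.2 ?_ (h4 b hb)
    rintro _ ⟨_, ⟨-, a, rfl⟩, rfl⟩
    exact hfg a
  have h2 : 0 < ‖b‖ + 1 := by positivity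
  have h3 := h1 ((‖b‖ + 1)⁻¹ • b) (by
    rw [norm_smul, Real.norm_of_nonneg (by positivity), inv_mul_eq_div, div_lt_one h2]
    linarith)
  simp only [map_smul] at h3
  exact smul_right_injective Z (inv_ne_zero h2.ne') h3

/-- The data which a compatible pair `(V, Y)` provides: the cocycle `LV` on `V` and its extension
`Lh` to `Y`, and the extensions `σ x` of the functionals `s x` to `V`, with the rate `μ`. -/
structure IsExtendedCocycle {X A V Y : Type*} [TopologicalSpace X]
    [NormedAddCommGroup A] [NormedSpace ℝ A] [NormedAddCommGroup V] [NormedSpace ℝ V]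
    [NormedAddCommGroup Y] [NormedSpace ℝ Y] (S : X → X) (j : A →L[ℝ] V) (k : V →L[ℝ] Y)
    (LA : X → A →L[ℝ] A) (u : X → A) (δ : X → ℝ) (s : X → A →L[ℝ] ℝ) (LV : X → V →L[ℝ] V)
    (Lh : X → Y →L[ℝ] Y) (σ : X → V →L[ℝ] ℝ) (M C μ : ℝ) : Prop where
  dense : ∀ {f g : Y →L[ℝ] Y}, (∀ a, f (k (j a)) = g (k (j a))) → ∀ b : V, f (k b) = g (k b)
  inter : ∀ x v, j (LA x v) = LV x (j v)
  interY : ∀ x v, k (LV x v) = Lh x (k v)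
  bound_nonneg : 0 ≤ M
  bound : ∀ x v, ‖LV x v‖ ≤ M * ‖v‖
  continuous : Continuous σ
  extends_functional : ∀ x v, σ x (j v) = s x v
  const_pos : 0 < C
  rate_pos : 0 < μ
  rate : ∀ n x v,
    ‖cocycle S LV n x v - (growth S δ n x * σ x v) • j (u (S^[n] x))‖ ≤ C * μ ^ n * ‖v‖

/-- The derivatives at the points of `K` extend to a bounded cocycle on the larger space, and so do the
functionals which define the stable spaces. This uses `exists_extension`. -/
theorem IsCompatible.exists_extendedCocycle {A V Y : Type*} [NormedAddCommGroup A]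
    [NormedSpace ℝ A] [NormedAddCommGroup V] [NormedSpace ℝ V] [NormedAddCommGroup Y]
    [NormedSpace ℝ Y] {T : A → A} {K : Set A} {j : A →L[ℝ] V} {k : V →L[ℝ] Y} {θ lam ρ C₀ : ℝ}
    (hcpt : IsCompatible T K j k θ lam ρ) [CompactSpace K] {S : K → K}
    (hS : Continuous S) (hsemi : ∀ x : K, T x = S x) {u : K → A} {δ : K → ℝ} {s : K → A →L[ℝ] ℝ}
    (hA : IsSplitCocycle S (fun x => fderiv ℝ T x) u δ s θ C₀ lam) (hu : Continuous u)
    (hδ : Continuous δ) (hj : Function.Injective j) (hk : Function.Injective k) :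
    ∃ LV Lh σ M C μ, μ < ρ ∧
      IsExtendedCocycle S j k (fun x : K => fderiv ℝ T x) u δ s LV Lh σ M C μ := by
  obtain ⟨hθρ, hρl, -, hcomp, Lhat, ⟨M, hM, h2⟩, h3, Δ, hΔ, h4, κ, hκ, m, hm, h5⟩ := hcpt
  choose w hw hwM using fun x : K => (h2 x x.2).2.2
  let LV : K → V →L[ℝ] V := fun x => LinearMap.mkContinuous
    { toFun := w x
      map_add' := fun v v' => hk (by simp only [map_add, hw])
      map_smul' := fun c v => hk (by simp only [map_smul, hw, RingHom.id_apply]) } M (hwM x)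
  have hLV : ∀ x v, k (LV x v) = Lhat x (k v) := hw
  have hjL : ∀ (x : K) v, j (fderiv ℝ T x v) = LV x (j v) := fun x v => hk (by
    rw [hLV, (h2 x x.2).1])
  have hcoc : ∀ n (x : K), cocycle T Lhat n x = cocycle S (fun x => Lhat x) n x := fun n x =>
    cocycle_semiconj (p := fun x : K => (x : A)) hsemi Lhat n x
  obtain ⟨c, hc, hcu⟩ := LocalModel.exists_lower
    (k.continuous.comp (j.continuous.comp hu)).norm fun x => norm_pos_iff.2 fun h0 => by
    have h1 : u x = 0 := hj (hk (by simpa using h0))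
    have := hA.one x
    rw [h1, map_zero] at this
    exact zero_ne_one this
  obtain ⟨σ, hσ, hσs, C, μ, hC, hμ, hμρ, hrate⟩ := exists_extension (Lh := fun x : K => Lhat x)
    hS hA hm hθρ hρl hcomp hjL hLV hwM (fun x => (h2 x x.2).2.1.le)
    (continuousOn_iff_continuous_domRestrict.1 h3) hδ
    (k.continuous.comp (j.continuous.comp hu)) hc hcu hΔ hκ h4 (fun x v => h5 x x.2 v _ (by
      rw [hcoc]; exact cocycle_intertwine hLV m x v))
  exact ⟨LV, fun x => Lhat x, σ, M, C, μ, hμρ, fun hfg => eqOn_of_dense h4 hfg, hjL, hLV, hM.le,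
    hwM, hσ, hσs, hC, hμ, hrate⟩

namespace IsExtendedCocycle

variable {X A V Y : Type*} [TopologicalSpace X]
    [NormedAddCommGroup A] [NormedSpace ℝ A] [NormedAddCommGroup V] [NormedSpace ℝ V]
    [NormedAddCommGroup Y] [NormedSpace ℝ Y] {S : X → X} {j : A →L[ℝ] V} {k : V →L[ℝ] Y}
    {LA : X → A →L[ℝ] A} {u : X → A} {δ : X → ℝ} {s : X → A →L[ℝ] ℝ} {LV : X → V →L[ℝ] V}
    {Lh : X → Y →L[ℝ] Y} {σ : X → V →L[ℝ] ℝ} {M C μ θ C₀ lam c : ℝ}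

/-- The extended functionals vary equivariantly, as they are determined by the growth of orbits. -/
lemma invariant (hE : IsExtendedCocycle S j k LA u δ s LV Lh σ M C μ) (hμ : μ < lam)
    (hA : IsSplitCocycle S LA u δ s θ C₀ lam) (hc : 0 < c) (hcu : ∀ x, c ≤ ‖j (u x)‖) (x : X)
    (v : V) : σ (S x) (LV x v) = δ x * σ x v := by
  refine component_unique (z := fun n => cocycle S LV (n + 1) x v)
    (e := fun n => j (u (S^[n] (S x)))) (C := C * ‖LV x v‖ + C * μ * ‖v‖) hA.const_pos hE.rate_pos.le
    hμ hc (fun n => hA.lower n (S x)) (fun n => hcu _) (fun n => ?_) (fun n => ?_)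
  · refine (hE.rate n (S x) (LV x v)).trans ?_
    have : 0 ≤ C * μ * ‖v‖ * μ ^ n := by have := hE.const_pos; have := hE.rate_pos; positivity
    linarith
  · have h1 := hE.rate (n + 1) x v
    have h2 : growth S δ (n + 1) x = growth S δ n (S x) * δ x := by
      rw [add_comm, growth_add, growth_one, mul_comm, Function.iterate_one]
    rw [h2, Function.iterate_succ_apply, mul_assoc] at h1
    refine h1.trans ?_
    have : 0 ≤ C * ‖LV x v‖ * μ ^ n := by have := hE.const_pos; have := hE.rate_pos; positivity
    rw [pow_succ]
    linarith

/-- Two extensions of the cocycle on `A`, to `V ⊆ W`, are compatible with the inclusion. -/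
lemma comp_inclusion {W : Type*} [NormedAddCommGroup W] [NormedSpace ℝ W] {ι : V →L[ℝ] W}
    {i : W →L[ℝ] Y} {LW : X → W →L[ℝ] W} {Lh' : X → Y →L[ℝ] Y} {σ' : X → W →L[ℝ] ℝ}
    {M' C' μ' : ℝ} (hE : IsExtendedCocycle S j (i.comp ι) LA u δ s LV Lh σ M C μ)
    (hE' : IsExtendedCocycle S (ι.comp j) i LA u δ s LW Lh' σ' M' C' μ')
    (hi : Function.Injective i) (hμ : μ < lam) (hμ' : μ' < lam)
    (hA : IsSplitCocycle S LA u δ s θ C₀ lam) (hc : 0 < c) (hcu : ∀ x, c ≤ ‖ι (j (u x))‖) :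
    (∀ x v, ι (LV x v) = LW x (ι v)) ∧ ∀ x v, σ x v = σ' x (ι v) := by
  have h1 : ∀ x v, ι (LV x v) = LW x (ι v) := fun x v => hi (by
    have e1 := hE.interY x v
    rw [ContinuousLinearMap.comp_apply, ContinuousLinearMap.comp_apply] at e1
    rw [e1, hE'.interY]
    refine hE.dense (fun a => ?_) v
    have e2 := hE.interY x (j a)
    have e3 := hE'.interY x (ι (j a))
    rw [← hE.inter] at e2
    rw [← ContinuousLinearMap.comp_apply ι j a, ← hE'.inter] at e3
    rw [← e2]
    exact e3)
  refine ⟨h1, fun x v => ?_⟩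
  have hC := hE.const_pos
  have hC' := hE'.const_pos
  have hμ0 := hE.rate_pos
  have hμ0' := hE'.rate_pos
  refine component_unique (z := fun n => cocycle S LW n x (ι v))
    (e := fun n => ι (j (u (S^[n] x)))) (C := ‖ι‖ * (C * ‖v‖) + C' * ‖ι v‖) (ν := max μ μ')
    hA.const_pos (hμ0.le.trans (le_max_left _ _)) (max_lt hμ hμ') hc (fun n => hA.lower n x)
    (fun n => hcu _) (fun n => ?_) (fun n => ?_)
  · have e : cocycle S LW n x (ι v) - (growth S δ n x * σ x v) • ι (j (u (S^[n] x)))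
        = ι (cocycle S LV n x v - (growth S δ n x * σ x v) • j (u (S^[n] x))) := by
      rw [map_sub, map_smul, cocycle_intertwine h1]
    rw [e]
    calc _ ≤ ‖ι‖ * (C * μ ^ n * ‖v‖) := ι.le_opNorm_of_le (hE.rate n x v)
      _ ≤ ‖ι‖ * (C * max μ μ' ^ n * ‖v‖) := by gcongr; exact le_max_left _ _
      _ = ‖ι‖ * (C * ‖v‖) * max μ μ' ^ n := by ring
      _ ≤ _ := by gcongr; exact le_add_of_nonneg_right (by positivity)
  · calc _ ≤ C' * μ' ^ n * ‖ι v‖ := hE'.rate n x (ι v)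
      _ ≤ C' * max μ μ' ^ n * ‖ι v‖ := by gcongr; exact le_max_right _ _
      _ = C' * ‖ι v‖ * max μ μ' ^ n := by ring
      _ ≤ _ := by gcongr; exact le_add_of_nonneg_left (by positivity)

end IsExtendedCocycle

/-! ### The basic set as a dynamical system -/

lemma hasFDerivAt_iterate {X A : Type*} [NormedAddCommGroup A] [NormedSpace ℝ A] {S : X → X}
    {p : X → A} {T : A → A} (hsemi : ∀ x, T (p x) = p (S x))
    (hT : ∀ x, DifferentiableAt ℝ T (p x)) (m : ℕ) (x : X) :
    HasFDerivAt T^[m] (cocycle S (fun x => fderiv ℝ T (p x)) m x) (p x) := by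
  induction m generalizing x with
  | zero => exact hasFDerivAt_id _
  | succ m ih =>
    have h1 := ih (S x)
    rw [← hsemi] at h1
    exact h1.comp (p x) (hT x).hasFDerivAt

/-- The functional `s` with `P v = s v • u`, for an operator `P` with range `ℝ u`. -/
lemma exists_functional {A : Type*} [NormedAddCommGroup A] [NormedSpace ℝ A] {P : A →L[ℝ] A} {u : A}
    (hu : ‖u‖ = 1) (hP : P.range = Submodule.span ℝ {u}) : ∃ s : A →L[ℝ] ℝ, ∀ v, s v • u = P v := by
  obtain ⟨g, -, hg⟩ := exists_dual_vector ℝ u (by rw [hu]; exact one_ne_zero)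
  refine ⟨g.comp P, fun v => ?_⟩
  obtain ⟨c, hc⟩ := Submodule.mem_span_singleton.1 (hP ▸ LinearMap.mem_range_self P.toLinearMap v)
  have hc' : c • u = P v := hc
  rw [ContinuousLinearMap.comp_apply, ← hc', map_smul, hg, hu]
  simp

lemma continuous_functional {X A : Type*} [TopologicalSpace X] [NormedAddCommGroup A]
    [NormedSpace ℝ A] {P : X → A →L[ℝ] A} {u : X → A} {s : X → A →L[ℝ] ℝ} (hP : Continuous P)
    (hu : Continuous u) (hu1 : ∀ x, ‖u x‖ = 1) (hs : ∀ x v, s x v • u x = P x v) :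
    Continuous s := by
  refine continuous_iff_continuousAt.2 fun y => ?_
  refine tendsto_iff_norm_sub_tendsto_zero.2 (squeeze_zero (fun _ => norm_nonneg _) (fun x => ?_)
    (g := fun x => ‖P x - P y‖ + ‖s y‖ * ‖u x - u y‖) ?_)
  · refine ContinuousLinearMap.opNorm_le_bound _ (by positivity) fun v => ?_
    calc ‖(s x - s y) v‖ = ‖(s x v - s y v) • u x‖ := by rw [norm_smul, hu1, mul_one]; rfl
      _ = ‖(P x - P y) v - s y v • (u x - u y)‖ := by
          congr 1
          rw [_root_.sub_apply, ← hs, ← hs]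
          module
      _ ≤ ‖P x - P y‖ * ‖v‖ + ‖s y‖ * ‖v‖ * ‖u x - u y‖ := by
          refine (norm_sub_le _ _).trans (add_le_add ((P x - P y).le_opNorm v) ?_)
          rw [norm_smul]
          gcongr
          exact (s y).le_opNorm v
      _ = _ := by ring
  · have h1 : Continuous fun x => ‖P x - P y‖ + ‖s y‖ * ‖u x - u y‖ := by fun_prop
    simpa using h1.tendsto y

/-- The base dynamics on a hyperbolic basic set with a one-dimensional unstable direction, and its
linearization. -/
theorem exists_base {A : Type*} [NormedAddCommGroup A] [NormedSpace ℝ A] {n : WithTop ℕ∞}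
    {T : A → A} {O K : Set A} {P : A → A →L[ℝ] A} {u : A → A} {δ : A → ℝ} {θ C₀ lam : ℝ}
    (hn : 1 ≤ n) (hT : ContDiffOn ℝ n T O) (hK : IsHyperbolicBasicSet T O K P θ)
    (hu : IsUnstableFrame T K P u δ) (hδ : IsExpansionRate T K δ C₀ lam) :
    ∃ (S R : K → K) (s : K → A →L[ℝ] ℝ), Continuous S ∧ Continuous R ∧ (∀ x, S (R x) = x) ∧
      (∀ x, R (S x) = x) ∧ (∀ x : K, T x = S x) ∧ Continuous s ∧
      (∀ x v, s x v • u x = P x v) ∧ Continuous (fun x : K => u x) ∧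
      Continuous (fun x : K => δ x) ∧
      (∀ x v, s (S x) (fderiv ℝ T x v) = δ x * s x v) ∧
      IsSplitCocycle S (fun x => fderiv ℝ T x) (fun x => u x) (fun x => δ x) s θ (min C₀ 1) lam ∧
      ∀ n x, 0 < n → C₀ * lam ^ n ≤ growth S (fun x => δ x) n x := by
  have : CompactSpace K := isCompact_iff_compactSpace.1 hK.isCompact
  let e : K ≃ K := hK.bijOn.equiv T
  have hS : Continuous e := (hK.continuousOn.comp_continuous continuous_subtype_val
    (fun x => x.2)).subtype_mk _
  let H : K ≃ₜ K := Continuous.homeoOfEquivCompactToT2 (f := e) hS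
  have hsemi : ∀ x : K, T x = e x := fun x => rfl
  choose! s₀ hs₀ using fun (x : A) (hx : x ∈ K) => exists_functional (hu.unit x hx) (hu.span x hx)
  have hu0 : ∀ x : K, u x ≠ 0 := fun x h0 => by
    have := hu.unit x x.2
    rw [h0, norm_zero] at this
    exact zero_ne_one this
  have hsu : ∀ (x : K) v, s₀ x v • u x = P x v := fun x v => hs₀ x x.2 v
  have hPu : ∀ x : K, P x (u x) = u x := fun x => by
    have h1 : u x ∈ (P x).range := by
      rw [hu.span x x.2]; exact Submodule.mem_span_singleton_self _
    obtain ⟨w, hw⟩ := h1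
    have hw' : P x w = u x := hw
    have h2 := congrArg (fun f => f w) (hK.proj x x.2)
    simpa [hw'] using h2
  have hs1 : ∀ x : K, s₀ x (u x) = 1 := fun x =>
    smul_left_injective ℝ (hu0 x) (by simp only [hsu, hPu, one_smul])
  have hcP : Continuous fun x : K => P x := continuousOn_iff_continuous_domRestrict.1 hK.proj_continuous
  have hcu : Continuous fun x : K => u x := continuousOn_iff_continuous_domRestrict.1 hu.continuousOn
  have hcs : Continuous fun x : K => s₀ x :=
    continuous_functional hcP hcu (fun x => hu.unit x x.2) hsu
  have hcL : Continuous fun x : K => fderiv ℝ T x :=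
    (hT.continuousOn_fderiv_of_isOpen hK.isOpen hn).comp_continuous continuous_subtype_val
      fun x => hK.subset x.2
  have hmap : ∀ x : K, fderiv ℝ T x (u x) = δ x • u (e x) := fun x => hu.map x x.2
  have hinv : ∀ (x : K) v, s₀ (e x) (fderiv ℝ T x v) = δ x * s₀ x v := fun x v => by
    have h1 := congrArg (fun f => f v) (hK.proj_invariant x x.2)
    simp only [ContinuousLinearMap.comp_apply] at h1
    rw [hsemi, ← hsu, ← hsu, map_smul, hmap, smul_smul, mul_comm] at h1
    exact smul_left_injective ℝ (hu0 (e x)) h1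
  have hcδ : Continuous fun x : K => δ x := by
    have h1 : Continuous fun x : K => s₀ (e x) (fderiv ℝ T x (u x)) :=
      (hcs.comp hS).clm_apply (hcL.clm_apply hcu)
    exact h1.congr fun x => by rw [hinv, hs1, mul_one]
  have hgrow : ∀ n (x : K), growth e (fun x => δ x) n x = ∏ i ∈ Finset.range n, δ (T^[i] x) :=
    fun n x => Finset.prod_congr rfl fun i _ => by
      rw [iterate_semiconj (p := fun x : K => (x : A)) hsemi]
  have hlower : ∀ n x, 0 < n → C₀ * lam ^ n ≤ growth e (fun x => δ x) n x := fun n x hn => by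
    rw [hgrow]; exact (hδ.lower x x.2 n hn).le
  have hlam : 0 < lam := by linarith [hδ.one_lt]
  refine ⟨e, H.symm, fun x => s₀ x, hS, H.symm.continuous, e.apply_symm_apply, e.symm_apply_apply,
    hsemi, hcs, hsu, hcu, hcδ, hinv, ⟨hmap, fun x => hu.pos x x.2, fun x => (hu.unit x x.2).le,
    hK.exponent.1, lt_min hδ.const_pos one_pos, hδ.one_lt, hs1, ?_, ?_, fun n x => ?_⟩, hlower⟩
  · obtain ⟨Q, hQ, hQs⟩ := LocalModel.exists_upper hcs.norm
    exact ⟨Q, by positivity, fun x v => ((s₀ x).le_opNorm v).trans (by gcongr; exact hQs x)⟩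
  · obtain ⟨Q, hQ, hQP⟩ := LocalModel.exists_upper hcP.norm
    obtain ⟨c, hc, hrate⟩ := hK.rates
    refine ⟨c * (1 + Q), by positivity, fun n x v => ?_⟩
    have hθ := hK.exponent.1
    have h1 : P x (v - P x v) = 0 := by
      have h2 := congrArg (fun f => f v) (hK.proj x x.2)
      simp only [ContinuousLinearMap.comp_apply] at h2
      rw [map_sub, h2, sub_self]
    have h3 := (hrate x x.2 n).1 _ h1
    have h4 : fderiv ℝ T^[n] (x : A) = cocycle e (fun x : K => fderiv ℝ T x) n x :=
      (hasFDerivAt_iterate (p := fun x : K => (x : A)) hsemi (fun x => (hT.differentiableOn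
        (ENat.one_le_iff_ne_zero_withTop.1 hn)).differentiableAt
        (hK.isOpen.mem_nhds (hK.subset x.2))) n x).fderiv
    rw [h4] at h3
    rw [hsu]
    calc _ ≤ c * θ ^ n * ‖v - P x v‖ := h3
      _ ≤ c * θ ^ n * (‖v‖ + Q * ‖v‖) := by
          gcongr
          exact (norm_sub_le _ _).trans (by gcongr; exact (P x).le_of_opNorm_le (hQP x) v)
      _ = _ := by ring
  · rcases Nat.eq_zero_or_pos n with rfl | h0
    · simp
    · exact le_trans (by gcongr; exact min_le_left _ _) (hlower n x h0)

/-! ### Robust operators satisfy the uniform local estimates -/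

lemma exists_uniform_ball {X E : Type*} [TopologicalSpace X] [CompactSpace X] [NormedAddCommGroup E]
    {p : X → E} (hp : Continuous p) {V : Set E} (hV : IsOpen V) (h : ∀ x, p x ∈ V) :
    ∃ r, 0 < r ∧ ∀ x, Metric.ball (p x) r ⊆ V := by
  obtain ⟨r, hr, h1⟩ := (isCompact_range hp).exists_thickening_subset_open hV
    (range_subset_iff.2 h)
  exact ⟨r, hr, fun x => (Metric.ball_subset_thickening (mem_range_self x) r).trans h1⟩

namespace IsRobust

variable {A B C D : Type*}
    [NormedAddCommGroup A] [NormedSpace ℝ A] [NormedAddCommGroup B] [NormedSpace ℝ B]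
    [NormedAddCommGroup C] [NormedSpace ℝ C] [NormedAddCommGroup D] [NormedSpace ℝ D]
    {iAB : A →L[ℝ] B} {iBC : B →L[ℝ] C} {iCD : C →L[ℝ] D} {TA : A → A} {OA K : Set A} {u : A → A}
    {θ C₀ lam : ℝ} {TB : B → B} {OB : Set B}
    (hR : IsRobust iAB iBC iCD TA OA K u θ C₀ lam TB OB)
include hR

/-- Near a point of the basic set, in the norm of `A`, the iterates of the two operators agree. -/
lemma iterate_eventuallyEq {S : K → K} (hsemi : ∀ x : K, TA x = S x) (hOA : IsOpen OA)
    (hKO : K ⊆ OA) (hTd : ∀ x : K, DifferentiableAt ℝ TA x) (m : ℕ) (x : K) :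
    ∀ᶠ f in 𝓝 (x : A), TB^[m] (iAB f) = iAB (TA^[m] f) := by
  induction m generalizing x with
  | zero => exact Eventually.of_forall fun f => rfl
  | succ m ih =>
    have h1 : Tendsto TA (𝓝 (x : A)) (𝓝 (S x : A)) := hsemi x ▸ (hTd x).continuousAt
    filter_upwards [hOA.mem_nhds (hKO x.2), h1.eventually (ih (S x))] with f hf1 hf2
    rw [Function.iterate_succ_apply, Function.iterate_succ_apply, (hR.extends_op f hf1).2, hf2]

variable [CompactSpace K] {S : K → K} {uK : K → A} {δ : K → ℝ} {s : K → A →L[ℝ] ℝ}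
  {LB : K → B →L[ℝ] B} {LC : K → C →L[ℝ] C} {Lh : K → D →L[ℝ] D} {σB : K → B →L[ℝ] ℝ}
  {M c₁ μ : ℝ} (hsemi : ∀ x : K, TA x = S x) (hOA : IsOpen OA) (hKO : K ⊆ OA)
  (hTd : ∀ x : K, DifferentiableAt ℝ TA x)
  (hE : IsExtendedCocycle S iAB (iCD.comp iBC) (fun x : K => fderiv ℝ TA x) uK δ s LB Lh σB M c₁ μ)

omit [CompactSpace K] in
lemma mem_iterDomain {m : ℕ} (hm : 0 < m) (x : K) : iAB x ∈ iterDomain TB OB m :=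
  (hR.B2 m hm).1 ⟨x, x.2, rfl⟩

lemma exists_domain {m : ℕ} (hm : 0 < m) :
    ∃ r, 0 < r ∧ ∀ x : K, Metric.ball (iAB x) r ⊆ iterDomain TB OB m :=
  exists_uniform_ball (iAB.continuous.comp continuous_subtype_val) isOpen_interior
    (hR.mem_iterDomain hm)

include hsemi hOA hKO hTd hE

omit [CompactSpace K] in
/-- On the basic set, the derivative of `T^m` is given by the extended cocycle: both extend to `D`,
and agree on the dense subspace `A`. -/
lemma fderiv_iterate {m : ℕ} (hm : 0 < m) (x : K) (v : B) :
    fderiv ℝ (iBC ∘ TB^[m]) (iAB x) v = iBC (cocycle S LB m x v) := by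
  obtain ⟨hdom, hdiff, -, hext⟩ := hR.B2 m hm
  obtain ⟨Lm, hLm, -, -⟩ := hext x (hR.mem_iterDomain hm x)
  have hd : DifferentiableAt ℝ (iBC ∘ TB^[m]) (iAB x) :=
    (hdiff.differentiableOn one_ne_zero).differentiableAt
      (isOpen_interior.mem_nhds (hR.mem_iterDomain hm x))
  have h1 := hd.hasFDerivAt.comp (x : A) iAB.hasFDerivAt
  have h2 := iBC.hasFDerivAt.comp (x : A) (iAB.hasFDerivAt.comp (x : A)
    (hasFDerivAt_iterate (p := fun x : K => (x : A)) hsemi hTd m x))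
  have h3 := h1.unique (h2.congr_of_eventuallyEq (by
    filter_upwards [hR.iterate_eventuallyEq hsemi hOA hKO hTd m x] with f hf
    simp only [Function.comp_apply, hf]))
  refine hR.injective.2.2 ?_
  rw [← hLm]
  have h4 : ∀ v, (iCD.comp iBC) (cocycle S LB m x v) = cocycle S Lh m x ((iCD.comp iBC) v) :=
    cocycle_intertwine hE.interY m x
  refine (hE.dense (g := cocycle S Lh m x) (fun a => ?_) v).trans (h4 v).symm
  rw [← h4, ← cocycle_intertwine hE.inter]
  refine (hLm (iAB a)).trans ?_
  have h5 := congrArg (fun f => f a) h3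
  simp only [ContinuousLinearMap.comp_apply] at h5
  rw [h5]
  rfl

/-- The derivatives of `T^m : B → C` near the basic set are close to the cocycle: they are uniformly
continuous there. -/
lemma exists_approx {m : ℕ} (hm : 0 < m) {τ : ℝ} (hτ : 0 < τ) : ∃ r, 0 < r ∧ ∀ x : K,
    Metric.ball (iAB x) r ⊆ iterDomain TB OB m ∧ ∀ y ∈ Metric.ball (iAB x) r, ∀ v,
      ‖fderiv ℝ (iBC ∘ TB^[m]) y v - iBC (cocycle S LB m x v)‖ ≤ τ * ‖v‖ := by
  obtain ⟨-, -, ⟨V, hV, hKV, hVO, huc⟩, -⟩ := hR.B2 m hm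
  obtain ⟨r₁, hr₁, hball⟩ := exists_uniform_ball (p := fun x : K => iAB x)
    (iAB.continuous.comp continuous_subtype_val) hV (fun x => hKV ⟨x, x.2, rfl⟩)
  obtain ⟨r₂, hr₂, hclose⟩ := Metric.uniformContinuousOn_iff.1 huc τ hτ
  refine ⟨min r₁ r₂, by positivity, fun x => ⟨((Metric.ball_subset_ball (min_le_left _ _)).trans
    (hball x)).trans hVO, fun y hy v => ?_⟩⟩
  have h1 := hclose y (hball x (Metric.ball_subset_ball (min_le_left _ _) hy)) (iAB x)
    (hKV ⟨x, x.2, rfl⟩) (lt_of_lt_of_le hy (min_le_right _ _))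
  rw [← hR.fderiv_iterate hsemi hOA hKO hTd hE hm, ← _root_.sub_apply]
  rw [dist_eq_norm] at h1
  exact ContinuousLinearMap.le_of_opNorm_le _ h1.le v

omit [CompactSpace K] hsemi hOA hKO hTd hE in
/-- The mean value inequality for the deviation of `T^m` from its linearization, with a bound
that may depend on the direction. -/
lemma norm_sub_le_of_fderiv {m : ℕ} (hm : 0 < m) {x : K} {r a : ℝ}
    (hdom : Metric.ball (iAB x) r ⊆ iterDomain TB OB m) {y z : B}
    (hy : y ∈ Metric.ball (iAB x) r) (hz : z ∈ Metric.ball (iAB x) r)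
    (h : ∀ f ∈ Metric.ball (iAB x) r,
      ‖fderiv ℝ (iBC ∘ TB^[m]) f (y - z) - iBC (cocycle S LB m x (y - z))‖ ≤ a) :
    ‖iBC (TB^[m] y - TB^[m] z - cocycle S LB m x (y - z))‖ ≤ a := by
  have hmem : ∀ t ∈ Icc (0 : ℝ) 1, z + t • (y - z) ∈ Metric.ball (iAB x) r := fun t ht =>
    (convex_ball _ r).add_smul_sub_mem hz hy ht
  have h1 := norm_image_sub_le_of_norm_deriv_le_segment_01' (C := a)
    (f := fun t : ℝ => (iBC ∘ TB^[m]) (z + t • (y - z)) - t • iBC (cocycle S LB m x (y - z)))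
    (f' := fun t : ℝ => fderiv ℝ (iBC ∘ TB^[m]) (z + t • (y - z)) (y - z)
      - (1 : ℝ) • iBC (cocycle S LB m x (y - z)))
    (fun t ht => by
      have hd : DifferentiableAt ℝ (iBC ∘ TB^[m]) (z + t • (y - z)) :=
        ((hR.B2 m hm).2.1.differentiableOn one_ne_zero).differentiableAt
          (isOpen_interior.mem_nhds (hdom (hmem t ht)))
      have h2 : HasDerivAt (fun t : ℝ => z + t • (y - z)) (y - z) t := by
        simpa using ((hasDerivAt_id t).smul_const (y - z)).const_add z
      exact ((hd.hasFDerivAt.comp_hasDerivAt t h2).sub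
        ((hasDerivAt_id t).smul_const _)).hasDerivWithinAt)
    (fun t ht => by rw [one_smul]; exact h _ (hmem t ⟨ht.1, ht.2.le⟩))
  simp only [Function.comp_apply, one_smul, zero_smul, add_zero, sub_zero, add_sub_cancel] at h1
  rw [map_sub, map_sub]
  convert h1 using 2
  abel

/-- The approximation by the cocycle for the norm of `B` on the right-hand side. -/
lemma approx {m : ℕ} (hm : 0 < m) {τ : ℝ} (hτ : 0 < τ) : ∃ r, 0 < r ∧ ∀ x : K,
    ∀ y ∈ Metric.ball (iAB x) r, ∀ z ∈ Metric.ball (iAB x) r,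
      ‖iBC (TB^[m] y - TB^[m] z - cocycle S LB m x (y - z))‖ ≤ τ * ‖y - z‖ := by
  obtain ⟨r, hr, h1⟩ := hR.exists_approx hsemi hOA hKO hTd hE hm hτ
  exact ⟨r, hr, fun x y hy z hz => hR.norm_sub_le_of_fderiv hm (h1 x).1 hy hz
    fun f hf => (h1 x).2 f hf _⟩

/-- The first estimate in `IsRobust.B56` controls the derivative on the stable part of a
vector, in the norm of `C`, and its uniform continuity controls it on the unstable part. -/
lemma approxC (hlam : 0 < lam) {U : K → B} {σ : K → C →L[ℝ] ℝ} (hU : Continuous U) :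
    ∃ m₀, ∀ m, m₀ ≤ m → ∀ τ : ℝ, 0 < τ → ∃ r, 0 < r ∧ ∀ x : K,
    ∀ y ∈ Metric.ball (iAB x) r, ∀ z ∈ Metric.ball (iAB x) r,
      ‖iBC (TB^[m] y - TB^[m] z - cocycle S LB m x (y - z))‖ ≤ τ * |σ x (iBC (y - z))|
        + C₀ / 8 * lam ^ m * ‖iBC (y - z) - σ x (iBC (y - z)) • iBC (U x)‖ := by
  obtain ⟨ν, C₂, C₃, hpos, hB5, ⟨m₀, -, hC₂⟩, -, -⟩ := hR.B56
  obtain ⟨Q, hQ, hUQ⟩ := LocalModel.exists_upper hU.norm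
  refine ⟨m₀ + 1, fun m hm τ hτ => ?_⟩
  have hm0 : 0 < m := by omega
  obtain ⟨r, hr, h1⟩ := hR.exists_approx hsemi hOA hKO hTd hE hm0 (τ := τ / Q) (by positivity)
  refine ⟨min r (ν m), lt_min hr (hpos m hm0).1, fun x y hy z hz => ?_⟩
  have hsub : Metric.ball (iAB x) (min r (ν m)) ⊆ Metric.ball (iAB x) r :=
    Metric.ball_subset_ball (min_le_left _ _)
  refine hR.norm_sub_le_of_fderiv hm0 (hsub.trans (h1 x).1) hy hz
    fun f hf => ?_
  set w := y - z
  set a := σ x (iBC w)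
  have h2 := (h1 x).2 f (hsub hf) (a • U x)
  have h3 := hB5 m hm0 x x.2 f ((h1 x).1 (hsub hf)) (by
    rw [← dist_eq_norm]; exact lt_of_lt_of_le hf (min_le_right _ _)) (w - a • U x)
  rw [hR.fderiv_iterate hsemi hOA hKO hTd hE hm0, map_sub iBC, map_smul iBC] at h3
  have e : fderiv ℝ (iBC ∘ TB^[m]) f w - iBC (cocycle S LB m x w)
      = (fderiv ℝ (iBC ∘ TB^[m]) f (a • U x) - iBC (cocycle S LB m x (a • U x)))
        + (fderiv ℝ (iBC ∘ TB^[m]) f (w - a • U x) - iBC (cocycle S LB m x (w - a • U x))) := by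
    simp only [map_sub]; abel
  rw [e]
  refine (norm_add_le _ _).trans (add_le_add (h2.trans ?_) (h3.trans ?_))
  · rw [norm_smul, Real.norm_eq_abs]
    calc τ / Q * (|a| * ‖U x‖) ≤ τ / Q * (|a| * Q) := by gcongr; exact hUQ x
      _ = τ * |a| := by field_simp
  · gcongr
    exact (hC₂ m (by omega)).le

/-- The Hölder estimate `IsRobust.B4` with a common radius, which a Lebesgue number provides. By
`IsRobust.B56` with `m = 1`, the derivatives are bounded for the norm of `C` on both sides. -/
lemma holder (hlam : 0 < lam) {MC : ℝ} (hMC : 0 ≤ MC) (hLC : ∀ x v, ‖LC x v‖ ≤ MC * ‖v‖)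
    (hinter : ∀ x v, iBC (LB x v) = LC x (iBC v)) :
    ∃ r c ρ : ℝ, 0 < r ∧ 0 < c ∧ 1 < ρ ∧ ∀ x : K, ∀ y ∈ Metric.ball (iAB x) r,
    ∃ D : B →L[ℝ] C, (∀ v, ‖D v‖ ≤ c * ‖iBC v‖) ∧ ∀ z ∈ Metric.ball (iAB x) r,
      ‖iBC (TB z - TB y) - D (z - y)‖ ≤ c * ‖iBC (z - y)‖ ^ ρ := by
  obtain ⟨ν, C₂, C₃, hpos, hB5, -, -, -⟩ := hR.B56
  obtain ⟨c, hc, ρ, hρ, hB4⟩ := hR.B4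
  choose V hV hgV hVO hest using fun x : K => hB4 x x.2
  obtain ⟨r₁, hr₁, hball⟩ := lebesgue_number_lemma_of_metric (s := iAB '' K) (c := V)
    ((isCompact_iff_compactSpace.2 inferInstance : IsCompact K).image iAB.continuous) hV (by
      rintro _ ⟨g, hg, rfl⟩
      exact mem_iUnion.2 ⟨⟨g, hg⟩, hgV ⟨g, hg⟩⟩)
  obtain ⟨r₂, hr₂, hdom⟩ := hR.exists_domain one_pos
  obtain ⟨hν, hC₂, -⟩ := hpos 1 one_pos
  refine ⟨min (min r₁ r₂) (ν 1), max c (MC + C₂ 1 * lam), ρ, by positivity, by positivity, hρ,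
    fun x y hy => ⟨fderiv ℝ (iBC ∘ TB) y, fun v => ?_, fun z hz => ?_⟩⟩
  · have h1 := hB5 1 one_pos x x.2 y (hdom x (Metric.ball_subset_ball
      ((min_le_left _ _).trans (min_le_right _ _)) hy)) (by
      rw [← dist_eq_norm]; exact lt_of_lt_of_le hy (min_le_right _ _)) v
    rw [hR.fderiv_iterate hsemi hOA hKO hTd hE one_pos, cocycle_one, hinter,
      Function.iterate_one, pow_one] at h1
    calc ‖fderiv ℝ (iBC ∘ TB) y v‖ ≤ ‖LC x (iBC v)‖
          + ‖fderiv ℝ (iBC ∘ TB) y v - LC x (iBC v)‖ := norm_le_norm_add_norm_sub' _ _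
      _ ≤ MC * ‖iBC v‖ + C₂ 1 * lam * ‖iBC v‖ := add_le_add (hLC x _) h1
      _ = (MC + C₂ 1 * lam) * ‖iBC v‖ := by ring
      _ ≤ _ := by gcongr; exact le_max_right _ _
  · have hsub : Metric.ball (iAB x) (min (min r₁ r₂) (ν 1)) ⊆ Metric.ball (iAB x) r₁ :=
      Metric.ball_subset_ball ((min_le_left _ _).trans (min_le_left _ _))
    obtain ⟨g, hg⟩ := hball (iAB x) ⟨x, x.2, rfl⟩
    rw [map_sub]
    refine (hest g z (hg (hsub hz)) y (hg (hsub hy))).trans ?_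
    gcongr
    exact le_max_left _ _

/-- The second estimate in `IsRobust.B56`, with the linearization given by the extended cocycle. -/
lemma approxG_of_lt {m : ℕ} (hm : 0 < m) {c : ℝ}
    (hB6 : ∃ ν : ℝ, 0 < ν ∧ ∀ g ∈ K, ∀ f : A, ‖f - g‖ < ν → ∀ v : B, ‖v‖ < ν →
      iAB f ∈ iterDomain TB OB m → iAB f + v ∈ iterDomain TB OB m →
      ∃ w : B, iBC w = fderiv ℝ (iBC ∘ TB^[m]) (iAB g) v ∧
        ‖TB^[m] (iAB f + v) - TB^[m] (iAB f) - w‖ ≤ c * ‖v‖) :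
    ∃ r, 0 < r ∧ ∀ x : K, ∀ f ∈ iAB '' Metric.ball (x : A) r, ∀ y ∈ Metric.ball (iAB x) r,
      ‖TB^[m] y - TB^[m] f - cocycle S LB m x (y - f)‖ ≤ c * ‖y - f‖ := by
  obtain ⟨ν, hν, hB6⟩ := hB6
  obtain ⟨r₁, hr₁, hdom⟩ := hR.exists_domain hm
  set Q := 1 + ‖iAB‖ with hQ
  have hQ0 : 0 < Q := by positivity
  set r := min (min (ν / Q) (r₁ / Q)) (min ν r₁) with hr
  have hr0 : 0 < r := by positivity
  have hrν : r * Q ≤ ν := by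
    calc r * Q ≤ ν / Q * Q := by gcongr; exact (min_le_left _ _).trans (min_le_left _ _)
      _ = ν := by field_simp
  have hrr : r * Q ≤ r₁ := by
    calc r * Q ≤ r₁ / Q * Q := by gcongr; exact (min_le_left _ _).trans (min_le_right _ _)
      _ = r₁ := by field_simp
  refine ⟨r, hr0, ?_⟩
  rintro x _ ⟨a, ha, rfl⟩ y hy
  rw [mem_ball_iff_norm] at ha hy
  have h1 : ‖iAB a - iAB x‖ ≤ ‖iAB‖ * r := by
    rw [← map_sub]; exact iAB.le_opNorm_of_le ha.le
  have h2 : ‖y - iAB a‖ < ν := by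
    calc ‖y - iAB a‖ = ‖(y - iAB x) - (iAB a - iAB x)‖ := by congr 1; abel
      _ ≤ ‖y - iAB x‖ + ‖iAB a - iAB x‖ := norm_sub_le _ _
      _ < r + ‖iAB‖ * r := by linarith
      _ = r * Q := by rw [hQ]; ring
      _ ≤ ν := hrν
  have h3 : iAB a ∈ iterDomain TB OB m := hdom x (mem_ball_iff_norm.2 (by
    calc _ ≤ ‖iAB‖ * r := h1
      _ < r * Q := by rw [hQ]; linarith
      _ ≤ r₁ := hrr))
  have h4 : iAB a + (y - iAB a) ∈ iterDomain TB OB m := by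
    rw [add_sub_cancel]
    exact hdom x (mem_ball_iff_norm.2 (hy.trans_le ((min_le_right _ _).trans (min_le_right _ _))))
  obtain ⟨w, hw, h5⟩ := hB6 x x.2 a
    (ha.trans_le ((min_le_right _ _).trans (min_le_left _ _))) _ h2 h3 h4
  rw [hR.fderiv_iterate hsemi hOA hKO hTd hE hm] at hw
  rw [hR.injective.2.1 hw, add_sub_cancel] at h5
  exact h5

end IsRobust

/-! ### The hyperbolic picture -/

section

variable {X B C : Type*} [TopologicalSpace X] [CompactSpace X]
    [NormedAddCommGroup B] [NormedSpace ℝ B] [NormedAddCommGroup C] [NormedSpace ℝ C]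
    {S : X → X} {p : X → B} {ι : B →L[ℝ] C} {T : B → B} {O : Set B} {U : X → B} {δ : X → ℝ}
    {σ : X → C →L[ℝ] ℝ} {LB : X → B →L[ℝ] B} {LC : X → C →L[ℝ] C} {G : ℝ → X → Set B}
    {C₀ lam : ℝ} {R : X → X} {n : WithTop ℕ∞} {r₀ R₀ : ℝ} {f : X → X → ℝ → ℕ → B}
    {Uf : B → B} {σf : B → B →L[ℝ] ℝ} {Lf : B → B →L[ℝ] B}

omit [CompactSpace X] in
lemma continuousOn_range {E F : Type*} [TopologicalSpace E] [TopologicalSpace F] {p : X → E}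
    (hp : IsEmbedding p) {g : E → F} (hg : Continuous fun x => g (p x)) :
    ContinuousOn g (range p) := by
  rintro _ ⟨x, rfl⟩
  rw [ContinuousWithinAt, ← hp.map_nhds_eq x, tendsto_map'_iff]
  exact hg.tendsto x

lemma mul_pow_le_max {a b c c' θ θ' d : ℝ} {m : ℕ} (hc : 0 ≤ c') (hcc : c ≤ c') (hθ : 0 ≤ θ)
    (hθθ : θ ≤ θ') (hd : 0 ≤ d) (h : a ≤ c * θ ^ m * d) (hb : b = a) : b ≤ c' * θ' ^ m * d := by
  rw [hb]
  refine h.trans ?_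
  gcongr

/-- The splitting of `B` is continuous, invariant and uniformly hyperbolic. The expansion constant uses
`min C₀ 1`, since the lower bound for the growth is only assumed for positive times. -/
theorem LocalModel.isHyperbolicSplitting (h : LocalModel S p ι T O U δ σ LB LC G C₀ lam)
    (hUf : ∀ x, Uf (p x) = U x) (hσf : ∀ x, σf (p x) = (σ x).comp ι)
    (hLf : ∀ x, Lf (p x) = LB x) : IsHyperbolicSplitting T (range p) Uf σf Lf := by
  have hemb : IsEmbedding p := (h.contp.isClosedEmbedding h.injp).isEmbedding
  refine ⟨continuousOn_range hemb (by simpa only [hUf] using h.contU),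
    continuousOn_range hemb ?_, ?_, ?_, ?_, ?_⟩
  · simp only [hσf]
    exact h.contσ.clm_comp continuous_const
  · rintro _ ⟨x, rfl⟩
    rw [hσf, hUf]; exact h.one x
  · rintro _ ⟨x, rfl⟩
    exact ⟨δ x, by rw [hLf, hUf, h.map, h.semi, hUf]⟩
  · rintro _ ⟨x, rfl⟩ v hv
    rw [hσf] at hv
    rw [h.semi, hσf, hLf, ContinuousLinearMap.comp_apply, h.inter, h.invariant]
    exact mul_eq_zero_of_right _ hv
  · obtain ⟨c, θ, hc, hθ0, hθ1, hrate⟩ := h.rateB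
    obtain ⟨Q, hQ, hUQ⟩ := exists_upper h.contU.norm
    obtain ⟨a, ha, hUa⟩ := exists_lower h.contU.norm fun x => norm_pos_iff.2 fun h0 =>
      h.U_ne x (by rw [h0, map_zero])
    have hC₀ : 0 < min C₀ 1 := lt_min h.const_pos one_pos
    have hlam : 0 < lam := by linarith [h.one_lt]
    have hQ0 : 0 < Q := by linarith
    set c' := Q / (min C₀ 1 * a) with hc'
    have hc'0 : 0 < c' := by positivity
    refine ⟨max c c', max θ lam⁻¹, by positivity, lt_max_of_lt_left hθ0,
      max_lt hθ1 (inv_lt_one_of_one_lt₀ h.one_lt), ?_⟩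
    rintro _ ⟨x, rfl⟩ n
    have e : cocycle T Lf n (p x) = cocycle S LB n x := by
      rw [cocycle_semiconj h.semi]; simp only [hLf]
    rw [e, hUf, hσf, cocycle_unstable h.map, norm_smul]
    refine ⟨fun v hv => ?_, ?_⟩
    · exact mul_pow_le_max (by positivity) (le_max_left _ _) hθ0.le (le_max_left _ _)
        (norm_nonneg v) (hrate n x v hv) rfl
    · have h1 : min C₀ 1 * lam ^ n ≤ growth S δ n x := by
        rcases Nat.eq_zero_or_pos n with rfl | hn
        · simp
        · exact le_trans (by gcongr; exact min_le_left _ _) (h.lower n x hn)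
      have h2 : (max θ lam⁻¹ ^ n)⁻¹ ≤ lam ^ n := by
        rw [inv_le_comm₀ (by positivity) (by positivity), ← inv_pow]
        gcongr
        exact le_max_right _ _
      have h3 : (max c c')⁻¹ ≤ c'⁻¹ := inv_anti₀ hc'0 (le_max_right _ _)
      calc (max c c')⁻¹ * (max θ lam⁻¹ ^ n)⁻¹ * ‖U x‖ ≤ c'⁻¹ * lam ^ n * Q := by
            gcongr; exact hUQ x
        _ = min C₀ 1 * lam ^ n * a := by rw [hc']; field_simp
        _ ≤ growth S δ n x * ‖U (S^[n] x)‖ := by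
            gcongr
            · exact (growth_pos h.pos n x).le
            · exact hUa _
        _ = ‖growth S δ n x‖ * ‖U (S^[n] x)‖ := by
            rw [Real.norm_of_nonneg (growth_pos h.pos n x).le]

/-- A local model with a family of unstable curves has the hyperbolic picture. -/
theorem LocalModel.hyperbolicPicture (h : LocalModel S p ι T O U δ σ LB LC G C₀ lam)
    (hF : UnstableFamily S p ι T U δ σ G R n r₀ R₀ f) (hn : 1 ≤ n)
    (hUf : ∀ x, Uf (p x) = U x) (hσf : ∀ x, σf (p x) = (σ x).comp ι) :
    HyperbolicPicture T O (range p) Uf σf n := by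
  obtain ⟨e₁, he₁, hlam⟩ := h.stableLamination hUf hσf
  obtain ⟨e₂, he₂, hcurv⟩ := h.unstableCurves hF hn hUf hσf
  obtain ⟨e₃, c₃, θ₃, he₃, hc₃, hθ₃, hθ₃', hloc, hglob⟩ := h.localStable_contract
  obtain ⟨e₄, c₄, θ₄, he₄, hc₄, hθ₄, hθ₄', hun⟩ := h.localUnstable_contract hF
  obtain ⟨e₅, c₅, θ₅, he₅, hc₅, hθ₅, hθ₅', hinfu⟩ := h.infDist_localUnstable hF
  obtain ⟨e₆, c₆, θ₆, κ, he₆, hc₆, hθ₆, hθ₆', hκ, hinfs⟩ := h.infDist_localStable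
  set e := min (min e₁ e₂) (min (min e₃ e₄) (min e₅ e₆)) with he
  set c := max (max c₃ c₄) (max c₅ c₆) with hc
  set θ := max (max θ₃ θ₄) (max θ₅ θ₆) with hθ
  have hc0 : 0 ≤ c := hc₄.le.trans ((le_max_right _ _).trans (le_max_left _ _))
  refine ⟨e, c, θ, κ, by positivity, hc₄.trans_le ((le_max_right _ _).trans (le_max_left _ _)),
    hθ₃.trans_le ((le_max_left _ _).trans (le_max_left _ _)),
    max_lt (max_lt hθ₃' hθ₄') (max_lt hθ₅' hθ₆'), hκ,
    hlam e ((min_le_left _ _).trans (min_le_left _ _)),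
    hcurv e ((min_le_left _ _).trans (min_le_right _ _)), ?_, ?_, ?_, ?_⟩
  · rintro ε - hε _ ⟨x, rfl⟩ y hy m
    exact mul_pow_le_max hc0 ((le_max_left _ _).trans (le_max_left _ _)) hθ₃.le
      ((le_max_left _ _).trans (le_max_left _ _)) (norm_nonneg _) (hloc ε
      (hε.trans ((min_le_right _ _).trans ((min_le_left _ _).trans (min_le_left _ _)))) x y hy m) rfl
  · rintro _ ⟨x, rfl⟩ y hy
    obtain ⟨C', hC', h1⟩ := hglob x y hy
    exact ⟨C', fun m => mul_pow_le_max hC' le_rfl hθ₃.le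
      ((le_max_left _ _).trans (le_max_left _ _)) (norm_nonneg _) (h1 m) rfl⟩
  · rintro ε - hε _ ⟨x, rfl⟩
    obtain ⟨h1, h2, h3⟩ := hun ε
      (hε.trans ((min_le_right _ _).trans ((min_le_left _ _).trans (min_le_right _ _)))) x
    exact ⟨h1, h2, fun z hz m => mul_pow_le_max hc0 ((le_max_right _ _).trans (le_max_left _ _))
      hθ₄.le ((le_max_right _ _).trans (le_max_left _ _)) (norm_nonneg _) (h3 z hz m) rfl⟩
  · rintro ε hε0 hε _ ⟨x, rfl⟩ y m hy
    have h1 := hinfu ε hε0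
      (hε.trans ((min_le_right _ _).trans ((min_le_right _ _).trans (min_le_left _ _)))) x y m hy
    have h2 := hinfs ε hε0
      (hε.trans ((min_le_right _ _).trans ((min_le_right _ _).trans (min_le_right _ _)))) x y m
      (by simpa only [h.iterate_p] using hy)
    rw [← mul_one (c₅ * _)] at h1
    rw [← mul_one (c₆ * _)] at h2
    rw [← mul_one (c * _)]
    exact ⟨mul_pow_le_max hc0 ((le_max_left _ _).trans (le_max_right _ _)) hθ₅.le
      ((le_max_left _ _).trans (le_max_right _ _)) zero_le_one h1 rfl,
      mul_pow_le_max hc0 ((le_max_right _ _).trans (le_max_right _ _)) hθ₆.le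
      ((le_max_right _ _).trans (le_max_right _ _)) zero_le_one h2 rfl⟩

end

variable {A B C D : Type*}
    [NormedAddCommGroup A] [NormedSpace ℝ A] [NormedAddCommGroup B] [NormedSpace ℝ B]
    [NormedAddCommGroup C] [NormedSpace ℝ C] [NormedAddCommGroup D] [NormedSpace ℝ D]
    {iAB : A →L[ℝ] B} {iBC : B →L[ℝ] C} {iCD : C →L[ℝ] D} {TA : A → A} {OA K : Set A} {u : A → A}
    {θ C₀ lam : ℝ} {TB : B → B} {OB : Set B}

/-- A robust operator has the local model given by its extended cocycles on `B` and on `C`. -/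
theorem IsRobust.localModel (hR : IsRobust iAB iBC iCD TA OA K u θ C₀ lam TB OB) [CompactSpace K]
    {S : K → K} {δ : K → ℝ} {s : K → A →L[ℝ] ℝ}
    {LB : K → B →L[ℝ] B} {LC : K → C →L[ℝ] C} {Lh Lh' : K → D →L[ℝ] D} {σB : K → B →L[ℝ] ℝ}
    {σC : K → C →L[ℝ] ℝ} {M M' c c' μ μ' C₁ : ℝ} (hS : Continuous S)
    (hsemi : ∀ x : K, TA x = S x) (hOA : IsOpen OA) (hKO : K ⊆ OA)
    (hTd : ∀ x : K, DifferentiableAt ℝ TA x) (hu : Continuous fun x : K => u x)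
    (hδ : Continuous δ) (hC₀ : 0 < C₀) (hlower : ∀ n x, 0 < n → C₀ * lam ^ n ≤ growth S δ n x)
    (hA : IsSplitCocycle S (fun x => fderiv ℝ TA x) (fun x : K => u x) δ s θ C₁ lam)
    (hE : IsExtendedCocycle S iAB (iCD.comp iBC) (fun x : K => fderiv ℝ TA x) (fun x : K => u x) δ s
      LB Lh σB M c μ)
    (hE' : IsExtendedCocycle S (iBC.comp iAB) iCD (fun x : K => fderiv ℝ TA x) (fun x : K => u x)
      δ s LC Lh' σC M' c' μ') (hμ : μ < 1) (hμ' : μ' < lam) :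
    LocalModel S (fun x : K => iAB x) iBC TB OB (fun x : K => iAB (u x)) δ σC LB LC
      (fun r x => iAB '' Metric.ball (x : A) r) C₀ lam := by
  have hone := hA.one_lt
  have hlam : 0 < lam := by linarith
  have hinj : Function.Injective fun x : K => iAB x := hR.injective.1.comp Subtype.val_injective
  obtain ⟨a, ha, hua⟩ := LocalModel.exists_lower
    ((iBC.comp iAB).continuous.comp hu).norm fun x => norm_pos_iff.2 fun h0 => by
    have h1 : u x = 0 := hR.injective.1 (hR.injective.2.1 (by simpa using h0))
    have := hA.one x
    rw [h1, map_zero] at this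
    exact zero_ne_one this
  obtain ⟨hinter, hσ⟩ := hE.comp_inclusion hE' hR.injective.2.2 (hμ.trans hone) hμ' hA ha hua
  have hTB : ∀ x : K, TB (iAB x) = iAB (S x) := fun x => by
    rw [(hR.extends_op x (hKO x.2)).2, hsemi]
  obtain ⟨ν, C₂, C₃, hpos, -, -, hB6, ⟨m₀, -, hC₃⟩⟩ := hR.B56
  have hG : ∀ m (hm : 0 < m), ∃ r, 0 < r ∧ ∀ x : K, ∀ f ∈ iAB '' Metric.ball (x : A) r,
      ∀ y ∈ Metric.ball (iAB x) r,
      ‖TB^[m] y - TB^[m] f - cocycle S LB m x (y - f)‖ ≤ C₃ m * ‖y - f‖ := fun m hm =>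
    hR.approxG_of_lt hsemi hOA hKO hTd hE hm ⟨ν m, (hpos m hm).1, hB6 m hm⟩
  exact {
    contS := hS
    contp := iAB.continuous.comp continuous_subtype_val
    contU := iAB.continuous.comp hu
    contδ := hδ
    contσ := hE'.continuous
    inj := hR.injective.2.1
    injp := hinj
    semi := hTB
    map := fun x => by rw [← hE.inter, hA.map, map_smul]
    pos := hA.pos
    const_pos := hC₀
    one_lt := hone
    lower := hlower
    one := fun x => (hE'.extends_functional x (u x)).trans (hA.one x)
    inter := hinter
    invariant := hE'.invariant hμ' hA ha hua
    rateB := ⟨c, μ, hE.const_pos, hE.rate_pos, hμ, fun n x v hv => by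
      simpa [hσ, hv] using hE.rate n x v⟩
    rateC := ⟨c', μ', hE'.const_pos, hE'.rate_pos, hμ', fun n x v hv => by
      simpa [hv] using hE'.rate n x v⟩
    domain := fun m hm => hR.exists_domain hm
    contDiff := fun m hm => (hR.B2 m hm).2.1
    approx := fun m hm τ hτ => hR.approx hsemi hOA hKO hTd hE hm hτ
    approxC := hR.approxC hsemi hOA hKO hTd hE hlam (iAB.continuous.comp hu)
    holder := hR.holder hsemi hOA hKO hTd hE hlam hE'.bound_nonneg hE'.bound hinter
    mem_G := fun r hr x => ⟨x, Metric.mem_ball_self hr, rfl⟩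
    mono_G := fun r r' hrr x => image_mono (Metric.ball_subset_ball hrr)
    small_G := fun r hr => by
      refine ⟨r / (‖iAB‖ + 1), by positivity, ?_⟩
      rintro x _ ⟨a, ha, rfl⟩
      rw [mem_ball_iff_norm] at ha ⊢
      rw [← map_sub]
      calc ‖iAB (a - x)‖ ≤ ‖iAB‖ * ‖a - x‖ := iAB.le_opNorm _
        _ ≤ (‖iAB‖ + 1) * ‖a - x‖ := by gcongr; linarith
        _ < (‖iAB‖ + 1) * (r / (‖iAB‖ + 1)) := by gcongr
        _ = r := by field_simp
    approxG := by
      refine ⟨m₀ + 1, fun m hm => ?_⟩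
      obtain ⟨r, hr, h1⟩ := hG m (by omega)
      exact ⟨r, hr, fun x f hf y hy => (h1 x f hf y hy).trans (by
        gcongr; exact (hC₃ m (by omega)).le)⟩
    map_G := fun r hr => by
      have hK : IsCompact K := isCompact_iff_compactSpace.2 inferInstance
      have h1 := hK.uniformContinuousAt_of_continuousAt TA (fun x hx => (hTd ⟨x, hx⟩).continuousAt)
        (Metric.dist_mem_uniformity hr)
      obtain ⟨r₁, hr₁, h2⟩ := Metric.mem_uniformity_dist.1 h1
      obtain ⟨r₂, hr₂, h3⟩ := exists_uniform_ball (p := fun x : K => (x : A))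
        continuous_subtype_val hOA fun x => hKO x.2
      refine ⟨min r₁ r₂, by positivity, ?_⟩
      rintro x _ ⟨f, hf, rfl⟩
      have h4 : f ∈ OA := h3 x (Metric.ball_subset_ball (min_le_right _ _) hf)
      refine ⟨TA f, ?_, (hR.extends_op f h4).2.symm⟩
      have h5 := h2 (a := (x : A)) (b := f)
        (by rw [dist_comm]; exact lt_of_lt_of_le hf (min_le_left _ _)) x.2
      rw [Metric.mem_ball, dist_comm, ← hsemi]
      exact h5
    lipG := fun m => by
      rcases Nat.eq_zero_or_pos m with rfl | hm
      · exact ⟨1, 1, one_pos, one_pos, fun x f _ y _ => by simp⟩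
      obtain ⟨r, hr, h1⟩ := hG m hm
      have hM := hE.bound_nonneg
      have hC₃m := (hpos m hm).2.2
      refine ⟨r, C₃ m + M ^ m, hr, by positivity, fun x f hf y hy => ?_⟩
      calc ‖TB^[m] y - TB^[m] f‖ ≤ ‖cocycle S LB m x (y - f)‖
            + ‖TB^[m] y - TB^[m] f - cocycle S LB m x (y - f)‖ := norm_le_norm_add_norm_sub' _ _
        _ ≤ M ^ m * ‖y - f‖ + C₃ m * ‖y - f‖ :=
            add_le_add (cocycle_norm_le hM hE.bound m x _) (h1 x f hf y hy)
        _ = _ := by ring }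

end Robust

theorem theorem6p1
    {A B C D : Type*}
    [NormedAddCommGroup A] [NormedSpace ℝ A] [CompleteSpace A]
    [NormedAddCommGroup B] [NormedSpace ℝ B] [CompleteSpace B]
    [NormedAddCommGroup C] [NormedSpace ℝ C] [CompleteSpace C]
    [NormedAddCommGroup D] [NormedSpace ℝ D] [CompleteSpace D]
    (iAB : A →L[ℝ] B) (iBC : B →L[ℝ] C) (iCD : C →L[ℝ] D)
    -- class `C^k` with `2 ≤ k < ∞`, or real analytic
    (n : WithTop ℕ∞) (hn : (∃ k : ℕ, 2 ≤ k ∧ n = (k : WithTop ℕ∞)) ∨ n = ω)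
    -- the hyperbolic operator on `A`
    (TA : A → A) (OA K : Set A) (P : A → A →L[ℝ] A) (u : A → A) (δ : A → ℝ) (θ C₀ lam : ℝ)
    (hT : ContDiffOn ℝ n TA OA)
    (hK : Robust.IsHyperbolicBasicSet TA OA K P θ)
    (hu : Robust.IsUnstableFrame TA K P u δ)
    (hδ : Robust.IsExpansionRate TA K δ C₀ lam)
    -- its extension to `B`
    (TB : B → B) (OB : Set B)
    (hR : Robust.IsRobust iAB iBC iCD TA OA K u θ C₀ lam TB OB) :
    ∃ (U : B → B) (σ : B → B →L[ℝ] ℝ) (L : B → B →L[ℝ] B),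
      -- the splitting of `B` and the cocycle extend those of `A`
      (∀ g ∈ K, U (iAB g) = iAB (u g) ∧
        (∀ v : A, σ (iAB g) (iAB v) • u g = P g v) ∧
        (∀ v : A, L (iAB g) (iAB v) = iAB (fderiv ℝ TA g v)) ∧
        (∀ v : B, iBC (L (iAB g) v) = fderiv ℝ (iBC ∘ TB) (iAB g) v)) ∧
      Robust.IsHyperbolicSplitting TB (iAB '' K) U σ L ∧
      Robust.HyperbolicPicture TB OB (iAB '' K) U σ n := by

  have hn1 : 1 ≤ n := by
    rcases hn with ⟨k, hk, rfl⟩ | rfl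
    · exact_mod_cast (by omega : 1 ≤ k)
    · exact le_top
  have : CompactSpace K := isCompact_iff_compactSpace.1 hK.isCompact
  obtain ⟨S, R, s, hS, hRc, hright, hleft, hsemi, hs, hsP, hcu, hcδ, hinv, hA, hlower⟩ :=
    Robust.exists_base hn1 hT hK hu hδ
  have hTd : ∀ x : K, DifferentiableAt ℝ TA x := fun x =>
    (hT.differentiableOn (ENat.one_le_iff_ne_zero_withTop.1 hn1)).differentiableAt
      (hK.isOpen.mem_nhds (hK.subset x.2))
  obtain ⟨hiAB, hiBC, hiCD⟩ := hR.injective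
  obtain ⟨hB, ρ, hC⟩ := hR.B1
  obtain ⟨LB, Lh, σB, M, c, μ, hμ, hE⟩ := hB.exists_extendedCocycle hS hsemi hA hcu hcδ hiAB
    (hiCD.comp hiBC)
  obtain ⟨LC, Lh', σC, M', c', μ', hμ', hE'⟩ := hC.exists_extendedCocycle hS hsemi hA hcu hcδ
    (hiBC.comp hiAB) hiCD
  have h := hR.localModel hS hsemi hK.isOpen hK.subset hTd hcu hcδ hδ.const_pos hlower hA hE hE' hμ
    (hμ'.trans hC.2.1)
  have hp : Function.Injective fun x : K => iAB x := h.injp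
  obtain ⟨r₀, R₀, f, hF⟩ := Robust.exists_unstableFamily (j := iAB) (ι := iBC) (TB := TB) (σ := σC)
    hn hK.isOpen hT continuous_subtype_val (fun x : K => hK.subset x.2) hsemi hA hK.exponent.2 hinv
    hright hleft hRc hcu hs hcδ hS hp (fun a ha => (hR.extends_op a ha).2) hE'.extends_functional
  set p : K → B := fun x => iAB x with hpdef
  have hrange : iAB '' K = range p := by rw [image_eq_range]
  -- extension of the data to all of `B`, by zero outside the basic set
  have hU : ∀ x, Function.extend p (fun x : K => iAB (u x)) 0 (p x) = iAB (u x) :=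
    fun x => hp.extend_apply _ _ x
  have hσ : ∀ x, Function.extend p (fun x => (σC x).comp iBC) 0 (p x) = (σC x).comp iBC :=
    fun x => hp.extend_apply _ _ x
  have hL : ∀ x, Function.extend p LB 0 (p x) = LB x := fun x => hp.extend_apply _ _ x
  refine ⟨Function.extend p (fun x : K => iAB (u x)) 0,
    Function.extend p (fun x => (σC x).comp iBC) 0, Function.extend p LB 0, fun g hg => ?_, ?_, ?_⟩
  · refine ⟨hU ⟨g, hg⟩, fun v => ?_, fun v => ?_, fun v => ?_⟩
    · rw [show iAB g = p ⟨g, hg⟩ from rfl, hσ, ← hsP ⟨g, hg⟩ v, ← hE'.extends_functional]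
      rfl
    · rw [show iAB g = p ⟨g, hg⟩ from rfl, hL, ← hE.inter]
    · have h1 := hR.fderiv_iterate hsemi hK.isOpen hK.subset hTd hE one_pos ⟨g, hg⟩ v
      rw [Function.iterate_one, Robust.cocycle_one] at h1
      rw [show iAB g = p ⟨g, hg⟩ from rfl, hL]
      exact h1.symm
  · rw [hrange]
    exact h.isHyperbolicSplitting hU hσ hL
  · rw [hrange]
    exact h.hyperbolicPicture hF hn1 hU hσ
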